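/- Let $d\ge 1$, $N\ge1$, $T>0$ and $p\ge 1$ with $\lfloor p\rfloor\le N$. Let $G^N(\mathbb R^d)\subset T^N(\mathbb R^d)=\bigoplus_{k=0}^N(\mathbb R^d)^{\otimes k}$ be the step-$N$ free nilpotent Lie group with the Carnot–Carathéodory metric, and write $\|\mathbf x\|_{p\text{-var}}$ for the $p$-variation of a path $\mathbf x:[0,T]\to G^N(\mathbb R^d)$ in this metric. All paths start from the identity; $\mathbf x_{s,t}=\mathbf x_s^{-1}\mathbf x_t$, and $\mathbf x^k_{s,t}$ is its component in $(\mathbb R^d)^{\otimes k}$. Put $$\rho_{p\text{-var}}(\mathbf x,\mathbf y)=\max_{1\le k\le N}\sup_{(t_i)}\Big(\sum_i|\mathbf x^k_{t_i,t_{i+1}}-\mathbf y^k_{t_i,t_{i+1}}|^{p/k}\Big)^{k/p},\qquad \sigma_{p\text{-var}}(\mathbf x,\mathbf y)=\inf_\lambda\max\Big\{\sup_{t}|\lambda(t)-t|,\ \rho_{p\text{-var}}(\mathbf x\circ\lambda,\mathbf y)\Big\},$$ where the supremum is over partitions of $[0,T]$ and the infimum over increasing bijections $\lambda$ of $[0,T]$.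 Let $C^{p\text{-var}}$ be the set of continuous paths of finite $p$-variation and $C^{0,p\text{-var}}$ the $\rho_{p\text{-var}}$-closure in $C^{p\text{-var}}$ of the step-$N$ lifts of paths in $C^\infty([0,T],\mathbb R^d)$. Let $\phi$ be a path function: a map that assigns to each $(x,y)$ in a set $J\subseteq G^N(\mathbb R^d)^2$ a continuous path $\phi(x,y):[0,1]\to G^N(\mathbb R^d)$ from $x$ to $y$. Fix a convergent series $\sum_k r_k$ of strictly positive numbers. For a càdlàg path $\mathbf x$ with $(\mathbf x_{t-},\mathbf x_t)\in J$ at every jump time $t$, enumerate the jump times as $t_1,t_2,\dots$ by decreasing jump size (equal sizes in order of time). For $\delta>0$ let $\mathbf x^{\phi,\delta}:[0,T]\to G^N(\mathbb R^d)$ be the path obtained by inserting at each $t_k$ an additional time interval of length $\delta r_k$, on which $\phi(\mathbf x_{t_k-},\mathbf x_{t_k})$ is run through at constant speed, and then rescaling time linearly back to $[0,T]$; write $\mathbf x^\phi=\mathbf x^{\phi,1}$. Let $\mathscr D^{p\text{-var}}_\phi$ be the set of all such $\mathbf x$ with $\|\mathbf x^\phi\|_{p\text{-var}}<\infty$, and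 set $$\alpha_{p\text{-var}}(\mathbf x,\mathbf y)=\lim_{\delta\downarrow0}\sigma_{p\text{-var}}(\mathbf x^{\phi,\delta},\mathbf y^{\phi,\delta}).$$ Let $\mathscr D^{0,p\text{-var}}_\phi$ be the closure of $C^{0,1\text{-var}}$ in $(\mathscr D^{p\text{-var}}_\phi,\alpha_{p\text{-var}})$, that is, the set of all $\mathbf x\in\mathscr D^{p\text{-var}}_\phi$ such that for every $\varepsilon>0$ there is $\mathbf y\in C^{0,1\text{-var}}$ with $\alpha_{p\text{-var}}(\mathbf x,\mathbf y)<\varepsilon$; the other closures and the density statements below are understood in the same way. Then: (i) The limit $\alpha_{p\text{-var}}(\mathbf x,\mathbf y)$ exists and is finite for all $\mathbf x,\mathbf y\in\mathscr D^{p\text{-var}}_\phi$; $\alpha_{p\text{-var}}$ is symmetric, vanishes exactly when $\mathbf x=\mathbf y$, and satisfies $\alpha_{p\text{-var}}(\mathbf x,\mathbf z)\le K\,(\alpha_{p\text{-var}}(\mathbf x,\mathbf y)+\alpha_{p\text{-var}}(\mathbf y,\mathbf z))$ with $K=\max\{1,2^{N/p-1}\}$, so that it is a metric if $N\le p$ and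 a quasi-metric in general. The space $(\mathscr D^{0,p\text{-var}}_\phi,\alpha_{p\text{-var}})$ is separable. (ii) $C^{p\text{-var}}$ is contained in $\mathscr D^{p\text{-var}}_\phi$ and is dense in $(\mathscr D^{p\text{-var}}_\phi,\alpha_{p\text{-var}})$. (iii) $\mathscr D^{0,1\text{-var}}_\phi=\mathscr D^{1\text{-var}}_\phi$. (iv) If $p>1$, the closure of $C^{0,1\text{-var}}$ in $(C^{p\text{-var}},\sigma_{p\text{-var}})$ is precisely $C^{0,p\text{-var}}$, and $\mathscr D^{0,p\text{-var}}_\phi\subsetneq\mathscr D^{p\text{-var}}_\phi$. (v) For every $p'>p$, $\mathscr D^{p\text{-var}}_\phi\subsetneq\mathscr D^{0,p'\text{-var}}_\phi$. -/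

import Mathlib

open scoped ENNReal Topology
open MeasureTheory Filter Set

noncomputable section

namespace CadlagRough

/-- The truncated tensor algebra `T^N(ℝ^d) = ⨁_{k ≤ N} (ℝ^d)^{⊗ k}`: a tensor of order `k` is given by
its coordinates, indexed by words of length `k` in the letters `Fin d`, with the Euclidean norm. -/
def TruncTensor (N d : ℕ) : Type := ∀ k : Fin (N + 1), EuclideanSpace ℝ (Fin k → Fin d)

namespace TruncTensor

variable {N d : ℕ}

instance : NormedAddCommGroup (TruncTensor N d) :=
  inferInstanceAs (NormedAddCommGroup (∀ k : Fin (N + 1), EuclideanSpace ℝ (Fin k → Fin d)))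

instance : NormedSpace ℝ (TruncTensor N d) :=
  inferInstanceAs (NormedSpace ℝ (∀ k : Fin (N + 1), EuclideanSpace ℝ (Fin k → Fin d)))

/-- The component of order `k`. -/
def level (k : Fin (N + 1)) (a : TruncTensor N d) : EuclideanSpace ℝ (Fin k → Fin d) := a k

/-- The coordinate of `a` at the word `w`; it is `0` for words of length greater than `N`. -/
def coeff (a : TruncTensor N d) (w : List (Fin d)) : ℝ :=
  if h : w.length ≤ N then level ⟨w.length, Nat.lt_succ_of_le h⟩ a w.get else 0

lemma coeff_ofFn (a : TruncTensor N d) (k : Fin (N + 1)) (v : Fin k → Fin d) :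
    coeff a (List.ofFn v) = level k a v := by
  have key : ∀ (n : ℕ) (hn : n < N + 1) (hk : n = k) (f : Fin n → Fin d),
      (∀ i, f i = v (Fin.cast hk i)) → level ⟨n, hn⟩ a f = level k a v := by
    rintro n hn hk f hf
    obtain ⟨k, hk'⟩ := k
    simp only at hk
    subst hk
    exact congrArg (level ⟨n, hn⟩ a) (funext hf)
  have hl : (List.ofFn v).length ≤ N := by simpa using Nat.lt_succ_iff.mp k.2
  unfold coeff
  rw [dif_pos hl]
  refine key _ _ (by simp) _ ?_
  intro i
  simp [Fin.cast]

lemma ext_coeff {a b : TruncTensor N d}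
    (h : ∀ w : List (Fin d), w.length ≤ N → coeff a w = coeff b w) : a = b := by
  funext k
  ext v
  have := h (List.ofFn v) (by simpa using Nat.lt_succ_iff.mp k.2)
  rwa [coeff_ofFn, coeff_ofFn] at this

/-- The tensor with prescribed coordinates. -/
def ofCoeff (f : List (Fin d) → ℝ) : TruncTensor N d :=
  fun _ => WithLp.toLp 2 fun v => f (List.ofFn v)

lemma coeff_ofCoeff (f : List (Fin d) → ℝ) {w : List (Fin d)} (h : w.length ≤ N) :
    coeff (ofCoeff f : TruncTensor N d) w = f w := by
  simp [coeff, h, ofCoeff, level]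

lemma coeff_add (a b : TruncTensor N d) (w : List (Fin d)) :
    coeff (a + b) w = coeff a w + coeff b w := by
  unfold coeff
  split_ifs
  · rfl
  · simp

lemma coeff_smul (c : ℝ) (a : TruncTensor N d) (w : List (Fin d)) :
    coeff (c • a) w = c * coeff a w := by
  unfold coeff
  split_ifs
  · rfl
  · simp

lemma coeff_zero (w : List (Fin d)) : coeff (0 : TruncTensor N d) w = 0 := by
  unfold coeff
  split_ifs <;> rfl

/-- The unit tensor `(1, 0, …, 0)`. -/
instance : One (TruncTensor N d) := ⟨ofCoeff fun w => if w = [] then 1 else 0⟩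

/-- The (truncated) tensor product, by concatenation of words. -/
instance : Mul (TruncTensor N d) :=
  ⟨fun a b => ofCoeff fun w =>
    ∑ i ∈ Finset.range (w.length + 1), coeff a (w.take i) * coeff b (w.drop i)⟩

lemma coeff_one {w : List (Fin d)} (h : w.length ≤ N) :
    coeff (1 : TruncTensor N d) w = if w = [] then 1 else 0 := coeff_ofCoeff _ h

lemma coeff_mul (a b : TruncTensor N d) {w : List (Fin d)} (h : w.length ≤ N) :
    coeff (a * b) w =
      ∑ i ∈ Finset.range (w.length + 1), coeff a (w.take i) * coeff b (w.drop i) :=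
  coeff_ofCoeff _ h

private lemma mul_assoc' (a b c : TruncTensor N d) : a * b * c = a * (b * c) := by
  refine ext_coeff fun w hw => ?_
  rw [coeff_mul _ _ hw, coeff_mul _ _ hw]
  have h1 : ∀ i ∈ Finset.range (w.length + 1),
      coeff (a * b) (w.take i) * coeff c (w.drop i) =
      ∑ j ∈ Finset.range (i + 1),
        coeff a (w.take j) * coeff b ((w.drop j).take (i - j)) * coeff c (w.drop i) := by
    intro i hi
    have hi' : i ≤ w.length := Nat.lt_succ_iff.mp (Finset.mem_range.mp hi)
    have hl : (w.take i).length = i := by simp [hi']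
    rw [coeff_mul _ _ (by omega), Finset.sum_mul, hl]
    refine Finset.sum_congr rfl fun j hj => ?_
    have hj' : j ≤ i := Nat.lt_succ_iff.mp (Finset.mem_range.mp hj)
    rw [List.take_take, min_eq_left hj', List.drop_take]
  have h2 : ∀ j ∈ Finset.range (w.length + 1),
      coeff a (w.take j) * coeff (b * c) (w.drop j) =
      ∑ i ∈ Finset.Ico j (w.length + 1),
        coeff a (w.take j) * coeff b ((w.drop j).take (i - j)) * coeff c (w.drop i) := by
    intro j hj
    have hj' : j ≤ w.length := Nat.lt_succ_iff.mp (Finset.mem_range.mp hj)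
    rw [coeff_mul _ _ (by rw [List.length_drop]; omega), Finset.mul_sum,
      Finset.sum_Ico_eq_sum_range, List.length_drop,
      show w.length + 1 - j = w.length - j + 1 by omega]
    refine Finset.sum_congr rfl fun i _ => ?_
    rw [List.drop_drop, Nat.add_sub_cancel_left, mul_assoc]
  rw [Finset.sum_congr rfl h1, Finset.sum_congr rfl h2]
  refine Finset.sum_comm' fun i j => ?_
  simp only [Finset.mem_range, Finset.mem_Ico]
  omega

private lemma one_mul' (a : TruncTensor N d) : 1 * a = a := by
  refine ext_coeff fun w hw => ?_
  rw [coeff_mul _ _ hw, Finset.sum_eq_single 0]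
  · rw [coeff_one (by simp)]
    simp
  · intro i hi h0
    have hi' : i ≤ w.length := Nat.lt_succ_iff.mp (Finset.mem_range.mp hi)
    have hl : (w.take i).length = i := by simp [hi']
    rw [coeff_one (by omega), if_neg, zero_mul]
    intro h
    rw [h] at hl
    exact h0 hl.symm
  · simp

private lemma mul_one' (a : TruncTensor N d) : a * 1 = a := by
  refine ext_coeff fun w hw => ?_
  rw [coeff_mul _ _ hw, Finset.sum_eq_single w.length]
  · rw [coeff_one (by simp)]
    simp
  · intro i hi h0
    have hi' : i ≤ w.length := Nat.lt_succ_iff.mp (Finset.mem_range.mp hi)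
    have hl : (w.drop i).length = w.length - i := by simp
    rw [coeff_one (by omega), if_neg, mul_zero]
    intro h
    rw [h] at hl
    simp at hl
    omega
  · simp

instance : Ring (TruncTensor N d) where
  __ := (inferInstance : AddCommGroup (TruncTensor N d))
  mul_assoc := mul_assoc'
  one_mul := one_mul'
  mul_one := mul_one'
  zero_mul a := by
    refine ext_coeff fun w hw => ?_
    rw [coeff_mul _ _ hw]
    simp [coeff_zero]
  mul_zero a := by
    refine ext_coeff fun w hw => ?_
    rw [coeff_mul _ _ hw]
    simp [coeff_zero]
  left_distrib a b c := by
    refine ext_coeff fun w hw => ?_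
    rw [coeff_add, coeff_mul _ _ hw, coeff_mul _ _ hw, coeff_mul _ _ hw, ← Finset.sum_add_distrib]
    simp [coeff_add, mul_add]
  right_distrib a b c := by
    refine ext_coeff fun w hw => ?_
    rw [coeff_add, coeff_mul _ _ hw, coeff_mul _ _ hw, coeff_mul _ _ hw, ← Finset.sum_add_distrib]
    simp [coeff_add, add_mul]

instance : Algebra ℝ (TruncTensor N d) :=
  Algebra.ofModule
    (fun c a b => by
      refine ext_coeff fun w hw => ?_
      rw [coeff_smul, coeff_mul _ _ hw, coeff_mul _ _ hw, Finset.mul_sum]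
      simp [coeff_smul, mul_assoc])
    (fun c a b => by
      refine ext_coeff fun w hw => ?_
      rw [coeff_smul, coeff_mul _ _ hw, coeff_mul _ _ hw, Finset.mul_sum]
      simp [coeff_smul, mul_left_comm])

/-- The Lie bracket `[a, b] = a ⊗ b - b ⊗ a`. -/
instance : LieRing (TruncTensor N d) := LieRing.ofAssociativeRing

/-- The inclusion of `ℝ^d` as the tensors of order one (it is zero if `N = 0`). -/
def vec (v : EuclideanSpace ℝ (Fin d)) : TruncTensor N d :=
  ofCoeff fun w => match w with
    | [i] => v i
    | _ => 0

/-- The exponential of a tensor without constant term; its series stops at the power `N`. -/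
def exp (a : TruncTensor N d) : TruncTensor N d :=
  ∑ k ∈ Finset.range (N + 1), ((k.factorial : ℝ)⁻¹) • a ^ k

end TruncTensor

open TruncTensor

/-- The step-`N` free nilpotent Lie algebra over `ℝ^d`, generated by `ℝ^d` under commutators. -/
def freeNilpotentLie (N d : ℕ) : LieSubalgebra ℝ (TruncTensor N d) :=
  LieSubalgebra.lieSpan ℝ (TruncTensor N d) (range vec)

/-- The step-`N` free nilpotent Lie group `G^N(ℝ^d) = exp (𝔤^N(ℝ^d)) ⊆ T^N(ℝ^d)`, with the topology
inherited from `T^N(ℝ^d)`, which is also that of the Carnot–Carathéodory metric. -/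
abbrev G (N d : ℕ) : Type :=
  {g : TruncTensor N d // ∃ a ∈ freeNilpotentLie N d, TruncTensor.exp a = g}

variable {N d : ℕ}

/-- `S` is the step-`N` lift over `[0, L]` of an absolutely continuous path in `ℝ^d` with
derivative `u`: it solves `dS = S ⊗ u dt`, `S_0 = 1`. -/
def IsLift (L : ℝ) (u : ℝ → EuclideanSpace ℝ (Fin d)) (S : ℝ → TruncTensor N d) : Prop :=
  IntervalIntegrable u volume 0 L ∧ ContinuousOn S (Icc 0 L) ∧
    ∀ t ∈ Icc (0 : ℝ) L, S t = 1 + ∫ s in (0 : ℝ)..t, S s * vec (u s)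

/-- The Carnot–Carathéodory norm: the least length of a path in `ℝ^d` whose lift ends at `g`. -/
def ccNorm (g : TruncTensor N d) : ℝ≥0∞ :=
  ⨅ (u : ℝ → EuclideanSpace ℝ (Fin d)) (S : ℝ → TruncTensor N d)
    (_ : IsLift 1 u S ∧ S 1 = g), ∫⁻ s in Icc (0 : ℝ) 1, ‖u s‖ₑ

/-- `g⁻¹ ⊗ h`, the increment from `g` to `h`. -/
def incr (g h : G N d) : TruncTensor N d := Ring.inverse (g : TruncTensor N d) * h

/-- The left-invariant Carnot–Carathéodory metric. -/
def ccDist (g h : G N d) : ℝ≥0∞ := ccNorm (incr g h)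

variable {T : ℝ}

/-- The points of a partition `0 = t_0 < t_1 < ⋯ < t_n = T`. -/
def IsPartition {n : ℕ} (t : Fin (n + 1) → Icc (0 : ℝ) T) : Prop :=
  StrictMono t ∧ (t 0 : ℝ) = 0 ∧ (t (Fin.last n) : ℝ) = T

/-- The `p`-variation of a path in `G^N(ℝ^d)`. -/
def pVar (p : ℝ) (x : Icc (0 : ℝ) T → G N d) : ℝ≥0∞ :=
  ⨆ (n : ℕ) (t : Fin (n + 1) → Icc (0 : ℝ) T) (_ : IsPartition t),
    (∑ i : Fin n, ccDist (x (t i.castSucc)) (x (t i.succ)) ^ p) ^ (1 / p)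

/-- The inhomogeneous `p`-variation distance. -/
def rho (p : ℝ) (x y : Icc (0 : ℝ) T → G N d) : ℝ≥0∞ :=
  ⨆ (k : Fin (N + 1)) (_ : 1 ≤ (k : ℕ)),
    ⨆ (n : ℕ) (t : Fin (n + 1) → Icc (0 : ℝ) T) (_ : IsPartition t),
      (∑ i : Fin n,
        ‖level k (incr (x (t i.castSucc)) (x (t i.succ))) -
          level k (incr (y (t i.castSucc)) (y (t i.succ)))‖ₑ ^ (p / (k : ℝ))) ^ ((k : ℝ) / p)

/-- The Skorokhod-type `p`-variation distance; an order isomorphism of `[0, T]` is a strictly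
increasing bijection. -/
def sigma (p : ℝ) (x y : Icc (0 : ℝ) T → G N d) : ℝ≥0∞ :=
  ⨅ l : Icc (0 : ℝ) T ≃o Icc (0 : ℝ) T, max (⨆ u, edist (l u) u) (rho p (x ∘ l) y)

/-- Paths that start from the identity. -/
def StartsAtOne (x : Icc (0 : ℝ) T → G N d) : Prop :=
  ∀ t : Icc (0 : ℝ) T, (t : ℝ) = 0 → (x t : TruncTensor N d) = 1

def IsCadlag (x : Icc (0 : ℝ) T → G N d) : Prop :=
  ∀ t, ContinuousWithinAt x (Ici t) t ∧ ∃ l, Tendsto x (𝓝[<] t) (𝓝 l)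

variable (N d T) in
/-- The space `C^{p-var}([0, T], G^N(ℝ^d))` of paths starting from the identity. -/
def Cp (p : ℝ) : Set (Icc (0 : ℝ) T → G N d) :=
  {x | StartsAtOne x ∧ Continuous x ∧ pVar p x < ∞}

variable (N d T) in
/-- The lifts of the smooth paths `C^∞([0, T], ℝ^d)`. -/
def smoothLifts : Set (Icc (0 : ℝ) T → G N d) :=
  {x | ∃ (γ : ℝ → EuclideanSpace ℝ (Fin d)) (S : ℝ → TruncTensor N d),
    ContDiffOn ℝ (⊤ : ℕ∞) γ (Icc 0 T) ∧ IsLift T (derivWithin γ (Icc 0 T)) S ∧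
    ∀ t : Icc (0 : ℝ) T, (x t : TruncTensor N d) = S t}

variable (N d T) in
/-- The space `C^{0,p-var}([0, T], G^N(ℝ^d))`: the closure of the lifts of smooth paths in
`C^{p-var}` under the inhomogeneous `p`-variation distance. -/
def C0p (p : ℝ) : Set (Icc (0 : ℝ) T → G N d) :=
  {x | x ∈ Cp N d T p ∧ ∀ ε > 0, ∃ y ∈ smoothLifts N d T, rho p x y < ε}

variable (N d) in
/-- A path function, with domain of definition `J`; its values outside `J` carry no information. -/
structure PathFunction where
  J : Set (G N d × G N d)
  toFun : G N d → G N d → C(unitInterval, G N d)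
  source : ∀ x y, (x, y) ∈ J → toFun x y 0 = x
  target : ∀ x y, (x, y) ∈ J → toFun x y 1 = y

/-- The set of jump times of a path. At time `0` the left limit is by convention the value. -/
def jumps (x : Icc (0 : ℝ) T → G N d) : Set (Icc (0 : ℝ) T) := {t | Function.leftLim x t ≠ x t}

/-- The size of the jump at `t`. -/
def jumpSize (x : Icc (0 : ℝ) T → G N d) (t : Icc (0 : ℝ) T) : ℝ≥0∞ :=
  ccDist (Function.leftLim x t) (x t)

/-- The (zero-based) position of a jump time in the enumeration of the jumps by decreasing size,
where jumps of equal size are ordered by time: the number of jumps that come earlier. -/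
def jumpRank (x : Icc (0 : ℝ) T → G N d) (t : Icc (0 : ℝ) T) : ℕ :=
  {s ∈ jumps x | jumpSize x t < jumpSize x s ∨ (jumpSize x s = jumpSize x t ∧ s < t)}.ncard

open Classical in
/-- The time change `τ(t) = t + ∑_k r_k 1{t_k ≤ t}`, where `t_0, t_1, …` are the jump times. -/
def tau (r : ℕ → ℝ) (x : Icc (0 : ℝ) T → G N d) (t : Icc (0 : ℝ) T) : ℝ :=
  t + ∑' s : jumps x, if (s : Icc (0 : ℝ) T) ≤ t then r (jumpRank x s) else 0

open Classical in
/-- The left limit `τ(t-)`. -/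
def tauLeft (r : ℕ → ℝ) (x : Icc (0 : ℝ) T → G N d) (t : Icc (0 : ℝ) T) : ℝ :=
  t + ∑' s : jumps x, if (s : Icc (0 : ℝ) T) < t then r (jumpRank x s) else 0

open Classical in
/-- The path on `[0, T + ∑_k r_k]` in which the jump at `t_k` is replaced by the connecting path
given by `φ`, run through during the additional time `r_k`. -/
def stretched (φ : PathFunction N d) (r : ℕ → ℝ) (x : Icc (0 : ℝ) T → G N d) (s : ℝ) : G N d :=
  if h : ∃ t, s = tau r x t then x h.choose
  else if h : ∃ t ∈ jumps x, s ∈ Ico (tauLeft r x t) (tau r x t) then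
    φ.toFun (Function.leftLim x h.choose) (x h.choose)
      (projIcc 0 1 zero_le_one ((s - tauLeft r x h.choose) / r (jumpRank x h.choose)))
  else ⟨1, 0, zero_mem _, by
    rw [TruncTensor.exp, Finset.sum_eq_single 0] <;> simp +contextual⟩

/-- The path `x^φ` on `[0, T]` built with the series `∑ r_k`. -/
def interp (φ : PathFunction N d) (r : ℕ → ℝ) (x : Icc (0 : ℝ) T → G N d) :
    Icc (0 : ℝ) T → G N d :=
  fun t => stretched φ r x (t * (T + ∑' s : jumps x, r (jumpRank x s)) / T)

/-- The distance `σ_{p-var}(x^{φ,δ}, y^{φ,δ})`, where `x^{φ,δ}` is built with the series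
`∑ δ r_k`. -/
def sigmaInterp (φ : PathFunction N d) (r : ℕ → ℝ) (p δ : ℝ) (x y : Icc (0 : ℝ) T → G N d) :
    ℝ≥0∞ :=
  sigma p (interp φ (fun k => δ * r k) x) (interp φ (fun k => δ * r k) y)

/-- The distance `α_{p-var}`. -/
def alpha (φ : PathFunction N d) (r : ℕ → ℝ) (p : ℝ) (x y : Icc (0 : ℝ) T → G N d) : ℝ≥0∞ :=
  limUnder (𝓝[>] (0 : ℝ)) fun δ => sigmaInterp φ r p δ x y

variable (T) in
/-- The space `𝒟^{p-var}_φ([0, T], G^N(ℝ^d))`: càdlàg paths from the identity, with all jumps in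
the domain of `φ`, for which `x^φ` has finite `p`-variation. -/
def Dp (φ : PathFunction N d) (r : ℕ → ℝ) (p : ℝ) : Set (Icc (0 : ℝ) T → G N d) :=
  {x | StartsAtOne x ∧ IsCadlag x ∧ (∀ t ∈ jumps x, (Function.leftLim x t, x t) ∈ φ.J) ∧
    pVar p (interp φ r x) < ∞}

variable (T) in
/-- The space `𝒟^{0,p-var}_φ`: the closure of `C^{0,1-var}` in `𝒟^{p-var}_φ` under `α_{p-var}`. -/
def D0p (φ : PathFunction N d) (r : ℕ → ℝ) (p : ℝ) : Set (Icc (0 : ℝ) T → G N d) :=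
  {x | x ∈ Dp T φ r p ∧ ∀ ε > 0, ∃ y ∈ C0p N d T 1, alpha φ r p x y < ε}

end CadlagRough

end

open CadlagRough

noncomputable section

namespace CadlagRough

namespace TruncTensor

variable {N d : ℕ}

/-! The group. A tensor with constant term 1 is the exponential of a Lie element exactly when its
logarithmic derivative `inv g * deg g` along the degree derivation is a Lie element
(`isGroupLike_iff`). This condition is closed, stable under products and inverses, and holds along
every lift, because `inv S * deg S` solves a linear equation whose flow preserves the Lie algebra.
Hence the exponentials form a closed group that contains all lifts.

The metric. At Carnot–Carathéodory distance l from the identity the component of order k is at most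
C l^k. Conversely, commutators of exponentials of vectors realise every Lie bracket to leading
order, so every element is reached by a Lipschitz curve with constant comparable to its homogeneous
norm (`exists_joined_of_homog_le`). The metric is therefore finite and induces the topology of the
tensor space; a Lipschitz path in this metric is a lift (`exists_dev_of_lipschitz`).

The distance α. For different δ the paths x^{φ,δ} are reparametrisations of one another which
displace times by at most a multiple of δ (`exists_rescale`). The distance ρ is invariant under a
common reparametrisation, so only the time term of σ changes and `sigmaInterp` satisfies a Cauchy
condition as δ tends to 0 (`sigmaInterp_le`). Symmetry and the quasi-triangle inequality pass to the
limit. If α vanishes, compactness gives for each t a point of the interval of x^φ over t at which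
x^φ equals y_t (`exists_theta_eq`); so x and y agree off the countably many jumps of x, and
right-continuity does the rest.

Density. The path x^{φ,δ} is continuous and has no jumps to fill, so its α-distance to x is at most
a multiple of δ; this is (ii). For (iii), a continuous path of bounded variation becomes Lipschitz,
hence a lift, after a time change close to the identity, and σ charges only for the time change. For
(v), Lipschitz interpolation along a fine grid keeps the p-variation bounded and converges
uniformly, which is convergence in p'-variation for p' > p (`exists_C0p_rho_lt`). In (iv) the time
change in σ is moved to the approximating path; the result is still continuous of bounded variation,
so for p > 1 it is a ρ-limit of smooth lifts. Separability holds because a smooth lift depends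
continuously on its derivative, a point of a separable space.

Strictness. A lacunary series of triangle functions, run along one direction, oscillates like
h^(1/q) at every scale h. With q = p it stays at positive distance from every smooth lift, whose
increments are O(h); with p < q < p' it has infinite p-variation but lies in the larger closure. -/

instance : FiniteDimensional ℝ (TruncTensor N d) :=
  inferInstanceAs (FiniteDimensional ℝ (∀ k : Fin (N + 1), EuclideanSpace ℝ (Fin k → Fin d)))

instance : Nontrivial (TruncTensor N d) := by
  refine ⟨1, 0, fun h => ?_⟩
  have := congrArg (fun a => coeff a ([] : List (Fin d))) h
  simp [coeff_one, coeff_zero] at this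

/-! ### Coordinates, norm and continuity of the product -/

lemma coeff_of_lt (a : TruncTensor N d) {w : List (Fin d)} (h : N < w.length) : coeff a w = 0 := by
  simp [coeff, not_le.2 h]

/-- The coordinate at a word, as a linear map. -/
def coeffₗ (w : List (Fin d)) : TruncTensor N d →ₗ[ℝ] ℝ where
  toFun a := coeff a w
  map_add' a b := coeff_add a b w
  map_smul' c a := coeff_smul c a w

lemma coeff_sub (a b : TruncTensor N d) (w : List (Fin d)) :
    coeff (a - b) w = coeff a w - coeff b w := map_sub (coeffₗ w) a b

lemma coeff_sum {ι : Type*} (s : Finset ι) (f : ι → TruncTensor N d) (w : List (Fin d)) :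
    coeff (∑ i ∈ s, f i) w = ∑ i ∈ s, coeff (f i) w := map_sum (coeffₗ w) f s

lemma continuous_coeff (w : List (Fin d)) : Continuous fun a : TruncTensor N d => coeff a w :=
  (coeffₗ w).continuous_of_finiteDimensional

lemma coeff_mul_nil (a b : TruncTensor N d) : coeff (a * b) [] = coeff a [] * coeff b [] := by
  rw [coeff_mul _ _ (by simp)]
  simp

/-- Multiplication as a continuous bilinear map. -/
def mulL : TruncTensor N d →L[ℝ] TruncTensor N d →L[ℝ] TruncTensor N d :=
  LinearMap.toContinuousLinearMap
    ((LinearMap.toContinuousLinearMap : (TruncTensor N d →ₗ[ℝ] TruncTensor N d) ≃ₗ[ℝ] _).toLinearMap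
      ∘ₗ LinearMap.mul ℝ (TruncTensor N d))

@[simp] lemma mulL_apply (a b : TruncTensor N d) : mulL a b = a * b := rfl

instance : ContinuousMul (TruncTensor N d) :=
  ⟨(mulL (N := N) (d := d)).isBoundedBilinearMap.continuous⟩

instance : IsTopologicalRing (TruncTensor N d) where

variable (N d) in
/-- A constant for which the product is submultiplicative. -/
def mulC : ℝ := max 1 ‖mulL (N := N) (d := d)‖

lemma one_le_mulC : 1 ≤ mulC N d := le_max_left _ _

lemma mulC_pos : 0 < mulC N d := zero_lt_one.trans_le one_le_mulC

lemma norm_mul_le' (a b : TruncTensor N d) : ‖a * b‖ ≤ mulC N d * ‖a‖ * ‖b‖ := by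
  refine (mulL.le_opNorm₂ a b).trans ?_
  gcongr
  exact le_max_right _ _

lemma norm_level_le (k : Fin (N + 1)) (a : TruncTensor N d) : ‖level k a‖ ≤ ‖a‖ :=
  norm_le_pi_norm (f := fun k => level k a) k

lemma norm_le_iff_level {a : TruncTensor N d} {c : ℝ} (hc : 0 ≤ c) :
    ‖a‖ ≤ c ↔ ∀ k, ‖level k a‖ ≤ c := pi_norm_le_iff_of_nonneg hc

lemma level_sub (k : Fin (N + 1)) (a b : TruncTensor N d) :
    level k (a - b) = level k a - level k b := rfl

lemma level_apply (k : Fin (N + 1)) (a : TruncTensor N d) (v : Fin k → Fin d) :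
    level k a v = coeff a (List.ofFn v) := (coeff_ofFn a k v).symm

/-! ### Homogeneous components -/

/-- The homogeneous component of degree `k`. -/
def homog (k : ℕ) : TruncTensor N d →ₗ[ℝ] TruncTensor N d where
  toFun a := ofCoeff fun w => if w.length = k then coeff a w else 0
  map_add' a b := ext_coeff fun w hw => by
    rw [coeff_add, coeff_ofCoeff _ hw, coeff_ofCoeff _ hw, coeff_ofCoeff _ hw, coeff_add]
    split_ifs <;> simp
  map_smul' c a := ext_coeff fun w hw => by
    rw [RingHom.id_apply, coeff_smul, coeff_ofCoeff _ hw, coeff_ofCoeff _ hw, coeff_smul]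
    split_ifs <;> simp

lemma coeff_homog (k : ℕ) (a : TruncTensor N d) (w : List (Fin d)) :
    coeff (homog k a) w = if w.length = k then coeff a w else 0 := by
  by_cases h : w.length ≤ N
  · exact coeff_ofCoeff (fun w => if w.length = k then coeff a w else 0) h
  · rw [coeff_of_lt _ (not_le.1 h), coeff_of_lt _ (not_le.1 h), ite_self]

lemma sum_homog (a : TruncTensor N d) : ∑ k ∈ Finset.range (N + 1), homog k a = a := by
  refine ext_coeff fun w hw => ?_
  rw [coeff_sum, Finset.sum_eq_single w.length]
  · simp [coeff_homog]
  · intro k _ hk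
    simp [coeff_homog, hk.symm]
  · intro h
    exact absurd (Finset.mem_range.2 (Nat.lt_succ_of_le hw)) h

lemma homog_mul (k : ℕ) (a b : TruncTensor N d) :
    homog k (a * b) = ∑ p ∈ Finset.HasAntidiagonal.antidiagonal k, homog p.1 a * homog p.2 b := by
  refine ext_coeff fun w hw => ?_
  rw [coeff_homog, coeff_sum]
  have key : ∀ p ∈ Finset.HasAntidiagonal.antidiagonal k, coeff (homog p.1 a * homog p.2 b) w =
      if w.length = k then coeff a (w.take p.1) * coeff b (w.drop p.1) else 0 := by
    intro p hp
    have hp' := Finset.HasAntidiagonal.mem_antidiagonal.1 hp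
    rw [coeff_mul _ _ hw]
    split_ifs with hk
    · rw [Finset.sum_eq_single p.1]
      · rw [coeff_homog, coeff_homog, if_pos (by simp; omega), if_pos (by simp; omega)]
      · intro i hi h
        have hi' := Finset.mem_range.1 hi
        rw [coeff_homog, if_neg, zero_mul]
        simp
        omega
      · intro h
        exact absurd (Finset.mem_range.2 (by omega)) h
    · refine Finset.sum_eq_zero fun i hi => ?_
      have hi' := Finset.mem_range.1 hi
      rw [coeff_homog, coeff_homog]
      split_ifs with h1 h2
      · simp at h1 h2
        omega
      all_goals simp
  rw [Finset.sum_congr rfl key]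
  split_ifs with hk
  · rw [coeff_mul _ _ hw, Finset.Nat.sum_antidiagonal_eq_sum_range_succ_mk, hk]
  · simp

lemma homog_lie (k : ℕ) (a b : TruncTensor N d) :
    homog k ⁅a, b⁆ = ∑ p ∈ Finset.HasAntidiagonal.antidiagonal k, ⁅homog p.1 a, homog p.2 b⁆ := by
  simp only [Ring.lie_def, map_sub, homog_mul, Finset.sum_sub_distrib]
  congr 1
  rw [← Finset.Nat.sum_antidiagonal_swap]
  rfl

lemma homog_one (k : ℕ) : homog k (1 : TruncTensor N d) = if k = 0 then 1 else 0 := by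
  refine ext_coeff fun w hw => ?_
  rw [coeff_homog, coeff_one hw]
  by_cases h2 : w = []
  · subst h2
    simp only [List.length_nil, if_true]
    by_cases hk : k = 0
    · rw [if_pos hk.symm, if_pos hk, coeff_one hw, if_pos rfl]
    · rw [if_neg (Ne.symm hk), if_neg hk, coeff_zero]
  · rw [if_neg h2, ite_self]
    split_ifs
    · rw [coeff_one hw, if_neg h2]
    · rw [coeff_zero]

lemma homog_of_lt {k : ℕ} (h : N < k) (a : TruncTensor N d) : homog k a = 0 := by
  refine ext_coeff fun w hw => ?_
  rw [coeff_homog, if_neg (by omega), coeff_zero]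

lemma continuous_homog (k : ℕ) : Continuous (homog (N := N) (d := d) k) :=
  (homog k).continuous_of_finiteDimensional

lemma level_homog (k : Fin (N + 1)) (a : TruncTensor N d) : level k (homog k a) = level k a := by
  ext v
  rw [level_apply, level_apply, coeff_homog, if_pos (by simp)]

lemma norm_homog (k : Fin (N + 1)) (a : TruncTensor N d) : ‖homog k a‖ = ‖level k a‖ := by
  refine le_antisymm ((norm_le_iff_level (norm_nonneg _)).2 fun j => ?_) ?_
  · by_cases h : j = k
    · subst h
      rw [level_homog]
    · have : level j (homog k a) = 0 := by
        ext v
        rw [level_apply, coeff_homog, if_neg]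
        · rfl
        · simpa [Fin.ext_iff] using h
      rw [this, norm_zero]
      exact norm_nonneg _
  · rw [← level_homog]
    exact norm_level_le _ _

lemma norm_homog_le (k : ℕ) (a : TruncTensor N d) : ‖homog k a‖ ≤ ‖a‖ := by
  by_cases h : k < N + 1
  · exact (norm_homog ⟨k, h⟩ a).le.trans (norm_level_le _ _)
  · rw [homog_of_lt (by omega), norm_zero]
    exact norm_nonneg _

/-! ### The filtration by order -/

/-- The tensors without components of degree less than `k`. -/
def ordGE (k : ℕ) : Submodule ℝ (TruncTensor N d) where
  carrier := {a | ∀ w : List (Fin d), w.length < k → coeff a w = 0}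
  add_mem' {a b} ha hb w hw := by rw [coeff_add, ha w hw, hb w hw, add_zero]
  zero_mem' w _ := coeff_zero w
  smul_mem' c a ha w hw := by rw [coeff_smul, ha w hw, mul_zero]

lemma mem_ordGE_zero (a : TruncTensor N d) : a ∈ ordGE 0 := fun _ h => absurd h (by simp)

lemma mem_ordGE_one {a : TruncTensor N d} : a ∈ ordGE 1 ↔ coeff a [] = 0 := by
  refine ⟨fun h => h [] (by simp), fun h w hw => ?_⟩
  rw [List.length_eq_zero_iff.1 (Nat.lt_one_iff.1 hw), h]

lemma ordGE_mono {j k : ℕ} (h : j ≤ k) {a : TruncTensor N d} (ha : a ∈ ordGE k) : a ∈ ordGE j :=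
  fun w hw => ha w (hw.trans_le h)

lemma mul_mem_ordGE {j k : ℕ} {a b : TruncTensor N d} (ha : a ∈ ordGE j) (hb : b ∈ ordGE k) :
    a * b ∈ ordGE (j + k) := by
  intro w hw
  by_cases hN : w.length ≤ N
  · rw [coeff_mul _ _ hN]
    refine Finset.sum_eq_zero fun i hi => ?_
    have hi' := Finset.mem_range.1 hi
    by_cases h : i < j
    · rw [ha _ (by simp; omega), zero_mul]
    · rw [hb _ (by simp; omega), mul_zero]
  · exact coeff_of_lt _ (not_le.1 hN)

lemma mul_mem_ordGE_left {j : ℕ} {a b : TruncTensor N d} (ha : a ∈ ordGE j) : a * b ∈ ordGE j :=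
  mul_mem_ordGE ha (mem_ordGE_zero b)

lemma mul_mem_ordGE_right {j : ℕ} {a b : TruncTensor N d} (hb : b ∈ ordGE j) : a * b ∈ ordGE j := by
  simpa using mul_mem_ordGE (mem_ordGE_zero a) hb

lemma eq_zero_of_mem_ordGE {a : TruncTensor N d} (h : a ∈ ordGE (N + 1)) : a = 0 :=
  ext_coeff fun w hw => by rw [h w (by omega), coeff_zero]

lemma pow_mem_ordGE {a : TruncTensor N d} (h : a ∈ ordGE 1) (n : ℕ) : a ^ n ∈ ordGE n := by
  induction n with
  | zero => exact mem_ordGE_zero _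
  | succ n ih => rw [pow_succ]; exact mul_mem_ordGE ih h

lemma pow_eq_zero_of_ordGE {a : TruncTensor N d} (h : a ∈ ordGE 1) : a ^ (N + 1) = 0 :=
  eq_zero_of_mem_ordGE (pow_mem_ordGE h _)

lemma homog_mem_ordGE {j k : ℕ} (h : j ≤ k) (a : TruncTensor N d) : homog k a ∈ ordGE j :=
  fun w hw => by rw [coeff_homog, if_neg (by omega)]

lemma homog_eq_zero_of_mem {j k : ℕ} {a : TruncTensor N d} (ha : a ∈ ordGE k) (h : j < k) :
    homog j a = 0 :=
  ext_coeff fun w _ => by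
    rw [coeff_homog, coeff_zero]
    split_ifs with hw
    · exact ha w (by omega)
    · rfl

lemma sub_homog_mem_ordGE {k : ℕ} {a : TruncTensor N d} (ha : a ∈ ordGE k) :
    a - homog k a ∈ ordGE (k + 1) := by
  intro w hw
  rw [coeff_sub, coeff_homog]
  split_ifs with h
  · exact sub_self _
  · rw [ha w (by omega), sub_zero]

/-! ### Dilations -/

/-- The dilation, which multiplies tensors of order `k` by `c ^ k`. -/
def dil (c : ℝ) : TruncTensor N d →ₐ[ℝ] TruncTensor N d :=
  AlgHom.ofLinearMap
    { toFun := fun a => ofCoeff fun w => c ^ w.length * coeff a w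
      map_add' := fun a b => ext_coeff fun w hw => by
        rw [coeff_add, coeff_ofCoeff _ hw, coeff_ofCoeff _ hw, coeff_ofCoeff _ hw, coeff_add, mul_add]
      map_smul' := fun e a => ext_coeff fun w hw => by
        rw [RingHom.id_apply, coeff_smul, coeff_ofCoeff _ hw, coeff_ofCoeff _ hw, coeff_smul]
        ring }
    (ext_coeff fun w hw => by
      rw [LinearMap.coe_mk, AddHom.coe_mk, coeff_ofCoeff _ hw, coeff_one hw]
      split_ifs with h <;> simp [h])
    (fun a b => ext_coeff fun w hw => by
      simp only [LinearMap.coe_mk, AddHom.coe_mk]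
      rw [coeff_ofCoeff _ hw, coeff_mul _ _ hw, coeff_mul _ _ hw, Finset.mul_sum]
      refine Finset.sum_congr rfl fun i hi => ?_
      have hi' := Finset.mem_range.1 hi
      rw [coeff_ofCoeff _ (by simp; omega), coeff_ofCoeff _ (by simp; omega)]
      have : c ^ w.length = c ^ (w.take i).length * c ^ (w.drop i).length := by
        rw [← pow_add]
        congr 1
        simp
        omega
      rw [this]
      ring)

lemma coeff_dil (c : ℝ) (a : TruncTensor N d) (w : List (Fin d)) :
    coeff (dil c a) w = c ^ w.length * coeff a w := by
  by_cases h : w.length ≤ N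
  · exact coeff_ofCoeff (fun w => c ^ w.length * coeff a w) h
  · rw [coeff_of_lt _ (not_le.1 h), coeff_of_lt _ (not_le.1 h), mul_zero]

lemma dil_dil (b c : ℝ) (a : TruncTensor N d) : dil b (dil c a) = dil (b * c) a :=
  ext_coeff fun w _ => by simp only [coeff_dil]; ring

lemma dil_one (a : TruncTensor N d) : dil 1 a = a :=
  ext_coeff fun w _ => by simp [coeff_dil]

lemma continuous_dil (c : ℝ) : Continuous (dil (N := N) (d := d) c) :=
  (dil c).toLinearMap.continuous_of_finiteDimensional

/-! ### The degree derivation -/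

/-- The derivation that multiplies tensors of order `k` by `k`. -/
def deg : TruncTensor N d →ₗ[ℝ] TruncTensor N d where
  toFun a := ofCoeff fun w => w.length * coeff a w
  map_add' a b := ext_coeff fun w hw => by
    rw [coeff_add, coeff_ofCoeff _ hw, coeff_ofCoeff _ hw, coeff_ofCoeff _ hw, coeff_add, mul_add]
  map_smul' e a := ext_coeff fun w hw => by
    rw [RingHom.id_apply, coeff_smul, coeff_ofCoeff _ hw, coeff_ofCoeff _ hw, coeff_smul]
    ring

lemma coeff_deg (a : TruncTensor N d) (w : List (Fin d)) :
    coeff (deg a) w = w.length * coeff a w := by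
  by_cases h : w.length ≤ N
  · exact coeff_ofCoeff (fun w => w.length * coeff a w) h
  · rw [coeff_of_lt _ (not_le.1 h), coeff_of_lt _ (not_le.1 h), mul_zero]

lemma deg_mul (a b : TruncTensor N d) : deg (a * b) = deg a * b + a * deg b := by
  refine ext_coeff fun w hw => ?_
  rw [coeff_add, coeff_deg, coeff_mul _ _ hw, coeff_mul _ _ hw, coeff_mul _ _ hw, Finset.mul_sum,
    ← Finset.sum_add_distrib]
  refine Finset.sum_congr rfl fun i hi => ?_
  have hi' := Finset.mem_range.1 hi
  rw [coeff_deg, coeff_deg]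
  have : (w.length : ℝ) = (w.take i).length + (w.drop i).length := by
    rw [← Nat.cast_add]
    congr 1
    simp
    omega
  rw [this]
  ring

lemma deg_one : deg (1 : TruncTensor N d) = 0 := by
  have := deg_mul (1 : TruncTensor N d) 1
  simp only [mul_one, one_mul] at this
  simpa using this

lemma homog_deg (k : ℕ) (a : TruncTensor N d) : homog k (deg a) = (k : ℝ) • homog k a := by
  refine ext_coeff fun w _ => ?_
  rw [coeff_homog, coeff_smul, coeff_homog, coeff_deg]
  split_ifs with h
  · rw [h]
  · simp

lemma deg_mem_ordGE {k : ℕ} {a : TruncTensor N d} (h : a ∈ ordGE k) : deg a ∈ ordGE k :=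
  fun w hw => by rw [coeff_deg, h w hw, mul_zero]

lemma continuous_deg : Continuous (deg (N := N) (d := d)) :=
  deg.continuous_of_finiteDimensional

/-! ### Tensors of order one -/

/-- The coordinates of a vector, as a function on words. -/
def wordOne (v : EuclideanSpace ℝ (Fin d)) : List (Fin d) → ℝ
  | [i] => v i
  | _ => 0

lemma wordOne_of_ne (v : EuclideanSpace ℝ (Fin d)) {w : List (Fin d)} (h : w.length ≠ 1) :
    wordOne v w = 0 := by
  unfold wordOne
  split
  · simp at h
  · rfl

lemma coeff_vec (v : EuclideanSpace ℝ (Fin d)) {w : List (Fin d)} (h : w.length ≤ N) :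
    coeff (vec v : TruncTensor N d) w = wordOne v w := (coeff_ofCoeff _ h).trans <| by
  unfold wordOne
  rcases w with _ | ⟨i, _ | ⟨j, w⟩⟩ <;> rfl

/-- The inclusion of `ℝ^d` as a linear map. -/
def vecₗ : EuclideanSpace ℝ (Fin d) →ₗ[ℝ] TruncTensor N d where
  toFun := vec
  map_add' v v' := ext_coeff fun w hw => by
    rw [coeff_add, coeff_vec _ hw, coeff_vec _ hw, coeff_vec _ hw]
    unfold wordOne
    split <;> simp
  map_smul' c v := ext_coeff fun w hw => by
    rw [RingHom.id_apply, coeff_smul, coeff_vec _ hw, coeff_vec _ hw]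
    unfold wordOne
    split <;> simp

/-- The inclusion of `ℝ^d` as a continuous linear map. -/
def vecL : EuclideanSpace ℝ (Fin d) →L[ℝ] TruncTensor N d := LinearMap.toContinuousLinearMap vecₗ

@[simp] lemma vecL_apply (v : EuclideanSpace ℝ (Fin d)) : vecL v = (vec v : TruncTensor N d) := rfl

lemma vec_smul (c : ℝ) (v : EuclideanSpace ℝ (Fin d)) :
    (vec (c • v) : TruncTensor N d) = c • vec v := map_smul vecL c v

lemma vec_sub (v v' : EuclideanSpace ℝ (Fin d)) :
    (vec (v - v') : TruncTensor N d) = vec v - vec v' := map_sub vecL v v'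

lemma vec_zero : (vec 0 : TruncTensor N d) = 0 := map_zero vecL

lemma homog_vec (k : ℕ) (v : EuclideanSpace ℝ (Fin d)) :
    homog k (vec v : TruncTensor N d) = if k = 1 then vec v else 0 := by
  refine ext_coeff fun w hw => ?_
  rw [coeff_homog]
  have : w.length ≠ 1 → coeff (vec v : TruncTensor N d) w = 0 := by
    intro h
    rw [coeff_vec _ hw, wordOne_of_ne v h]
  by_cases hk : k = 1
  · subst hk
    simp only [if_true]
    split_ifs with h
    · rfl
    · exact (this h).symm
  · rw [if_neg hk, coeff_zero]
    split_ifs with h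
    · exact this (by omega)
    · rfl

lemma vec_mem_ordGE (v : EuclideanSpace ℝ (Fin d)) : (vec v : TruncTensor N d) ∈ ordGE 1 := by
  rw [mem_ordGE_one, coeff_vec _ (by simp), wordOne_of_ne v (by simp)]

lemma norm_vec (v : EuclideanSpace ℝ (Fin d)) (hN : 1 ≤ N) : ‖(vec v : TruncTensor N d)‖ = ‖v‖ := by
  have h1 : homog 1 (vec v : TruncTensor N d) = vec v := by simp [homog_vec]
  rw [← h1]
  have := norm_homog ⟨1, by omega⟩ (vec v : TruncTensor N d)
  simp only at this
  rw [this, EuclideanSpace.norm_eq, EuclideanSpace.norm_eq]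
  congr 1
  refine Fintype.sum_equiv (Equiv.funUnique (Fin 1) (Fin d)) _ _ fun w => ?_
  rw [level_apply, coeff_vec _ (by simp; omega)]
  simp [wordOne]

lemma norm_vec_le (v : EuclideanSpace ℝ (Fin d)) : ‖(vec v : TruncTensor N d)‖ ≤ ‖v‖ := by
  rcases Nat.eq_zero_or_pos N with h | h
  · subst h
    have : (vec v : TruncTensor 0 d) = 0 := eq_zero_of_mem_ordGE (vec_mem_ordGE v)
    rw [this, norm_zero]
    exact norm_nonneg _
  · exact (norm_vec v h).le

lemma dil_vec (c : ℝ) (v : EuclideanSpace ℝ (Fin d)) :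
    dil c (vec v : TruncTensor N d) = vec (c • v) := by
  refine ext_coeff fun w hw => ?_
  rw [coeff_dil, coeff_vec _ hw, coeff_vec _ hw]
  unfold wordOne
  split <;> simp

/-! ### Inverses -/

/-- The inverse of a tensor with constant term one. -/
def inv (g : TruncTensor N d) : TruncTensor N d := ∑ k ∈ Finset.range (N + 1), (1 - g) ^ k

/-- The geometric series in `1 - g` terminates: without constant term, `1 - g` is nilpotent of order
`N + 1`. -/
lemma inv_mul_cancel' {g : TruncTensor N d} (h : coeff g [] = 1) : inv g * g = 1 := by
  have h1 : (1 - g) ∈ ordGE 1 := by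
    rw [mem_ordGE_one, coeff_sub, h, coeff_one (by simp)]
    simp
  have := geom_sum_mul_neg (1 - g) (N + 1)
  rwa [sub_sub_cancel, pow_eq_zero_of_ordGE h1, sub_zero] at this

lemma mul_inv_cancel' {g : TruncTensor N d} (h : coeff g [] = 1) : g * inv g = 1 := by
  have h1 : (1 - g) ∈ ordGE 1 := by
    rw [mem_ordGE_one, coeff_sub, h, coeff_one (by simp)]
    simp
  have := mul_neg_geom_sum (1 - g) (N + 1)
  rwa [sub_sub_cancel, pow_eq_zero_of_ordGE h1, sub_zero] at this

lemma continuous_inv : Continuous (inv (N := N) (d := d)) := by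
  unfold inv
  fun_prop

lemma ringInverse_eq_inv {g : TruncTensor N d} (h : coeff g [] = 1) : Ring.inverse g = inv g :=
  (Ring.inverse_unit (⟨g, inv g, mul_inv_cancel' h, inv_mul_cancel' h⟩ : (TruncTensor N d)ˣ) :)

lemma inv_eq_of_mul_eq_one {g h : TruncTensor N d} (hg : coeff g [] = 1) (e : g * h = 1) :
    inv g = h := by
  rw [← mul_one (inv g), ← e, ← mul_assoc, inv_mul_cancel' hg, one_mul]

end TruncTensor

open TruncTensor

/-! ### The free nilpotent Lie algebra -/

variable {N d : ℕ}

variable (N d) in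
/-- The span of the left-nested brackets of `k` vectors. -/
def brackets : ℕ → Submodule ℝ (TruncTensor N d)
  | 0 => ⊥
  | 1 => LinearMap.range vecₗ
  | k + 2 => Submodule.span ℝ {c | ∃ b ∈ brackets (k + 1), ∃ v, c = ⁅b, vec v⁆}

lemma vec_mem_lie (v : EuclideanSpace ℝ (Fin d)) : (vec v : TruncTensor N d) ∈ freeNilpotentLie N d :=
  LieSubalgebra.subset_lieSpan ⟨v, rfl⟩

lemma brackets_le_lie (k : ℕ) : brackets N d k ≤ (freeNilpotentLie N d).toSubmodule := by
  induction k using brackets.induct with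
  | case1 => simp [brackets]
  | case2 =>
    rintro _ ⟨v, rfl⟩
    exact vec_mem_lie v
  | case3 k ih =>
    rw [brackets, Submodule.span_le]
    rintro _ ⟨b, hb, v, rfl⟩
    exact (freeNilpotentLie N d).lie_mem (ih hb) (vec_mem_lie v)

lemma lie_vec_mem_brackets {k : ℕ} {b : TruncTensor N d} (hb : b ∈ brackets N d k)
    (v : EuclideanSpace ℝ (Fin d)) : (⁅b, vec v⁆ : TruncTensor N d) ∈ brackets N d (k + 1) := by
  cases k with
  | zero =>
    rw [brackets, Submodule.mem_bot] at hb
    rw [hb, zero_lie]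
    exact zero_mem _
  | succ k => exact Submodule.subset_span ⟨b, hb, v, rfl⟩

/-- By the Jacobi identity a bracket with a long second entry is a difference of brackets with
shorter second entries. Left-nested brackets with vectors therefore span everything. -/
lemma lie_mem_brackets {j k : ℕ} {a b : TruncTensor N d} (ha : a ∈ brackets N d j)
    (hb : b ∈ brackets N d k) : (⁅a, b⁆ : TruncTensor N d) ∈ brackets N d (j + k) := by
  induction k using brackets.induct generalizing j a b with
  | case1 =>
    rw [brackets, Submodule.mem_bot] at hb
    rw [hb, lie_zero]
    exact zero_mem _
  | case2 =>
    obtain ⟨v, rfl⟩ := hb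
    exact lie_vec_mem_brackets ha v
  | case3 k ih =>
    rw [brackets] at hb
    induction hb using Submodule.span_induction with
    | mem c hc =>
      obtain ⟨b, hb, v, rfl⟩ := hc
      have e : (⁅a, ⁅b, (vec v : TruncTensor N d)⁆⁆ : TruncTensor N d) =
          ⁅⁅a, b⁆, (vec v : TruncTensor N d)⁆ - ⁅⁅a, (vec v : TruncTensor N d)⁆, b⁆ := by
        simp only [Ring.lie_def]
        noncomm_ring
      rw [e]
      refine sub_mem (lie_vec_mem_brackets (ih ha hb) v) ?_
      have := ih (lie_vec_mem_brackets ha v) hb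
      rwa [show j + 1 + (k + 1) = j + (k + 2) by ring] at this
    | zero => rw [lie_zero]; exact zero_mem _
    | add x y _ _ hx hy => rw [lie_add]; exact add_mem hx hy
    | smul c x _ hx =>
      have : ⁅a, c • x⁆ = c • ⁅a, x⁆ := by
        simp only [Ring.lie_def, mul_smul_comm, smul_mul_assoc, smul_sub]
      rw [this]
      exact Submodule.smul_mem _ _ hx

/-- The tensors all of whose components are combinations of nested brackets form a Lie subalgebra
containing the vectors. Hence the free nilpotent Lie algebra is graded, and its part of order k is
spanned by brackets of k vectors. -/
lemma homog_mem_brackets {a : TruncTensor N d} (ha : a ∈ freeNilpotentLie N d) (k : ℕ) :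
    homog k a ∈ brackets N d k := by
  let L : LieSubalgebra ℝ (TruncTensor N d) :=
    { carrier := {a | ∀ k, homog k a ∈ brackets N d k}
      add_mem' := fun ha hb k => by rw [map_add]; exact add_mem (ha k) (hb k)
      zero_mem' := fun k => by rw [map_zero]; exact zero_mem _
      smul_mem' := fun c a ha k => by rw [map_smul]; exact Submodule.smul_mem _ _ (ha k)
      lie_mem' := fun {a b} ha hb k => by
        rw [homog_lie]
        refine sum_mem fun p hp => ?_
        rw [← Finset.HasAntidiagonal.mem_antidiagonal.1 hp]
        exact lie_mem_brackets (ha _) (hb _) }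
  have : freeNilpotentLie N d ≤ L := by
    refine LieSubalgebra.lieSpan_le.2 ?_
    rintro _ ⟨v, rfl⟩ k
    rw [homog_vec]
    split_ifs with h
    · subst h
      exact ⟨v, rfl⟩
    · exact zero_mem _
  exact this ha k

lemma homog_mem_lie {a : TruncTensor N d} (ha : a ∈ freeNilpotentLie N d) (k : ℕ) :
    homog k a ∈ freeNilpotentLie N d := brackets_le_lie k (homog_mem_brackets ha k)

lemma coeff_nil_of_mem_lie {a : TruncTensor N d} (ha : a ∈ freeNilpotentLie N d) :
    coeff a [] = 0 := by
  have h := homog_mem_brackets ha 0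
  rw [brackets, Submodule.mem_bot] at h
  have := coeff_homog 0 a []
  rw [h, coeff_zero] at this
  simpa using this.symm

lemma lie_le_ordGE {a : TruncTensor N d} (ha : a ∈ freeNilpotentLie N d) : a ∈ ordGE 1 :=
  mem_ordGE_one.2 (coeff_nil_of_mem_lie ha)

lemma mem_lie_of_homog {a : TruncTensor N d} (h : ∀ k, homog k a ∈ freeNilpotentLie N d) :
    a ∈ freeNilpotentLie N d := by
  rw [← sum_homog a]
  exact sum_mem fun k _ => h k

lemma deg_mem_lie {a : TruncTensor N d} (ha : a ∈ freeNilpotentLie N d) :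
    deg a ∈ freeNilpotentLie N d :=
  mem_lie_of_homog fun k => by
    rw [homog_deg]
    exact (freeNilpotentLie N d).smul_mem _ (homog_mem_lie ha k)

lemma homog_dil (c : ℝ) (k : ℕ) (a : TruncTensor N d) : homog k (dil c a) = c ^ k • homog k a := by
  refine ext_coeff fun w _ => ?_
  rw [coeff_homog, coeff_smul, coeff_homog, coeff_dil]
  split_ifs with h
  · rw [h]
  · simp

lemma dil_mem_lie {a : TruncTensor N d} (ha : a ∈ freeNilpotentLie N d) (c : ℝ) :
    dil c a ∈ freeNilpotentLie N d :=
  mem_lie_of_homog fun k => by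
    rw [homog_dil]
    exact (freeNilpotentLie N d).smul_mem _ (homog_mem_lie ha k)

open TruncTensor

variable {N d : ℕ}

/-! ### The exponential -/

lemma hasDerivAt_tensor_mul {f g : ℝ → TruncTensor N d} {f' g' : TruncTensor N d} {t : ℝ}
    (hf : HasDerivAt f f' t) (hg : HasDerivAt g g' t) :
    HasDerivAt (fun s => f s * g s) (f' * g t + f t * g') t := by
  have := mulL.hasDerivAt_of_bilinear (x := t) (fun _ => hf) (fun _ => hg)
  simpa [add_comm] using this

lemma _root_.HasDerivAt.linearMap_comp {E F : Type*} [NormedAddCommGroup E] [NormedSpace ℝ E]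
    [FiniteDimensional ℝ E] [NormedAddCommGroup F] [NormedSpace ℝ F] (l : E →ₗ[ℝ] F)
    {f : ℝ → E} {f' : E} {t : ℝ} (hf : HasDerivAt f f' t) :
    HasDerivAt (fun s => l (f s)) (l f') t :=
  (LinearMap.toContinuousLinearMap l).hasFDerivAt.comp_hasDerivAt t hf

lemma coeff_exp_nil {a : TruncTensor N d} (ha : a ∈ ordGE 1) : coeff (TruncTensor.exp a) [] = 1 := by
  rw [TruncTensor.exp, coeff_sum, Finset.sum_eq_single 0]
  · simp [coeff_one]
  · intro k _ hk
    rw [coeff_smul, pow_mem_ordGE ha k [] (by simp; omega), mul_zero]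
  · simp

lemma exp_zero' : TruncTensor.exp (0 : TruncTensor N d) = 1 := by
  rw [TruncTensor.exp, Finset.sum_eq_single 0] <;> simp +contextual

lemma hasDerivAt_exp_smul {a : TruncTensor N d} (ha : a ∈ ordGE 1) (t : ℝ) :
    HasDerivAt (fun s : ℝ => TruncTensor.exp (s • a)) (TruncTensor.exp (t • a) * a) t := by
  have h1 : ∀ k : ℕ, HasDerivAt (fun s : ℝ => ((k.factorial : ℝ)⁻¹) • (s • a) ^ k)
      ((((k : ℝ) * t ^ (k - 1)) * (k.factorial : ℝ)⁻¹) • a ^ k) t := by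
    intro k
    have := ((hasDerivAt_pow k t).mul_const ((k.factorial : ℝ)⁻¹)).smul_const (a ^ k)
    refine this.congr_of_eventuallyEq (Eventually.of_forall fun s => ?_)
    simp only [smul_pow, smul_smul]
    rw [mul_comm]
  have h2 := HasDerivAt.fun_sum fun (k : ℕ) (_ : k ∈ Finset.range (N + 1)) => h1 k
  refine h2.congr_deriv (Eq.symm ?_)
  change (∑ k ∈ Finset.range (N + 1), ((k.factorial : ℝ)⁻¹) • (t • a) ^ k) * a = _
  rw [Finset.sum_mul, Finset.sum_range_succ, Finset.sum_range_succ']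
  -- The term that would overshoot the truncation has order N + 1 and vanishes, so the finite series
  -- is closed under differentiation.
  have h3 : (((N.factorial : ℝ)⁻¹) • (t • a) ^ N) * a = 0 := by
    rw [smul_mul_assoc, smul_pow, smul_mul_assoc, ← pow_succ, pow_eq_zero_of_ordGE ha, smul_zero,
      smul_zero]
  rw [h3, add_zero]
  simp only [CharP.cast_eq_zero, zero_mul, zero_smul, add_zero]
  refine Finset.sum_congr rfl fun k _ => ?_
  rw [smul_mul_assoc, smul_pow, smul_mul_assoc, ← pow_succ, smul_smul]
  congr 1
  rw [Nat.factorial_succ, Nat.add_sub_cancel]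
  push_cast
  have : (k.factorial : ℝ) ≠ 0 := by positivity
  field_simp

lemma commute_exp (a : TruncTensor N d) (s : ℝ) : Commute a (TruncTensor.exp (s • a)) := by
  rw [TruncTensor.exp]
  refine Commute.sum_right _ _ _ fun k _ => ?_
  exact ((Commute.refl a).smul_right s |>.pow_right k).smul_right _

lemma eq_of_hasDerivAt_zero {E : Type*} [NormedAddCommGroup E] [NormedSpace ℝ E] {f : ℝ → E}
    (h : ∀ t, HasDerivAt f 0 t) (s t : ℝ) : f s = f t :=
  is_const_of_deriv_eq_zero (fun t => (h t).differentiableAt) (fun t => (h t).deriv) s t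

/-- The product of the exponentials of `r • a` and `(s + t - r) • a` has derivative zero in r;
compare r = s with r = 0. -/
lemma exp_smul_mul_exp_smul {a : TruncTensor N d} (ha : a ∈ ordGE 1) (s t : ℝ) :
    TruncTensor.exp (s • a) * TruncTensor.exp (t • a) = TruncTensor.exp ((s + t) • a) := by
  have h : ∀ r : ℝ, HasDerivAt
      (fun r : ℝ => TruncTensor.exp (r • a) * TruncTensor.exp ((s + t - r) • a)) 0 r := by
    intro r
    have h2 := (hasDerivAt_exp_smul ha (s + t - r)).scomp r ((hasDerivAt_id r).const_sub (s + t))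
    have := hasDerivAt_tensor_mul (hasDerivAt_exp_smul ha r) h2
    refine this.congr_deriv (Eq.symm ?_)
    change 0 = TruncTensor.exp (r • a) * a * TruncTensor.exp ((s + t - r) • a) + _
    rw [mul_assoc, (commute_exp a (s + t - r)).eq]
    simp
  have := eq_of_hasDerivAt_zero h s 0
  simpa [exp_zero'] using this

lemma exp_mul_exp_neg {a : TruncTensor N d} (ha : a ∈ ordGE 1) :
    TruncTensor.exp a * TruncTensor.exp (-a) = 1 := by
  have := exp_smul_mul_exp_smul ha 1 (-1)
  simpa [exp_zero'] using this

lemma exp_neg_mul_exp {a : TruncTensor N d} (ha : a ∈ ordGE 1) :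
    TruncTensor.exp (-a) * TruncTensor.exp a = 1 := by
  have := exp_smul_mul_exp_smul ha (-1) 1
  simpa [exp_zero'] using this

lemma dil_exp (c : ℝ) (a : TruncTensor N d) :
    dil c (TruncTensor.exp a) = TruncTensor.exp (dil c a) := by
  simp only [TruncTensor.exp, map_sum, map_smul, map_pow]

/-! ### Differential equations in the free nilpotent Lie algebra -/

lemma mem_of_forall_functional {E : Type*} [AddCommGroup E] [Module ℝ E] {V : Submodule ℝ E} {x : E}
    (h : ∀ l : E →ₗ[ℝ] ℝ, (∀ v ∈ V, l v = 0) → l x = 0) : x ∈ V := by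
  by_contra hx
  obtain ⟨l, hl, hlV⟩ := Submodule.exists_le_ker_of_notMem hx
  exact hl (h l fun v hv => LinearMap.mem_ker.1 (hlV hv))

/-- Every functional vanishing on V is constant along f, and such functionals separate V from its
complement. -/
lemma mem_of_hasDerivAt_mem {E : Type*} [NormedAddCommGroup E] [NormedSpace ℝ E]
    [FiniteDimensional ℝ E] {V : Submodule ℝ E} {f f' : ℝ → E} (hf : ∀ t, HasDerivAt f (f' t) t)
    (h' : ∀ t, f' t ∈ V) {r : ℝ} (h0 : f r ∈ V) (t : ℝ) : f t ∈ V := by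
  refine mem_of_forall_functional fun l hl => ?_
  have h : ∀ s, HasDerivAt (fun s => l (f s)) 0 s := fun s => by
    have := (hf s).linearMap_comp l
    rwa [hl _ (h' s)] at this
  have := eq_of_hasDerivAt_zero h t r
  exact this.trans (hl _ h0)

/-- The flow of `B' = [B, c] + w` preserves the Lie algebra if `c` and `w` belong to it. -/
lemma mem_lie_of_hasDerivAt {B c w : ℝ → TruncTensor N d}
    (hB : ∀ t, HasDerivAt B (⁅B t, c t⁆ + w t) t) (hc : ∀ t, c t ∈ freeNilpotentLie N d)
    (hw : ∀ t, w t ∈ freeNilpotentLie N d) {r : ℝ} (h0 : B r ∈ freeNilpotentLie N d) (t : ℝ) :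
    B t ∈ freeNilpotentLie N d := by
  refine mem_lie_of_homog fun k => ?_
  -- Since c has no constant term, the part of order k of the bracket involves only the parts of B
  -- of order below k, which are already known to be Lie elements.
  induction k using Nat.strong_induction_on generalizing t with
  | _ k ih =>
  refine mem_of_hasDerivAt_mem (V := (freeNilpotentLie N d).toSubmodule)
    (fun t => (hB t).linearMap_comp (homog k)) (fun t => ?_) (homog_mem_lie h0 k) t
  rw [map_add, homog_lie]
  refine add_mem (sum_mem fun p hp => ?_) (homog_mem_lie (hw t) k)
  have hp' := Finset.HasAntidiagonal.mem_antidiagonal.1 hp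
  rcases Nat.eq_zero_or_pos p.2 with h | h
  · rw [h, homog_eq_zero_of_mem (lie_le_ordGE (hc t)) Nat.one_pos, lie_zero]
    exact zero_mem _
  · exact (freeNilpotentLie N d).lie_mem (ih p.1 (by omega) t) (homog_mem_lie (hc t) _)

/-! ### Group-like elements -/

/-- The logarithmic derivative of `g` along the degree derivation lies in the Lie algebra. -/
def IsGroupLike (g : TruncTensor N d) : Prop :=
  coeff g [] = 1 ∧ inv g * deg g ∈ freeNilpotentLie N d

lemma isGroupLike_of_deg {g b : TruncTensor N d} (h1 : coeff g [] = 1)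
    (hb : b ∈ freeNilpotentLie N d) (h : deg g = g * b) : IsGroupLike g := by
  refine ⟨h1, ?_⟩
  rwa [h, ← mul_assoc, inv_mul_cancel' h1, one_mul]

lemma IsGroupLike.deg_eq {g : TruncTensor N d} (h : IsGroupLike g) :
    deg g = g * (inv g * deg g) := by
  rw [← mul_assoc, mul_inv_cancel' h.1, one_mul]

/-- This is what carries group-likeness from lifts with continuous derivative to general lifts, and
makes the group a closed subset of the tensor space. -/
lemma isClosed_isGroupLike : IsClosed {g : TruncTensor N d | IsGroupLike g} := by
  have h : IsClosed ((freeNilpotentLie N d : Set (TruncTensor N d))) :=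
    (freeNilpotentLie N d).toSubmodule.closed_of_finiteDimensional
  exact (isClosed_eq (continuous_coeff _) continuous_const).inter
    (h.preimage (continuous_inv.mul continuous_deg))

/-- The curve B(t) = exp(-ta) deg(exp(ta)) starts at 0 and solves B' = [B, a] + deg a, an equation
that preserves the Lie algebra. -/
lemma isGroupLike_exp {a : TruncTensor N d} (ha : a ∈ freeNilpotentLie N d) :
    IsGroupLike (TruncTensor.exp a) := by
  have ha1 := lie_le_ordGE ha
  have hna : -a ∈ ordGE 1 := neg_mem ha1
  have hB : ∀ t : ℝ, HasDerivAt
      (fun t : ℝ => TruncTensor.exp (t • -a) * deg (TruncTensor.exp (t • a)))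
      (⁅TruncTensor.exp (t • -a) * deg (TruncTensor.exp (t • a)), a⁆ + deg a) t := by
    intro t
    have := hasDerivAt_tensor_mul (hasDerivAt_exp_smul hna t)
      ((hasDerivAt_exp_smul ha1 t).linearMap_comp deg)
    convert this using 1
    have h1 : TruncTensor.exp (t • -a) * a = a * TruncTensor.exp (t • -a) := by
      have := (commute_exp (-a) t).eq
      simpa using this.symm
    have h2 : TruncTensor.exp (t • -a) * TruncTensor.exp (t • a) = 1 := by
      have := exp_neg_mul_exp (Submodule.smul_mem _ t ha1)
      rwa [smul_neg]
    rw [deg_mul, Ring.lie_def, mul_neg, h1, mul_add,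
      ← mul_assoc (TruncTensor.exp (t • -a)) (TruncTensor.exp (t • a)) (deg a), h2]
    noncomm_ring
  have h0 : TruncTensor.exp ((0 : ℝ) • -a) * deg (TruncTensor.exp ((0 : ℝ) • a)) ∈
      freeNilpotentLie N d := by
    rw [zero_smul, zero_smul, exp_zero', deg_one, mul_zero]
    exact zero_mem _
  have := mem_lie_of_hasDerivAt hB (fun _ => ha) (fun _ => deg_mem_lie ha) h0 1
  rw [one_smul, one_smul] at this
  refine isGroupLike_of_deg (coeff_exp_nil ha1) this ?_
  rw [← mul_assoc, exp_mul_exp_neg ha1, one_mul]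

lemma add_pow_sub_pow_mem_ordGE {a c : TruncTensor N d} {k : ℕ} (ha : a ∈ ordGE 1)
    (hc : c ∈ ordGE (k + 1)) (n : ℕ) : (a + c) ^ (n + 2) - a ^ (n + 2) ∈ ordGE (k + 2) := by
  have h1 : ∀ n : ℕ, (a + c) ^ (n + 1) - a ^ (n + 1) ∈ ordGE (k + 1) := by
    intro n
    induction n with
    | zero => simpa using hc
    | succ n ih =>
      have e : (a + c) ^ (n + 1 + 1) - a ^ (n + 1 + 1) =
          ((a + c) ^ (n + 1) - a ^ (n + 1)) * (a + c) + a ^ (n + 1) * c := by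
        rw [pow_succ (a + c), pow_succ a]; noncomm_ring
      rw [e]
      exact add_mem (mul_mem_ordGE_left ih) (mul_mem_ordGE_right hc)
  have e : (a + c) ^ (n + 2) - a ^ (n + 2) =
      ((a + c) ^ (n + 1) - a ^ (n + 1)) * (a + c) + a ^ (n + 1) * c := by
    rw [pow_succ (a + c), pow_succ a]; noncomm_ring
  rw [e]
  refine add_mem (mul_mem_ordGE (j := k + 1) (k := 1) (h1 n)
    (add_mem ha (ordGE_mono (by omega) hc))) ?_
  have := mul_mem_ordGE (ordGE_mono (by omega) (pow_mem_ordGE ha (n + 1)) : a ^ (n + 1) ∈ ordGE 1) hc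
  rwa [show 1 + (k + 1) = k + 2 by ring] at this

/-- In the powers from the second on, each occurrence of c comes with another factor of positive
order, so only the linear term contributes at order k + 1. -/
lemma exp_add_sub_exp_mem_ordGE {a c : TruncTensor N d} {k : ℕ} (ha : a ∈ ordGE 1)
    (hc : c ∈ ordGE (k + 1)) :
    TruncTensor.exp (a + c) - TruncTensor.exp a - c ∈ ordGE (k + 2) := by
  rcases N with _ | N
  · have h1 : c = 0 := eq_zero_of_mem_ordGE (ordGE_mono (by omega) hc)
    rw [h1]
    simp
  · rw [TruncTensor.exp, TruncTensor.exp, ← Finset.sum_sub_distrib, Finset.sum_range_succ',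
      Finset.sum_range_succ']
    simp only [pow_zero, zero_add, pow_one, Nat.factorial_zero, Nat.factorial_one, Nat.cast_one,
      inv_one, one_smul, sub_self, add_zero, add_sub_cancel_left, add_sub_cancel_right]
    refine sum_mem fun n _ => ?_
    rw [← smul_sub]
    exact Submodule.smul_mem _ _ (add_pow_sub_pow_mem_ordGE ha hc n)

/-- The logarithm is built order by order. If g and h = exp a agree up to order k, comparing deg g =
g b with deg h = h b' at order k + 1 gives (k + 1) times the component of g - h on the left and that
of b - b' on the right. The latter is a Lie element, so the component of g - h can be added to a. -/
lemma IsGroupLike.exists_exp {g : TruncTensor N d} (hg : IsGroupLike g) :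
    ∃ a ∈ freeNilpotentLie N d, TruncTensor.exp a = g := by
  have key : ∀ k : ℕ, ∃ a ∈ freeNilpotentLie N d, g - TruncTensor.exp a ∈ ordGE (k + 1) := by
    intro k
    induction k with
    | zero =>
      refine ⟨0, zero_mem _, ?_⟩
      rw [mem_ordGE_one, coeff_sub, hg.1, exp_zero', coeff_one (by simp)]
      simp
    | succ k ih =>
      obtain ⟨a, ha, hD⟩ := ih
      have hh := isGroupLike_exp ha
      set h := TruncTensor.exp a with h_def
      set b := inv g * deg g with b_def
      set b' := inv h * deg h with b'_def
      have e1 : deg (g - h) = (g - h) * b + h * (b - b') := by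
        rw [map_sub, hg.deg_eq, hh.deg_eq, ← b_def, ← b'_def]
        noncomm_ring
      have hDb : (g - h) * b ∈ ordGE (k + 2) := 
        mul_mem_ordGE (j := k + 1) (k := 1) hD (lie_le_ordGE hg.2)
      have he : b - b' ∈ ordGE (k + 1) := by
        have : b - b' = inv h * (deg (g - h) - (g - h) * b) := by
          rw [e1, add_sub_cancel_left, ← mul_assoc, inv_mul_cancel' hh.1, one_mul]
        rw [this]
        exact mul_mem_ordGE_right (sub_mem (deg_mem_ordGE hD) (ordGE_mono (by omega) hDb))
      have hh1 : (h - 1) * (b - b') ∈ ordGE (k + 2) := by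
        have : h - 1 ∈ ordGE 1 := by
          rw [mem_ordGE_one, coeff_sub, hh.1, coeff_one (by simp)]
          simp
        have := mul_mem_ordGE this he
        rwa [show 1 + (k + 1) = k + 2 by ring] at this
      have e2 : ((k + 1 : ℕ) : ℝ) • homog (k + 1) (g - h) = homog (k + 1) (b - b') := by
        rw [← homog_deg, e1, ← sub_eq_zero, ← map_sub]
        refine homog_eq_zero_of_mem (k := k + 2) ?_ (by omega)
        have : (g - h) * b + h * (b - b') - (b - b') = (g - h) * b + (h - 1) * (b - b') := by
          noncomm_ring
        rw [this]
        exact add_mem hDb hh1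
      have hc : homog (k + 1) (g - h) ∈ freeNilpotentLie N d := by
        have h3 : homog (k + 1) (g - h) = ((k + 1 : ℕ) : ℝ)⁻¹ • homog (k + 1) (b - b') := by
          rw [← e2, smul_smul, inv_mul_cancel₀ (by positivity), one_smul]
        rw [h3]
        exact (freeNilpotentLie N d).smul_mem _ (homog_mem_lie (sub_mem hg.2 hh.2) _)
      refine ⟨a + homog (k + 1) (g - h), add_mem ha hc, ?_⟩
      have h4 := exp_add_sub_exp_mem_ordGE (k := k) (lie_le_ordGE ha)
        (homog_mem_ordGE le_rfl (g - h))
      rw [← h_def] at h4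
      have h5 := sub_homog_mem_ordGE hD
      have := sub_mem h5 h4
      rwa [show ∀ x y z : TruncTensor N d, g - x - y - (z - x - y) = g - z from
        fun x y z => by abel] at this
  obtain ⟨a, ha, h⟩ := key N
  exact ⟨a, ha, (sub_eq_zero.1 (eq_zero_of_mem_ordGE h)).symm⟩

lemma isGroupLike_iff {g : TruncTensor N d} :
    IsGroupLike g ↔ ∃ a ∈ freeNilpotentLie N d, TruncTensor.exp a = g :=
  ⟨IsGroupLike.exists_exp, fun ⟨_, ha, h⟩ => h ▸ isGroupLike_exp ha⟩

/-- The conjugate of b by exp(ta) solves B' = [B, a]. -/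
lemma conj_mem_lie {a b : TruncTensor N d} (ha : a ∈ freeNilpotentLie N d)
    (hb : b ∈ freeNilpotentLie N d) :
    TruncTensor.exp (-a) * b * TruncTensor.exp a ∈ freeNilpotentLie N d := by
  have ha1 := lie_le_ordGE ha
  have hna : -a ∈ ordGE 1 := neg_mem ha1
  have hB : ∀ t : ℝ, HasDerivAt
      (fun t : ℝ => TruncTensor.exp (t • -a) * b * TruncTensor.exp (t • a))
      (⁅TruncTensor.exp (t • -a) * b * TruncTensor.exp (t • a), a⁆ + 0) t := by
    intro t
    have := hasDerivAt_tensor_mul (hasDerivAt_tensor_mul (hasDerivAt_exp_smul hna t)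
      (hasDerivAt_const t b)) (hasDerivAt_exp_smul ha1 t)
    convert this using 1
    have h1 : TruncTensor.exp (t • -a) * a = a * TruncTensor.exp (t • -a) := by
      have := (commute_exp (-a) t).eq
      simpa using this.symm
    rw [Ring.lie_def, mul_neg, h1]
    noncomm_ring
  have h0 : TruncTensor.exp ((0 : ℝ) • -a) * b * TruncTensor.exp ((0 : ℝ) • a) ∈
      freeNilpotentLie N d := by
    rwa [zero_smul, zero_smul, exp_zero', one_mul, mul_one]
  have := mem_lie_of_hasDerivAt hB (fun _ => ha) (fun _ => zero_mem _) h0 1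
  rwa [one_smul, one_smul] at this

/-- The logarithmic derivative of a product gh is that of g conjugated by h, plus that of h. -/
lemma IsGroupLike.mul {g h : TruncTensor N d} (hg : IsGroupLike g) (hh : IsGroupLike h) :
    IsGroupLike (g * h) := by
  obtain ⟨a, ha, rfl⟩ := hh.exists_exp
  have ha1 := lie_le_ordGE ha
  refine isGroupLike_of_deg (by rw [coeff_mul_nil, hg.1, hh.1, one_mul])
    (add_mem (conj_mem_lie ha hg.2) hh.2) ?_
  rw [deg_mul, mul_add]
  congr 1
  · rw [show ∀ x y z u v : TruncTensor N d, x * y * (z * u * v) = x * (y * z) * u * v from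
      fun x y z u v => by noncomm_ring, exp_mul_exp_neg ha1, mul_one, ← hg.deg_eq]
  · rw [mul_assoc, ← hh.deg_eq]

lemma isGroupLike_one : IsGroupLike (1 : TruncTensor N d) := by
  rw [← exp_zero']
  exact isGroupLike_exp (zero_mem _)

lemma IsGroupLike.inv {g : TruncTensor N d} (hg : IsGroupLike g) :
    IsGroupLike (TruncTensor.inv g) := by
  obtain ⟨a, ha, rfl⟩ := hg.exists_exp
  rw [inv_eq_of_mul_eq_one hg.1 (exp_mul_exp_neg (lie_le_ordGE ha))]
  exact isGroupLike_exp (neg_mem ha)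

lemma IsGroupLike.dil {g : TruncTensor N d} (hg : IsGroupLike g) (c : ℝ) :
    IsGroupLike (TruncTensor.dil c g) := by
  obtain ⟨a, ha, rfl⟩ := hg.exists_exp
  rw [dil_exp]
  exact isGroupLike_exp (dil_mem_lie ha c)

lemma G.isGroupLike (g : G N d) : IsGroupLike (g : TruncTensor N d) := isGroupLike_iff.2 g.2

lemma G.coeff_nil (g : G N d) : coeff (g : TruncTensor N d) [] = 1 := g.isGroupLike.1

/-- A group-like element as an element of the free nilpotent group. -/
def G.mk (g : TruncTensor N d) (h : IsGroupLike g) : G N d := ⟨g, isGroupLike_iff.1 h⟩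

instance : Group (G N d) where
  mul g h := G.mk (g * h) (g.isGroupLike.mul h.isGroupLike)
  one := G.mk 1 isGroupLike_one
  inv g := G.mk (TruncTensor.inv (g : TruncTensor N d)) g.isGroupLike.inv
  mul_assoc a b c := Subtype.ext (mul_assoc (a : TruncTensor N d) b c)
  one_mul a := Subtype.ext (one_mul (a : TruncTensor N d))
  mul_one a := Subtype.ext (mul_one (a : TruncTensor N d))
  inv_mul_cancel a := Subtype.ext (inv_mul_cancel' a.coeff_nil)

@[simp] lemma G.coe_mul (g h : G N d) : ((g * h : G N d) : TruncTensor N d) = g * h := rfl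

@[simp] lemma G.coe_one : ((1 : G N d) : TruncTensor N d) = 1 := rfl

@[simp] lemma G.coe_inv (g : G N d) :
    ((g⁻¹ : G N d) : TruncTensor N d) = TruncTensor.inv (g : TruncTensor N d) := rfl

instance : IsTopologicalGroup (G N d) where
  continuous_mul := by
    refine Continuous.subtype_mk ?_ _
    fun_prop
  continuous_inv := Continuous.subtype_mk (continuous_inv.comp continuous_subtype_val) _

lemma incr_eq (g h : G N d) : incr g h = ((g⁻¹ * h : G N d) : TruncTensor N d) := by
  rw [incr, ringInverse_eq_inv g.coeff_nil, G.coe_mul, G.coe_inv]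

lemma isClosedEmbedding_coe :
    Topology.IsClosedEmbedding (fun g : G N d => (g : TruncTensor N d)) := by
  refine Topology.IsClosedEmbedding.subtypeVal ?_
  convert isClosed_isGroupLike (N := N) (d := d) using 1
  ext g
  exact isGroupLike_iff.symm

/-- The exponential of a vector. -/
def gexp (v : EuclideanSpace ℝ (Fin d)) : G N d := ⟨TruncTensor.exp (vec v), vec v, vec_mem_lie v, rfl⟩

@[simp] lemma coe_gexp (v : EuclideanSpace ℝ (Fin d)) :
    ((gexp v : G N d) : TruncTensor N d) = TruncTensor.exp (vec v) := rfl

/-- The dilation of the free nilpotent group. -/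
def gdil (c : ℝ) : G N d →* G N d where
  toFun g := G.mk (dil c g) (g.isGroupLike.dil c)
  map_one' := Subtype.ext (map_one (dil c))
  map_mul' g h := Subtype.ext (map_mul (dil c) (g : TruncTensor N d) h)

@[simp] lemma coe_gdil (c : ℝ) (g : G N d) :
    ((gdil c g : G N d) : TruncTensor N d) = dil c (g : TruncTensor N d) := rfl

lemma gexp_mul_gexp (v : EuclideanSpace ℝ (Fin d)) (s t : ℝ) :
    (gexp (s • v) * gexp (t • v) : G N d) = gexp ((s + t) • v) :=
  Subtype.ext <| by
    simp only [G.coe_mul, coe_gexp, vec_smul]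
    exact exp_smul_mul_exp_smul (vec_mem_ordGE v) s t

lemma gexp_zero : (gexp 0 : G N d) = 1 := Subtype.ext <| by
  rw [coe_gexp, vec_zero, exp_zero', G.coe_one]

lemma inv_gexp (v : EuclideanSpace ℝ (Fin d)) : (gexp v : G N d)⁻¹ = gexp (-v) := by
  rw [inv_eq_iff_mul_eq_one]
  have := gexp_mul_gexp (N := N) v 1 (-1)
  simpa [gexp_zero] using this

/-! ### Lifts defined on the whole line -/

/-- `S` solves `dS = S ⊗ u dt` on the whole line. -/
structure Dev (u : ℝ → EuclideanSpace ℝ (Fin d)) (S : ℝ → TruncTensor N d) : Prop where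
  int : ∀ s t, IntervalIntegrable u volume s t
  cont : Continuous S
  eq : ∀ s t, S t - S s = ∫ r in s..t, S r * vec (u r)

lemma intervalIntegrable_mul_vec {u : ℝ → EuclideanSpace ℝ (Fin d)} {S : ℝ → TruncTensor N d}
    {s t : ℝ} (hu : IntervalIntegrable u volume s t) (hS : ContinuousOn S (uIcc s t)) :
    IntervalIntegrable (fun r => S r * vec (u r)) volume s t := by
  obtain ⟨M, hM⟩ := isCompact_uIcc.exists_bound_of_continuousOn hS
  rw [intervalIntegrable_iff] at hu ⊢
  refine Integrable.mono' (hu.norm.const_mul (mulC N d * M)) ?_ ?_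
  · exact mulL.aestronglyMeasurable_comp₂
      ((hS.mono uIoc_subset_uIcc).aestronglyMeasurable measurableSet_uIoc)
      (vecL.continuous.comp_aestronglyMeasurable hu.aestronglyMeasurable)
  · refine (ae_restrict_mem measurableSet_uIoc).mono fun r hr => (TruncTensor.norm_mul_le' _ _).trans ?_
    have := mulC_pos (N := N) (d := d)
    have h1 := hM r (uIoc_subset_uIcc hr)
    have := norm_vec_le (N := N) (u r)
    have : 0 ≤ M := (norm_nonneg _).trans h1
    gcongr

namespace Dev

variable {u v : ℝ → EuclideanSpace ℝ (Fin d)} {S R : ℝ → TruncTensor N d}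

lemma int_mul (h : Dev u S) (s t : ℝ) : IntervalIntegrable (fun r => S r * vec (u r)) volume s t :=
  intervalIntegrable_mul_vec (h.int s t) h.cont.continuousOn

lemma const_mul (h : Dev u S) (g : TruncTensor N d) : Dev u fun t => g * S t where
  int := h.int
  cont := by have := h.cont; fun_prop
  eq s t := by
    have := (mulL g).intervalIntegral_comp_comm (h.int_mul s t)
    simp only [mulL_apply] at this
    rw [← mul_sub, h.eq, ← this]
    simp only [mul_assoc]

lemma comp_affine (h : Dev u S) (c e : ℝ) :
    Dev (fun t => c • u (c * t + e)) fun t => S (c * t + e) where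
  int s t := by
    rcases eq_or_ne c 0 with rfl | hc
    · simp
    · have h1 := ((h.int (c * s + e) (c * t + e)).comp_add_right e).comp_mul_left (c := c)
      have e1 : ∀ x : ℝ, (c * x + e - e) / c = x := fun x => by
        rw [add_sub_cancel_right, mul_div_cancel_left₀ _ hc]
      rw [e1, e1] at h1
      exact h1.smul c
  cont := by have := h.cont; fun_prop
  eq s t := by
    have := intervalIntegral.smul_integral_comp_mul_add (a := s) (b := t)
      (fun r => S r * vec (u r)) c e
    rw [h.eq, ← this, ← intervalIntegral.integral_smul]
    simp only [vec_smul, mul_smul_comm]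

lemma dil (h : Dev u S) (c : ℝ) : Dev (fun t => c • u t) fun t => TruncTensor.dil c (S t) where
  int s t := (h.int s t).smul c
  cont := (continuous_dil c).comp h.cont
  eq s t := by
    have := (LinearMap.toContinuousLinearMap
      (TruncTensor.dil (N := N) (d := d) c).toLinearMap).intervalIntegral_comp_comm (h.int_mul s t)
    simp only [LinearMap.coe_toContinuousLinearMap', AlgHom.toLinearMap_apply, map_mul,
      dil_vec] at this
    rw [← map_sub, h.eq, ← this]

lemma zero (g : TruncTensor N d) : Dev (fun _ => 0) fun _ => g where
  int s t := by simp
  cont := continuous_const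
  eq s t := by simp [vec_zero]

lemma concat (h : Dev u S) (h' : Dev v R) {b : ℝ} (hb : S b = R b) :
    Dev (fun t => if t ≤ b then u t else v t) fun t => if t ≤ b then S t else R t := by
  have hl : ∀ {s t : ℝ}, s ≤ b → t ≤ b → ∀ r ∈ uIoc s t, r ≤ b := fun hs ht r hr =>
    hr.2.trans (max_le hs ht)
  have hr : ∀ {s t : ℝ}, b ≤ s → b ≤ t → ∀ r ∈ uIoc s t, ¬ r ≤ b := fun hs ht r hr =>
    not_le.2 ((le_min hs ht).trans_lt hr.1)
  have il : ∀ {s t : ℝ}, s ≤ b → t ≤ b →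
      IntervalIntegrable (fun t => if t ≤ b then u t else v t) volume s t := fun hs ht =>
    (h.int _ _).congr fun r hr => (if_pos (hl hs ht r hr)).symm
  have ir : ∀ {s t : ℝ}, b ≤ s → b ≤ t →
      IntervalIntegrable (fun t => if t ≤ b then u t else v t) volume s t := fun hs ht =>
    (h'.int _ _).congr fun r hr' => (if_neg (hr hs ht r hr')).symm
  have hint : ∀ s t, IntervalIntegrable (fun t => if t ≤ b then u t else v t) volume s t := by
    intro s t
    have : ∀ s, IntervalIntegrable (fun t => if t ≤ b then u t else v t) volume s b := fun s =>
      (le_total s b).elim (fun h => il h le_rfl) fun h => ir h le_rfl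
    exact (this s).trans (this t).symm
  have hcont : Continuous fun t => if t ≤ b then S t else R t :=
    Continuous.if_le h.cont h'.cont continuous_id continuous_const fun x hx => by
      rw [show x = b from hx, hb]
  refine ⟨hint, hcont, ?_⟩
  have key : ∀ t, (if t ≤ b then S t else R t) - S b =
      ∫ r in b..t, (if r ≤ b then S r else R r) * vec (if r ≤ b then u r else v r) := by
    intro t
    rcases le_total t b with ht | ht
    · rw [if_pos ht, h.eq]
      refine intervalIntegral.integral_congr_ae (Eventually.of_forall fun r hr => ?_)
      simp only [if_pos (hl le_rfl ht r hr)]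
    · have : (if t ≤ b then S t else R t) = R t := by
        split_ifs with h
        · rw [le_antisymm h ht, hb]
        · rfl
      rw [this, hb, h'.eq]
      refine intervalIntegral.integral_congr_ae (Eventually.of_forall fun r hr' => ?_)
      simp only [if_neg (hr le_rfl ht r hr')]
  intro s t
  have hi := fun s t => intervalIntegrable_mul_vec (hint s t) hcont.continuousOn
  rw [← intervalIntegral.integral_interval_sub_left (hi b t) (hi b s), ← key, ← key]
  abel

lemma isLift (h : Dev u S) (h0 : S 0 = 1) (L : ℝ) : IsLift L u S :=
  ⟨h.int _ _, h.cont.continuousOn, fun t _ => by rw [← h.eq, h0]; abel⟩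

end Dev

lemma IsLift.apply_zero {u : ℝ → EuclideanSpace ℝ (Fin d)} {S : ℝ → TruncTensor N d} {L : ℝ}
    (h : IsLift L u S) (hL : 0 ≤ L) : S 0 = 1 := by
  simpa using h.2.2 0 ⟨le_rfl, hL⟩

/-- A lift on `[0, L]` extends to the whole line. -/
lemma IsLift.dev {u : ℝ → EuclideanSpace ℝ (Fin d)} {S : ℝ → TruncTensor N d} {L : ℝ}
    (h : IsLift L u S) (hL : 0 ≤ L) :
    Dev ((Ioc 0 L).indicator u) fun t => S (projIcc 0 L hL t) := by
  have hu : Integrable ((Ioc 0 L).indicator u) volume :=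
    (integrable_indicator_iff measurableSet_Ioc).2
      ((intervalIntegrable_iff_integrableOn_Ioc_of_le hL).1 h.1)
  have hint : ∀ s t, IntervalIntegrable ((Ioc 0 L).indicator u) volume s t := fun s t =>
    hu.intervalIntegrable
  have hcont : Continuous fun t => S (projIcc 0 L hL t) :=
    (continuousOn_iff_continuous_domRestrict.1 h.2.1).comp continuous_projIcc
  refine ⟨hint, hcont, ?_⟩
  have hi := fun s t => intervalIntegrable_mul_vec (hint s t) hcont.continuousOn
  have hz : ∀ s t, (∀ r ∈ uIoc s t, r ∉ Ioc 0 L) → ∫ r in s..t, S (projIcc 0 L hL r) *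
      vec ((Ioc 0 L).indicator u r) = 0 := by
    intro s t hst
    refine intervalIntegral.integral_zero_ae (Eventually.of_forall fun r hr => ?_)
    rw [indicator_of_notMem (hst r hr), vec_zero, mul_zero]
  have hm : ∀ t ∈ Icc 0 L, S t = 1 + ∫ r in (0 : ℝ)..t, S (projIcc 0 L hL r) *
      vec ((Ioc 0 L).indicator u r) := by
    intro t ht
    rw [h.2.2 t ht]
    congr 1
    refine intervalIntegral.integral_congr_ae (Eventually.of_forall fun r hr => ?_)
    rw [uIoc_of_le ht.1] at hr
    have hr' : r ∈ Ioc 0 L := ⟨hr.1, hr.2.trans ht.2⟩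
    rw [indicator_of_mem hr', projIcc_of_mem hL ⟨hr'.1.le, hr'.2⟩]
  have key : ∀ t, S (projIcc 0 L hL t) = 1 + ∫ r in (0 : ℝ)..t, S (projIcc 0 L hL r) *
      vec ((Ioc 0 L).indicator u r) := by
    intro t
    rcases le_total t 0 with ht | ht
    · rw [projIcc_of_le_left hL ht, h.apply_zero hL, hz, add_zero]
      intro r hr hr'
      rw [uIoc_of_ge ht] at hr
      exact not_le.2 hr'.1 hr.2
    · rcases le_total t L with htL | htL
      · rw [projIcc_of_mem hL ⟨ht, htL⟩]
        exact hm t ⟨ht, htL⟩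
      · rw [projIcc_of_right_le hL htL, ← intervalIntegral.integral_add_adjacent_intervals
          (hi 0 L) (hi L t), hz L t, add_zero]
        · exact hm L ⟨hL, le_rfl⟩
        · intro r hr hr'
          rw [uIoc_of_le htL] at hr
          exact not_le.2 hr.1 hr'.2
  intro s t
  rw [← intervalIntegral.integral_interval_sub_left (hi 0 t) (hi 0 s), key t, key s]
  abel

/-! ### Estimates -/

lemma homog_succ_mul_vec (k : ℕ) (a : TruncTensor N d) (v : EuclideanSpace ℝ (Fin d)) :
    homog (k + 1) (a * vec v) = homog k a * vec v := by
  rw [homog_mul, Finset.sum_eq_single (k, 1)]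
  · simp [homog_vec]
  · rintro ⟨i, j⟩ hp hne
    rw [homog_vec, if_neg, mul_zero]
    rintro rfl
    have := Finset.HasAntidiagonal.mem_antidiagonal.1 hp
    simp only [Nat.add_right_cancel_iff] at this
    exact hne (by rw [this])
  · intro h
    exact absurd (Finset.HasAntidiagonal.mem_antidiagonal.2 (show k + 1 = k + 1 from rfl)) h

lemma homog_zero_mul_vec (a : TruncTensor N d) (v : EuclideanSpace ℝ (Fin d)) :
    homog 0 (a * vec v) = 0 :=
  homog_eq_zero_of_mem (mul_mem_ordGE_right (vec_mem_ordGE v)) Nat.one_pos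

namespace Dev

variable {u v : ℝ → EuclideanSpace ℝ (Fin d)} {S R : ℝ → TruncTensor N d}

lemma homog_zero_eq (h : Dev u S) (s t : ℝ) : homog 0 (S t) = homog 0 (S s) := by
  have := (LinearMap.toContinuousLinearMap
    (homog (N := N) (d := d) 0)).intervalIntegral_comp_comm (h.int_mul s t)
  simp only [LinearMap.coe_toContinuousLinearMap', homog_zero_mul_vec,
    intervalIntegral.integral_zero] at this
  rw [← h.eq, map_sub] at this
  exact sub_eq_zero.1 this.symm

lemma homog_succ_sub (h : Dev u S) (k : ℕ) (s t : ℝ) :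
    homog (k + 1) (S t) - homog (k + 1) (S s) = ∫ r in s..t, homog k (S r) * vec (u r) := by
  have := (LinearMap.toContinuousLinearMap
    (homog (N := N) (d := d) (k + 1))).intervalIntegral_comp_comm (h.int_mul s t)
  simp only [LinearMap.coe_toContinuousLinearMap', homog_succ_mul_vec] at this
  rw [this, ← h.eq, map_sub]

lemma norm_int (h : Dev u S) (s t : ℝ) : IntervalIntegrable (fun r => ‖u r‖) volume s t :=
  (h.int s t).norm

/-- Each order is the integral of the previous one against u. Bounding the integrand by its maximum
loses the factor 1/k!, which plays no role later. -/
lemma norm_homog_le (h : Dev u S) {a b l : ℝ} (h1 : S a = 1)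
    (hl : ∫ r in a..b, ‖u r‖ ≤ l) (k : ℕ) {t : ℝ} (ht : t ∈ Icc a b) :
    ‖homog k (S t)‖ ≤ ‖(1 : TruncTensor N d)‖ * (mulC N d * l) ^ k := by
  have hC := mulC_pos (N := N) (d := d)
  have hl0 : 0 ≤ l := (intervalIntegral.integral_nonneg (ht.1.trans ht.2)
    fun _ _ => norm_nonneg _).trans hl
  induction k generalizing t with
  | zero =>
    rw [h.homog_zero_eq a t, h1, homog_one, if_pos rfl]
    simp
  | succ k ih =>
    have e := h.homog_succ_sub k a t
    rw [h1, homog_one, if_neg (by omega), sub_zero] at e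
    rw [e]
    have hb : ∀ r ∈ Ioc a t, ‖homog k (S r) * vec (u r)‖ ≤
        mulC N d * (‖(1 : TruncTensor N d)‖ * (mulC N d * l) ^ k) * ‖u r‖ := by
      intro r hr
      refine (TruncTensor.norm_mul_le' _ _).trans ?_
      have := ih ⟨hr.1.le, hr.2.trans ht.2⟩
      have := norm_vec_le (N := N) (u r)
      gcongr
    refine (intervalIntegral.norm_integral_le_of_norm_le ht.1 (Eventually.of_forall hb)
      ((h.norm_int a t).const_mul _)).trans ?_
    rw [intervalIntegral.integral_const_mul]
    have : ∫ r in a..t, ‖u r‖ ≤ l := (intervalIntegral.integral_mono_interval le_rfl ht.1 ht.2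
      (Eventually.of_forall fun _ => norm_nonneg _) (h.norm_int a b)).trans hl
    calc _ ≤ mulC N d * (‖(1 : TruncTensor N d)‖ * (mulC N d * l) ^ k) * l := by gcongr
      _ = _ := by ring

/-- Split S u - R v = (S - R) u + R (u - v) and induct on the order. The bound is of first order in
e and of order k in l, a shape that `exists_rho_path_le` turns into a (k+1)-st power of one control.
-/
lemma norm_homog_sub_le (h : Dev u S) (h' : Dev v R) {a b l e : ℝ} (h1 : S a = 1) (h1' : R a = 1)
    (hl : ∫ r in a..b, ‖u r‖ ≤ l) (hl' : ∫ r in a..b, ‖v r‖ ≤ l)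
    (he : ∫ r in a..b, ‖u r - v r‖ ≤ e) (k : ℕ) {t : ℝ} (ht : t ∈ Icc a b) :
    ‖homog (k + 1) (S t - R t)‖ ≤
      (k + 1) * ‖(1 : TruncTensor N d)‖ * mulC N d ^ (k + 1) * l ^ k * e := by
  have hC := mulC_pos (N := N) (d := d)
  have hl0 : 0 ≤ l := (intervalIntegral.integral_nonneg (ht.1.trans ht.2)
    fun _ _ => norm_nonneg _).trans hl
  have he0 : 0 ≤ e := (intervalIntegral.integral_nonneg (ht.1.trans ht.2)
    fun _ _ => norm_nonneg _).trans he
  have hint : ∀ s t, IntervalIntegrable (fun r => ‖u r - v r‖) volume s t := fun s t =>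
    ((h.int s t).sub (h'.int s t)).norm
  have hD : ∀ (k : ℕ) (t : ℝ), homog (k + 1) (S t - R t) =
      ∫ r in a..t, (homog k (S r - R r) * vec (u r) + homog k (R r) * vec (u r - v r)) := by
    intro k t
    have e1 := h.homog_succ_sub k a t
    have e2 := h'.homog_succ_sub k a t
    rw [h1] at e1
    rw [h1'] at e2
    have i1 : IntervalIntegrable (fun r => homog k (S r) * vec (u r)) volume a t :=
      intervalIntegrable_mul_vec (h.int a t) ((continuous_homog k).comp h.cont).continuousOn
    have i2 : IntervalIntegrable (fun r => homog k (R r) * vec (v r)) volume a t :=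
      intervalIntegrable_mul_vec (h'.int a t) ((continuous_homog k).comp h'.cont).continuousOn
    rw [map_sub, ← sub_sub_sub_cancel_right _ _ (homog (k + 1) 1), e1, e2,
      ← intervalIntegral.integral_sub i1 i2]
    refine intervalIntegral.integral_congr fun r _ => ?_
    simp only [map_sub, vec_sub]
    noncomm_ring
  have hmono : ∀ {t}, t ∈ Icc a b → ∀ {f : ℝ → ℝ}, (∀ r, 0 ≤ f r) →
      IntervalIntegrable f volume a b → ∫ r in a..t, f r ≤ ∫ r in a..b, f r := fun ht _ hf hi =>
    intervalIntegral.integral_mono_interval le_rfl ht.1 ht.2 (Eventually.of_forall hf) hi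
  induction k generalizing t with
  | zero =>
    rw [hD 0 t]
    have h0 : ∀ r, homog 0 (S r - R r) = 0 := fun r => by
      rw [map_sub, h.homog_zero_eq a r, h'.homog_zero_eq a r, h1, h1', sub_self]
    have hb : ∀ r ∈ Ioc a t, ‖homog 0 (S r - R r) * vec (u r) + homog 0 (R r) * vec (u r - v r)‖ ≤
        mulC N d * ‖(1 : TruncTensor N d)‖ * ‖u r - v r‖ := by
      intro r hr
      rw [h0, zero_mul, zero_add]
      refine (TruncTensor.norm_mul_le' _ _).trans ?_
      have := h'.norm_homog_le h1' hl' 0 (t := r) ⟨hr.1.le, hr.2.trans ht.2⟩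
      rw [pow_zero, mul_one] at this
      have := norm_vec_le (N := N) (u r - v r)
      gcongr
    refine (intervalIntegral.norm_integral_le_of_norm_le ht.1 (Eventually.of_forall hb)
      ((hint a t).const_mul _)).trans ?_
    rw [intervalIntegral.integral_const_mul]
    have := (hmono ht (fun r => norm_nonneg (u r - v r)) (hint a b)).trans he
    calc _ ≤ mulC N d * ‖(1 : TruncTensor N d)‖ * e := by gcongr
      _ = _ := by rw [Nat.cast_zero, zero_add, one_mul, zero_add, pow_one, pow_zero]; ring
  | succ k ih =>
    rw [hD (k + 1) t]
    set A := (k + 1) * ‖(1 : TruncTensor N d)‖ * mulC N d ^ (k + 1) * l ^ k * e with hA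
    set B := ‖(1 : TruncTensor N d)‖ * (mulC N d * l) ^ (k + 1) with hB
    have hb : ∀ r ∈ Ioc a t, ‖homog (k + 1) (S r - R r) * vec (u r) +
        homog (k + 1) (R r) * vec (u r - v r)‖ ≤
        mulC N d * A * ‖u r‖ + mulC N d * B * ‖u r - v r‖ := by
      intro r hr
      have hr' : r ∈ Icc a b := ⟨hr.1.le, hr.2.trans ht.2⟩
      refine (norm_add_le _ _).trans (add_le_add ((TruncTensor.norm_mul_le' _ _).trans ?_)
        ((TruncTensor.norm_mul_le' _ _).trans ?_))
      · have := ih hr'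
        have := norm_vec_le (N := N) (u r)
        gcongr
      · have := h'.norm_homog_le h1' hl' (k + 1) hr'
        have := norm_vec_le (N := N) (u r - v r)
        gcongr
    refine (intervalIntegral.norm_integral_le_of_norm_le ht.1 (Eventually.of_forall hb)
      (((h.norm_int a t).const_mul _).add ((hint a t).const_mul _))).trans ?_
    rw [intervalIntegral.integral_add ((h.norm_int a t).const_mul _) ((hint a t).const_mul _),
      intervalIntegral.integral_const_mul, intervalIntegral.integral_const_mul]
    have i1 := (hmono ht (fun r => norm_nonneg (u r)) (h.norm_int a b)).trans hl
    have i2 := (hmono ht (fun r => norm_nonneg (u r - v r)) (hint a b)).trans he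
    calc _ ≤ mulC N d * A * l + mulC N d * B * e := by gcongr
      _ = _ := by rw [hA, hB]; push_cast; ring

end Dev

lemma norm_le_sum_homog (a : TruncTensor N d) : ‖a‖ ≤ ∑ k ∈ Finset.range (N + 1), ‖homog k a‖ := by
  conv_lhs => rw [← sum_homog a]
  exact norm_sum_le _ _

/-! ### Existence -/

/-- The Picard iterates for `dS = S ⊗ u dt`, `S_a = 1`. -/
def picard (a : ℝ) (u : ℝ → EuclideanSpace ℝ (Fin d)) : ℕ → ℝ → TruncTensor N d
  | 0, _ => 1
  | n + 1, t => 1 + ∫ r in a..t, picard a u n r * vec (u r)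

/-- The component of order k of the iterates no longer changes from the k-th iterate on, because
integration against u raises the order by one. The N-th Picard iterate is thus an exact solution,
with no convergence argument. -/
lemma exists_dev (a : ℝ) {u : ℝ → EuclideanSpace ℝ (Fin d)}
    (hu : ∀ s t, IntervalIntegrable u volume s t) :
    ∃ S : ℝ → TruncTensor N d, Dev u S ∧ S a = 1 := by
  have hc : ∀ n, Continuous (picard (N := N) a u n) := by
    intro n
    induction n with
    | zero => exact continuous_const
    | succ n ih =>
      exact continuous_const.add (intervalIntegral.continuous_primitive
        (fun s t => intervalIntegrable_mul_vec (hu s t) ih.continuousOn) a)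
  have hi := fun n s t => intervalIntegrable_mul_vec (hu s t) (hc n).continuousOn
  have key : ∀ k n t, k ≤ n → homog k (picard (N := N) a u (n + 1) t) = homog k (picard a u n t) := by
    intro k
    induction k with
    | zero =>
      intro n t _
      have : ∀ n, homog 0 (picard (N := N) a u n t) = 1 := by
        intro n
        cases n with
        | zero => simp [picard, homog_one]
        | succ n =>
          have := (LinearMap.toContinuousLinearMap
            (homog (N := N) (d := d) 0)).intervalIntegral_comp_comm (hi n a t)
          simp only [LinearMap.coe_toContinuousLinearMap', homog_zero_mul_vec,
            intervalIntegral.integral_zero] at this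
          rw [picard, map_add, ← this, homog_one]
          simp
      rw [this, this]
    | succ k ih =>
      intro n t hn
      have h1 : ∀ n, homog (k + 1) (picard (N := N) a u (n + 1) t) =
          ∫ r in a..t, homog k (picard a u n r) * vec (u r) := by
        intro n
        have := (LinearMap.toContinuousLinearMap
          (homog (N := N) (d := d) (k + 1))).intervalIntegral_comp_comm (hi n a t)
        simp only [LinearMap.coe_toContinuousLinearMap', homog_succ_mul_vec] at this
        rw [picard, map_add, ← this, homog_one, if_neg (by omega), zero_add]
      obtain ⟨m, rfl⟩ : ∃ m, n = m + 1 := ⟨n - 1, by omega⟩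
      rw [h1, h1]
      simp only [ih m _ (by omega)]
  have hS : ∀ t, picard (N := N) a u (N + 1) t = picard a u N t := by
    intro t
    rw [← sum_homog (picard a u (N + 1) t), ← sum_homog (picard a u N t)]
    exact Finset.sum_congr rfl fun k hk => key k N t (by simp at hk; omega)
  have he : ∀ t, picard (N := N) a u N t = 1 + ∫ r in a..t, picard a u N r * vec (u r) :=
    fun t => (hS t).symm
  refine ⟨picard a u N, ⟨hu, hc N, fun s t => ?_⟩, ?_⟩
  · rw [← intervalIntegral.integral_interval_sub_left (hi N a t) (hi N a s), he t, he s]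
    abel
  · rw [he a]
    simp

/-! ### Lifts are group-like -/

lemma Dev.hasDerivAt {u : ℝ → EuclideanSpace ℝ (Fin d)} {S : ℝ → TruncTensor N d} (h : Dev u S)
    (hu : Continuous u) (t : ℝ) : HasDerivAt S (S t * vec (u t)) t := by
  have hc : Continuous fun r => S r * vec (u r) := by
    have := h.cont
    have : Continuous fun r => (vec (u r) : TruncTensor N d) := vecL.continuous.comp hu
    fun_prop
  have h1 := intervalIntegral.integral_hasDerivAt_right (a := 0) (b := t)
    (hc.intervalIntegrable 0 t) hc.stronglyMeasurable.stronglyMeasurableAtFilter hc.continuousAt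
  have h2 := h1.const_add (S 0)
  refine h2.congr_of_eventuallyEq (Eventually.of_forall fun s => ?_)
  simp only [← h.eq]
  abel

lemma differentiable_tensor_mul {f g : ℝ → TruncTensor N d} (hf : Differentiable ℝ f)
    (hg : Differentiable ℝ g) : Differentiable ℝ fun t => f t * g t := fun t =>
  (hasDerivAt_tensor_mul (hf t).hasDerivAt (hg t).hasDerivAt).differentiableAt

lemma differentiable_inv {S : ℝ → TruncTensor N d} (hS : Differentiable ℝ S) :
    Differentiable ℝ fun t => TruncTensor.inv (S t) := by
  have h1 : ∀ k : ℕ, Differentiable ℝ fun t => (1 - S t) ^ k := by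
    intro k
    induction k with
    | zero => simp
    | succ k ih =>
      simp only [pow_succ]
      exact differentiable_tensor_mul ih (hS.const_sub 1)
  unfold TruncTensor.inv
  exact Differentiable.fun_sum fun k _ => h1 k

lemma Dev.coeff_nil {u : ℝ → EuclideanSpace ℝ (Fin d)} {S : ℝ → TruncTensor N d} (h : Dev u S)
    (s t : ℝ) : coeff (S t) [] = coeff (S s) [] := by
  have := congrArg (fun a => coeff a ([] : List (Fin d))) (h.homog_zero_eq s t)
  simpa [coeff_homog] using this

/-- The curve B = S⁻¹ deg S starts at 0 and solves B' = [B, u] + deg u, with u viewed as a tensor of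
order one. -/
lemma Dev.isGroupLike_of_continuous {u : ℝ → EuclideanSpace ℝ (Fin d)} {S : ℝ → TruncTensor N d}
    (h : Dev u S) (hu : Continuous u) {a : ℝ} (ha : S a = 1) (t : ℝ) : IsGroupLike (S t) := by
  have hc : ∀ t, coeff (S t) [] = 1 := fun t => by
    rw [h.coeff_nil a t, ha, coeff_one (by simp), if_pos rfl]
  have hR : ∀ t, HasDerivAt (fun t => TruncTensor.inv (S t))
      (-(vec (u t) * TruncTensor.inv (S t))) t := by
    intro t
    have hd := (differentiable_inv (fun t => (h.hasDerivAt hu t).differentiableAt) t).hasDerivAt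
    set R' := deriv (fun t => TruncTensor.inv (S t)) t
    have h1 := hasDerivAt_tensor_mul hd (h.hasDerivAt hu t)
    -- The derivative of the inverse is read off from the constant product of the inverse with S.
    have h2 : HasDerivAt (fun s => TruncTensor.inv (S s) * S s) 0 t := by
      simp only [inv_mul_cancel' (hc _)]
      exact hasDerivAt_const _ _
    have h3 := h1.unique h2
    have h4 : R' = -(vec (u t) * TruncTensor.inv (S t)) := by
      have : R' * S t = -vec (u t) := by
        rw [← mul_assoc, inv_mul_cancel' (hc t), one_mul] at h3
        exact eq_neg_of_add_eq_zero_left h3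
      rw [← mul_one R', ← mul_inv_cancel' (hc t), ← mul_assoc, this, neg_mul]
    rwa [h4] at hd
  refine ⟨hc t, mem_lie_of_hasDerivAt (B := fun t => TruncTensor.inv (S t) * deg (S t))
    (c := fun t => vec (u t)) (w := fun t => deg (vec (u t))) (fun t => ?_)
    (fun t => vec_mem_lie _) (fun t => deg_mem_lie (vec_mem_lie _)) (r := a) ?_ t⟩
  · refine (hasDerivAt_tensor_mul (hR t) ((h.hasDerivAt hu t).linearMap_comp deg)).congr_deriv ?_
    rw [deg_mul, mul_add, ← mul_assoc (TruncTensor.inv (S t)) (S t), inv_mul_cancel' (hc t),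
      Ring.lie_def]
    noncomm_ring
  · rw [ha, deg_one, mul_zero]
    exact zero_mem _

lemma exists_continuous_approx {u : ℝ → EuclideanSpace ℝ (Fin d)} {a b : ℝ} (hab : a ≤ b)
    (hu : IntervalIntegrable u volume a b) {ε : ℝ} (hε : 0 < ε) :
    ∃ v : ℝ → EuclideanSpace ℝ (Fin d), Continuous v ∧ HasCompactSupport v ∧
      ∫ r in a..b, ‖u r - v r‖ ≤ ε := by
  have h1 : Integrable u (volume.restrict (Ioc a b)) :=
    (intervalIntegrable_iff_integrableOn_Ioc_of_le hab).1 hu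
  obtain ⟨v, hv1, hv2, hv3, -⟩ := h1.exists_hasCompactSupport_integral_sub_le hε
  exact ⟨v, hv3, hv1, by rwa [intervalIntegral.integral_of_le hab]⟩

lemma Dev.norm_sub_le {u v : ℝ → EuclideanSpace ℝ (Fin d)} {S R : ℝ → TruncTensor N d}
    (h : Dev u S) (h' : Dev v R) {a b l e : ℝ} (h1 : S a = 1) (h1' : R a = 1)
    (hl : ∫ r in a..b, ‖u r‖ ≤ l) (hl' : ∫ r in a..b, ‖v r‖ ≤ l)
    (he : ∫ r in a..b, ‖u r - v r‖ ≤ e) {t : ℝ} (ht : t ∈ Icc a b) :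
    ‖S t - R t‖ ≤
      (∑ k ∈ Finset.range N, (k + 1) * ‖(1 : TruncTensor N d)‖ * mulC N d ^ (k + 1) * l ^ k) * e := by
  refine (norm_le_sum_homog _).trans ?_
  rw [Finset.sum_range_succ', Finset.sum_mul]
  have h0 : homog 0 (S t - R t) = 0 := by
    rw [map_sub, h.homog_zero_eq a t, h'.homog_zero_eq a t, h1, h1', sub_self]
  rw [h0, norm_zero, add_zero]
  exact Finset.sum_le_sum fun k _ => h.norm_homog_sub_le h' h1 h1' hl hl' he k ht

/-- Approximate u in L¹ by continuous functions. Their lifts are group-like and converge to S by the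
stability estimate, and the set of group-like tensors is closed. -/
lemma Dev.isGroupLike_aux {u : ℝ → EuclideanSpace ℝ (Fin d)} {S : ℝ → TruncTensor N d}
    (h : Dev u S) {a : ℝ} (ha : S a = 1) {t : ℝ} (hat : a ≤ t) : IsGroupLike (S t) := by
  set l := (∫ r in a..t, ‖u r‖) + 1 with hl
  set C := ∑ k ∈ Finset.range N,
    ((k : ℝ) + 1) * ‖(1 : TruncTensor N d)‖ * mulC N d ^ (k + 1) * l ^ k with hC
  have hint : 0 ≤ ∫ r in a..t, ‖u r‖ :=
    intervalIntegral.integral_nonneg hat fun _ _ => norm_nonneg _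
  have hC0 : 0 ≤ C := by
    have := mulC_pos (N := N) (d := d)
    refine Finset.sum_nonneg fun k _ => by positivity
  refine isClosed_isGroupLike.closure_subset (Metric.mem_closure_iff.2 fun ε hε => ?_)
  obtain ⟨v, hv, -, hve⟩ := exists_continuous_approx hat (h.int a t)
    (ε := min 1 (ε / (C + 1) / 2)) (by positivity)
  obtain ⟨R, hR, hRa⟩ := exists_dev (N := N) a (u := v) fun s t => hv.intervalIntegrable s t
  refine ⟨R t, hR.isGroupLike_of_continuous hv hRa t, ?_⟩
  have hvl : ∫ r in a..t, ‖v r‖ ≤ l := by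
    have h1 : ∫ r in a..t, ‖v r‖ ≤ ∫ r in a..t, (‖u r‖ + ‖u r - v r‖) := by
      refine intervalIntegral.integral_mono_on hat (hR.norm_int a t)
        ((h.norm_int a t).add ((h.int a t).sub (hR.int a t)).norm) fun r _ => ?_
      have := _root_.norm_sub_le (u r) (u r - v r)
      rwa [sub_sub_cancel] at this
    rw [intervalIntegral.integral_add (h.norm_int a t) ((h.int a t).sub (hR.int a t)).norm] at h1
    linarith [min_le_left 1 (ε / (C + 1) / 2)]
  have := h.norm_sub_le hR ha hRa (by rw [hl]; linarith) hvl hve (right_mem_Icc.2 hat)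
  rw [dist_eq_norm]
  refine this.trans_lt ?_
  rw [← hC]
  calc C * min 1 (ε / (C + 1) / 2) ≤ (C + 1) * (ε / (C + 1) / 2) := by
        gcongr
        · linarith
        · exact min_le_right _ _
    _ = ε / 2 := by field_simp
    _ < ε := by linarith

lemma Dev.isGroupLike {u : ℝ → EuclideanSpace ℝ (Fin d)} {S : ℝ → TruncTensor N d}
    (h : Dev u S) {a : ℝ} (ha : S a = 1) (t : ℝ) : IsGroupLike (S t) := by
  rcases le_total a t with hat | hat
  · exact h.isGroupLike_aux ha hat
  · have hc : coeff (S t) [] = 1 := by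
      rw [h.coeff_nil a t, ha, coeff_one (by simp), if_pos rfl]
    -- For t before a, translate so that the path starts from the unit at time t; its value at a is
    -- then the inverse of `S t`.
    have h1 := (h.const_mul (TruncTensor.inv (S t))).isGroupLike_aux (inv_mul_cancel' hc) hat
    simp only [ha, mul_one] at h1
    have h2 := h1.inv
    rwa [inv_eq_of_mul_eq_one h1.1 (inv_mul_cancel' hc)] at h2

/-! ### The Carnot–Carathéodory norm -/

lemma lintegral_enorm_eq {u : ℝ → EuclideanSpace ℝ (Fin d)} {a b : ℝ} (hab : a ≤ b)
    (hu : IntervalIntegrable u volume a b) :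
    ∫⁻ s in Icc a b, ‖u s‖ₑ = ENNReal.ofReal (∫ r in a..b, ‖u r‖) := by
  rw [intervalIntegral.integral_of_le hab, ofReal_integral_norm_eq_lintegral_enorm
    ((intervalIntegrable_iff_integrableOn_Ioc_of_le hab).1 hu), restrict_Ioc_eq_restrict_Icc]

/-- An affine time change to the unit interval preserves length, so any interval may serve in place
of the one in the definition. -/
lemma Dev.ccNorm_le {u : ℝ → EuclideanSpace ℝ (Fin d)} {S : ℝ → TruncTensor N d} (h : Dev u S)
    {a b : ℝ} (hab : a ≤ b) (ha : S a = 1) :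
    ccNorm (S b) ≤ ENNReal.ofReal (∫ r in a..b, ‖u r‖) := by
  have h' := h.comp_affine (b - a) a
  have hL := h'.isLift (by simpa using ha) 1
  have hb : S ((b - a) * 1 + a) = S b := by simp
  refine (iInf₂_le_of_le _ _ (iInf_le_of_le ⟨hL, hb⟩ le_rfl)).trans ?_
  · rw [lintegral_enorm_eq zero_le_one (h'.int 0 1)]
    refine ENNReal.ofReal_le_ofReal (le_of_eq ?_)
    have := intervalIntegral.smul_integral_comp_mul_add (a := 0) (b := 1)
      (fun r => ‖u r‖) (b - a) a
    simp only [norm_smul, Real.norm_eq_abs, abs_of_nonneg (sub_nonneg.2 hab),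
      intervalIntegral.integral_const_mul]
    simpa using this

lemma exists_dev_of_ccNorm_lt {g : TruncTensor N d} {c : ℝ≥0∞} (h : ccNorm g < c) :
    ∃ (u : ℝ → EuclideanSpace ℝ (Fin d)) (S : ℝ → TruncTensor N d), Dev u S ∧ S 0 = 1 ∧ S 1 = g ∧
      ENNReal.ofReal (∫ r in (0 : ℝ)..1, ‖u r‖) < c := by
  simp only [ccNorm, iInf_lt_iff] at h
  obtain ⟨u, S, ⟨hS, hg⟩, hu⟩ := h
  refine ⟨_, _, hS.dev zero_le_one, ?_, ?_, ?_⟩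
  · rw [projIcc_left]
    exact hS.apply_zero zero_le_one
  · rw [projIcc_right]
    exact hg
  · rw [← lintegral_enorm_eq zero_le_one ((hS.dev zero_le_one).int 0 1),
      ← restrict_Ioc_eq_restrict_Icc]
    rw [← restrict_Ioc_eq_restrict_Icc] at hu
    refine lt_of_eq_of_lt (setLIntegral_congr_fun measurableSet_Ioc fun r hr => ?_) hu
    simp only [indicator_of_mem hr]

lemma ccNorm_one : ccNorm (1 : TruncTensor N d) = 0 := by
  have := (Dev.zero (1 : TruncTensor N d)).ccNorm_le (zero_le_one (α := ℝ)) rfl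
  simpa using this

/-- Concatenate almost optimal paths for g and h, the second translated by g. -/
lemma ccNorm_mul_le (g h : TruncTensor N d) : ccNorm (g * h) ≤ ccNorm g + ccNorm h := by
  rcases eq_or_ne (ccNorm g) ∞ with hg | hg
  · simp [hg]
  rcases eq_or_ne (ccNorm h) ∞ with hh | hh
  · simp [hh]
  refine ENNReal.le_of_forall_pos_le_add fun ε hε _ => ?_
  have hε' : (ε / 2 : NNReal) ≠ 0 := by positivity
  obtain ⟨u, S, hS, hS0, hS1, hu⟩ := exists_dev_of_ccNorm_lt
    (ENNReal.lt_add_right hg (ENNReal.coe_ne_zero.2 hε'))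
  obtain ⟨v, R, hR, hR0, hR1, hv⟩ := exists_dev_of_ccNorm_lt
    (ENNReal.lt_add_right hh (ENNReal.coe_ne_zero.2 hε'))
  have hR' := (hR.comp_affine 1 (-1)).const_mul g
  have hc := hS.concat hR' (b := 1) (by simp [hS1, hR0])
  have h2 := hc.ccNorm_le (a := 0) (b := 2) zero_le_two (by simp [hS0])
  have e1 : (if (2 : ℝ) ≤ 1 then S 2 else g * R (1 * 2 + -1)) = g * h := by
    rw [if_neg (by norm_num), ← hR1]
    norm_num
  rw [e1] at h2
  refine h2.trans ?_
  rw [← intervalIntegral.integral_add_adjacent_intervals (hc.norm_int 0 1) (hc.norm_int 1 2)]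
  have i1 : ∫ r in (0 : ℝ)..1, ‖if r ≤ 1 then u r else (1 : ℝ) • v (1 * r + -1)‖ =
      ∫ r in (0 : ℝ)..1, ‖u r‖ := by
    refine intervalIntegral.integral_congr fun r hr => ?_
    rw [uIcc_of_le zero_le_one] at hr
    simp only [if_pos hr.2]
  have i2 : ∫ r in (1 : ℝ)..2, ‖if r ≤ 1 then u r else (1 : ℝ) • v (1 * r + -1)‖ =
      ∫ r in (0 : ℝ)..1, ‖v r‖ := by
    have := intervalIntegral.integral_comp_add_right (a := 1) (b := 2) (fun r => ‖v r‖) (-1)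
    norm_num at this
    rw [← this]
    refine intervalIntegral.integral_congr_ae (Eventually.of_forall fun r hr => ?_)
    rw [uIoc_of_le one_le_two] at hr
    rw [if_neg (not_le.2 hr.1), one_smul, one_mul]
  rw [i1, i2]
  refine ENNReal.ofReal_add_le.trans ((add_le_add hu.le hv.le).trans (le_of_eq ?_))
  rw [add_add_add_comm, ← ENNReal.coe_add, add_halves]

/-- A path from the unit to g, run backwards and multiplied by h on the left, leads from h g = 1 to
h with the same length. -/
lemma ccNorm_le_of_mul_eq_one {g h : TruncTensor N d} (e : h * g = 1) :
    ccNorm h ≤ ccNorm g := by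
  refine le_of_forall_gt fun c hc => ?_
  obtain ⟨u, S, hS, hS0, hS1, hu⟩ := exists_dev_of_ccNorm_lt hc
  have h1 := ((hS.comp_affine (-1) 1).const_mul h).ccNorm_le zero_le_one (by simp [hS1, e])
  simp only [mul_one, neg_add_cancel, hS0] at h1
  refine h1.trans_lt (lt_of_eq_of_lt ?_ hu)
  congr 1
  have := intervalIntegral.integral_comp_sub_left (a := 0) (b := 1) (fun r => ‖u r‖) 1
  simp only [sub_zero, sub_self] at this
  rw [← this]
  refine intervalIntegral.integral_congr fun r _ => ?_
  simp only [neg_smul, one_smul, norm_neg]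
  congr 2
  ring

lemma ccNorm_dil_le (g : TruncTensor N d) {c : ℝ} (hc : 0 < c) :
    ccNorm (dil c g) ≤ ENNReal.ofReal c * ccNorm g := by
  have hc' : ENNReal.ofReal c ≠ 0 := by simpa using hc
  refine le_of_forall_gt fun e he => ?_
  have h1 : ccNorm g < e / ENNReal.ofReal c := by
    rw [ENNReal.lt_div_iff_mul_lt (Or.inl hc') (Or.inl ENNReal.ofReal_ne_top), mul_comm]
    exact he
  obtain ⟨u, S, hS, hS0, hS1, hu⟩ := exists_dev_of_ccNorm_lt h1
  have h2 := (hS.dil c).ccNorm_le zero_le_one (by rw [hS0, map_one])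
  rw [hS1] at h2
  refine h2.trans_lt ?_
  simp only [norm_smul, Real.norm_eq_abs, abs_of_pos hc, intervalIntegral.integral_const_mul]
  rw [ENNReal.ofReal_mul hc.le, mul_comm]
  exact (ENNReal.lt_div_iff_mul_lt (Or.inl hc') (Or.inl ENNReal.ofReal_ne_top)).1 hu

lemma ccNorm_gexp_le (v : EuclideanSpace ℝ (Fin d)) :
    ccNorm (TruncTensor.exp (vec v) : TruncTensor N d) ≤ ‖v‖ₑ := by
  have hD : Dev (fun _ => v) fun t : ℝ => TruncTensor.exp (t • (vec v : TruncTensor N d)) := by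
    have hd := hasDerivAt_exp_smul (vec_mem_ordGE (N := N) v)
    have hc : Continuous fun t : ℝ => TruncTensor.exp (t • (vec v : TruncTensor N d)) :=
      continuous_iff_continuousAt.2 fun t => (hd t).continuousAt
    refine ⟨fun s t => intervalIntegrable_const, hc, fun s t => ?_⟩
    rw [intervalIntegral.integral_eq_sub_of_hasDerivAt (fun t _ => hd t)]
    exact (hc.mul continuous_const).intervalIntegrable _ _
  have := hD.ccNorm_le zero_le_one (by rw [zero_smul, exp_zero'])
  simpa using this

variable (N d) in
/-- The constant in the estimate of tensor components by the Carnot–Carathéodory norm. -/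
def ballC : ℝ := ‖(1 : TruncTensor N d)‖ * mulC N d ^ N

lemma ballC_nonneg : 0 ≤ ballC N d := by
  have := mulC_pos (N := N) (d := d)
  unfold ballC
  positivity

/-- This is the easy half of the ball-box comparison: a path of length l has component of order k at
most a constant times l^k. -/
lemma norm_homog_le_of_ccNorm {g : TruncTensor N d} {l : ℝ} (hl : 0 ≤ l)
    (h : ccNorm g ≤ ENNReal.ofReal l) (k : ℕ) : ‖homog k g‖ ≤ ballC N d * l ^ k := by
  by_cases hk : k ≤ N
  swap
  · rw [homog_of_lt (not_le.1 hk), norm_zero]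
    have := ballC_nonneg (N := N) (d := d)
    positivity
  have key : ∀ l' > l, ‖homog k g‖ ≤ ‖(1 : TruncTensor N d)‖ * (mulC N d * l') ^ k := by
    intro l' hl'
    obtain ⟨u, S, hS, hS0, hS1, hu⟩ := exists_dev_of_ccNorm_lt
      (h.trans_lt ((ENNReal.ofReal_lt_ofReal_iff (hl.trans_lt hl')).2 hl'))
    have := hS.norm_homog_le hS0 (ENNReal.ofReal_lt_ofReal_iff_of_nonneg
      (intervalIntegral.integral_nonneg zero_le_one fun _ _ => norm_nonneg _) |>.1 hu).le k
      (right_mem_Icc.2 zero_le_one)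
    rwa [hS1] at this
  have h2 : ‖homog k g‖ ≤ ‖(1 : TruncTensor N d)‖ * (mulC N d * l) ^ k := by
    -- The infimum in the norm need not be attained, so the estimate is obtained for every l' > l
    -- and then passed to the limit.
    have hc : Continuous fun l' : ℝ => ‖(1 : TruncTensor N d)‖ * (mulC N d * l') ^ k := by fun_prop
    exact ge_of_tendsto (hc.continuousAt.tendsto.mono_left nhdsWithin_le_nhds)
      (eventually_nhdsWithin_of_forall (s := Ioi l) key)
  refine h2.trans ?_
  rw [mul_pow, ← mul_assoc, ballC]
  have := one_le_mulC (N := N) (d := d)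
  gcongr

lemma norm_level_le_of_ccNorm {g : TruncTensor N d} {l : ℝ} (hl : 0 ≤ l)
    (h : ccNorm g ≤ ENNReal.ofReal l) (k : Fin (N + 1)) :
    ‖level k g‖ ≤ ballC N d * l ^ (k : ℕ) := by
  rw [← norm_homog]
  exact norm_homog_le_of_ccNorm hl h k

/-! ### The Carnot–Carathéodory distance -/

lemma ccDist_eq (g h : G N d) : ccDist g h = ccNorm ((g⁻¹ * h : G N d) : TruncTensor N d) := by
  rw [ccDist, incr_eq]

lemma ccDist_self (g : G N d) : ccDist g g = 0 := by
  rw [ccDist_eq, inv_mul_cancel, G.coe_one, ccNorm_one]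

lemma ccDist_triangle (g h k : G N d) : ccDist g k ≤ ccDist g h + ccDist h k := by
  simp only [ccDist_eq]
  have : g⁻¹ * k = g⁻¹ * h * (h⁻¹ * k) := by group
  rw [this, G.coe_mul]
  exact ccNorm_mul_le _ _

lemma ccNorm_inv_le (g : G N d) : ccNorm ((g⁻¹ : G N d) : TruncTensor N d) ≤ ccNorm (g : TruncTensor N d) :=
  ccNorm_le_of_mul_eq_one (by rw [← G.coe_mul, inv_mul_cancel, G.coe_one])

lemma ccDist_comm (g h : G N d) : ccDist g h = ccDist h g := by
  have : ∀ g h : G N d, ccDist g h ≤ ccDist h g := fun g h => by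
    simp only [ccDist_eq]
    have := ccNorm_inv_le (h⁻¹ * g)
    rwa [mul_inv_rev, inv_inv] at this
  exact le_antisymm (this g h) (this h g)

lemma ccDist_mul_left (k g h : G N d) : ccDist (k * g) (k * h) = ccDist g h := by
  rw [ccDist_eq, ccDist_eq]
  congr 2
  group

lemma G.homog_zero (g : G N d) : homog 0 (g : TruncTensor N d) = 1 := by
  refine ext_coeff fun w hw => ?_
  rw [coeff_homog, coeff_one hw]
  by_cases hw' : w = []
  · subst hw'
    simp [g.coeff_nil]
  · rw [if_neg hw', if_neg (by simpa using hw')]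

lemma mul_mem_ordGE_of_le {i j k : ℕ} {a b : TruncTensor N d} (ha : a ∈ ordGE i) (hb : b ∈ ordGE j)
    (h : k ≤ i + j) : a * b ∈ ordGE k := ordGE_mono h (mul_mem_ordGE ha hb)

lemma eq_one_of_ccNorm_eq_zero {g : G N d} (h : ccNorm (g : TruncTensor N d) = 0) : g = 1 := by
  refine Subtype.ext ?_
  have h1 : ∀ k, homog (k + 1) (g : TruncTensor N d) = 0 := fun k => by
    have := norm_homog_le_of_ccNorm (g := (g : TruncTensor N d)) le_rfl (by simp [h]) (k + 1)
    simpa using this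
  rw [← sum_homog (g : TruncTensor N d), Finset.sum_range_succ']
  simp only [h1, Finset.sum_const_zero, zero_add, G.homog_zero, G.coe_one]

/-- There is a `K`-Lipschitz path from the identity to `g` on the unit interval. -/
def Joined (K : ℝ) (g : G N d) : Prop :=
  ∃ c : ℝ → G N d, c 0 = 1 ∧ c 1 = g ∧ ∀ s t, ccDist (c s) (c t) ≤ ENNReal.ofReal (K * |t - s|)

namespace Joined

variable {K L : ℝ} {g h : G N d}

lemma mono (hg : Joined K g) (hKL : K ≤ L) : Joined L g := by
  obtain ⟨c, h0, h1, hc⟩ := hg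
  exact ⟨c, h0, h1, fun s t => (hc s t).trans (ENNReal.ofReal_le_ofReal (by gcongr))⟩

lemma one : Joined 0 (1 : G N d) := ⟨fun _ => 1, rfl, rfl, fun s t => by simp [ccDist_self]⟩

lemma gexp (v : EuclideanSpace ℝ (Fin d)) : Joined ‖v‖ (gexp v : G N d) := by
  refine ⟨fun t => CadlagRough.gexp (t • v), ?_, ?_, fun s t => ?_⟩
  · simp only [zero_smul, gexp_zero]
  · simp only [one_smul]
  · have h1 : (CadlagRough.gexp (s • v) : G N d)⁻¹ * CadlagRough.gexp (t • v) =
        CadlagRough.gexp ((t - s) • v) := by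
      rw [inv_gexp, ← neg_smul, gexp_mul_gexp, neg_add_eq_sub]
    rw [ccDist_eq, h1, coe_gexp]
    refine (ccNorm_gexp_le _).trans ?_
    rw [← ofReal_norm, norm_smul, Real.norm_eq_abs, mul_comm]

lemma mul (hg : Joined K g) (hh : Joined K h) : Joined (2 * K) (g * h) := by
  obtain ⟨c, c0, c1, hc⟩ := hg
  obtain ⟨e, e0, e1, he⟩ := hh
  set f : ℝ → G N d := fun t => if t ≤ 1 / 2 then c (2 * t) else g * e (2 * t - 1) with hf
  have hl : ∀ s t, s ≤ 1 / 2 → t ≤ 1 / 2 →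
      ccDist (f s) (f t) ≤ ENNReal.ofReal (2 * K * |t - s|) := by
    intro s t hs ht
    simp only [hf, if_pos hs, if_pos ht]
    refine (hc _ _).trans (le_of_eq ?_)
    rw [← mul_sub, abs_mul, abs_two]
    congr 1
    ring
  have hr' : ∀ t, 1 / 2 ≤ t → f t = g * e (2 * t - 1) := by
    intro t ht
    simp only [hf]
    split_ifs with h
    · have : t = 1 / 2 := le_antisymm h ht
      rw [this]
      norm_num
      rw [c1, e0, mul_one]
    · rfl
  have hr : ∀ s t, 1 / 2 ≤ s → 1 / 2 ≤ t →
      ccDist (f s) (f t) ≤ ENNReal.ofReal (2 * K * |t - s|) := by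
    intro s t hs ht
    rw [hr' s hs, hr' t ht, ccDist_mul_left]
    refine (he _ _).trans (le_of_eq ?_)
    rw [show 2 * t - 1 - (2 * s - 1) = 2 * (t - s) by ring, abs_mul, abs_two]
    congr 1
    ring
  -- If K is negative, all the bounds are `ENNReal.ofReal` of nonpositive numbers, hence zero.
  have hK : 0 ≤ K ∨ K < 0 := le_or_gt 0 K
  have hm : ∀ s t, s ≤ 1 / 2 → 1 / 2 ≤ t →
      ccDist (f s) (f t) ≤ ENNReal.ofReal (2 * K * |t - s|) := by
    intro s t hs ht
    refine (ccDist_triangle _ (f (1 / 2)) _).trans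
      ((add_le_add (hl _ _ hs le_rfl) (hr _ _ le_rfl ht)).trans ?_)
    rcases hK with hK | hK
    · rw [← ENNReal.ofReal_add (by positivity) (by positivity), abs_of_nonneg (by linarith),
        abs_of_nonneg (by linarith), abs_of_nonneg (by linarith)]
      refine ENNReal.ofReal_le_ofReal (le_of_eq ?_)
      ring
    · have : ∀ x : ℝ, ENNReal.ofReal (2 * K * |x|) = 0 := fun x =>
        ENNReal.ofReal_of_nonpos (by nlinarith [abs_nonneg x])
      simp [this]
  refine ⟨f, ?_, ?_, fun s t => ?_⟩
  · simp [hf, c0]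
  · rw [hr' 1 (by norm_num)]
    norm_num
    exact e1
  · rcases le_total s (1 / 2) with hs | hs <;> rcases le_total t (1 / 2) with ht | ht
    · exact hl s t hs ht
    · exact hm s t hs ht
    · rw [ccDist_comm, abs_sub_comm]
      exact hm t s ht hs
    · exact hr s t hs ht

lemma inv (hg : Joined K g) : Joined K g⁻¹ := by
  obtain ⟨c, c0, c1, hc⟩ := hg
  refine ⟨fun t => g⁻¹ * c (1 - t), by simp [c1], by simp [c0], fun s t => ?_⟩
  rw [ccDist_mul_left]
  refine (hc _ _).trans (le_of_eq ?_)
  rw [sub_sub_sub_cancel_left, abs_sub_comm]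

lemma dil (hg : Joined K g) {c : ℝ} (hc : 0 < c) : Joined (c * K) (gdil c g) := by
  obtain ⟨e, e0, e1, he⟩ := hg
  refine ⟨fun t => gdil c (e t), by simp [e0], by simp [e1], fun s t => ?_⟩
  rw [ccDist_eq, ← map_inv, ← map_mul, coe_gdil]
  refine (ccNorm_dil_le _ hc).trans ?_
  rw [mul_assoc, ENNReal.ofReal_mul hc.le]
  gcongr
  rw [← ccDist_eq]
  exact he s t

lemma ccNorm_le (hg : Joined K g) : ccNorm (g : TruncTensor N d) ≤ ENNReal.ofReal K := by
  obtain ⟨c, c0, c1, hc⟩ := hg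
  have := hc 0 1
  simpa [c0, c1, ccDist_eq] using this

end Joined

/-! ### Connectivity by horizontal paths -/

lemma exists_bounded_preimage {E F : Type*} [NormedAddCommGroup E] [NormedSpace ℝ E]
    [FiniteDimensional ℝ E] [NormedAddCommGroup F] [NormedSpace ℝ F] [FiniteDimensional ℝ F]
    (f : E →ₗ[ℝ] F) : ∃ M : ℝ, 0 ≤ M ∧ ∀ y ∈ LinearMap.range f, ∃ x, f x = y ∧ ‖x‖ ≤ M * ‖y‖ := by
  obtain ⟨g, hg⟩ := f.rangeRestrict.exists_rightInverse_of_surjective f.range_rangeRestrict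
  refine ⟨‖LinearMap.toContinuousLinearMap g‖, norm_nonneg (LinearMap.toContinuousLinearMap g), fun y hy => ⟨g ⟨y, hy⟩, ?_, ?_⟩⟩
  · have := congrArg Subtype.val (LinearMap.congr_fun hg ⟨y, hy⟩)
    simpa using this
  · exact (LinearMap.toContinuousLinearMap g).le_opNorm ⟨y, hy⟩

lemma exp_sub_mem_ordGE {a : TruncTensor N d} {k : ℕ} (ha : a ∈ ordGE (k + 1)) :
    TruncTensor.exp a - 1 - a ∈ ordGE (k + 2) := by
  have := exp_add_sub_exp_mem_ordGE (zero_mem (ordGE 1)) ha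
  rwa [zero_add, exp_zero'] at this

lemma G.sub_one_mem (g : G N d) : (g : TruncTensor N d) - 1 ∈ ordGE 1 := by
  rw [mem_ordGE_one, coeff_sub, g.coeff_nil, coeff_one (by simp)]
  simp

/-- A group commutator reproduces the Lie bracket to leading order: heh⁻¹e⁻¹ - 1 = (he - eh) h⁻¹e⁻¹,
and he - eh is the commutator of h - 1 with e - 1, whose leading term is [X, V]. -/
lemma commutator_mem_ordGE {h e : G N d} {X V : TruncTensor N d} {k : ℕ} (hX : X ∈ ordGE k)
    (hV : V ∈ ordGE 1) (hh : (h : TruncTensor N d) - 1 - X ∈ ordGE (k + 1))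
    (he : (e : TruncTensor N d) - 1 - V ∈ ordGE 2) :
    ((h * e * h⁻¹ * e⁻¹ : G N d) : TruncTensor N d) - 1 - ⁅X, V⁆ ∈ ordGE (k + 2) := by
  set a := (h : TruncTensor N d) with ha
  set b := (e : TruncTensor N d) with hb
  have e1 : a * b - b * a - ⁅X, V⁆ = (a - 1 - X) * (b - 1) - (b - 1) * (a - 1 - X) +
      (X * (b - 1 - V) - (b - 1 - V) * X) := by
    rw [Ring.lie_def]
    noncomm_ring
  have hb1 : b - 1 ∈ ordGE 1 := e.sub_one_mem
  have e2 : a * b - b * a - ⁅X, V⁆ ∈ ordGE (k + 2) := by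
    rw [e1]
    refine add_mem (sub_mem ?_ ?_) (sub_mem ?_ ?_)
    · exact mul_mem_ordGE_of_le hh hb1 (by omega)
    · exact mul_mem_ordGE_of_le hb1 hh (by omega)
    · exact mul_mem_ordGE hX he
    · exact mul_mem_ordGE_of_le he hX (by omega)
  have hXV : ⁅X, V⁆ ∈ ordGE (N := N) (d := d) (k + 1) := by
    rw [Ring.lie_def]
    refine sub_mem (mul_mem_ordGE hX hV) ?_
    rw [add_comm]
    exact mul_mem_ordGE hV hX
  have e3 : ((h * e * h⁻¹ * e⁻¹ : G N d) : TruncTensor N d) - 1 =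
      (a * b - b * a) * ((h⁻¹ * e⁻¹ : G N d) : TruncTensor N d) := by
    have h1 : b * a * ((h⁻¹ * e⁻¹ : G N d) : TruncTensor N d) = 1 := by
      rw [ha, hb, ← G.coe_mul, ← G.coe_mul]
      simp
    rw [sub_mul, h1, ha, hb, ← G.coe_mul, ← G.coe_mul, mul_assoc (h * e)]
  have e4 : ((h * e * h⁻¹ * e⁻¹ : G N d) : TruncTensor N d) - 1 - ⁅X, V⁆ =
      (a * b - b * a - ⁅X, V⁆) * ((h⁻¹ * e⁻¹ : G N d) : TruncTensor N d) +
      ⁅X, V⁆ * (((h⁻¹ * e⁻¹ : G N d) : TruncTensor N d) - 1) := by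
    rw [e3]
    noncomm_ring
  rw [e4]
  exact add_mem (mul_mem_ordGE_left e2) (mul_mem_ordGE_of_le hXV (G.sub_one_mem _) (by omega))

lemma brackets_le_ordGE {k : ℕ} {X : TruncTensor N d} (hX : X ∈ brackets N d k) :
    X ∈ ordGE k := by
  induction k using brackets.induct generalizing X with
  | case1 => exact mem_ordGE_zero X
  | case2 =>
    obtain ⟨v, rfl⟩ := hX
    exact vec_mem_ordGE v
  | case3 k ih =>
    rw [brackets] at hX
    refine (Submodule.span_le (p := ordGE (k + 2))).2 ?_ hX
    rintro _ ⟨b, hb, v, rfl⟩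
    rw [Ring.lie_def]
    exact sub_mem (mul_mem_ordGE_of_le (ih hb) (vec_mem_ordGE v) (by omega))
      (mul_mem_ordGE_of_le (vec_mem_ordGE v) (ih hb) (by omega))

/-- The group elements that approximate a tensor of order `k` up to terms of higher order, uniformly
on bounded sets. -/
def Approximable (V : Submodule ℝ (TruncTensor N d)) (k : ℕ) : Prop :=
  ∀ R : ℝ, ∃ K : ℝ, 0 ≤ K ∧ ∀ X ∈ V, ‖X‖ ≤ R →
    ∃ h : G N d, Joined K h ∧ (h : TruncTensor N d) - 1 - X ∈ ordGE (k + 1)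

lemma mul_sub_one_sub_add_mem {a b X Y : TruncTensor N d} {j k : ℕ} (ha : a - 1 ∈ ordGE j)
    (hb : b - 1 ∈ ordGE 1) (hX : a - 1 - X ∈ ordGE k) (hY : b - 1 - Y ∈ ordGE k) (h : k ≤ j + 1) :
    a * b - 1 - (X + Y) ∈ ordGE k := by
  have e1 : a * b - 1 - (X + Y) = (a - 1 - X) + (b - 1 - Y) + (a - 1) * (b - 1) := by noncomm_ring
  rw [e1]
  exact add_mem (add_mem hX hY) (mul_mem_ordGE_of_le ha hb h)

/-- Multiply the group commutators for the basis vectors one after another. Each is close to 1 to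
order k, so the product adds their leading terms up to a higher order. -/
lemma Approximable.lie_basis {V : Submodule ℝ (TruncTensor N d)} {k : ℕ} (hV : Approximable V k)
    (hk : V ≤ ordGE k) (R : ℝ) (s : Finset (Fin d)) :
    ∃ K : ℝ, 0 ≤ K ∧ ∀ b : Fin d → V, ‖b‖ ≤ R → ∃ h : G N d, Joined K h ∧ (h : TruncTensor N d) - 1 -
      ∑ i ∈ s, ⁅(b i : TruncTensor N d), vec (EuclideanSpace.single i 1)⁆ ∈ ordGE (k + 2) := by
  obtain ⟨K, hK, hKb⟩ := hV R
  induction s using Finset.induction_on with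
  | empty => exact ⟨0, le_rfl, fun b _ => ⟨1, Joined.one, by simp⟩⟩
  | insert i s his ihs =>
    obtain ⟨K', hK', hb'⟩ := ihs
    -- A commutator is a product of four curves, hence three doublings of the Lipschitz constant,
    -- and the outer factor 2 pays for the product with the remaining indices. The exponentials of
    -- basis vectors are 1-Lipschitz, which explains `max K 1`.
    refine ⟨2 * max (2 * (2 * (2 * max K 1))) K', by positivity, fun b hb => ?_⟩
    obtain ⟨h', hh', hm'⟩ := hb' b hb
    obtain ⟨h, hh, hm⟩ := hKb (b i) (b i).2 ((norm_le_pi_norm b i).trans hb)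
    have hje : Joined (max K 1) (gexp (EuclideanSpace.single i 1) : G N d) := by
      refine (Joined.gexp _).mono ?_
      rw [PiLp.norm_single, norm_one]
      exact le_max_right _ _
    have hjh : Joined (max K 1) h := hh.mono (le_max_left _ _)
    have hK1' : max K 1 ≤ 2 * max K 1 := by linarith [le_max_right K 1]
    have hK2' : max K 1 ≤ 2 * (2 * max K 1) := by linarith [le_max_right K 1]
    have hcom := ((hjh.mul hje).mul (hjh.inv.mono hK1')).mul (hje.inv.mono hK2')
    refine ⟨_, (hcom.mono (le_max_left _ _)).mul (hh'.mono (le_max_right _ _)), ?_⟩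
    have hbi : (b i : TruncTensor N d) ∈ ordGE k := hk (b i).2
    have hvi := vec_mem_ordGE (N := N) (EuclideanSpace.single i (1 : ℝ) : EuclideanSpace ℝ (Fin d))
    have he : ((gexp (EuclideanSpace.single i 1) : G N d) : TruncTensor N d) - 1 -
        vec (EuclideanSpace.single i 1) ∈ ordGE 2 := exp_sub_mem_ordGE (k := 0) hvi
    have hc := commutator_mem_ordGE hbi hvi hm he
    have hX : ⁅(b i : TruncTensor N d), (vec (EuclideanSpace.single i 1) : TruncTensor N d)⁆ ∈
        ordGE (N := N) (d := d) (k + 1) := by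
      rw [Ring.lie_def]
      exact sub_mem (mul_mem_ordGE hbi hvi) (mul_mem_ordGE_of_le hvi hbi (by omega))
    rw [Finset.sum_insert his, G.coe_mul]
    refine mul_sub_one_sub_add_mem (j := k + 1) ?_ h'.sub_one_mem hc hm' (by omega)
    have := add_mem (ordGE_mono (by omega : k + 1 ≤ k + 2) hc) hX
    rwa [sub_add_cancel] at this

/-- Every element of the span is a sum of brackets of some b_i in V with the basis vectors. The b_i
can be chosen with norm bounded by that of the element, since a linear map of finite-dimensional
spaces has a bounded linear section over its range. -/
lemma Approximable.span_lie {V : Submodule ℝ (TruncTensor N d)} {k : ℕ} (hV : Approximable V k)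
    (hk : V ≤ ordGE k) :
    Approximable (Submodule.span ℝ {c | ∃ b ∈ V, ∃ v, c = ⁅b, (vec v : TruncTensor N d)⁆}) (k + 1) := by
  intro R
  let F : (Fin d → V) →ₗ[ℝ] TruncTensor N d :=
    ∑ i, (LinearMap.mulRight ℝ (vec (EuclideanSpace.single i 1)) -
      LinearMap.mulLeft ℝ (vec (EuclideanSpace.single i 1))) ∘ₗ V.subtype ∘ₗ LinearMap.proj i
  have hF : ∀ b, F b = ∑ i, ⁅(b i : TruncTensor N d), vec (EuclideanSpace.single i 1)⁆ := by
    intro b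
    simp [F, Ring.lie_def]
  obtain ⟨M, hM, hMx⟩ := exists_bounded_preimage F
  obtain ⟨K', hK', hb'⟩ := hV.lie_basis hk (M * |R|) Finset.univ
  refine ⟨K', hK', fun X hX hXR => ?_⟩
  have hXF : X ∈ LinearMap.range F := by
    refine (Submodule.span_le (p := LinearMap.range F)).2 ?_ hX
    rintro _ ⟨b, hb, v, rfl⟩
    refine ⟨fun i => v i • ⟨b, hb⟩, ?_⟩
    rw [hF]
    have hv : (vec v : TruncTensor N d) = ∑ i, v i • vec (EuclideanSpace.single i 1) := by
      have h1 : v = ∑ i, v i • (EuclideanSpace.single i 1 : EuclideanSpace ℝ (Fin d)) := by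
        ext j
        simp [Pi.single_apply]
      have h2 := congrArg (vecL (N := N)) h1
      rw [map_sum] at h2
      simpa only [map_smul, vecL_apply] using h2
    rw [hv]
    simp only [Ring.lie_def, Finset.mul_sum, Finset.sum_mul, ← Finset.sum_sub_distrib]
    refine Finset.sum_congr rfl fun i _ => ?_
    simp only [Submodule.coe_smul, smul_mul_assoc, mul_smul_comm]
  obtain ⟨b, rfl, hb⟩ := hMx X hXF
  obtain ⟨h, hh, hm⟩ := hb' b (hb.trans (by gcongr; exact hXR.trans (le_abs_self R)))
  exact ⟨h, hh, by rwa [hF]⟩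

lemma approximable_brackets (k : ℕ) : Approximable (brackets N d (k + 1)) (k + 1) := by
  induction k with
  | zero =>
    intro R
    obtain ⟨M, hM, hMx⟩ := exists_bounded_preimage (vecₗ (N := N) (d := d))
    refine ⟨M * |R|, by positivity, fun X hX hXR => ?_⟩
    obtain ⟨v, rfl, hv⟩ := hMx X hX
    exact ⟨gexp v, (Joined.gexp v).mono (hv.trans (by gcongr; exact hXR.trans (le_abs_self R))),
      exp_sub_mem_ordGE (vec_mem_ordGE v)⟩
  | succ k ih => exact ih.span_lie fun _ => brackets_le_ordGE

/-- The lowest-order part of deg g = g b says that k times the leading component of g equals that of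
the Lie element b. -/
lemma homog_mem_brackets_of_group (g : G N d) {k : ℕ} (hk : 1 ≤ k)
    (hg : (g : TruncTensor N d) - 1 ∈ ordGE k) : homog k (g : TruncTensor N d) ∈ brackets N d k := by
  set a := (g : TruncTensor N d) with ha
  set b := inv a * deg a with hb
  have hd : deg a = a * b := g.isGroupLike.deg_eq
  have hda : deg a ∈ ordGE k := by
    have := deg_mem_ordGE hg
    rwa [map_sub, deg_one, sub_zero] at this
  have hbk : b ∈ ordGE k := mul_mem_ordGE_right hda
  have e : (k : ℝ) • homog k a = homog k b := by
    rw [← homog_deg, hd]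
    have : a * b = b + (a - 1) * b := by noncomm_ring
    rw [this, map_add, homog_eq_zero_of_mem (mul_mem_ordGE g.sub_one_mem hbk) (by omega), add_zero]
  have : homog k a = (k : ℝ)⁻¹ • homog k b := by
    rw [← e, smul_smul, inv_mul_cancel₀ (by positivity), one_smul]
  rw [this]
  exact Submodule.smul_mem _ _ (homog_mem_brackets g.isGroupLike.2 k)

lemma Joined.norm_le {K : ℝ} (hK : 0 ≤ K) {g : G N d} (h : Joined K g) :
    ‖(g : TruncTensor N d)‖ ≤ ∑ k ∈ Finset.range (N + 1), ballC N d * K ^ k :=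
  (norm_le_sum_homog _).trans
    (Finset.sum_le_sum fun k _ => norm_homog_le_of_ccNorm hK h.ccNorm_le k)

/-- Chow's theorem, order by order. Approximate the leading component of g by a reachable element h;
then h⁻¹g differs from 1 only at higher order and stays in a bounded set, so the induction applies
to it. -/
lemma exists_joined_of_ordGE (j k : ℕ) (hjk : j + k = N) (R : ℝ) : ∃ K : ℝ, 0 ≤ K ∧ ∀ g : G N d,
    (g : TruncTensor N d) - 1 ∈ ordGE (k + 1) → ‖(g : TruncTensor N d)‖ ≤ R → Joined K g := by
  induction j generalizing k R with
  | zero =>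
    refine ⟨0, le_rfl, fun g hg _ => ?_⟩
    have : (g : TruncTensor N d) - 1 = 0 := eq_zero_of_mem_ordGE (by
      rwa [show k = N by omega] at hg)
    have h1 : g = 1 := Subtype.ext (sub_eq_zero.1 this)
    rw [h1]
    exact Joined.one
  | succ j ih =>
    obtain ⟨K₁, hK₁, h1⟩ := approximable_brackets (N := N) (d := d) k R
    -- The third argument bounds the norm of h⁻¹g: the sum bounds h⁻¹, which is reached with
    -- constant `K₁`, and R bounds g.
    obtain ⟨K₂, hK₂, h2⟩ := ih (k + 1) (by omega)
      (mulC N d * (∑ k ∈ Finset.range (N + 1), ballC N d * K₁ ^ k) * R)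
    refine ⟨2 * max K₁ K₂, by positivity, fun g hg hgR => ?_⟩
    have hR : 0 ≤ R := (norm_nonneg _).trans hgR
    obtain ⟨h, hh, hm⟩ := h1 (homog (k + 1) (g : TruncTensor N d))
      (homog_mem_brackets_of_group g (by omega) hg) ((norm_homog_le _ _).trans hgR)
    have hgh : (g : TruncTensor N d) - h ∈ ordGE (k + 2) := by
      have h3 := sub_homog_mem_ordGE hg
      rw [map_sub, homog_one, if_neg (by omega), sub_zero] at h3
      have := sub_mem h3 hm
      rwa [sub_sub_sub_cancel_right, sub_sub_sub_cancel_right] at this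
    have h4 : Joined K₂ (h⁻¹ * g) := by
      refine h2 _ ?_ ?_
      · have : ((h⁻¹ * g : G N d) : TruncTensor N d) - 1 = ((h⁻¹ : G N d) : TruncTensor N d) * (g - h) := by
          rw [mul_sub, ← G.coe_mul, ← G.coe_mul, inv_mul_cancel, G.coe_one]
        rw [this]
        exact mul_mem_ordGE_right hgh
      · rw [G.coe_mul]
        refine (TruncTensor.norm_mul_le' _ _).trans ?_
        have h6 := hh.inv.norm_le hK₁
        have := mulC_pos (N := N) (d := d)
        have := (norm_nonneg _).trans h6
        gcongr
    have h5 := (hh.mono (le_max_left K₁ K₂)).mul (h4.mono (le_max_right K₁ K₂))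
    rwa [mul_inv_cancel_left] at h5

/-- Every element of the group is reached by a Lipschitz path whose constant is controlled by the
homogeneous norm. -/
lemma exists_joined_of_homog_le (N d : ℕ) : ∃ K : ℝ, 0 ≤ K ∧ ∀ (g : G N d) (l : ℝ), 0 < l →
    (∀ k, ‖homog (k + 1) (g : TruncTensor N d)‖ ≤ l ^ (k + 1)) → Joined (K * l) g := by
  -- After dilation by 1/l each of the N components of positive order has norm at most 1, and the
  -- component of order zero is the unit.
  obtain ⟨K, hK, h⟩ := exists_joined_of_ordGE (N := N) (d := d) N 0 rfl (N + ‖(1 : TruncTensor N d)‖)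
  refine ⟨K, hK, fun g l hl hg => ?_⟩
  have h1 : Joined K (gdil l⁻¹ g) := by
    refine h _ (G.sub_one_mem _) ?_
    refine (norm_le_sum_homog _).trans ?_
    rw [Finset.sum_range_succ']
    refine add_le_add ?_ ?_
    · refine (Finset.sum_le_card_nsmul _ _ 1 fun k _ => ?_).trans (by simp)
      rw [coe_gdil, homog_dil, norm_smul, norm_pow, norm_inv, Real.norm_eq_abs, abs_of_pos hl,
        inv_pow, inv_mul_le_iff₀ (by positivity), mul_one]
      exact hg k
    · rw [G.homog_zero]
  have h2 := h1.dil hl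
  have h3 : gdil l (gdil l⁻¹ g) = g := Subtype.ext (by
    rw [coe_gdil, coe_gdil, dil_dil, mul_inv_cancel₀ hl.ne', dil_one])
  rwa [h3, mul_comm] at h2

lemma exists_joined_of_ccNorm_le (N d : ℕ) : ∃ K : ℝ, 0 ≤ K ∧ ∀ (g : G N d) (l : ℝ), 0 ≤ l →
    ccNorm (g : TruncTensor N d) ≤ ENNReal.ofReal l → Joined (K * l) g := by
  obtain ⟨K, hK, h⟩ := exists_joined_of_homog_le N d
  refine ⟨K * max 1 (ballC N d), by positivity, fun g l hl hg => ?_⟩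
  rcases hl.eq_or_lt with rfl | hl
  · have h1 : g = 1 := eq_one_of_ccNorm_eq_zero (by simpa using hg)
    rw [h1, mul_zero]
    exact Joined.one
  · rw [mul_assoc]
    refine h g _ (by positivity) fun k => (norm_homog_le_of_ccNorm hl.le hg _).trans ?_
    rw [mul_pow]
    gcongr
    exact (le_max_right _ _).trans (le_self_pow₀ (le_max_left _ _) (by omega))

lemma ccNorm_lt_top (g : G N d) : ccNorm (g : TruncTensor N d) < ∞ := by
  obtain ⟨K, hK, h⟩ := exists_joined_of_homog_le N d
  refine (h g (1 + ‖(g : TruncTensor N d)‖) (by positivity) fun k => ?_).ccNorm_le.trans_lt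
    ENNReal.ofReal_lt_top
  refine (norm_homog_le _ _).trans ((le_add_of_nonneg_left zero_le_one).trans
    (le_self_pow₀ (by simp) (by omega)))

lemma ccDist_lt_top (g h : G N d) : ccDist g h < ∞ := by
  rw [ccDist_eq]
  exact ccNorm_lt_top _

lemma tendsto_ccNorm_one : Tendsto (fun g : G N d => ccNorm (g : TruncTensor N d)) (𝓝 1) (𝓝 0) := by
  obtain ⟨K, hK, h⟩ := exists_joined_of_homog_le N d
  rw [ENNReal.tendsto_nhds_zero]
  intro ε hε
  obtain ⟨e, he0, he⟩ : ∃ e : ℝ, 0 < e ∧ ENNReal.ofReal e ≤ ε := by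
    rcases eq_or_ne ε ∞ with rfl | hε'
    · exact ⟨1, one_pos, le_top⟩
    · exact ⟨ε.toReal, ENNReal.toReal_pos hε.ne' hε', by rw [ENNReal.ofReal_toReal hε']⟩
  set l := e / (K + 1) with hl
  have hl0 : 0 < l := by positivity
  have h1 : ∀ k, ∀ᶠ g : G N d in 𝓝 1, ‖homog (k + 1) (g : TruncTensor N d)‖ ≤ l ^ (k + 1) := by
    intro k
    have hc : Continuous fun g : G N d => ‖homog (k + 1) (g : TruncTensor N d)‖ :=
      ((continuous_homog _).comp continuous_subtype_val).norm
    have h0 : ‖homog (k + 1) ((1 : G N d) : TruncTensor N d)‖ = 0 := by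
      rw [G.coe_one, homog_one, if_neg (by omega), norm_zero]
    exact (hc.continuousAt.eventually_lt continuousAt_const (by rw [h0]; positivity)).mono
      fun g hg => hg.le
  have h2 : ∀ᶠ g : G N d in 𝓝 1, ∀ k ∈ Finset.range N,
      ‖homog (k + 1) (g : TruncTensor N d)‖ ≤ l ^ (k + 1) :=
    (Finset.eventually_all _).2 fun k _ => h1 k
  refine h2.mono fun g hg => (h g l hl0 fun k => ?_).ccNorm_le.trans
    ((ENNReal.ofReal_le_ofReal ?_).trans he)
  · by_cases hk : k < N
    · exact hg k (Finset.mem_range.2 hk)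
    · rw [homog_of_lt (by omega), norm_zero]
      positivity
  · calc K * l ≤ (K + 1) * l := by gcongr; linarith
      _ = e := by rw [hl]; field_simp

lemma tendsto_ccDist {X : Type*} {l : Filter X} {f g : X → G N d} {a : G N d}
    (hf : Tendsto f l (𝓝 a)) (hg : Tendsto g l (𝓝 a)) :
    Tendsto (fun x => ccDist (f x) (g x)) l (𝓝 0) := by
  simp only [ccDist_eq]
  refine tendsto_ccNorm_one.comp ?_
  have := hf.inv.mul hg
  rwa [inv_mul_cancel] at this

/-- Convergence in the Carnot–Carathéodory distance implies convergence in the group. -/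
lemma tendsto_of_ccDist {X : Type*} {l : Filter X} {f g : X → G N d} {a : G N d}
    (hf : Tendsto f l (𝓝 a)) (h : Tendsto (fun x => ccDist (f x) (g x)) l (𝓝 0)) :
    Tendsto g l (𝓝 a) := by
  have h1 : Tendsto (fun x => (f x)⁻¹ * g x) l (𝓝 1) := by
    rw [isClosedEmbedding_coe.isEmbedding.tendsto_nhds_iff]
    have h2 : ∀ k, Tendsto (fun x => homog (k + 1) (((f x)⁻¹ * g x : G N d) : TruncTensor N d)) l (𝓝 0) := by
      intro k
      rw [tendsto_zero_iff_norm_tendsto_zero]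
      have h3 : Tendsto (fun x => ballC N d * (ccDist (f x) (g x)).toReal ^ (k + 1)) l (𝓝 0) := by
        have := ((ENNReal.tendsto_toReal ENNReal.zero_ne_top).comp h).pow (k + 1) |>.const_mul
          (ballC N d)
        simpa using this
      refine squeeze_zero (fun _ => norm_nonneg _) (fun x => ?_) h3
      refine norm_homog_le_of_ccNorm ENNReal.toReal_nonneg ?_ _
      rw [ENNReal.ofReal_toReal (ccDist_lt_top _ _).ne, ccDist_eq]
    have h4 : ∀ g : G N d, (g : TruncTensor N d) =
        (∑ k ∈ Finset.range N, homog (k + 1) (g : TruncTensor N d)) + 1 := by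
      intro g
      conv_lhs => rw [← sum_homog (g : TruncTensor N d), Finset.sum_range_succ', G.homog_zero]
    have h5 : Tendsto (fun x => (∑ k ∈ Finset.range N,
        homog (k + 1) (((f x)⁻¹ * g x : G N d) : TruncTensor N d)) + 1) l (𝓝 ((∑ k ∈ Finset.range N, 0) + 1)) :=
      (tendsto_finsetSum _ fun k _ => h2 k).add_const 1
    simp only [Finset.sum_const_zero, zero_add] at h5
    refine h5.congr fun x => ?_
    exact (h4 _).symm
  have := hf.mul h1
  simpa using this

variable {T : ℝ}

/-! ### Suprema over partitions -/

/-- The supremum over partitions of the sums of a function of pairs of times. -/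
def varSup (c : Icc (0 : ℝ) T → Icc (0 : ℝ) T → ℝ≥0∞) : ℝ≥0∞ :=
  ⨆ (n : ℕ) (t : Fin (n + 1) → Icc (0 : ℝ) T) (_ : IsPartition t),
    ∑ i : Fin n, c (t i.castSucc) (t i.succ)

lemma varSup_le_iff {c : Icc (0 : ℝ) T → Icc (0 : ℝ) T → ℝ≥0∞} {M : ℝ≥0∞} :
    varSup c ≤ M ↔ ∀ (n : ℕ) (t : Fin (n + 1) → Icc (0 : ℝ) T), IsPartition t →
      ∑ i : Fin n, c (t i.castSucc) (t i.succ) ≤ M := by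
  simp only [varSup, iSup_le_iff]

lemma sum_le_varSup (c : Icc (0 : ℝ) T → Icc (0 : ℝ) T → ℝ≥0∞) {n : ℕ}
    {t : Fin (n + 1) → Icc (0 : ℝ) T} (ht : IsPartition t) :
    ∑ i : Fin n, c (t i.castSucc) (t i.succ) ≤ varSup c := varSup_le_iff.1 le_rfl n t ht

lemma varSup_mono {c c' : Icc (0 : ℝ) T → Icc (0 : ℝ) T → ℝ≥0∞}
    (h : ∀ s t, s ≤ t → c s t ≤ c' s t) : varSup c ≤ varSup c' :=
  varSup_le_iff.2 fun _ _ ht => (Finset.sum_le_sum fun _ _ =>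
    h _ _ (ht.1.monotone (Fin.castSucc_lt_succ).le)).trans (sum_le_varSup c' ht)

/-- Repetitions in a monotone sequence can be deleted, as c vanishes on the diagonal. -/
lemma exists_strictMono_sum {α : Type*} [LinearOrder α] (c : α → α → ℝ≥0∞) (hc : ∀ t, c t t = 0)
    {t : ℕ → α} (ht : Monotone t) (n : ℕ) : ∃ (m : ℕ) (s : Fin (m + 1) → α), StrictMono s ∧
      s 0 = t 0 ∧ s (Fin.last m) = t n ∧
      ∑ i ∈ Finset.range n, c (t i) (t (i + 1)) = ∑ i : Fin m, c (s i.castSucc) (s i.succ) := by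
  induction n with
  | zero => exact ⟨0, fun _ => t 0, Fin.strictMono_iff_lt_succ.2 fun i => i.elim0, rfl, rfl, by simp⟩
  | succ n ih =>
    obtain ⟨m, s, hs, h0, hl, hsum⟩ := ih
    rcases (ht n.le_succ).eq_or_lt with h | h
    · refine ⟨m, s, hs, h0, hl.trans h, ?_⟩
      rw [Finset.sum_range_succ, hsum, ← Nat.succ_eq_add_one, ← h, hc, add_zero]
    · refine ⟨m + 1, Fin.snoc s (t (n + 1)), Fin.strictMono_iff_lt_succ.2 fun i => ?_, ?_, ?_, ?_⟩
      · refine Fin.lastCases ?_ (fun i => ?_) i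
        · rw [Fin.snoc_castSucc, Fin.succ_last, Fin.snoc_last, hl]
          exact h
        · rw [Fin.snoc_castSucc, Fin.succ_castSucc, Fin.snoc_castSucc]
          exact hs Fin.castSucc_lt_succ
      · rw [← Fin.castSucc_zero, Fin.snoc_castSucc, h0]
      · rw [Fin.snoc_last]
      · rw [Finset.sum_range_succ, hsum, Fin.sum_univ_castSucc]
        congr 1
        · refine Finset.sum_congr rfl fun i _ => ?_
          rw [Fin.snoc_castSucc, Fin.succ_castSucc, Fin.snoc_castSucc]
        · rw [Fin.snoc_castSucc, Fin.succ_last, Fin.snoc_last, hl]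

/-- The end points 0 and T are added to the sequence and repetitions removed, which gives a genuine
partition. Arbitrary monotone sequences may thus be tested against `varSup`, in particular images of
partitions under a monotone time change. -/
lemma sum_range_le_varSup (hT : 0 ≤ T) (c : Icc (0 : ℝ) T → Icc (0 : ℝ) T → ℝ≥0∞)
    (hc : ∀ t, c t t = 0) {t : ℕ → Icc (0 : ℝ) T} (ht : Monotone t) (n : ℕ) :
    ∑ i ∈ Finset.range n, c (t i) (t (i + 1)) ≤ varSup c := by
  let a : Icc (0 : ℝ) T := ⟨0, le_rfl, hT⟩
  let b : Icc (0 : ℝ) T := ⟨T, hT, le_rfl⟩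
  let t' : ℕ → Icc (0 : ℝ) T := fun i => if i = 0 then a else if i ≤ n + 1 then t (i - 1) else b
  have ht' : Monotone t' := by
    refine monotone_nat_of_le_succ fun i => ?_
    rcases Nat.eq_zero_or_pos i with rfl | hi
    · exact (t' 1).2.1
    rcases le_or_gt (i + 1) (n + 1) with h | h
    · simp only [t']
      rw [if_neg hi.ne', if_pos (by omega), if_neg (by omega), if_pos h]
      exact ht (by omega)
    · have h1 : t' (i + 1) = b := by
        simp only [t']
        rw [if_neg (by omega), if_neg (by omega)]
      rw [h1]
      exact (t' i).2.2
  obtain ⟨m, s, hs, h0, hl, hsum⟩ := exists_strictMono_sum c hc ht' (n + 2)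
  have hp : IsPartition s := ⟨hs, by rw [h0]; simp [t', a], by rw [hl]; simp [t', b]⟩
  refine le_trans ?_ (hsum.le.trans (sum_le_varSup c hp))
  rw [Finset.sum_range_succ, Finset.sum_range_succ']
  refine le_trans (le_of_eq ?_) (le_self_add.trans le_self_add)
  refine Finset.sum_congr rfl fun i hi => ?_
  have hi' := Finset.mem_range.1 hi
  simp only [t']
  rw [if_neg (by omega), if_pos (by omega), if_neg (by omega), if_pos (by omega)]
  rfl

lemma sum_fin_le_varSup (hT : 0 ≤ T) (c : Icc (0 : ℝ) T → Icc (0 : ℝ) T → ℝ≥0∞)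
    (hc : ∀ t, c t t = 0) {n : ℕ} {t : Fin (n + 1) → Icc (0 : ℝ) T} (ht : Monotone t) :
    ∑ i : Fin n, c (t i.castSucc) (t i.succ) ≤ varSup c := by
  let t' : ℕ → Icc (0 : ℝ) T := fun i => t ⟨min i n, by omega⟩
  have ht' : Monotone t' := fun i j hij => ht (by
    rw [Fin.mk_le_mk]
    exact min_le_min_right n hij)
  have := sum_range_le_varSup hT c hc ht' n
  rw [Finset.sum_range] at this
  refine le_trans (le_of_eq (Finset.sum_congr rfl fun i _ => ?_)) this
  simp only [t']
  congr 2
  · ext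
    simp
  · ext
    simp

lemma varSup_comp_le (hT : 0 ≤ T) (c : Icc (0 : ℝ) T → Icc (0 : ℝ) T → ℝ≥0∞)
    (hc : ∀ t, c t t = 0) {θ : Icc (0 : ℝ) T → Icc (0 : ℝ) T} (hθ : Monotone θ) :
    varSup (fun s t => c (θ s) (θ t)) ≤ varSup c :=
  varSup_le_iff.2 fun _ _ ht => sum_fin_le_varSup hT c hc (hθ.comp ht.1.monotone)

lemma le_varSup (hT : 0 ≤ T) (c : Icc (0 : ℝ) T → Icc (0 : ℝ) T → ℝ≥0∞)
    (hc : ∀ t, c t t = 0) {s t : Icc (0 : ℝ) T} (hst : s ≤ t) : c s t ≤ varSup c := by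
  have ht : Monotone fun i : ℕ => if i = 0 then s else t := by
    refine monotone_nat_of_le_succ fun i => ?_
    rcases Nat.eq_zero_or_pos i with rfl | hi
    · simpa using hst
    · simp only [if_neg hi.ne', if_neg i.succ_ne_zero, le_refl]
  simpa using sum_range_le_varSup hT c hc ht 1

lemma sum_telescope_fin {n : ℕ} (f : Fin (n + 1) → ℝ) :
    ∑ i : Fin n, (f i.succ - f i.castSucc) = f (Fin.last n) - f 0 := by
  induction n with
  | zero => simp
  | succ n ih =>
    rw [Fin.sum_univ_castSucc]
    have := ih fun i => f i.castSucc
    simp only [Fin.succ_castSucc, Fin.succ_last, Fin.castSucc_zero] at this ⊢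
    rw [this]
    ring

lemma varSup_le_of_additive (hT : 0 ≤ T) {c : Icc (0 : ℝ) T → Icc (0 : ℝ) T → ℝ≥0∞}
    {A : Icc (0 : ℝ) T → ℝ} (hA : Monotone A)
    (h : ∀ s t, s ≤ t → c s t ≤ ENNReal.ofReal (A t - A s)) :
    varSup c ≤ ENNReal.ofReal (A ⟨T, hT, le_rfl⟩ - A ⟨0, le_rfl, hT⟩) := by
  refine varSup_le_iff.2 fun n t ht => ?_
  have h1 : ∀ i : Fin n, t i.castSucc ≤ t i.succ := fun i =>
    ht.1.monotone (Fin.castSucc_lt_succ).le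
  refine (Finset.sum_le_sum fun i _ => h _ _ (h1 i)).trans ?_
  rw [← ENNReal.ofReal_sum_of_nonneg fun i _ => sub_nonneg.2 (hA (h1 i))]
  rw [sum_telescope_fin fun i => A (t i)]
  have e0 : t 0 = ⟨0, le_rfl, hT⟩ := Subtype.ext ht.2.1
  have e1 : t (Fin.last n) = ⟨T, hT, le_rfl⟩ := Subtype.ext ht.2.2
  rw [e0, e1]

/-! ### The `p`-variation -/

lemma pVar_le_iff {p : ℝ} (hp : 0 < p) {x : Icc (0 : ℝ) T → G N d} {M : ℝ≥0∞} :
    pVar p x ≤ M ↔ varSup (fun s t => ccDist (x s) (x t) ^ p) ≤ M ^ p := by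
  rw [varSup_le_iff]
  simp only [pVar, iSup_le_iff, one_div, ENNReal.rpow_inv_le_iff hp]

lemma varSup_eq_pVar_rpow {p : ℝ} (hp : 0 < p) (x : Icc (0 : ℝ) T → G N d) :
    varSup (fun s t => ccDist (x s) (x t) ^ p) = pVar p x ^ p := by
  refine le_antisymm ((pVar_le_iff hp).1 le_rfl) ?_
  rw [← ENNReal.le_rpow_inv_iff hp, pVar_le_iff hp, ENNReal.rpow_inv_rpow hp.ne']

lemma ccDist_rpow_self {p : ℝ} (hp : 0 < p) (x : Icc (0 : ℝ) T → G N d) (t : Icc (0 : ℝ) T) :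
    ccDist (x t) (x t) ^ p = 0 := by rw [ccDist_self, ENNReal.zero_rpow_of_pos hp]

lemma ccDist_le_pVar (hT : 0 ≤ T) {p : ℝ} (hp : 0 < p) (x : Icc (0 : ℝ) T → G N d)
    {s t : Icc (0 : ℝ) T} (hst : s ≤ t) : ccDist (x s) (x t) ≤ pVar p x := by
  have := le_varSup hT (fun s t => ccDist (x s) (x t) ^ p) (ccDist_rpow_self hp x) hst
  rw [varSup_eq_pVar_rpow hp] at this
  exact (ENNReal.rpow_le_rpow_iff hp).1 this

lemma pVar_comp_le (hT : 0 ≤ T) {p : ℝ} (hp : 0 < p) (x : Icc (0 : ℝ) T → G N d)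
    {θ : Icc (0 : ℝ) T → Icc (0 : ℝ) T} (hθ : Monotone θ) : pVar p (x ∘ θ) ≤ pVar p x := by
  rw [pVar_le_iff hp, ← varSup_eq_pVar_rpow hp]
  exact varSup_comp_le hT (fun s t => ccDist (x s) (x t) ^ p) (ccDist_rpow_self hp x) hθ

lemma sum_rpow_le_rpow_sum {ι : Type*} (s : Finset ι) (f : ι → ℝ≥0∞) {r : ℝ} (hr : 1 ≤ r) :
    ∑ i ∈ s, f i ^ r ≤ (∑ i ∈ s, f i) ^ r := by
  classical
  induction s using Finset.induction_on with
  | empty => simp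
  | insert i s hi ih =>
    rw [Finset.sum_insert hi, Finset.sum_insert hi]
    exact (add_le_add le_rfl ih).trans (ENNReal.add_rpow_le_rpow_add _ _ hr)

lemma varSup_rpow_le (c : Icc (0 : ℝ) T → Icc (0 : ℝ) T → ℝ≥0∞) {q q' : ℝ} (hq : 0 < q)
    (hqq : q ≤ q') : varSup (fun s t => c s t ^ q') ≤ varSup (fun s t => c s t ^ q) ^ (q' / q) := by
  refine varSup_le_iff.2 fun n t ht => ?_
  have h1 : ∀ s t, c s t ^ q' = (c s t ^ q) ^ (q' / q) := fun s t => by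
    rw [← ENNReal.rpow_mul, mul_div_cancel₀ _ hq.ne']
  simp only [h1]
  refine (sum_rpow_le_rpow_sum _ _ ((one_le_div hq).2 hqq)).trans ?_
  exact ENNReal.rpow_le_rpow (sum_le_varSup (fun s t => c s t ^ q) ht) (div_nonneg (hq.le.trans hqq) hq.le)

lemma pVar_anti {p p' : ℝ} (hp : 0 < p) (hpp : p ≤ p') (x : Icc (0 : ℝ) T → G N d) :
    pVar p' x ≤ pVar p x := by
  rw [pVar_le_iff (hp.trans_le hpp)]
  refine (varSup_rpow_le (fun s t => ccDist (x s) (x t)) hp hpp).trans ?_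
  rw [varSup_eq_pVar_rpow hp, ← ENNReal.rpow_mul, mul_div_cancel₀ _ hp.ne']

/-! ### The inhomogeneous distance -/

/-- The distance of the increments of order `k` of two paths. -/
def levelDist (k : Fin (N + 1)) (x y : Icc (0 : ℝ) T → G N d) (s t : Icc (0 : ℝ) T) : ℝ≥0∞ :=
  ‖level k (incr (x s) (x t)) - level k (incr (y s) (y t))‖ₑ

lemma levelDist_self (k : Fin (N + 1)) (x y : Icc (0 : ℝ) T → G N d) (t : Icc (0 : ℝ) T) :
    levelDist k x y t t = 0 := by
  simp [levelDist, incr_eq]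

lemma levelDist_comm (k : Fin (N + 1)) (x y : Icc (0 : ℝ) T → G N d) (s t : Icc (0 : ℝ) T) :
    levelDist k x y s t = levelDist k y x s t := by
  rw [levelDist, levelDist, ← enorm_neg, neg_sub]

lemma levelDist_triangle (k : Fin (N + 1)) (x y z : Icc (0 : ℝ) T → G N d) (s t : Icc (0 : ℝ) T) :
    levelDist k x z s t ≤ levelDist k x y s t + levelDist k y z s t := by
  simp only [levelDist]
  refine le_trans (le_of_eq ?_) (enorm_add_le _ _)
  rw [sub_add_sub_cancel]

lemma levelDist_rpow_self {q : ℝ} (hq : 0 < q) (k : Fin (N + 1)) (x y : Icc (0 : ℝ) T → G N d)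
    (t : Icc (0 : ℝ) T) : levelDist k x y t t ^ q = 0 := by
  rw [levelDist_self, ENNReal.zero_rpow_of_pos hq]

lemma rho_le_iff {p : ℝ} (hp : 0 < p) {x y : Icc (0 : ℝ) T → G N d} {M : ℝ≥0∞} :
    rho p x y ≤ M ↔ ∀ k : Fin (N + 1), 1 ≤ (k : ℕ) →
      varSup (fun s t => levelDist k x y s t ^ (p / (k : ℝ))) ≤ M ^ (p / (k : ℝ)) := by
  simp only [rho, iSup_le_iff, varSup_le_iff, levelDist]
  refine forall_congr' fun k => forall_congr' fun hk => forall_congr' fun n =>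
    forall_congr' fun t => forall_congr' fun ht => ?_
  have hk' : (0 : ℝ) < k := by exact_mod_cast hk
  rw [← inv_div p (k : ℝ), ENNReal.rpow_inv_le_iff (by positivity)]

lemma varSup_levelDist_le {p : ℝ} (hp : 0 < p) (x y : Icc (0 : ℝ) T → G N d) (k : Fin (N + 1))
    (hk : 1 ≤ (k : ℕ)) :
    varSup (fun s t => levelDist k x y s t ^ (p / (k : ℝ))) ≤ rho p x y ^ (p / (k : ℝ)) :=
  (rho_le_iff hp).1 le_rfl k hk

lemma levelDist_le_rho (hT : 0 ≤ T) {p : ℝ} (hp : 0 < p) (x y : Icc (0 : ℝ) T → G N d)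
    (k : Fin (N + 1)) (hk : 1 ≤ (k : ℕ)) {s t : Icc (0 : ℝ) T} (hst : s ≤ t) :
    levelDist k x y s t ≤ rho p x y := by
  have hk' : (0 : ℝ) < k := by exact_mod_cast hk
  have := (le_varSup hT (fun s t => levelDist k x y s t ^ (p / (k : ℝ)))
    (levelDist_rpow_self (by positivity) k x y) hst).trans (varSup_levelDist_le hp x y k hk)
  exact (ENNReal.rpow_le_rpow_iff (by positivity)).1 this

lemma rho_self {p : ℝ} (hp : 0 < p) (x : Icc (0 : ℝ) T → G N d) : rho p x x = 0 := by
  rw [← le_zero_iff, rho_le_iff hp]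
  intro k hk
  have hk' : (0 : ℝ) < k := by exact_mod_cast hk
  refine varSup_le_iff.2 fun n t _ => ?_
  have : ∀ s t, levelDist k x x s t = 0 := fun s t => by simp [levelDist]
  simp [this, ENNReal.zero_rpow_of_pos (div_pos hp hk')]

lemma rho_comm (p : ℝ) (x y : Icc (0 : ℝ) T → G N d) : rho p x y = rho p y x := by
  have := fun k s t => levelDist_comm k x y s t
  simp only [levelDist] at this
  simp only [rho, this]

lemma rho_comp_le (hT : 0 ≤ T) {p : ℝ} (hp : 0 < p) (x y : Icc (0 : ℝ) T → G N d)
    {θ : Icc (0 : ℝ) T → Icc (0 : ℝ) T} (hθ : Monotone θ) : rho p (x ∘ θ) (y ∘ θ) ≤ rho p x y := by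
  refine (rho_le_iff hp).2 fun k hk => ?_
  have hk' : (0 : ℝ) < k := by exact_mod_cast hk
  exact (varSup_comp_le hT (fun s t => levelDist k x y s t ^ (p / (k : ℝ)))
    (levelDist_rpow_self (by positivity) k x y) hθ).trans
    (varSup_levelDist_le hp x y k hk)

lemma rho_comp (hT : 0 ≤ T) {p : ℝ} (hp : 0 < p) (x y : Icc (0 : ℝ) T → G N d)
    (l : Icc (0 : ℝ) T ≃o Icc (0 : ℝ) T) : rho p (x ∘ l) (y ∘ l) = rho p x y := by
  refine le_antisymm (rho_comp_le hT hp x y l.monotone) ?_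
  have := rho_comp_le hT hp (x ∘ l) (y ∘ l) l.symm.monotone
  have e : ∀ z : Icc (0 : ℝ) T → G N d, (z ∘ l) ∘ l.symm = z := fun z => by
    funext u
    simp only [Function.comp_apply, OrderIso.apply_symm_apply]
  rwa [e x, e y] at this

lemma rho_anti {p p' : ℝ} (hp : 0 < p) (hpp : p ≤ p') (x y : Icc (0 : ℝ) T → G N d) :
    rho p' x y ≤ rho p x y := by
  refine (rho_le_iff (hp.trans_le hpp)).2 fun k hk => ?_
  have hk' : (0 : ℝ) < k := by exact_mod_cast hk
  refine (varSup_rpow_le (levelDist k x y) (q := p / k) (by positivity) (by gcongr)).trans ?_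
  refine (ENNReal.rpow_le_rpow (varSup_levelDist_le hp x y k hk)
    (by have := hp.trans_le hpp; positivity)).trans (le_of_eq ?_)
  rw [← ENNReal.rpow_mul, mul_div_cancel₀ _ (by positivity)]

/-- The constant in the quasi-triangle inequality. -/
def quasiC (N : ℕ) (p : ℝ) : ℝ≥0∞ := ENNReal.ofReal (max 1 (2 ^ ((N : ℝ) / p - 1)))

lemma one_le_quasiC (N : ℕ) (p : ℝ) : 1 ≤ quasiC N p := by
  rw [quasiC, ← ENNReal.ofReal_one]
  exact ENNReal.ofReal_le_ofReal (le_max_left _ _)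

lemma quasiC_ne_top (N : ℕ) (p : ℝ) : quasiC N p ≠ ∞ := ENNReal.ofReal_ne_top

/-- For q ≥ 1 this is Minkowski's inequality. For q ≤ 1 the power q is subadditive, and convexity of
the power 1/q costs the factor 2^(1/q - 1). Exponents below 1 do occur, namely q = p/k for the
orders k > p. -/
lemma sum_add_rpow_le {ι : Type*} (s : Finset ι) (f g : ι → ℝ≥0∞) {q : ℝ} (hq : 0 < q) :
    (∑ i ∈ s, (f i + g i) ^ q) ^ (1 / q) ≤ ENNReal.ofReal (max 1 (2 ^ (1 / q - 1))) *
      ((∑ i ∈ s, f i ^ q) ^ (1 / q) + (∑ i ∈ s, g i ^ q) ^ (1 / q)) := by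
  rcases le_total 1 q with h | h
  · refine (ENNReal.Lp_add_le s f g h).trans (le_mul_of_one_le_left' ?_)
    rw [← ENNReal.ofReal_one]
    exact ENNReal.ofReal_le_ofReal (le_max_left _ _)
  · have h1 : ∑ i ∈ s, (f i + g i) ^ q ≤ ∑ i ∈ s, f i ^ q + ∑ i ∈ s, g i ^ q := by
      rw [← Finset.sum_add_distrib]
      exact Finset.sum_le_sum fun i _ => ENNReal.rpow_add_le_add_rpow _ _ hq.le h
    refine (ENNReal.rpow_le_rpow h1 (by positivity)).trans
      ((ENNReal.rpow_add_le_mul_rpow_add_rpow _ _ ((one_le_div hq).2 h)).trans ?_)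
    gcongr
    have : (2 : ℝ≥0∞) ^ (1 / q - 1) = ENNReal.ofReal (2 ^ (1 / q - 1)) := by
      rw [← ENNReal.ofReal_rpow_of_pos two_pos]
      simp
    rw [this]
    exact ENNReal.ofReal_le_ofReal (le_max_right _ _)

lemma rho_triangle {p : ℝ} (hp : 0 < p) (x y z : Icc (0 : ℝ) T → G N d) :
    rho p x z ≤ quasiC N p * (rho p x y + rho p y z) := by
  refine (rho_le_iff hp).2 fun k hk => varSup_le_iff.2 fun n t ht => ?_
  have hk' : (0 : ℝ) < k := by exact_mod_cast hk
  have hq : 0 < p / (k : ℝ) := by positivity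
  rw [← ENNReal.rpow_inv_le_iff hq, ← one_div]
  have h1 : ∑ i : Fin n, levelDist k x z (t i.castSucc) (t i.succ) ^ (p / (k : ℝ)) ≤
      ∑ i : Fin n, (levelDist k x y (t i.castSucc) (t i.succ) +
        levelDist k y z (t i.castSucc) (t i.succ)) ^ (p / (k : ℝ)) :=
    Finset.sum_le_sum fun i _ => ENNReal.rpow_le_rpow (levelDist_triangle _ _ _ _ _ _) hq.le
  refine (ENNReal.rpow_le_rpow h1 (by positivity)).trans ((sum_add_rpow_le _ _ _ hq).trans ?_)
  have h2 : ∀ x y : Icc (0 : ℝ) T → G N d,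
      (∑ i : Fin n, levelDist k x y (t i.castSucc) (t i.succ) ^ (p / (k : ℝ))) ^ (1 / (p / (k : ℝ))) ≤
        rho p x y := by
    intro x y
    rw [one_div, ENNReal.rpow_inv_le_iff hq]
    exact (sum_le_varSup (fun s t => levelDist k x y s t ^ (p / (k : ℝ))) ht).trans
      (varSup_levelDist_le hp x y k hk)
  -- At order k the exponent of 2 is k/p - 1, which is largest at the top order N.
  refine mul_le_mul' (ENNReal.ofReal_le_ofReal (max_le_max le_rfl ?_)) (add_le_add (h2 x y) (h2 y z))
  rw [one_div_div]
  refine Real.rpow_le_rpow_of_exponent_le one_le_two (sub_le_sub_right ?_ _)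
  gcongr
  exact_mod_cast Nat.lt_succ_iff.1 k.2

/-! ### Comparison of the two variations -/

lemma enorm_level_le_ccDist (k : Fin (N + 1)) (g h : G N d) :
    ‖level k (incr g h)‖ₑ ≤ ENNReal.ofReal (ballC N d) * ccDist g h ^ (k : ℕ) := by
  have h1 := norm_level_le_of_ccNorm (g := incr g h) (l := (ccDist g h).toReal)
    ENNReal.toReal_nonneg (by rw [ENNReal.ofReal_toReal (ccDist_lt_top g h).ne]; rfl) k
  rw [← ofReal_norm]
  refine (ENNReal.ofReal_le_ofReal h1).trans (le_of_eq ?_)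
  rw [ENNReal.ofReal_mul ballC_nonneg, ENNReal.ofReal_pow ENNReal.toReal_nonneg,
    ENNReal.ofReal_toReal (ccDist_lt_top g h).ne]

/-- The constant in the comparison of increments with the Carnot–Carathéodory distance. -/
def cmpC (N d : ℕ) (p : ℝ) (k : ℕ) : ℝ≥0∞ := (2 * ENNReal.ofReal (ballC N d)) ^ (p / (k : ℝ))

lemma cmpC_ne_top {p : ℝ} (hp : 0 < p) (k : ℕ) : cmpC N d p k ≠ ∞ :=
  (ENNReal.rpow_lt_top_of_nonneg (by positivity)
    (ENNReal.mul_ne_top ENNReal.ofNat_ne_top ENNReal.ofReal_ne_top)).ne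

lemma levelDist_rpow_le {p : ℝ} (hp : 0 < p) (x y : Icc (0 : ℝ) T → G N d) (k : Fin (N + 1))
    (hk : 1 ≤ (k : ℕ)) (s t : Icc (0 : ℝ) T) : levelDist k x y s t ^ (p / (k : ℝ)) ≤
      cmpC N d p k * (ccDist (x s) (x t) ^ p + ccDist (y s) (y t) ^ p) := by
  have hk' : (0 : ℝ) < k := by exact_mod_cast hk
  set a := ccDist (x s) (x t)
  set b := ccDist (y s) (y t)
  have h1 : levelDist k x y s t ≤ 2 * ENNReal.ofReal (ballC N d) * max a b ^ (k : ℕ) := by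
    refine (enorm_sub_le).trans ((add_le_add (enorm_level_le_ccDist k _ _)
      (enorm_level_le_ccDist k _ _)).trans ?_)
    rw [mul_assoc, two_mul]
    gcongr
    · exact le_max_left _ _
    · exact le_max_right _ _
  refine (ENNReal.rpow_le_rpow h1 (by positivity)).trans ?_
  rw [ENNReal.mul_rpow_of_nonneg _ _ (by positivity), cmpC]
  gcongr
  rw [← ENNReal.rpow_natCast, ← ENNReal.rpow_mul, mul_div_cancel₀ _ hk'.ne']
  rcases max_cases a b with ⟨h, -⟩ | ⟨h, -⟩ <;> rw [h]
  · exact le_self_add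
  · exact le_add_self

lemma varSup_add_le (c c' : Icc (0 : ℝ) T → Icc (0 : ℝ) T → ℝ≥0∞) :
    varSup (fun s t => c s t + c' s t) ≤ varSup c + varSup c' :=
  varSup_le_iff.2 fun n t ht => by
    rw [Finset.sum_add_distrib]
    exact add_le_add (sum_le_varSup c ht) (sum_le_varSup c' ht)

lemma varSup_const_mul_le (a : ℝ≥0∞) (c : Icc (0 : ℝ) T → Icc (0 : ℝ) T → ℝ≥0∞) :
    varSup (fun s t => a * c s t) ≤ a * varSup c :=
  varSup_le_iff.2 fun n t ht => by
    rw [← Finset.mul_sum]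
    exact mul_le_mul_right (sum_le_varSup c ht) a

lemma varSup_levelDist_le_pVar {p : ℝ} (hp : 0 < p) (x y : Icc (0 : ℝ) T → G N d)
    (k : Fin (N + 1)) (hk : 1 ≤ (k : ℕ)) :
    varSup (fun s t => levelDist k x y s t ^ (p / (k : ℝ))) ≤
      cmpC N d p k * (pVar p x ^ p + pVar p y ^ p) := by
  refine (varSup_mono fun s t _ => levelDist_rpow_le hp x y k hk s t).trans
    ((varSup_const_mul_le _ _).trans ?_)
  rw [← varSup_eq_pVar_rpow hp, ← varSup_eq_pVar_rpow hp]
  gcongr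
  exact varSup_add_le _ _

lemma rho_lt_top {p : ℝ} (hp : 0 < p) {x y : Icc (0 : ℝ) T → G N d} (hx : pVar p x < ∞)
    (hy : pVar p y < ∞) : rho p x y < ∞ := by
  set M : Fin (N + 1) → ℝ≥0∞ := fun k =>
    (cmpC N d p k * (pVar p x ^ p + pVar p y ^ p)) ^ ((k : ℝ) / p) with hM
  have hMt : ∀ k, M k < ∞ := fun k => by
    refine ENNReal.rpow_lt_top_of_nonneg (by positivity) (ENNReal.mul_ne_top (cmpC_ne_top hp k)
      (ENNReal.add_ne_top.2 ⟨?_, ?_⟩))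
    · exact (ENNReal.rpow_lt_top_of_nonneg hp.le hx.ne).ne
    · exact (ENNReal.rpow_lt_top_of_nonneg hp.le hy.ne).ne
  refine lt_of_le_of_lt ((rho_le_iff hp).2 fun k hk => ?_)
    (ENNReal.sum_lt_top.2 fun k _ => hMt k : ∑ k, M k < ∞)
  have hk' : (0 : ℝ) < k := by exact_mod_cast hk
  refine (varSup_levelDist_le_pVar hp x y k hk).trans ?_
  have h1 : M k ≤ ∑ k, M k := Finset.single_le_sum (fun _ _ => zero_le) (Finset.mem_univ k)
  refine le_trans (le_of_eq ?_) (ENNReal.rpow_le_rpow h1 (by positivity))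
  rw [hM, ← ENNReal.rpow_mul, div_mul_div_cancel₀ hp.ne', div_self hk'.ne', ENNReal.rpow_one]

/-! ### The Skorokhod-type distance -/

lemma sigma_le_rho (p : ℝ) (x y : Icc (0 : ℝ) T → G N d) : sigma p x y ≤ rho p x y := by
  refine iInf_le_of_le (OrderIso.refl _) ?_
  simp

lemma sigma_le {p : ℝ} {x y : Icc (0 : ℝ) T → G N d} {c : ℝ≥0∞} (l : Icc (0 : ℝ) T ≃o Icc (0 : ℝ) T)
    (h1 : ∀ u, edist (l u) u ≤ c) (h2 : rho p (x ∘ l) y ≤ c) : sigma p x y ≤ c :=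
  iInf_le_of_le l (max_le (iSup_le h1) h2)

lemma exists_of_sigma_lt {p : ℝ} {x y : Icc (0 : ℝ) T → G N d} {c : ℝ≥0∞} (h : sigma p x y < c) :
    ∃ l : Icc (0 : ℝ) T ≃o Icc (0 : ℝ) T, (∀ u, edist (l u) u < c) ∧ rho p (x ∘ l) y < c := by
  obtain ⟨l, hl⟩ := iInf_lt_iff.1 h
  exact ⟨l, fun u => (le_iSup (fun u => edist (l u) u) u).trans_lt ((le_max_left _ _).trans_lt hl),
    (le_max_right _ _).trans_lt hl⟩

lemma sigma_comm_le (hT : 0 ≤ T) {p : ℝ} (hp : 0 < p) (x y : Icc (0 : ℝ) T → G N d) :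
    sigma p x y ≤ sigma p y x := by
  refine le_of_forall_gt fun c hc => ?_
  obtain ⟨c', hc', hcc⟩ := exists_between hc
  obtain ⟨l, h1, h2⟩ := exists_of_sigma_lt hc'
  refine (sigma_le l.symm (fun u => ?_) ?_).trans_lt hcc
  · have := (h1 (l.symm u)).le
    rwa [l.apply_symm_apply, edist_comm] at this
  · rw [rho_comm, ← rho_comp hT hp _ _ l]
    have e : (x ∘ l.symm) ∘ l = x := by
      funext u
      simp only [Function.comp_apply, OrderIso.symm_apply_apply]
    rw [e]
    exact h2.le

lemma sigma_comm (hT : 0 ≤ T) {p : ℝ} (hp : 0 < p) (x y : Icc (0 : ℝ) T → G N d) :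
    sigma p x y = sigma p y x := le_antisymm (sigma_comm_le hT hp x y) (sigma_comm_le hT hp y x)

/-- Compose two almost optimal time changes. Since ρ does not change under a common
reparametrisation, the composition only adds the displacements, and the constant is that of ρ. -/
lemma sigma_triangle (hT : 0 ≤ T) {p : ℝ} (hp : 0 < p) (x y z : Icc (0 : ℝ) T → G N d) :
    sigma p x z ≤ quasiC N p * (sigma p x y + sigma p y z) := by
  rcases eq_or_ne (sigma p x y) ∞ with hx | hx
  · rw [hx, top_add, ENNReal.mul_top (zero_lt_one.trans_le (one_le_quasiC N p)).ne']
    exact le_top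
  rcases eq_or_ne (sigma p y z) ∞ with hy | hy
  · rw [hy, add_top, ENNReal.mul_top (zero_lt_one.trans_le (one_le_quasiC N p)).ne']
    exact le_top
  have key : ∀ ε : ℝ≥0∞, 0 < ε → sigma p x z ≤
      quasiC N p * ((sigma p x y + ε) + (sigma p y z + ε)) := by
    intro ε hε
    obtain ⟨l, hl1, hl2⟩ := exists_of_sigma_lt (ENNReal.lt_add_right hx hε.ne')
    obtain ⟨m, hm1, hm2⟩ := exists_of_sigma_lt (ENNReal.lt_add_right hy hε.ne')
    refine sigma_le (m.trans l) (fun u => ?_) ?_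
    · refine (edist_triangle _ (m u) _).trans ((add_le_add (hl1 (m u)).le (hm1 u).le).trans
        (le_mul_of_one_le_left' (one_le_quasiC N p)))
    · have h1 : rho p (x ∘ (m.trans l)) (y ∘ m) = rho p (x ∘ l) y := by
        rw [← rho_comp hT hp (x ∘ l) y m]
        rfl
      refine (rho_triangle hp _ (y ∘ m) _).trans ?_
      rw [h1]
      gcongr
  have hc : Tendsto (fun ε : ℝ≥0∞ => quasiC N p * ((sigma p x y + ε) + (sigma p y z + ε)))
      (𝓝 0) (𝓝 (quasiC N p * ((sigma p x y + 0) + (sigma p y z + 0)))) := by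
    refine ENNReal.Tendsto.const_mul ?_ (Or.inr (quasiC_ne_top N p))
    exact (tendsto_const_nhds.add tendsto_id).add (tendsto_const_nhds.add tendsto_id)
  simp only [add_zero] at hc
  refine ge_of_tendsto (hc.mono_left (nhdsWithin_le_nhds (s := Ioi 0))) ?_
  exact eventually_nhdsWithin_of_forall key

/-- A time change l for (x, y) yields the time change that first applies b, then l, then the inverse
of a, for the reparametrised paths. It leaves the ρ-term unchanged and adds only the displacements
of a and b. -/
lemma sigma_comp_le (hT : 0 ≤ T) {p : ℝ} (hp : 0 < p) (x y : Icc (0 : ℝ) T → G N d)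
    (a b : Icc (0 : ℝ) T ≃o Icc (0 : ℝ) T) {ε η : ℝ≥0∞} (ha : ∀ u, edist (a u) u ≤ ε)
    (hb : ∀ u, edist (b u) u ≤ η) : sigma p (x ∘ a) (y ∘ b) ≤ sigma p x y + (ε + η) := by
  refine le_of_forall_gt fun c hc => ?_
  have h1 : sigma p x y < c - (ε + η) := lt_tsub_iff_right.2 hc
  obtain ⟨c', hc', hcc⟩ := exists_between h1
  obtain ⟨l, hl1, hl2⟩ := exists_of_sigma_lt hc'
  refine lt_of_le_of_lt (sigma_le (c := c' + (ε + η)) ((b.trans l).trans a.symm) (fun u => ?_) ?_)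
    (lt_tsub_iff_right.1 hcc)
  · have h2 := ha (a.symm (l (b u)))
    rw [a.apply_symm_apply, edist_comm] at h2
    refine (edist_triangle _ (l (b u)) _).trans ?_
    refine (add_le_add h2 ((edist_triangle _ (b u) _).trans
      (add_le_add (hl1 (b u)).le (hb u)))).trans (le_of_eq ?_)
    ring
  · have e1 : (x ∘ a) ∘ ((b.trans l).trans a.symm) = (x ∘ l) ∘ b := by
      funext u
      simp
    rw [e1, rho_comp hT hp]
    exact hl2.le.trans le_self_add

/-! ### Interpolation -/

lemma exists_norm_le_of_ccNorm (N d : ℕ) (M : ℝ≥0∞) (hM : M ≠ ∞) : ∃ R : ℝ, ∀ g : G N d,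
    ccNorm (g : TruncTensor N d) ≤ M → ‖(g : TruncTensor N d)‖ ≤ R := by
  refine ⟨∑ k ∈ Finset.range (N + 1), ballC N d * M.toReal ^ k, fun g hg => ?_⟩
  refine (norm_le_sum_homog _).trans (Finset.sum_le_sum fun k _ => ?_)
  exact norm_homog_le_of_ccNorm ENNReal.toReal_nonneg (by rwa [ENNReal.ofReal_toReal hM]) k

lemma StartsAtOne.comp_orderIso (hT : 0 ≤ T) {x : Icc (0 : ℝ) T → G N d} (hx : StartsAtOne x)
    (l : Icc (0 : ℝ) T ≃o Icc (0 : ℝ) T) : StartsAtOne (x ∘ l) := by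
  intro t ht
  refine hx _ ?_
  have h1 : l t ≤ ⟨0, le_rfl, hT⟩ := by
    rw [← l.apply_symm_apply ⟨0, le_rfl, hT⟩]
    refine l.monotone ?_
    change (t : ℝ) ≤ _
    rw [ht]
    exact (l.symm _).2.1
  exact le_antisymm h1 (l t).2.1

lemma StartsAtOne.ccNorm_le (hT : 0 ≤ T) {p : ℝ} (hp : 0 < p) {x : Icc (0 : ℝ) T → G N d}
    (hx : StartsAtOne x) (t : Icc (0 : ℝ) T) : ccNorm (x t : TruncTensor N d) ≤ pVar p x := by
  have h1 : x ⟨0, le_rfl, hT⟩ = 1 := Subtype.ext (hx _ rfl)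
  have := ccDist_le_pVar hT hp x (s := ⟨0, le_rfl, hT⟩) (t := t) t.2.1
  rwa [h1, ccDist_eq, inv_one, one_mul] at this

/-- Uniformly close paths with bounded `p`-variation are close in `p'`-variation for `p' > p`. -/
lemma exists_rho_le_of_uniform (hT : 0 ≤ T) {p p' : ℝ} (hp : 0 < p) (hpp : p < p') {M : ℝ≥0∞}
    (hM : M ≠ ∞) {ε : ℝ≥0∞} (hε : 0 < ε) : ∃ δ : ℝ, 0 < δ ∧ ∀ x y : Icc (0 : ℝ) T → G N d,
      StartsAtOne x → StartsAtOne y → pVar p x ≤ M → pVar p y ≤ M →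
      (∀ t, ‖(x t : TruncTensor N d) - y t‖ < δ) → rho p' x y ≤ ε := by
  have hp' : 0 < p' := hp.trans hpp
  -- a bound on increments that suffices
  have h1 : ∀ k : Fin (N + 1), 1 ≤ (k : ℕ) → ∀ᶠ η : ℝ≥0∞ in 𝓝 0,
      η ^ ((p' - p) / (k : ℝ)) * (cmpC N d p k * (M ^ p + M ^ p)) ≤ ε ^ (p' / (k : ℝ)) := by
    intro k hk
    have hk' : (0 : ℝ) < k := by exact_mod_cast hk
    have hMp : M ^ p ≠ ∞ := (ENNReal.rpow_lt_top_of_nonneg hp.le hM).ne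
    have hq : 0 < (p' - p) / (k : ℝ) := div_pos (sub_pos.2 hpp) hk'
    have h2 : Tendsto (fun η : ℝ≥0∞ => η ^ ((p' - p) / (k : ℝ)) * (cmpC N d p k * (M ^ p + M ^ p)))
        (𝓝 0) (𝓝 (0 * (cmpC N d p k * (M ^ p + M ^ p)))) := by
      refine ENNReal.Tendsto.mul_const ?_ (Or.inr (ENNReal.mul_ne_top (cmpC_ne_top hp k)
        (ENNReal.add_ne_top.2 ⟨hMp, hMp⟩)))
      have := (ENNReal.continuous_rpow_const (y := (p' - p) / (k : ℝ))).tendsto 0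
      rwa [ENNReal.zero_rpow_of_pos hq] at this
    rw [zero_mul] at h2
    refine h2.eventually_le_const (ENNReal.rpow_pos_of_nonneg hε (by positivity))
  have h2 : ∀ᶠ η : ℝ≥0∞ in 𝓝 0, ∀ k : Fin (N + 1), 1 ≤ (k : ℕ) →
      η ^ ((p' - p) / (k : ℝ)) * (cmpC N d p k * (M ^ p + M ^ p)) ≤ ε ^ (p' / (k : ℝ)) := by
    refine eventually_all.2 fun k => ?_
    by_cases hk : 1 ≤ (k : ℕ)
    · exact (h1 k hk).mono fun η h _ => h
    · exact Eventually.of_forall fun η h => absurd h hk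
  obtain ⟨η, hη0, hη⟩ : ∃ η : ℝ, 0 < η ∧ ∀ k : Fin (N + 1), 1 ≤ (k : ℕ) →
      ENNReal.ofReal η ^ ((p' - p) / (k : ℝ)) * (cmpC N d p k * (M ^ p + M ^ p)) ≤
        ε ^ (p' / (k : ℝ)) := by
    have h3 : Tendsto ENNReal.ofReal (𝓝[>] 0) (𝓝 0) := by
      have := ENNReal.continuous_ofReal.tendsto 0
      rw [ENNReal.ofReal_zero] at this
      exact this.mono_left nhdsWithin_le_nhds
    exact ((eventually_mem_nhdsWithin (s := Ioi (0 : ℝ))).and (h3.eventually h2)).exists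
  -- increments are uniformly continuous on bounded sets
  obtain ⟨R, hR⟩ := exists_norm_le_of_ccNorm N d M hM
  have hcpt : IsCompact (Metric.closedBall (0 : TruncTensor N d) R ×ˢ
      Metric.closedBall (0 : TruncTensor N d) R) :=
    haveI : ProperSpace (TruncTensor N d) := FiniteDimensional.proper_real _
    (isCompact_closedBall _ _).prod (isCompact_closedBall _ _)
  have huc := hcpt.uniformContinuousOn_of_continuous
    (f := fun q : TruncTensor N d × TruncTensor N d => TruncTensor.inv q.1 * q.2)
    ((TruncTensor.continuous_inv.comp continuous_fst).mul continuous_snd).continuousOn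
  obtain ⟨δ, hδ, hδη⟩ := Metric.uniformContinuousOn_iff.1 huc η hη0
  refine ⟨δ, hδ, fun x y hx hy hxM hyM hxy => (rho_le_iff hp').2 fun k hk => ?_⟩
  have hk' : (0 : ℝ) < k := by exact_mod_cast hk
  have hb : ∀ s t, levelDist k x y s t ≤ ENNReal.ofReal η := by
    intro s t
    rw [levelDist, ← level_sub, ← ofReal_norm]
    refine ENNReal.ofReal_le_ofReal ((norm_level_le k _).trans ?_)
    have hxb : ∀ t, (x t : TruncTensor N d) ∈ Metric.closedBall (0 : TruncTensor N d) R := fun t =>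
      mem_closedBall_zero_iff.2 (hR _ ((hx.ccNorm_le hT hp t).trans hxM))
    have hyb : ∀ t, (y t : TruncTensor N d) ∈ Metric.closedBall (0 : TruncTensor N d) R := fun t =>
      mem_closedBall_zero_iff.2 (hR _ ((hy.ccNorm_le hT hp t).trans hyM))
    have := hδη (x s, x t) ⟨hxb s, hxb t⟩ (y s, y t) ⟨hyb s, hyb t⟩ (by
      rw [Prod.dist_eq, max_lt_iff, dist_eq_norm, dist_eq_norm]
      exact ⟨hxy s, hxy t⟩)
    rw [dist_eq_norm] at this
    simpa only [incr_eq, G.coe_mul, G.coe_inv] using this.le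
  -- Interpolation: p'/k = (p' - p)/k + p/k. The first power is bounded by the uniform distance of
  -- the increments, the second is summed using the bounded p-variation.
  have h3 : varSup (fun s t => levelDist k x y s t ^ (p' / (k : ℝ))) ≤
      varSup (fun s t => ENNReal.ofReal η ^ ((p' - p) / (k : ℝ)) *
        levelDist k x y s t ^ (p / (k : ℝ))) := by
    refine varSup_mono fun s t _ => ?_
    have e : p' / (k : ℝ) = (p' - p) / (k : ℝ) + p / (k : ℝ) := by ring
    have hq : 0 < (p' - p) / (k : ℝ) := div_pos (sub_pos.2 hpp) hk'
    rw [e, ENNReal.rpow_add_of_nonneg _ _ hq.le (by positivity)]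
    gcongr
    exact hb s t
  refine h3.trans ((varSup_const_mul_le _ _).trans (le_trans ?_ (hη k hk)))
  gcongr
  exact (varSup_levelDist_le_pVar hp x y k hk).trans (by gcongr)

/-! ### Lipschitz paths are lifts -/

lemma exists_norm_sub_le (N d : ℕ) {M : ℝ≥0∞} (hM : M ≠ ∞) : ∃ C : ℝ, 0 ≤ C ∧
    ∀ (g h : G N d) (l : ℝ), ccNorm (g : TruncTensor N d) ≤ M → ccNorm (h : TruncTensor N d) ≤ M →
      0 ≤ l → ccDist g h ≤ ENNReal.ofReal l →
        ‖(g : TruncTensor N d) - h‖ ≤ C * l := by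
  obtain ⟨R, hR⟩ := exists_norm_le_of_ccNorm N d M hM
  have hR0 : 0 ≤ R := (norm_nonneg _).trans (hR 1 (by rw [G.coe_one, ccNorm_one]; exact zero_le))
  have hC := mulC_pos (N := N) (d := d)
  have hB := ballC_nonneg (N := N) (d := d)
  -- The distance of g and h is at most 2M, so in its (k+1)-st power all factors but one are
  -- absorbed in L^k, leaving a bound linear in l.
  set L : ℝ := (M + M).toReal with hL
  have hL0 : 0 ≤ L := ENNReal.toReal_nonneg
  have hLM : ENNReal.ofReal L = M + M := ENNReal.ofReal_toReal (ENNReal.add_ne_top.2 ⟨hM, hM⟩)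
  refine ⟨mulC N d * R * ∑ k ∈ Finset.range N, ballC N d * L ^ k, by positivity,
    fun g h l hg hh hl hgh => ?_⟩
  have hm0 : 0 ≤ min l L := le_min hl hL0
  have h1 : ccNorm ((g⁻¹ * h : G N d) : TruncTensor N d) ≤ ENNReal.ofReal (min l L) := by
    rw [ENNReal.ofReal_min, ← ccDist_eq, hLM]
    refine le_min hgh ?_
    rw [ccDist_eq, G.coe_mul]
    exact (ccNorm_mul_le _ _).trans (add_le_add ((ccNorm_inv_le g).trans hg) hh)
  have h2 : ‖((g⁻¹ * h : G N d) : TruncTensor N d) - 1‖ ≤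
      (∑ k ∈ Finset.range N, ballC N d * L ^ k) * l := by
    refine (norm_le_sum_homog _).trans ?_
    rw [Finset.sum_range_succ', map_sub, G.homog_zero, homog_one, if_pos rfl, sub_self, norm_zero,
      add_zero, Finset.sum_mul]
    refine Finset.sum_le_sum fun k _ => ?_
    rw [map_sub, homog_one, if_neg k.succ_ne_zero, sub_zero]
    refine (norm_homog_le_of_ccNorm hm0 h1 _).trans ?_
    rw [pow_succ, ← mul_assoc]
    gcongr
    · exact min_le_right _ _
    · exact min_le_left _ _
  have h3 : (h : TruncTensor N d) - g = g * (((g⁻¹ * h : G N d) : TruncTensor N d) - 1) := by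
    rw [mul_sub, mul_one, ← G.coe_mul, mul_inv_cancel_left]
  rw [norm_sub_rev, h3]
  refine (TruncTensor.norm_mul_le' _ _).trans ?_
  rw [mul_assoc (mulC N d * R)]
  gcongr
  exact hR g hg

/-- The vector of coordinates of order one. -/
def unvec : TruncTensor N d →L[ℝ] EuclideanSpace ℝ (Fin d) :=
  LinearMap.toContinuousLinearMap
    { toFun := fun a => WithLp.toLp 2 fun i => coeff a [i]
      map_add' := fun a b => by
        ext i
        simp [coeff_add]
      map_smul' := fun c a => by
        ext i
        simp [coeff_smul] }

lemma vec_unvec (a : TruncTensor N d) : vec (unvec a) = homog 1 a := by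
  refine ext_coeff fun w hw => ?_
  rw [coeff_homog, vec, coeff_ofCoeff _ hw]
  match w, hw with
  | [], _ => simp
  | [i], _ => simp [unvec]
  | _ :: _ :: _, _ => simp

/-- A path which is Lipschitz for the Carnot–Carathéodory distance is a lift. -/
lemma exists_dev_of_lipschitz {X : ℝ → G N d} {K : ℝ} (hK : 0 ≤ K)
    (hX : ∀ s t, ccDist (X s) (X t) ≤ ENNReal.ofReal (K * |t - s|)) {M : ℝ≥0∞} (hM : M ≠ ∞)
    (hXM : ∀ t, ccNorm (X t : TruncTensor N d) ≤ M) :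
    ∃ u, Dev u fun t => (X t : TruncTensor N d) := by
  set Y : ℝ → TruncTensor N d := fun t => (X t : TruncTensor N d) with hY
  obtain ⟨C, hC, hCX⟩ := exists_norm_sub_le N d hM
  obtain ⟨R, hR⟩ := exists_norm_le_of_ccNorm N d M hM
  have hlip : LipschitzWith (C * K).toNNReal Y := by
    refine LipschitzWith.of_dist_le_mul fun s t => ?_
    rw [dist_eq_norm, Real.coe_toNNReal _ (by positivity), Real.dist_eq, abs_sub_comm, mul_assoc]
    exact hCX _ _ _ (hXM s) (hXM t) (by positivity) (hX s t)
  have hYc : Continuous Y := hlip.continuous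
  have hIc : Continuous fun t => TruncTensor.inv (Y t) := TruncTensor.continuous_inv.comp hYc
  set u : ℝ → EuclideanSpace ℝ (Fin d) := fun t => unvec (TruncTensor.inv (Y t) * deriv Y t) with hu
  have hint : ∀ s t, IntervalIntegrable (deriv Y) volume s t := by
    intro s t
    refine (intervalIntegrable_const (c := (((C * K).toNNReal : ℝ)))).mono_fun
      (stronglyMeasurable_deriv Y).aestronglyMeasurable (Eventually.of_forall fun r => ?_)
    rw [Real.norm_of_nonneg (NNReal.coe_nonneg _)]
    exact norm_deriv_le_of_lipschitz hlip
  have huint : ∀ s t, IntervalIntegrable u volume s t := by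
    intro s t
    have h1 : StronglyMeasurable u := by
      have h2 : StronglyMeasurable fun t => TruncTensor.inv (Y t) * deriv Y t :=
        hIc.stronglyMeasurable.mul (stronglyMeasurable_deriv Y)
      exact unvec.continuous.comp_stronglyMeasurable h2
    obtain ⟨B, hB⟩ := (isCompact_uIcc (a := s) (b := t)).exists_bound_of_continuousOn
      hIc.continuousOn
    refine (intervalIntegrable_const (c := ‖(unvec : TruncTensor N d →L[ℝ] _)‖ *
      (mulC N d * B * (C * K).toNNReal))).mono_fun h1.aestronglyMeasurable ?_
    refine (ae_restrict_iff' measurableSet_uIoc).2 (Eventually.of_forall fun r hr => ?_)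
    refine le_trans ?_ (le_abs_self _)
    refine (unvec.le_opNorm _).trans ?_
    have h3 := mulC_pos (N := N) (d := d)
    have h4 := hB r (uIoc_subset_uIcc hr)
    have h5 := norm_deriv_le_of_lipschitz (x₀ := r) hlip
    have h6 := (TruncTensor.norm_mul_le' (TruncTensor.inv (Y r)) (deriv Y r))
    have h7 : 0 ≤ B := (norm_nonneg _).trans h4
    gcongr
    refine h6.trans ?_
    gcongr
  have hder : ∀ᵐ t, deriv Y t = Y t * vec (u t) := by
    filter_upwards [hlip.ae_differentiableAt_real] with t ht
    have hd : HasDerivAt (fun s => TruncTensor.inv (Y t) * Y s) (TruncTensor.inv (Y t) * deriv Y t) t :=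
      (hasDerivAt_tensor_mul (hasDerivAt_const t (TruncTensor.inv (Y t))) ht.hasDerivAt).congr_deriv
        (by simp)
    have hG : ∀ s, TruncTensor.inv (Y t) * Y s = (((X t)⁻¹ * X s : G N d) : TruncTensor N d) :=
      fun s => by rw [G.coe_mul, G.coe_inv]
    -- The increment from t to s has component of order k of size O(|s - t|^k). For k ≥ 2 its
    -- derivative at t vanishes, and for k = 0 it is constant; only the order one survives, so the
    -- path is horizontal.
    have h0 : ∀ k, k ≠ 1 → homog k (TruncTensor.inv (Y t) * deriv Y t) = 0 := by
      intro k hk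
      have h1 := HasDerivAt.linearMap_comp (homog k) hd
      simp only [hG] at h1
      rcases Nat.eq_zero_or_pos k with rfl | hk0
      · simp only [G.homog_zero] at h1
        exact h1.unique (hasDerivAt_const t _)
      · have h2 : (fun s => homog k (((X t)⁻¹ * X s : G N d) : TruncTensor N d)) =O[𝓝 t]
            fun s => ‖s - t‖ ^ k := by
          refine Asymptotics.IsBigO.of_bound (ballC N d * K ^ k) (Eventually.of_forall fun s => ?_)
          rw [norm_pow, norm_norm, mul_assoc, ← mul_pow]
          refine norm_homog_le_of_ccNorm (by positivity) ?_ k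
          rw [← ccDist_eq]
          exact hX t s
        have h3 := (h2.hasFDerivAt (by omega)).hasDerivAt
        simpa using h1.unique h3
    have h1 : TruncTensor.inv (Y t) * deriv Y t = vec (u t) := by
      rw [hu, vec_unvec]
      conv_lhs => rw [← sum_homog (TruncTensor.inv (Y t) * deriv Y t)]
      refine Finset.sum_eq_single 1 (fun k _ hk => h0 k hk) fun h => homog_of_lt ?_ _
      simpa using h
    rw [← h1, ← mul_assoc]
    have : Y t * TruncTensor.inv (Y t) = 1 := by
      rw [hY, ← G.coe_inv, ← G.coe_mul, mul_inv_cancel, G.coe_one]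
    rw [this, one_mul]
  refine ⟨u, huint, hYc, fun s t => ?_⟩
  have h1 : ∫ r in s..t, Y r * vec (u r) = ∫ r in s..t, deriv Y r :=
    intervalIntegral.integral_congr_ae (hder.mono fun r hr _ => hr.symm)
  change Y t - Y s = ∫ r in s..t, Y r * vec (u r)
  rw [h1]
  refine ext_coeff fun w _ => ?_
  let φ : TruncTensor N d →L[ℝ] ℝ := LinearMap.toContinuousLinearMap (coeffₗ w)
  have hφ : ∀ a, coeff a w = φ a := fun a => rfl
  rw [hφ, hφ, ← φ.intervalIntegral_comp_comm (hint s t), map_sub]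
  have h2 : ∫ r in s..t, φ (deriv Y r) = ∫ r in s..t, deriv (fun r => φ (Y r)) r := by
    refine intervalIntegral.integral_congr_ae ?_
    filter_upwards [hlip.ae_differentiableAt_real] with r hr _
    exact ((φ.hasFDerivAt.comp_hasDerivAt r hr.hasDerivAt).deriv).symm
  rw [h2]
  -- Each coordinate is Lipschitz, hence absolutely continuous, hence the integral of its
  -- derivative.
  have h3 : LipschitzWith (‖φ‖₊ * (C * K).toNNReal) fun r => φ (Y r) := φ.lipschitz.comp hlip
  exact (h3.lipschitzOnWith.absolutelyContinuousOnInterval.integral_deriv_eq_sub).symm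

/-! ### Paths given by lifts -/

/-- The path in the group given by a lift. -/
def Dev.path (T : ℝ) {u : ℝ → EuclideanSpace ℝ (Fin d)} {S : ℝ → TruncTensor N d} (h : Dev u S)
    (h0 : S 0 = 1) (t : Icc (0 : ℝ) T) : G N d := G.mk (S t) (h.isGroupLike h0 t)

lemma Dev.ccDist_path_le {u : ℝ → EuclideanSpace ℝ (Fin d)} {S : ℝ → TruncTensor N d} (h : Dev u S)
    (h0 : S 0 = 1) {s t : Icc (0 : ℝ) T} (hst : s ≤ t) :
    ccDist (h.path T h0 s) (h.path T h0 t) ≤ ENNReal.ofReal (∫ r in (s : ℝ)..t, ‖u r‖) := by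
  rw [ccDist_eq, G.coe_mul, G.coe_inv]
  refine (h.const_mul (TruncTensor.inv (S s))).ccNorm_le hst ?_
  exact inv_mul_cancel' (by rw [h.coeff_nil 0, h0, coeff_one (by simp), if_pos rfl])

lemma Dev.integral_sub {u : ℝ → EuclideanSpace ℝ (Fin d)} {S : ℝ → TruncTensor N d} (h : Dev u S)
    (s t : ℝ) : (∫ r in (0 : ℝ)..t, ‖u r‖) - ∫ r in (0 : ℝ)..s, ‖u r‖ = ∫ r in s..t, ‖u r‖ :=
  intervalIntegral.integral_interval_sub_left (h.int _ _).norm (h.int _ _).norm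

lemma Dev.integral_mono {u : ℝ → EuclideanSpace ℝ (Fin d)} {S : ℝ → TruncTensor N d} (h : Dev u S) :
    Monotone fun t : ℝ => ∫ r in (0 : ℝ)..t, ‖u r‖ := fun s t hst => by
  rw [← sub_nonneg, h.integral_sub]
  exact intervalIntegral.integral_nonneg hst fun _ _ => norm_nonneg _

lemma Dev.pVar_path_le (hT : 0 ≤ T) {u : ℝ → EuclideanSpace ℝ (Fin d)} {S : ℝ → TruncTensor N d}
    (h : Dev u S) (h0 : S 0 = 1) :
    pVar 1 (h.path T h0) ≤ ENNReal.ofReal (∫ r in (0 : ℝ)..T, ‖u r‖) := by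
  rw [pVar_le_iff one_pos]
  simp only [ENNReal.rpow_one]
  refine (varSup_le_of_additive hT (A := fun t => ∫ r in (0 : ℝ)..t, ‖u r‖)
    (fun s t hst => h.integral_mono hst) fun s t hst => ?_).trans (by simp)
  rw [h.integral_sub]
  exact h.ccDist_path_le h0 hst

lemma Cp_anti {p p' : ℝ} (hp : 0 < p) (hpp : p ≤ p') : Cp N d T p ⊆ Cp N d T p' :=
  fun x hx => ⟨hx.1, hx.2.1, (pVar_anti hp hpp x).trans_lt hx.2.2⟩

lemma Dev.path_mem_Cp (hT : 0 ≤ T) {u : ℝ → EuclideanSpace ℝ (Fin d)} {S : ℝ → TruncTensor N d}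
    (h : Dev u S) (h0 : S 0 = 1) : h.path T h0 ∈ Cp N d T 1 := by
  refine ⟨fun t ht => ?_, ?_, (h.pVar_path_le hT h0).trans_lt ENNReal.ofReal_lt_top⟩
  · change S t = 1
    rw [ht, h0]
  · exact isClosedEmbedding_coe.isEmbedding.continuous_iff.2 (h.cont.comp continuous_subtype_val)

/-- Control of the increments of order `k` by the `k`-th power of an additive function. -/
lemma rho_one_le_of_control (hT : 0 ≤ T) {x y : Icc (0 : ℝ) T → G N d} {C e : ℝ} (hC : 0 ≤ C)
    (he : e ≤ 1) {B : Icc (0 : ℝ) T → ℝ} (hB : Monotone B)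
    (hBe : B ⟨T, hT, le_rfl⟩ - B ⟨0, le_rfl, hT⟩ ≤ e)
    (h : ∀ (k : Fin (N + 1)) (s t : Icc (0 : ℝ) T), 1 ≤ (k : ℕ) → s ≤ t →
      ‖level k (incr (x s) (x t)) - level k (incr (y s) (y t))‖ ≤ C * (B t - B s) ^ (k : ℕ)) :
    rho 1 x y ≤ ENNReal.ofReal (C * e) := by
  have he0 : 0 ≤ e := (sub_nonneg.2 (hB hT)).trans hBe
  refine (rho_le_iff one_pos).2 fun k hk => ?_
  have hk' : (0 : ℝ) < k := by exact_mod_cast hk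
  have hk1 : 0 ≤ 1 / (k : ℝ) := by positivity
  set D : ℝ := C ^ (1 / (k : ℝ))
  have hD : 0 ≤ D := by positivity
  have h1 : ∀ s t, s ≤ t → levelDist k x y s t ^ (1 / (k : ℝ)) ≤
      ENNReal.ofReal (D * B t - D * B s) := by
    intro s t hst
    have hb := sub_nonneg.2 (hB hst)
    rw [levelDist, ← ofReal_norm, ENNReal.ofReal_rpow_of_nonneg (norm_nonneg _) hk1]
    refine ENNReal.ofReal_le_ofReal ((Real.rpow_le_rpow (norm_nonneg _) (h k s t hk hst) hk1).trans
      (le_of_eq ?_))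
    rw [Real.mul_rpow hC (by positivity), one_div, Real.pow_rpow_inv_natCast hb (by omega), ← mul_sub,
      ← one_div]
  refine (varSup_le_of_additive hT (A := fun t => D * B t)
    (fun s t hst => mul_le_mul_of_nonneg_left (hB hst) hD) h1).trans ?_
  rw [ENNReal.ofReal_rpow_of_nonneg (by positivity) hk1, Real.mul_rpow hC he0, ← mul_sub]
  refine ENNReal.ofReal_le_ofReal (mul_le_mul_of_nonneg_left (hBe.trans ?_) hD)
  -- At order k the target involves e^(1/k), which is at least e because e ≤ 1.
  refine Real.self_le_rpow_of_le_one he0 he ?_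
  rw [div_le_one hk']
  exact_mod_cast hk

/-- Lifts of paths close in `L¹` are close. -/
lemma exists_rho_path_le (N d : ℕ) (hT : 0 ≤ T) (M : ℝ) {ε : ℝ≥0∞} (hε : 0 < ε) :
    ∃ δ : ℝ, 0 < δ ∧ ∀ (u v : ℝ → EuclideanSpace ℝ (Fin d)) (S R : ℝ → TruncTensor N d)
      (h : Dev u S) (h' : Dev v R) (h0 : S 0 = 1) (h0' : R 0 = 1),
      (∫ r in (0 : ℝ)..T, ‖u r‖) ≤ M → (∫ r in (0 : ℝ)..T, ‖u r - v r‖) ≤ δ →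
        rho 1 (h.path T h0) (h'.path T h0') ≤ ε := by
  have hmC := mulC_pos (N := N) (d := d)
  set C : ℝ := 1 + ∑ k ∈ Finset.range (N + 1),
    (((k : ℝ) + 1) * ‖(1 : TruncTensor N d)‖ * mulC N d ^ (k + 1)) with hCdef
  have hC0 : 0 < C := by positivity
  have hCk : ∀ k ≤ N, ((k : ℝ) + 1) * ‖(1 : TruncTensor N d)‖ * mulC N d ^ (k + 1) ≤ C := by
    intro k hk
    have := Finset.single_le_sum (f := fun k : ℕ =>
      ((k : ℝ) + 1) * ‖(1 : TruncTensor N d)‖ * mulC N d ^ (k + 1)) (fun i _ => by positivity)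
      (Finset.mem_range.2 (Nat.lt_succ_of_le hk))
    linarith
  obtain ⟨e, he0, he1, heε⟩ : ∃ e : ℝ, 0 < e ∧ e ≤ 1 ∧ ENNReal.ofReal (C * e) ≤ ε := by
    have h3 : Tendsto (fun e => ENNReal.ofReal (C * e)) (𝓝[>] 0) (𝓝 0) := by
      have : Continuous fun e : ℝ => ENNReal.ofReal (C * e) :=
        ENNReal.continuous_ofReal.comp (continuous_const.mul continuous_id)
      have := this.tendsto 0
      rw [mul_zero, ENNReal.ofReal_zero] at this
      exact this.mono_left nhdsWithin_le_nhds
    obtain ⟨e, h1, h2, h3⟩ := ((eventually_mem_nhdsWithin (s := Ioi (0 : ℝ))).and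
      ((eventually_nhdsWithin_of_eventually_nhds (eventually_le_nhds one_pos)).and
        (h3.eventually_le_const hε))).exists
    exact ⟨e, h1, h2, h3⟩
  -- The number 2|M| + 2 bounds the total length of u and v together, so that η times this length is
  -- at most e/2.
  set η : ℝ := min 1 (e / (2 * (2 * |M| + 2))) with hη
  have hη0 : 0 < η := lt_min one_pos (by positivity)
  have hη1 : η ≤ 1 := min_le_left _ _
  refine ⟨min 1 (e / 2 * η ^ N), lt_min one_pos (by positivity), fun u v S R h h' h0 h0' hu hd => ?_⟩
  have hd1 := hd.trans (min_le_left _ _)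
  have hd2 := hd.trans (min_le_right _ _)
  have hint : ∀ s t, IntervalIntegrable (fun r => ‖u r - v r‖) volume s t := fun s t =>
    ((h.int s t).sub (h'.int s t)).norm
  have hintl : ∀ s t, IntervalIntegrable (fun r => ‖u r‖ + ‖v r‖) volume s t := fun s t =>
    (h.int s t).norm.add (h'.int s t).norm
  -- The estimate at order j + 1 is a multiple of l^j e', with l the length and e' the L¹-distance
  -- on the interval. Weighting l by η and e' by η^(-N) dominates this by the (j+1)-st power of an
  -- increment of B. The first weight makes the length part small, and the choice of δ then makes
  -- the second part small.
  set B : ℝ → ℝ := fun t => η * (∫ r in (0 : ℝ)..t, (‖u r‖ + ‖v r‖)) +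
    (η ^ N)⁻¹ * ∫ r in (0 : ℝ)..t, ‖u r - v r‖ with hB
  have hBsub : ∀ s t, B t - B s = η * (∫ r in s..t, (‖u r‖ + ‖v r‖)) +
      (η ^ N)⁻¹ * ∫ r in s..t, ‖u r - v r‖ := by
    intro s t
    rw [← intervalIntegral.integral_interval_sub_left (hintl 0 t) (hintl 0 s),
      ← intervalIntegral.integral_interval_sub_left (hint 0 t) (hint 0 s)]
    simp only [hB]
    ring
  have hl0 : ∀ s t, s ≤ t → 0 ≤ ∫ r in s..t, (‖u r‖ + ‖v r‖) := fun s t hst =>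
    intervalIntegral.integral_nonneg hst fun _ _ => by positivity
  have he0' : ∀ s t, s ≤ t → 0 ≤ ∫ r in s..t, ‖u r - v r‖ := fun s t hst =>
    intervalIntegral.integral_nonneg hst fun _ _ => norm_nonneg _
  refine (rho_one_le_of_control hT hC0.le he1 (B := fun t => B t) (fun s t hst => ?_) ?_ ?_).trans heε
  · rw [← sub_nonneg, hBsub]
    have := hl0 s t hst
    have := he0' s t hst
    positivity
  · rw [hBsub]
    have hv : ∫ r in (0 : ℝ)..T, ‖v r‖ ≤ M + 1 := by
      have h1 : ∫ r in (0 : ℝ)..T, ‖v r‖ ≤ ∫ r in (0 : ℝ)..T, (‖u r‖ + ‖u r - v r‖) := by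
        refine intervalIntegral.integral_mono_on hT (h'.int _ _).norm
          ((h.int _ _).norm.add (hint _ _)) fun r _ => ?_
        have := _root_.norm_sub_le (u r) (u r - v r)
        rwa [sub_sub_cancel] at this
      rw [intervalIntegral.integral_add (h.int _ _).norm (hint _ _)] at h1
      linarith
    have h1 : ∫ r in (0 : ℝ)..T, (‖u r‖ + ‖v r‖) ≤ 2 * |M| + 2 := by
      rw [intervalIntegral.integral_add (h.int _ _).norm (h'.int _ _).norm]
      have := le_abs_self M
      linarith
    have h2 : η * ∫ r in (0 : ℝ)..T, (‖u r‖ + ‖v r‖) ≤ e / 2 := by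
      calc η * ∫ r in (0 : ℝ)..T, (‖u r‖ + ‖v r‖)
          ≤ e / (2 * (2 * |M| + 2)) * (2 * |M| + 2) := by
            gcongr
            · exact hl0 _ _ hT
            · exact min_le_right _ _
        _ = e / 2 := by field_simp
    have h3 : (η ^ N)⁻¹ * ∫ r in (0 : ℝ)..T, ‖u r - v r‖ ≤ e / 2 := by
      rw [inv_mul_le_iff₀ (by positivity), mul_comm]
      exact hd2
    linarith
  · intro k s t hk hst
    obtain ⟨j, hj⟩ : ∃ j, (k : ℕ) = j + 1 := ⟨k - 1, by omega⟩
    have hS : TruncTensor.inv (S s) * S s = 1 := inv_mul_cancel' (by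
      rw [h.coeff_nil 0, h0, coeff_one (by simp), if_pos rfl])
    have hR : TruncTensor.inv (R s) * R s = 1 := inv_mul_cancel' (by
      rw [h'.coeff_nil 0, h0', coeff_one (by simp), if_pos rfl])
    have hul : ∫ r in (s : ℝ)..t, ‖u r‖ ≤ ∫ r in (s : ℝ)..t, (‖u r‖ + ‖v r‖) :=
      intervalIntegral.integral_mono_on hst (h.int _ _).norm (hintl _ _) fun r _ =>
        le_add_of_nonneg_right (norm_nonneg _)
    have hvl : ∫ r in (s : ℝ)..t, ‖v r‖ ≤ ∫ r in (s : ℝ)..t, (‖u r‖ + ‖v r‖) :=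
      intervalIntegral.integral_mono_on hst (h'.int _ _).norm (hintl _ _) fun r _ =>
        le_add_of_nonneg_left (norm_nonneg _)
    have key := (h.const_mul (TruncTensor.inv (S s))).norm_homog_sub_le
      (h'.const_mul (TruncTensor.inv (R s))) hS hR hul hvl le_rfl j ⟨hst, le_rfl⟩
    rw [← level_sub, ← norm_homog, hj, incr_eq, incr_eq, G.coe_mul, G.coe_mul, G.coe_inv, G.coe_inv]
    refine key.trans ?_
    have hll := hl0 s t hst
    have hee := he0' s t hst
    set l := ∫ r in (s : ℝ)..t, (‖u r‖ + ‖v r‖)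
    set e' := ∫ r in (s : ℝ)..t, ‖u r - v r‖
    rw [hBsub, mul_assoc]
    have hjN : j ≤ N := by omega
    refine mul_le_mul (hCk j hjN) ?_ (by positivity) hC0.le
    have h1 : l ^ j * e' ≤ (η * l) ^ j * ((η ^ N)⁻¹ * e') := by
      rw [mul_pow]
      have : 1 ≤ η ^ j * (η ^ N)⁻¹ := by
        rw [← div_eq_mul_inv, one_le_div (by positivity)]
        exact pow_le_pow_of_le_one hη0.le hη1 hjN
      calc l ^ j * e' = 1 * (l ^ j * e') := (one_mul _).symm
        _ ≤ (η ^ j * (η ^ N)⁻¹) * (l ^ j * e') := by gcongr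
        _ = _ := by ring
    refine h1.trans ?_
    rw [pow_succ]
    gcongr
    · exact le_add_of_nonneg_right (by positivity)
    · exact le_add_of_nonneg_left (by positivity)

/-! ### Smooth lifts and their closure -/

lemma Dev.path_mem_smoothLifts (hT : 0 < T) {w : ℝ → EuclideanSpace ℝ (Fin d)} {R : ℝ → TruncTensor N d}
    (h : Dev w R) (h0 : R 0 = 1) (hw : ContDiff ℝ (⊤ : ℕ∞) w) :
    h.path T h0 ∈ smoothLifts N d T := by
  set γ : ℝ → EuclideanSpace ℝ (Fin d) := fun t => ∫ r in (0 : ℝ)..t, w r with hγ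
  have hd : ∀ t, HasDerivAt γ (w t) t := fun t =>
    intervalIntegral.integral_hasDerivAt_right (h.int _ _)
      (hw.continuous.stronglyMeasurableAtFilter _ _) hw.continuous.continuousAt
  have hder : deriv γ = w := funext fun t => (hd t).deriv
  have hc : ContDiff ℝ (⊤ : ℕ∞) γ := by
    rw [contDiff_infty_iff_deriv, hder]
    exact ⟨fun t => (hd t).differentiableAt, hw⟩
  have hw' : ∀ t ∈ Icc 0 T, derivWithin γ (Icc 0 T) t = w t := fun t ht =>
    (hd t).hasDerivWithinAt.derivWithin (uniqueDiffOn_Icc hT t ht)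
  obtain ⟨h1, h2, h3⟩ := h.isLift h0 T
  refine ⟨γ, R, hc.contDiffOn, ⟨?_, h2, fun t ht => ?_⟩, fun t => rfl⟩
  · refine h1.congr fun r hr => (hw' r ?_).symm
    rw [uIoc_of_le hT.le] at hr
    exact ⟨hr.1.le, hr.2⟩
  · rw [h3 t ht]
    congr 1
    refine intervalIntegral.integral_congr fun r hr => ?_
    rw [uIcc_of_le ht.1] at hr
    simp only [hw' r ⟨hr.1, hr.2.trans ht.2⟩]

/-- Encoding a smooth lift by its derivative, a point of C([0, T], ℝ^d), gives both the separability
of the set of smooth lifts and their Lipschitz bounds. -/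
lemma exists_path_of_mem_smoothLifts (hT : 0 < T) {x : Icc (0 : ℝ) T → G N d}
    (hx : x ∈ smoothLifts N d T) : ∃ (w : C(Icc (0 : ℝ) T, EuclideanSpace ℝ (Fin d)))
      (R : ℝ → TruncTensor N d) (h : Dev (fun t => w (projIcc 0 T hT.le t)) R) (h0 : R 0 = 1),
      x = h.path T h0 := by
  obtain ⟨γ, S, hγ, hS, hx⟩ := hx
  have hc : ContinuousOn (derivWithin γ (Icc 0 T)) (Icc 0 T) :=
    hγ.continuousOn_derivWithin (uniqueDiffOn_Icc hT) (by simp)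
  let w : C(Icc (0 : ℝ) T, EuclideanSpace ℝ (Fin d)) :=
    ⟨fun t => derivWithin γ (Icc 0 T) t, continuousOn_iff_continuous_domRestrict.1 hc⟩
  have hwc : Continuous fun t => w (projIcc 0 T hT.le t) := w.continuous.comp continuous_projIcc
  obtain ⟨R, hR, hR0⟩ := exists_dev (N := N) 0 fun s t => hwc.intervalIntegrable s t
  refine ⟨w, R, hR, hR0, ?_⟩
  have hL := hS.dev hT.le
  have key : ∀ t ∈ Icc 0 T, R t = S (projIcc 0 T hT.le t) := by
    intro t ht
    have h1 : S (projIcc 0 T hT.le 0) = 1 := by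
      rw [projIcc_left]
      exact hS.apply_zero hT.le
    -- Uniqueness of lifts is the stability estimate with derivatives at L¹-distance zero.
    have e : ∫ r in (0 : ℝ)..T, ‖w (projIcc 0 T hT.le r) -
        (Ioc 0 T).indicator (derivWithin γ (Icc 0 T)) r‖ ≤ 0 := by
      rw [intervalIntegral.integral_congr_ae (g := fun _ => 0), intervalIntegral.integral_zero]
      refine Eventually.of_forall fun r hr => ?_
      rw [uIoc_of_le hT.le] at hr
      rw [indicator_of_mem hr, projIcc_of_mem hT.le ⟨hr.1.le, hr.2⟩]
      exact norm_eq_zero.2 (sub_self _)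
    have := hR.norm_sub_le hL hR0 h1 (le_max_left _ _) (le_max_right _ _) e ht
    rw [mul_zero] at this
    exact sub_eq_zero.1 (norm_le_zero_iff.1 this)
  funext t
  refine Subtype.ext ?_
  rw [hx]
  change S t = R t
  rw [key t t.2, projIcc_val]

lemma smoothLifts_subset (hT : 0 < T) : smoothLifts N d T ⊆ Cp N d T 1 := fun x hx => by
  obtain ⟨w, R, h, h0, rfl⟩ := exists_path_of_mem_smoothLifts hT hx
  exact h.path_mem_Cp hT.le h0

lemma smoothLifts_subset_C0p (hT : 0 < T) {p : ℝ} (hp : 1 ≤ p) :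
    smoothLifts N d T ⊆ C0p N d T p := fun x hx =>
  ⟨Cp_anti one_pos hp (smoothLifts_subset hT hx), fun ε hε => ⟨x, hx, by
    rwa [rho_self (one_pos.trans_le hp)]⟩⟩

/-- All lifts belong to the closure of the smooth ones. -/
lemma Dev.path_mem_C0p (hT : 0 < T) {u : ℝ → EuclideanSpace ℝ (Fin d)} {S : ℝ → TruncTensor N d}
    (h : Dev u S) (h0 : S 0 = 1) : h.path T h0 ∈ C0p N d T 1 := by
  refine ⟨h.path_mem_Cp hT.le h0, fun ε hε => ?_⟩
  obtain ⟨ε', hε', hεε⟩ := exists_between hε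
  obtain ⟨δ, hδ, hδu⟩ := exists_rho_path_le N d hT.le (∫ r in (0 : ℝ)..T, ‖u r‖) hε'
  have hu : MemLp ((Ioc 0 T).indicator u) 1 volume := by
    rw [memLp_one_iff_integrable, integrable_indicator_iff measurableSet_Ioc]
    exact (intervalIntegrable_iff_integrableOn_Ioc_of_le hT.le).1 (h.int _ _)
  -- Smooth compactly supported functions are dense in L¹, and L¹-closeness of derivatives gives
  -- ρ-closeness of lifts.
  obtain ⟨w, hw1, hw2, hw3⟩ := MeasureTheory.MemLp.exist_eLpNorm_sub_le ENNReal.one_ne_top le_rfl hu hδ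
  obtain ⟨R, hR, hR0⟩ := exists_dev (N := N) 0 fun s t => hw2.continuous.intervalIntegrable s t
  refine ⟨hR.path T hR0, hR.path_mem_smoothLifts hT hR0 hw2, (hδu _ _ _ _ h hR h0 hR0 le_rfl ?_).trans_lt hεε⟩
  have h1 : ∫ r in (0 : ℝ)..T, ‖u r - w r‖ = ∫ r in Ioc 0 T, ‖((Ioc 0 T).indicator u - w) r‖ := by
    rw [intervalIntegral.integral_of_le hT.le]
    refine setIntegral_congr_fun measurableSet_Ioc fun r hr => ?_
    simp only [Pi.sub_apply, indicator_of_mem hr]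
  have hi : Integrable ((Ioc 0 T).indicator u - w) volume :=
    (memLp_one_iff_integrable.1 hu).sub (hw2.continuous.integrable_of_hasCompactSupport hw1)
  rw [h1]
  refine (setIntegral_le_integral hi.norm (Eventually.of_forall fun _ => norm_nonneg _)).trans ?_
  rw [integral_norm_eq_lintegral_enorm hi.1, ← eLpNorm_one_eq_lintegral_enorm]
  exact ENNReal.toReal_le_of_le_ofReal hδ.le hw3

/-- Extended by constants outside [0, T], the path is Lipschitz and bounded on the line, hence a
lift. -/
lemma mem_C0p_of_lipschitz (hT : 0 < T) {x : Icc (0 : ℝ) T → G N d} (hx : StartsAtOne x) {K : ℝ}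
    (hK : 0 ≤ K) (h : ∀ s t, ccDist (x s) (x t) ≤ ENNReal.ofReal (K * |(t : ℝ) - s|)) :
    x ∈ C0p N d T 1 := by
  set X : ℝ → G N d := fun t => x (projIcc 0 T hT.le t) with hX
  have h1 : ∀ s t, ccDist (X s) (X t) ≤ ENNReal.ofReal (K * |t - s|) := fun s t => by
    refine (h _ _).trans (ENNReal.ofReal_le_ofReal ?_)
    exact mul_le_mul_of_nonneg_left (abs_projIcc_sub_projIcc hT.le) hK
  have hX0 : X 0 = 1 := Subtype.ext (hx _ (by simp))
  have h2 : ∀ t, ccNorm (X t : TruncTensor N d) ≤ ENNReal.ofReal (K * T) := by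
    intro t
    have h3 := h ⟨0, le_rfl, hT.le⟩ (projIcc 0 T hT.le t)
    have h4 : x ⟨0, le_rfl, hT.le⟩ = 1 := Subtype.ext (hx _ rfl)
    rw [h4, ccDist_eq, inv_one, one_mul] at h3
    refine h3.trans (ENNReal.ofReal_le_ofReal ?_)
    gcongr
    rw [sub_zero, abs_of_nonneg (projIcc 0 T hT.le t).2.1]
    exact (projIcc 0 T hT.le t).2.2
  obtain ⟨u, hu⟩ := exists_dev_of_lipschitz hK h1 ENNReal.ofReal_ne_top h2
  have h0 : (X 0 : TruncTensor N d) = 1 := by rw [hX0, G.coe_one]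
  have e : x = hu.path T h0 := by
    funext t
    refine Subtype.ext ?_
    change (x t : TruncTensor N d) = X t
    simp [hX]
  rw [e]
  exact hu.path_mem_C0p hT h0

/-! ### The Carnot–Carathéodory metric space -/

/-- The group with the Carnot–Carathéodory metric. -/
def CC (N d : ℕ) : Type := G N d

instance : PseudoEMetricSpace (CC N d) where
  edist g h := ccDist (N := N) (d := d) g h
  edist_self := ccDist_self
  edist_comm := ccDist_comm
  edist_triangle := ccDist_triangle

/-- The identity map to the metric space. -/
def toCC (g : G N d) : CC N d := g

lemma edist_toCC (g h : G N d) : edist (toCC g) (toCC h) = ccDist g h := rfl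

lemma continuous_toCC : Continuous (toCC : G N d → CC N d) :=
  continuous_iff_continuousAt.2 fun _ =>
    tendsto_iff_edist_tendsto_0.2 (tendsto_ccDist tendsto_id tendsto_const_nhds)

lemma edist_Icc (s t : Icc (0 : ℝ) T) : edist s t = ENNReal.ofReal |(s : ℝ) - t| := by
  rw [edist_dist, Subtype.dist_eq, Real.dist_eq]

lemma exists_ccDist_le {x : Icc (0 : ℝ) T → G N d} (hx : Continuous x) {η : ℝ≥0∞} (hη : 0 < η) :
    ∃ δ : ℝ, 0 < δ ∧ ∀ s t : Icc (0 : ℝ) T, |(s : ℝ) - t| < δ → ccDist (x s) (x t) ≤ η := by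
  have huc := CompactSpace.uniformContinuous_of_continuous (continuous_toCC.comp hx)
  obtain ⟨δ, hδ, h⟩ := EMetric.uniformContinuous_iff.1 huc η hη
  rcases eq_or_ne δ ∞ with rfl | hδ'
  · exact ⟨1, one_pos, fun s t _ => (h (edist_lt_top s t)).le⟩
  · refine ⟨δ.toReal, ENNReal.toReal_pos hδ.ne' hδ', fun s t hst => (h ?_).le⟩
    rw [edist_Icc]
    exact (ENNReal.ofReal_lt_iff_lt_toReal (abs_nonneg _) hδ').2 hst

/-! ### Reparametrisation of paths of bounded variation -/

lemma exists_orderIso_of_strictMonoOn (hT : 0 ≤ T) {f : ℝ → ℝ} (hc : ContinuousOn f (Icc 0 T))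
    (hm : StrictMonoOn f (Icc 0 T)) (h0 : f 0 = 0) (h1 : f T = T) :
    ∃ e : Icc (0 : ℝ) T ≃o Icc (0 : ℝ) T, ∀ t, (e t : ℝ) = f t := by
  have hmaps : ∀ t : Icc (0 : ℝ) T, f t ∈ Icc 0 T := fun t =>
    ⟨h0.ge.trans (hm.monotoneOn ⟨le_rfl, hT⟩ t.2 t.2.1), (hm.monotoneOn t.2 ⟨hT, le_rfl⟩ t.2.2).trans h1.le⟩
  have hsm : StrictMono fun t : Icc (0 : ℝ) T => (⟨f t, hmaps t⟩ : Icc (0 : ℝ) T) :=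
    fun s t hst => hm s.2 t.2 hst
  refine ⟨hsm.orderIsoOfSurjective _ fun t => ?_, fun t => rfl⟩
  have h2 : (t : ℝ) ∈ Icc (f 0) (f T) := by
    rw [h0, h1]
    exact t.2
  obtain ⟨s, hs, hst⟩ := intermediate_value_Icc hT hc h2
  exact ⟨⟨s, hs⟩, Subtype.ext hst⟩

/-- A continuous path of bounded variation has a continuous control. -/
lemma exists_continuous_control (hT : 0 ≤ T) {x : Icc (0 : ℝ) T → G N d} (hx : Continuous x)
    (hv : pVar 1 x < ∞) : ∃ V : ℝ → ℝ, Continuous V ∧ Monotone V ∧ V 0 = 0 ∧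
      ∀ s t : Icc (0 : ℝ) T, s ≤ t → ccDist (x s) (x t) ≤ ENNReal.ofReal (V t - V s) := by
  set f : ℝ → CC N d := fun t => toCC (x (projIcc 0 T hT t)) with hf
  have hfc : Continuous f := continuous_toCC.comp (hx.comp continuous_projIcc)
  have hb : BoundedVariationOn f univ := by
    refine (lt_of_le_of_lt (iSup_le fun q => ?_) hv).ne
    obtain ⟨n, u, hu, -⟩ := q
    have h1 := sum_range_le_varSup hT (fun s t => ccDist (x s) (x t) ^ (1 : ℝ))
      (ccDist_rpow_self one_pos x) (t := fun i => projIcc 0 T hT (u i)) ((monotone_projIcc hT).comp hu) n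
    rw [varSup_eq_pVar_rpow one_pos, ENNReal.rpow_one] at h1
    refine le_trans (Finset.sum_le_sum fun i _ => ?_) h1
    rw [ENNReal.rpow_one, edist_comm]
    exact le_rfl
  have hl := hb.locallyBoundedVariationOn
  set V : ℝ → ℝ := fun t => variationOnFromTo f univ 0 t with hV
  have hsub : ∀ s t, V t - V s = variationOnFromTo f univ s t := fun s t => by
    rw [sub_eq_iff_eq_add', hV, variationOnFromTo.add hl trivial trivial trivial]
  have hne : ∀ s t, eVariationOn f (univ ∩ Icc s t) ≠ ∞ := fun s t =>
    ((eVariationOn.mono f (subset_univ _)).trans_lt hb.lt_top).ne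
  refine ⟨V, ?_, ?_, variationOnFromTo.self f univ 0, fun s t hst => ?_⟩
  · refine continuous_iff_continuousAt.2 fun t => ?_
    -- Where a function is continuous, its variation over intervals shrinking to the point from
    -- either side tends to zero, so the variation function is continuous.
    have h1 := hb.tendsto_eVariationOn_Icc_zero_left (x := t)
      (hfc.continuousAt.continuousWithinAt (s := univ ∩ Iic t))
    have h2 := hb.tendsto_eVariationOn_Icc_zero_right t
      (hfc.continuousAt.continuousWithinAt (s := univ ∩ Ici t))
    rw [nhdsWithin_univ] at h1 h2
    have h3 := ((ENNReal.tendsto_toReal ENNReal.zero_ne_top).comp h1).add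
      ((ENNReal.tendsto_toReal ENNReal.zero_ne_top).comp h2)
    simp only [ENNReal.toReal_zero, add_zero] at h3
    rw [ContinuousAt, tendsto_iff_dist_tendsto_zero]
    refine squeeze_zero (fun _ => dist_nonneg) (fun s => ?_) h3
    rw [Real.dist_eq, hsub]
    rcases le_total t s with h | h
    · rw [variationOnFromTo.eq_of_le f univ h, abs_of_nonneg ENNReal.toReal_nonneg]
      exact le_add_of_nonneg_left ENNReal.toReal_nonneg
    · rw [variationOnFromTo.eq_of_ge f univ h, abs_neg, abs_of_nonneg ENNReal.toReal_nonneg]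
      exact le_add_of_nonneg_right ENNReal.toReal_nonneg
  · exact monotoneOn_univ.1 (variationOnFromTo.monotoneOn hl trivial)
  · rw [hsub, variationOnFromTo.eq_of_le f univ hst, ENNReal.ofReal_toReal (hne _ _)]
    have h1 : ccDist (x s) (x t) = edist (f s) (f t) := by
      simp only [hf, projIcc_val, edist_toCC]
    rw [h1]
    exact eVariationOn.edist_le f ⟨trivial, le_rfl, hst⟩ ⟨trivial, hst, le_rfl⟩

/-- Use the normalised time f(t) = k (t + c V(t)), where V is the variation. The summand t makes f
strictly increasing even where the path rests. In the new time the path is Lipschitz with constant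
1/(kc), and f is close to the identity when c is small. -/
lemma exists_lipschitz_reparam (hT : 0 < T) {x : Icc (0 : ℝ) T → G N d} (hx : Continuous x)
    (hv : pVar 1 x < ∞) {ε : ℝ} (hε : 0 < ε) :
    ∃ (e : Icc (0 : ℝ) T ≃o Icc (0 : ℝ) T) (K : ℝ), 0 ≤ K ∧ (∀ t, |(e t : ℝ) - t| ≤ ε) ∧
      ∀ s t, ccDist (x (e s)) (x (e t)) ≤ ENNReal.ofReal (K * |(t : ℝ) - s|) := by
  obtain ⟨V, hVc, hVm, hV0, hV⟩ := exists_continuous_control hT.le hx hv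
  have hVn : ∀ t, 0 ≤ t → 0 ≤ V t := fun t ht => hV0 ▸ hVm ht
  have hVT := hVn T hT.le
  set c : ℝ := ε / (V T + 1) with hc
  have hc0 : 0 < c := by positivity
  set k : ℝ := T / (T + c * V T) with hk
  have hk0 : 0 < k := by positivity
  set f : ℝ → ℝ := fun t => k * (t + c * V t) with hf
  have hfsub : ∀ s t, f t - f s = k * (t - s) + k * c * (V t - V s) := fun s t => by
    simp only [hf]
    ring
  have hfm : StrictMono f := fun s t hst => by
    rw [← sub_pos, hfsub]
    have := sub_nonneg.2 (hVm hst.le)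
    have := sub_pos.2 hst
    positivity
  obtain ⟨e, he⟩ := exists_orderIso_of_strictMonoOn hT.le (f := f)
    (by fun_prop) (hfm.strictMonoOn _) (by simp [hf, hV0]) (by
      simp only [hf, hk]
      field_simp)
  have hee : ∀ t, f (e.symm t) = t := fun t => by rw [← he, e.apply_symm_apply]
  refine ⟨e.symm, (k * c)⁻¹, by positivity, fun t => ?_, ?_⟩
  · set s := e.symm t
    have hs := hee t
    rw [← hs]
    -- The displacement is c (s V(T) - T V(s)) over T + c V(T). Both products lie in [0, T V(T)], so
    -- it is at most c V(T), and c was chosen to make this at most ε.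
    have h1 : (T + c * V T) * ((s : ℝ) - f s) = c * (s * V T - T * V s) := by
      simp only [hf, hk]
      field_simp
      ring
    have h2 : |(s : ℝ) * V T - T * V s| ≤ T * V T := by
      have h3 : V s ≤ V T := hVm s.2.2
      have h4 := hVn s s.2.1
      have h5 : (s : ℝ) * V T ≤ T * V T := mul_le_mul_of_nonneg_right s.2.2 hVT
      have h6 : 0 ≤ (s : ℝ) * V T := mul_nonneg s.2.1 hVT
      have h7 : T * V s ≤ T * V T := mul_le_mul_of_nonneg_left h3 hT.le
      have h8 : 0 ≤ T * V s := mul_nonneg hT.le h4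
      rw [abs_le]
      constructor <;> linarith
    have h3 : (T + c * V T) * |(s : ℝ) - f s| ≤ c * (T * V T) := by
      rw [← abs_of_nonneg (show 0 ≤ T + c * V T by positivity), ← abs_mul, h1, abs_mul,
        abs_of_pos hc0]
      gcongr
    have h4 : c * V T ≤ ε := by
      rw [hc, div_mul_eq_mul_div, div_le_iff₀ (by positivity)]
      nlinarith
    have h5 : T * |(s : ℝ) - f s| ≤ T * ε := by
      have h6 : 0 ≤ c * V T * |(s : ℝ) - f s| := by positivity
      nlinarith
    exact le_of_mul_le_mul_left h5 hT
  · have key : ∀ s t : Icc (0 : ℝ) T, s ≤ t → ccDist (x (e.symm s)) (x (e.symm t)) ≤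
        ENNReal.ofReal ((k * c)⁻¹ * ((t : ℝ) - s)) := by
      intro s t hst
      have hm : e.symm s ≤ e.symm t := e.symm.monotone hst
      refine (hV _ _ hm).trans (ENNReal.ofReal_le_ofReal ?_)
      rw [le_inv_mul_iff₀ (by positivity)]
      have := hfsub (e.symm s) (e.symm t)
      rw [hee, hee] at this
      rw [this]
      have h6 : (0 : ℝ) ≤ (e.symm t : ℝ) - e.symm s := sub_nonneg.2 hm
      have : 0 ≤ k * ((e.symm t : ℝ) - e.symm s) := by positivity
      linarith
    intro s t
    rcases le_total s t with h | h
    · rw [abs_of_nonneg (sub_nonneg.2 (show (s : ℝ) ≤ t from h))]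
      exact key s t h
    · rw [ccDist_comm, abs_sub_comm, abs_of_nonneg (sub_nonneg.2 (show (t : ℝ) ≤ s from h))]
      exact key t s h

/-- Continuous paths of bounded variation are limits, up to reparametrisation, of lifts. -/
lemma exists_C0p_sigma_lt (hT : 0 < T) {x : Icc (0 : ℝ) T → G N d} (hx : x ∈ Cp N d T 1)
    {ε : ℝ≥0∞} (hε : 0 < ε) : ∃ y ∈ C0p N d T 1, sigma 1 x y < ε := by
  obtain ⟨ε', hε', hεε⟩ := exists_between hε
  obtain ⟨c, hc0, hc⟩ : ∃ c : ℝ, 0 < c ∧ ENNReal.ofReal c ≤ ε' := by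
    rcases eq_or_ne ε' ∞ with rfl | h
    · exact ⟨1, one_pos, le_top⟩
    · exact ⟨ε'.toReal, ENNReal.toReal_pos hε'.ne' h, ENNReal.ofReal_toReal_le⟩
  obtain ⟨e, K, hK, he, hxe⟩ := exists_lipschitz_reparam hT hx.2.1 hx.2.2 hc0
  refine ⟨x ∘ e, mem_C0p_of_lipschitz hT (hx.1.comp_orderIso hT.le e) hK hxe,
    (sigma_le e (fun t => ?_) ?_).trans_lt hεε⟩
  · rw [edist_Icc]
    exact (ENNReal.ofReal_le_ofReal (he t)).trans hc
  · rw [rho_self one_pos]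
    exact zero_le

/-! ### Interpolation along a sequence of points -/

/-- The path which joins the points `a i` by the curves `c i`. -/
def polyPath (a : ℕ → G N d) (c : ℕ → ℝ → G N d) (t : ℝ) : G N d :=
  a ⌊t⌋₊ * c ⌊t⌋₊ (t - ⌊t⌋₊)

/-- The piecewise linear interpolation of a sequence. -/
def polyLin (w : ℕ → ℝ) (t : ℝ) : ℝ := w ⌊t⌋₊ + (w (⌊t⌋₊ + 1) - w ⌊t⌋₊) * (t - ⌊t⌋₊)

lemma polyLin_natCast (w : ℕ → ℝ) (n : ℕ) : polyLin w n = w n := by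
  simp [polyLin]

lemma polyLin_mono {w : ℕ → ℝ} (hw : Monotone w) {s t : ℝ} (hs : 0 ≤ s) (hst : s ≤ t) :
    polyLin w s ≤ polyLin w t := by
  have h1 : (⌊s⌋₊ : ℝ) ≤ s := Nat.floor_le hs
  have h2 : (⌊t⌋₊ : ℝ) ≤ t := Nat.floor_le (hs.trans hst)
  have h3 := Nat.lt_floor_add_one s
  have hw1 := sub_nonneg.2 (hw ⌊s⌋₊.le_succ)
  have hw2 := sub_nonneg.2 (hw ⌊t⌋₊.le_succ)
  rcases (Nat.floor_mono hst).eq_or_lt with h | h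
  · rw [polyLin, polyLin, ← h]
    gcongr
  · have h4 : polyLin w s ≤ w (⌊s⌋₊ + 1) := by
      rw [polyLin]
      nlinarith
    have h5 : w ⌊t⌋₊ ≤ polyLin w t := by
      rw [polyLin]
      nlinarith
    exact h4.trans ((hw h).trans h5)

/-- Between two times lie the rest of one curve, a stretch between grid points and the beginning of
another curve; each is at most K times the q-th power of its share of the increment of `polyLin w`.
On a single curve the linear bound is weakened by x ≤ x^q on [0, 1]. It is applied twice below: with
q = 1/p and the control of the path to bound the p-variation, and with q = 1 and linear w to get a
Lipschitz bound. -/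
lemma ccDist_polyPath_le {q K : ℝ} (hq : 0 < q) (hq1 : q ≤ 1) (hK : 1 ≤ K) {a : ℕ → G N d}
    {c : ℕ → ℝ → G N d} {l w : ℕ → ℝ} (c0 : ∀ i, c i 0 = 1) (c1 : ∀ i, c i 1 = (a i)⁻¹ * a (i + 1))
    (hc : ∀ i s t, ccDist (c i s) (c i t) ≤ ENNReal.ofReal (K * l i * |t - s|)) (hw : Monotone w)
    (hl : ∀ i, l i ≤ (w (i + 1) - w i) ^ q)
    (ha : ∀ i j, i ≤ j → ccDist (a i) (a j) ≤ ENNReal.ofReal ((w j - w i) ^ q)) {s t : ℝ}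
    (hs : 0 ≤ s) (hst : s ≤ t) : ccDist (polyPath a c s) (polyPath a c t) ≤
      ENNReal.ofReal (3 * K * (polyLin w t - polyLin w s) ^ q) := by
  have hK0 : 0 < K := one_pos.trans_le hK
  have h1 : (⌊s⌋₊ : ℝ) ≤ s := Nat.floor_le hs
  have h2 : (⌊t⌋₊ : ℝ) ≤ t := Nat.floor_le (hs.trans hst)
  have h3 := Nat.lt_floor_add_one s
  have h4 := Nat.lt_floor_add_one t
  -- a piece of a curve
  have hp : ∀ i (σ τ : ℝ), σ ≤ τ → τ - σ ≤ 1 → ccDist (c i σ) (c i τ) ≤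
      ENNReal.ofReal (K * ((w (i + 1) - w i) * (τ - σ)) ^ q) := by
    intro i σ τ hστ h
    have h0 := sub_nonneg.2 hστ
    have hw0 := sub_nonneg.2 (hw i.le_succ)
    refine (hc i σ τ).trans (ENNReal.ofReal_le_ofReal ?_)
    rw [abs_of_nonneg h0, mul_assoc, Real.mul_rpow hw0 h0]
    have h5 : τ - σ ≤ (τ - σ) ^ q := Real.self_le_rpow_of_le_one h0 h hq1
    have h6 : l i * (τ - σ) ≤ (w (i + 1) - w i) ^ q * (τ - σ) := by
      gcongr
      exact hl i
    have h7 : (w (i + 1) - w i) ^ q * (τ - σ) ≤ (w (i + 1) - w i) ^ q * (τ - σ) ^ q := by gcongr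
    exact mul_le_mul_of_nonneg_left (h6.trans h7) hK0.le
  rcases (Nat.floor_mono hst).eq_or_lt with h | h
  · rw [← h] at h4
    rw [polyPath, polyPath, ← h, ccDist_mul_left]
    refine (hp _ _ _ (by linarith) (by linarith)).trans (ENNReal.ofReal_le_ofReal ?_)
    have e : polyLin w t - polyLin w s =
        (w (⌊s⌋₊ + 1) - w ⌊s⌋₊) * ((t - ⌊s⌋₊) - (s - ⌊s⌋₊)) := by
      rw [polyLin, polyLin, ← h]
      ring
    rw [← e]
    have h0 := sub_nonneg.2 (polyLin_mono hw hs hst)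
    have : 0 ≤ (polyLin w t - polyLin w s) ^ q := by positivity
    nlinarith
  · set i := ⌊s⌋₊
    set j := ⌊t⌋₊
    have hw1 := sub_nonneg.2 (hw i.le_succ)
    have hw2 := sub_nonneg.2 (hw j.le_succ)
    have hw3 := sub_nonneg.2 (hw h)
    have e : polyLin w t - polyLin w s = (w (i + 1) - w i) * (1 - (s - i)) +
        (w j - w (i + 1)) + (w (j + 1) - w j) * (t - j - 0) := by
      rw [polyLin, polyLin]
      ring
    have p1 : 0 ≤ (w (i + 1) - w i) * (1 - (s - i)) := mul_nonneg hw1 (by linarith)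
    have p2 : 0 ≤ (w (j + 1) - w j) * (t - j - 0) := mul_nonneg hw2 (by linarith)
    have p3 : 0 ≤ w j - w (i + 1) := hw3
    set Q := (polyLin w t - polyLin w s) ^ q
    have b1 : ccDist (polyPath a c s) (a (i + 1)) ≤ ENNReal.ofReal (K * Q) := by
      have : a (i + 1) = a i * c i 1 := by rw [c1, mul_inv_cancel_left]
      rw [polyPath, this, ccDist_mul_left]
      refine (hp i _ 1 (by linarith) (by linarith)).trans (ENNReal.ofReal_le_ofReal ?_)
      gcongr
      refine Real.rpow_le_rpow p1 ?_ hq.le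
      linarith
    have b2 : ccDist (a (i + 1)) (a j) ≤ ENNReal.ofReal (K * Q) := by
      refine (ha _ _ h).trans (ENNReal.ofReal_le_ofReal ?_)
      have : (w j - w (i + 1)) ^ q ≤ Q := Real.rpow_le_rpow p3 (by linarith) hq.le
      have : 0 ≤ (w j - w (i + 1)) ^ q := by positivity
      nlinarith
    have b3 : ccDist (a j) (polyPath a c t) ≤ ENNReal.ofReal (K * Q) := by
      have : a j = a j * c j 0 := by rw [c0, mul_one]
      rw [polyPath, this, mul_assoc, c0, one_mul, ccDist_mul_left, ← c0 j]
      refine (hp j 0 _ (by linarith) (by linarith)).trans (ENNReal.ofReal_le_ofReal ?_)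
      gcongr
      refine Real.rpow_le_rpow p2 ?_ hq.le
      linarith
    have hQ : 0 ≤ Q := Real.rpow_nonneg (sub_nonneg.2 (polyLin_mono hw hs hst)) _
    refine (ccDist_triangle _ (a j) _).trans
      ((add_le_add ((ccDist_triangle _ (a (i + 1)) _).trans (add_le_add b1 b2)) b3).trans ?_)
    rw [← ENNReal.ofReal_add (by positivity) (by positivity),
      ← ENNReal.ofReal_add (by positivity) (by positivity)]
    exact ENNReal.ofReal_le_ofReal (by linarith)

/-- A path of finite `p`-variation is controlled by a monotone function. -/
lemma exists_control (hT : 0 ≤ T) {p : ℝ} (hp : 0 < p) {x : Icc (0 : ℝ) T → G N d}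
    (hx : pVar p x < ∞) : ∃ V : Icc (0 : ℝ) T → ℝ, Monotone V ∧ (∀ t, 0 ≤ V t) ∧
      (∀ t, V t ≤ (pVar p x ^ p).toReal) ∧
      ∀ s t, s ≤ t → ccDist (x s) (x t) ≤ ENNReal.ofReal ((V t - V s) ^ (1 / p)) := by
  -- W t is the p-th power of the p-variation of the path stopped at t, so no variation over
  -- subintervals is needed.
  set W : Icc (0 : ℝ) T → ℝ≥0∞ := fun t =>
    varSup (fun a b => ccDist (x (min a t)) (x (min b t)) ^ p) with hW
  have hWle : ∀ t, W t ≤ pVar p x ^ p := fun t => by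
    rw [← varSup_eq_pVar_rpow hp]
    exact varSup_comp_le hT (fun s t => ccDist (x s) (x t) ^ p) (ccDist_rpow_self hp x)
      (θ := fun a => min a t) (fun a b hab => min_le_min_right t hab)
  have htop : pVar p x ^ p ≠ ∞ := (ENNReal.rpow_lt_top_of_nonneg hp.le hx.ne).ne
  have hWt : ∀ t, W t ≠ ∞ := fun t => ((hWle t).trans_lt htop.lt_top).ne
  have hWadd : ∀ s t, s ≤ t → W s + ccDist (x s) (x t) ^ p ≤ W t := by
    intro s t hst
    have h1 : W s ≤ W t - ccDist (x s) (x t) ^ p := by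
      refine varSup_le_iff.2 fun n u hu => ?_
      refine ENNReal.le_sub_of_add_le_right
        (ENNReal.rpow_lt_top_of_nonneg hp.le (ccDist_lt_top _ _).ne).ne ?_
      -- Superadditivity: a partition stopped at s, followed by the additional point t, competes in
      -- the supremum defining `W t`.
      let v : ℕ → Icc (0 : ℝ) T := fun i => if h : i ≤ n then min (u ⟨i, by omega⟩) s else t
      have hv : Monotone v := by
        refine monotone_nat_of_le_succ fun i => ?_
        rcases le_or_gt (i + 1) n with h | h
        · simp only [v]
          rw [dif_pos (by omega), dif_pos h]
          exact min_le_min_right s (hu.1.monotone (by simp [Fin.le_def]))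
        · have h2 : v (i + 1) = t := by
            simp only [v]
            rw [dif_neg (by omega)]
          rw [h2]
          simp only [v]
          split_ifs
          · exact (min_le_right _ _).trans hst
          · exact le_rfl
      have h2 := sum_range_le_varSup hT (fun a b => ccDist (x (min a t)) (x (min b t)) ^ p)
        (fun a => ccDist_rpow_self hp x (min a t)) hv (n + 1)
      refine le_trans (le_of_eq ?_) h2
      rw [Finset.sum_range_succ, Finset.sum_range]
      have hlast : u (Fin.last n) = ⟨T, hT, le_rfl⟩ := Subtype.ext hu.2.2
      congr 1
      · refine Finset.sum_congr rfl fun i _ => ?_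
        have e1 : v i = min (u i.castSucc) s := by
          simp only [v]
          rw [dif_pos (by omega)]
          rfl
        have e2 : v (i + 1) = min (u i.succ) s := by
          simp only [v]
          rw [dif_pos (by omega)]
          rfl
        rw [e1, e2, min_assoc, min_assoc, min_eq_left hst]
      · have e1 : v n = s := by
          simp only [v]
          rw [dif_pos le_rfl]
          change min (u (Fin.last n)) s = s
          rw [hlast]
          exact min_eq_right s.2.2
        have e2 : v (n + 1) = t := by
          simp only [v]
          rw [dif_neg (by omega)]
        rw [e1, e2, min_eq_left hst, min_self]
    have h2 : ccDist (x s) (x t) ^ p ≤ W t := by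
      have := le_varSup hT (fun a b => ccDist (x (min a t)) (x (min b t)) ^ p)
        (fun a => ccDist_rpow_self hp x (min a t)) hst
      rwa [min_eq_left hst, min_self] at this
    calc W s + ccDist (x s) (x t) ^ p ≤ W t - ccDist (x s) (x t) ^ p + ccDist (x s) (x t) ^ p := by
          gcongr
      _ = W t := tsub_add_cancel_of_le h2
  refine ⟨fun t => (W t).toReal, fun s t hst => ?_, fun t => ENNReal.toReal_nonneg,
    fun t => ENNReal.toReal_mono htop (hWle t), fun s t hst => ?_⟩
  · exact ENNReal.toReal_mono (hWt t) (le_self_add.trans (hWadd s t hst))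
  · have h1 := hWadd s t hst
    have h2 : ccDist (x s) (x t) ^ p ≤ ENNReal.ofReal ((W t).toReal - (W s).toReal) := by
      rw [ENNReal.ofReal_sub _ ENNReal.toReal_nonneg, ENNReal.ofReal_toReal (hWt _),
        ENNReal.ofReal_toReal (hWt _)]
      exact ENNReal.le_sub_of_add_le_left (hWt s) h1
    have h3 : 0 ≤ (W t).toReal - (W s).toReal :=
      sub_nonneg.2 (ENNReal.toReal_mono (hWt t) (le_self_add.trans h1))
    rw [← ENNReal.ofReal_rpow_of_nonneg h3 (by positivity), one_div,
      ENNReal.le_rpow_inv_iff hp]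
    exact h2

/-- Paths of finite `p`-variation are limits of lifts in `p'`-variation for `p' > p`. -/
lemma exists_C0p_rho_lt (hT : 0 < T) {p p' : ℝ} (hp : 1 ≤ p) (hpp : p < p')
    {x : Icc (0 : ℝ) T → G N d} (hx : x ∈ Cp N d T p) {ε : ℝ≥0∞} (hε : 0 < ε) :
    ∃ y ∈ C0p N d T 1, rho p' x y < ε := by
  have hp0 : 0 < p := one_pos.trans_le hp
  obtain ⟨ε', hε', hεε⟩ := exists_between hε
  obtain ⟨K₀, hK₀, hjoin₀⟩ := exists_joined_of_ccNorm_le N d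
  obtain ⟨K, hK, hjoin⟩ : ∃ K : ℝ, 1 ≤ K ∧ ∀ (g : G N d) (l : ℝ), 0 ≤ l →
      ccNorm (g : TruncTensor N d) ≤ ENNReal.ofReal l → Joined (K * l) g :=
    ⟨max 1 K₀, le_max_left _ _, fun g l hl hg => (hjoin₀ g l hl hg).mono (by
      gcongr
      exact le_max_right _ _)⟩
  have hK0 : 0 < K := one_pos.trans_le hK
  obtain ⟨V, hVm, hV0, hVle, hV⟩ := exists_control hT.le hp0 hx.2.2
  set P : ℝ := (pVar p x ^ p).toReal with hP
  have hP0 : 0 ≤ P := ENNReal.toReal_nonneg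
  -- a bound for the variation of the approximations
  set M : ℝ≥0∞ := max (pVar p x) (ENNReal.ofReal (((3 * K) ^ p * P) ^ (1 / p))) with hM
  have hMt : M ≠ ∞ := (max_lt hx.2.2 ENNReal.ofReal_lt_top).ne
  obtain ⟨δ, hδ, hδr⟩ := exists_rho_le_of_uniform (N := N) (d := d) hT.le hp0 hpp hMt hε'
  obtain ⟨C, hC, hCn⟩ := exists_norm_sub_le N d hMt
  obtain ⟨η, hη0, hηδ⟩ : ∃ η : ℝ, 0 < η ∧ C * (η + K * η) < δ := by
    have : Tendsto (fun η : ℝ => C * (η + K * η)) (𝓝[>] 0) (𝓝 0) := by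
      have h : Continuous fun η : ℝ => C * (η + K * η) := by fun_prop
      have := h.tendsto 0
      simp only [mul_zero, add_zero] at this
      exact this.mono_left nhdsWithin_le_nhds
    exact ((eventually_mem_nhdsWithin (s := Ioi (0 : ℝ))).and (this.eventually_lt_const hδ)).exists
  obtain ⟨ζ, hζ, hζx⟩ := exists_ccDist_le hx.2.1 (η := ENNReal.ofReal η) (by simpa using hη0)
  -- The mesh T/n is below ζ, so the path moves by at most η within a cell and the joining curve by
  -- at most K η.
  obtain ⟨n, hn⟩ := exists_nat_gt (T / ζ)
  have hn0 : (0 : ℝ) < n := (div_pos hT hζ).trans hn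
  set h : ℝ := T / n with hh
  have hh0 : 0 < h := div_pos hT hn0
  have hhζ : h < ζ := by
    rw [hh, div_lt_iff₀ hn0]
    rwa [div_lt_iff₀ hζ, mul_comm] at hn
  set τ : ℕ → Icc (0 : ℝ) T := fun i => projIcc 0 T hT.le (i * h) with hτ
  have hτm : Monotone τ := fun i j hij => monotone_projIcc hT.le (by gcongr)
  set a : ℕ → G N d := fun i => x (τ i) with ha
  set l : ℕ → ℝ := fun i => (ccDist (a i) (a (i + 1))).toReal with hl
  have hlr : ∀ i, ENNReal.ofReal (l i) = ccDist (a i) (a (i + 1)) := fun i =>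
    ENNReal.ofReal_toReal (ccDist_lt_top _ _).ne
  have hl0 : ∀ i, 0 ≤ l i := fun i => ENNReal.toReal_nonneg
  choose c c0 c1 hc using fun i => hjoin ((a i)⁻¹ * a (i + 1)) (l i) (hl0 i)
    (by rw [← ccDist_eq, hlr])
  set w : ℕ → ℝ := fun i => V (τ i) with hw
  have hwm : Monotone w := hVm.comp hτm
  have haw : ∀ i j, i ≤ j → ccDist (a i) (a j) ≤ ENNReal.ofReal ((w j - w i) ^ (1 / p)) :=
    fun i j hij => hV _ _ (hτm hij)
  have hlw : ∀ i, l i ≤ (w (i + 1) - w i) ^ (1 / p) := fun i =>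
    ENNReal.toReal_le_of_le_ofReal (Real.rpow_nonneg (sub_nonneg.2 (hwm i.le_succ)) _)
      (haw i (i + 1) i.le_succ)
  set y : Icc (0 : ℝ) T → G N d := fun t => polyPath a c (t / h) with hy
  have hq1 : 1 / p ≤ 1 := by rw [div_le_one hp0]; exact hp
  have hdiv0 : ∀ t : Icc (0 : ℝ) T, 0 ≤ (t : ℝ) / h := fun t => div_nonneg t.2.1 hh0.le
  have hy1 : StartsAtOne y := by
    intro t ht
    have : y t = 1 := by
      simp only [hy, polyPath, ht, zero_div, Nat.floor_zero, Nat.cast_zero, sub_zero, c0, mul_one]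
      exact Subtype.ext (hx.1 _ (by simp [hτ]))
    rw [this, G.coe_one]
  -- the variation of the approximation
  have hyp : pVar p y ≤ M := by
    refine le_trans ?_ (le_max_right _ _)
    rw [pVar_le_iff hp0, ENNReal.ofReal_rpow_of_nonneg (by positivity) hp0.le, ← Real.rpow_mul
      (by positivity), one_div_mul_cancel hp0.ne', Real.rpow_one]
    refine (varSup_le_of_additive hT.le (A := fun t => (3 * K) ^ p * polyLin w (t / h))
      (fun s t hst => ?_) fun s t hst => ?_).trans (ENNReal.ofReal_le_ofReal ?_)
    · exact mul_le_mul_of_nonneg_left (polyLin_mono hwm (hdiv0 s)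
        (div_le_div_of_nonneg_right hst hh0.le)) (by positivity)
    · have hst' : (s : ℝ) / h ≤ t / h := div_le_div_of_nonneg_right hst hh0.le
      have hd := sub_nonneg.2 (polyLin_mono hwm (hdiv0 s) hst')
      refine (ENNReal.rpow_le_rpow (ccDist_polyPath_le (by positivity) hq1 hK c0 c1 hc hwm hlw haw
        (hdiv0 s) hst') hp0.le).trans (le_of_eq ?_)
      rw [ENNReal.ofReal_rpow_of_nonneg (by positivity) hp0.le, Real.mul_rpow (by positivity)
        (by positivity), ← Real.rpow_mul hd, one_div_mul_cancel hp0.ne', Real.rpow_one, mul_sub]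
    · rw [← mul_sub]
      have e1 : T / h = (n : ℝ) := by
        rw [hh]
        field_simp
      have e0 : (0 : ℝ) / h = ((0 : ℕ) : ℝ) := by simp
      change (3 * K) ^ p * (polyLin w (T / h) - polyLin w (0 / h)) ≤ _
      rw [e1, e0, polyLin_natCast, polyLin_natCast]
      gcongr
      have := hV0 (τ 0)
      have := hVle (τ n)
      simp only [hw]
      linarith
  -- the approximation is Lipschitz
  set D : ℝ := (pVar p x).toReal with hD
  have hD0 : 0 ≤ D := ENNReal.toReal_nonneg
  have haD : ∀ i j, i ≤ j → ccDist (a i) (a j) ≤ ENNReal.ofReal D := fun i j hij => by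
    rw [hD, ENNReal.ofReal_toReal hx.2.2.ne]
    exact ccDist_le_pVar hT.le hp0 x (hτm hij)
  have hylip : ∀ s t, s ≤ t → ccDist (y s) (y t) ≤ ENNReal.ofReal (3 * K * D / h * ((t : ℝ) - s)) := by
    intro s t hst
    have hst' : (s : ℝ) / h ≤ t / h := div_le_div_of_nonneg_right hst hh0.le
    -- The same estimate with exponent 1: D bounds every increment of the grid points, so w(i) = D i
    -- is admissible.
    refine (ccDist_polyPath_le (w := fun i => D * i) one_pos le_rfl hK c0 c1 hc
      (fun i j hij => mul_le_mul_of_nonneg_left (Nat.cast_le.2 hij) hD0) (fun i => ?_) (fun i j hij => ?_) (hdiv0 s) hst').trans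
      (le_of_eq ?_)
    · rw [Real.rpow_one]
      refine (ENNReal.toReal_le_of_le_ofReal hD0 (haD i (i + 1) i.le_succ)).trans (le_of_eq ?_)
      push_cast
      ring
    · rw [Real.rpow_one]
      rcases hij.eq_or_lt with rfl | hij'
      · rw [ccDist_self]
        exact zero_le
      · refine (haD i j hij).trans (ENNReal.ofReal_le_ofReal ?_)
        have : (i : ℝ) + 1 ≤ j := by exact_mod_cast hij'
        nlinarith
    · have e : ∀ r : ℝ, polyLin (fun i => D * i) r = D * r := fun r => by
        rw [polyLin]
        push_cast
        ring
      rw [Real.rpow_one, e, e]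
      congr 1
      field_simp
  have hylip' : ∀ s t, ccDist (y s) (y t) ≤ ENNReal.ofReal (3 * K * D / h * |(t : ℝ) - s|) := by
    intro s t
    rcases le_total s t with hst | hst
    · rw [abs_of_nonneg (sub_nonneg.2 (show (s : ℝ) ≤ t from hst))]
      exact hylip s t hst
    · rw [ccDist_comm, abs_sub_comm, abs_of_nonneg (sub_nonneg.2 (show (t : ℝ) ≤ s from hst))]
      exact hylip t s hst
  refine ⟨y, mem_C0p_of_lipschitz hT hy1 (by positivity) hylip',
    (hδr x y hx.1 hy1 (le_max_left _ _) hyp fun t => ?_).trans_lt hεε⟩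
  -- the approximation is uniformly close
  refine (hCn _ _ (η + K * η) ((hx.1.ccNorm_le hT.le hp0 t).trans (le_max_left _ _))
    ((hy1.ccNorm_le hT.le hp0 t).trans hyp) (by positivity) ?_).trans_lt hηδ
  set i := ⌊(t : ℝ) / h⌋₊ with hi
  have f1 : (i : ℝ) ≤ t / h := Nat.floor_le (hdiv0 t)
  have f2 : (t : ℝ) / h < i + 1 := Nat.lt_floor_add_one _
  rw [le_div_iff₀ hh0] at f1
  rw [div_lt_iff₀ hh0] at f2
  have g1 : (τ i : ℝ) = i * h := by
    simp only [hτ]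
    rw [projIcc_of_mem hT.le ⟨by positivity, f1.trans t.2.2⟩]
  have g2 : |(τ i : ℝ) - τ (i + 1)| < ζ := by
    refine (abs_projIcc_sub_projIcc hT.le).trans_lt ?_
    push_cast
    rw [show (i : ℝ) * h - (i + 1) * h = -h by ring, abs_neg, abs_of_pos hh0]
    exact hhζ
  have g3 : |(t : ℝ) - τ i| < ζ := by
    rw [g1, abs_of_nonneg (sub_nonneg.2 f1)]
    linarith
  have hlη : l i ≤ η := ENNReal.toReal_le_of_le_ofReal hη0.le (hζx _ _ g2)
  refine (ccDist_triangle _ (a i) _).trans ?_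
  rw [ENNReal.ofReal_add hη0.le (by positivity)]
  refine add_le_add (hζx _ _ g3) ?_
  have e : a i = a i * c i 0 := by rw [c0, mul_one]
  rw [e]
  simp only [hy, polyPath]
  rw [← hi, ccDist_mul_left]
  refine (hc i _ _).trans (ENNReal.ofReal_le_ofReal ?_)
  have f3 : |(t : ℝ) / h - i - 0| ≤ 1 := by
    rw [sub_zero, abs_le]
    rw [← le_div_iff₀ hh0] at f1
    rw [← div_lt_iff₀ hh0] at f2
    constructor <;> linarith
  calc K * l i * |(t : ℝ) / h - i - 0| ≤ K * l i * 1 := by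
        have := hl0 i
        gcongr
    _ ≤ K * η := by
        rw [mul_one]
        gcongr

/-! ### The jumps of a càdlàg path -/

lemma IsCadlag.tendsto_leftLim {x : Icc (0 : ℝ) T → G N d} (hx : IsCadlag x) (t : Icc (0 : ℝ) T) :
    Tendsto x (𝓝[<] t) (𝓝 (Function.leftLim x t)) :=
  tendsto_leftLim_of_tendsto (hx t).2

lemma IsCadlag.tendsto_right {x : Icc (0 : ℝ) T → G N d} (hx : IsCadlag x) (t : Icc (0 : ℝ) T) :
    Tendsto x (𝓝[>] t) (𝓝 (x t)) :=
  (hx t).1.tendsto.mono_left (nhdsWithin_mono _ Ioi_subset_Ici_self)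

lemma eq_of_ccDist_eq_zero {g h : G N d} (hgh : ccDist g h = 0) : g = h := by
  rw [ccDist_eq] at hgh
  exact inv_mul_eq_one.1 (eq_one_of_ccNorm_eq_zero hgh)

lemma jumpSize_pos {x : Icc (0 : ℝ) T → G N d} {t : Icc (0 : ℝ) T} (ht : t ∈ jumps x) :
    0 < jumpSize x t :=
  pos_iff_ne_zero.2 fun h => ht (eq_of_ccDist_eq_zero h)

/-- Near t on the given side all values of x are close to a. As S is open, this includes the values
just before s, hence the left limit at s. -/
lemma eventually_jumpSize_le {x : Icc (0 : ℝ) T → G N d} (hx : IsCadlag x) {S : Set (Icc (0 : ℝ) T)}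
    (hS : IsOpen S) {t : Icc (0 : ℝ) T} {a : G N d} (ha : Tendsto x (𝓝[S] t) (𝓝 a)) {ε : ℝ≥0∞}
    (hε : 0 < ε) : ∀ᶠ s in 𝓝[S] t, jumpSize x s ≤ ε := by
  have h1 : ∀ᶠ s in 𝓝[S] t, ccDist a (x s) ≤ ε / 2 :=
    (tendsto_ccDist tendsto_const_nhds ha).eventually_le_const (ENNReal.half_pos hε.ne')
  filter_upwards [h1, eventually_eventually_nhdsWithin.2 h1, self_mem_nhdsWithin] with s hs1 hs2 hs3
  rw [hS.nhdsWithin_eq hs3] at hs2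
  rcases eq_or_neBot (𝓝[<] s) with hb | hb
  · rw [jumpSize, leftLim_eq_of_eq_bot x hb, ccDist_self]
    exact zero_le
  · have h2 : Tendsto (fun u => ccDist a (x u)) (𝓝[<] s) (𝓝 (ccDist a (Function.leftLim x s))) := by
      have := (continuous_toCC.tendsto _).comp (hx.tendsto_leftLim s)
      exact (tendsto_const_nhds (x := toCC a)).edist this
    have h3 : ccDist a (Function.leftLim x s) ≤ ε / 2 :=
      le_of_tendsto h2 (hs2.filter_mono nhdsWithin_le_nhds)
    rw [jumpSize, ← ENNReal.add_halves ε]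
    refine (ccDist_triangle _ a _).trans (add_le_add ?_ hs1)
    rwa [ccDist_comm]

/-- Infinitely many large jumps would accumulate at some t, where the one-sided limits force the
nearby jumps on both sides to be small. -/
lemma finite_jumps {x : Icc (0 : ℝ) T → G N d} (hx : IsCadlag x) {ε : ℝ≥0∞} (hε : 0 < ε) :
    {t | ε ≤ jumpSize x t}.Finite := by
  by_contra hinf
  obtain ⟨ε', hε', hεε⟩ := exists_between hε
  obtain ⟨t, -, ht⟩ := Set.Infinite.exists_accPt_of_subset_isCompact hinf isCompact_univ
    (subset_univ _)
  have h1 : ∀ᶠ s in 𝓝[≠] t, jumpSize x s ≤ ε' := by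
    rw [← nhdsLT_sup_nhdsGT, eventually_sup]
    exact ⟨eventually_jumpSize_le hx isOpen_Iio (hx.tendsto_leftLim t) hε',
      eventually_jumpSize_le hx isOpen_Ioi (hx.tendsto_right t) hε'⟩
  have h2 := (accPt_iff_frequently_nhdsNE.1 ht).and_eventually h1
  obtain ⟨s, hs1, hs2⟩ := h2.exists
  exact absurd (hs1.trans hs2) (not_le.2 hεε)

lemma finite_earlier_jumps {x : Icc (0 : ℝ) T → G N d} (hx : IsCadlag x) {t : Icc (0 : ℝ) T}
    (ht : t ∈ jumps x) : {s ∈ jumps x | jumpSize x t < jumpSize x s ∨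
      (jumpSize x s = jumpSize x t ∧ s < t)}.Finite :=
  (finite_jumps hx (jumpSize_pos ht)).subset fun _ hs => hs.2.elim (fun h => h.le) fun h => h.1.ge

/-- The set of earlier jumps of s is strictly contained in that of t. Finiteness is essential, as
`ncard` of an infinite set is 0; it holds because jumps of at least a given positive size are finite
in number. -/
lemma jumpRank_lt {x : Icc (0 : ℝ) T → G N d} (hx : IsCadlag x) {s t : Icc (0 : ℝ) T}
    (hs : s ∈ jumps x) (ht : t ∈ jumps x)
    (h : jumpSize x t < jumpSize x s ∨ (jumpSize x s = jumpSize x t ∧ s < t)) :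
    jumpRank x s < jumpRank x t := by
  have hsub : {u ∈ jumps x | jumpSize x s < jumpSize x u ∨ (jumpSize x u = jumpSize x s ∧ u < s)} ⊆
      {u ∈ jumps x | jumpSize x t < jumpSize x u ∨ (jumpSize x u = jumpSize x t ∧ u < t)} := by
    refine fun u hu => ⟨hu.1, ?_⟩
    rcases hu.2 with h1 | ⟨h1, h2⟩ <;> rcases h with h3 | ⟨h3, h4⟩
    · exact Or.inl (h3.trans h1)
    · exact Or.inl (h3 ▸ h1)
    · exact Or.inl (h1 ▸ h3)
    · exact Or.inr ⟨h1.trans h3, h2.trans h4⟩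
  refine Set.ncard_lt_ncard ((Set.ssubset_iff_of_subset hsub).2 ⟨s, ⟨hs, h⟩, fun h' => ?_⟩)
    (finite_earlier_jumps hx ht)
  · rcases h'.2 with h1 | ⟨-, h1⟩ <;> exact lt_irrefl _ h1

lemma jumpRank_injective {x : Icc (0 : ℝ) T → G N d} (hx : IsCadlag x) :
    Function.Injective fun s : jumps x => jumpRank x s := by
  have key : ∀ s t : jumps x, s < t → jumpRank x s ≠ jumpRank x t := by
    intro s t hst
    rcases lt_trichotomy (jumpSize x s) (jumpSize x t) with h | h | h
    · exact (jumpRank_lt hx t.2 s.2 (Or.inl h)).ne'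
    · exact (jumpRank_lt hx s.2 t.2 (Or.inr ⟨h, hst⟩)).ne
    · exact (jumpRank_lt hx s.2 t.2 (Or.inl h)).ne
  intro s t hst
  rcases lt_trichotomy s t with h | h | h
  · exact absurd hst (key s t h)
  · exact h
  · exact absurd hst.symm (key t s h)

lemma summable_jumps {x : Icc (0 : ℝ) T → G N d} (hx : IsCadlag x) {r : ℕ → ℝ} (hrs : Summable r) :
    Summable fun s : jumps x => r (jumpRank x s) := hrs.comp_injective (jumpRank_injective hx)

/-! ### The time change -/

/-- The total length of the inserted intervals. -/
def extra (r : ℕ → ℝ) (x : Icc (0 : ℝ) T → G N d) : ℝ := ∑' s : jumps x, r (jumpRank x s)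

section

variable {r : ℕ → ℝ} {x : Icc (0 : ℝ) T → G N d}

lemma extra_nonneg (hr : ∀ k, 0 < r k) : 0 ≤ extra r x := tsum_nonneg fun _ => (hr _).le

lemma summable_ite (hr : ∀ k, 0 < r k) (hs : Summable fun s : jumps x => r (jumpRank x s))
    (P : jumps x → Prop) [DecidablePred P] :
    Summable fun s : jumps x => if P s then r (jumpRank x s) else 0 := by
  refine hs.of_nonneg_of_le (fun s => ?_) fun s => ?_
  · split_ifs
    exacts [(hr _).le, le_rfl]
  · split_ifs
    exacts [le_rfl, (hr _).le]

lemma tsum_ite_mono (hr : ∀ k, 0 < r k) (hs : Summable fun s : jumps x => r (jumpRank x s))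
    {P Q : jumps x → Prop} [DecidablePred P] [DecidablePred Q] (h : ∀ s, P s → Q s) :
    ∑' s : jumps x, (if P s then r (jumpRank x s) else 0) ≤
      ∑' s : jumps x, if Q s then r (jumpRank x s) else 0 := by
  refine (summable_ite hr hs P).tsum_le_tsum (fun s => ?_) (summable_ite hr hs Q)
  by_cases hP : P s
  · rw [if_pos hP, if_pos (h s hP)]
  · rw [if_neg hP]
    split_ifs
    exacts [(hr _).le, le_rfl]

/-- All jumps up to s are among the jumps before t. Besides monotonicity this yields that original
time never runs faster than stretched time. -/
lemma tau_add_le (hr : ∀ k, 0 < r k) (hs : Summable fun s : jumps x => r (jumpRank x s))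
    {s t : Icc (0 : ℝ) T} (hst : s < t) : tau r x s + (t - s) ≤ tauLeft r x t := by
  classical
  have := tsum_ite_mono hr hs (P := fun u => (u : Icc (0 : ℝ) T) ≤ s)
    (Q := fun u => (u : Icc (0 : ℝ) T) < t) fun u hu => hu.trans_lt hst
  simp only [tau, tauLeft]
  linarith

lemma tauLeft_le_tau (hr : ∀ k, 0 < r k) (hs : Summable fun s : jumps x => r (jumpRank x s))
    (t : Icc (0 : ℝ) T) : tauLeft r x t ≤ tau r x t := by
  simp only [tau, tauLeft]
  exact add_le_add le_rfl (tsum_ite_mono hr hs (P := fun u => (u : Icc (0 : ℝ) T) < t)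
    (Q := fun u => (u : Icc (0 : ℝ) T) ≤ t) fun u hu => le_of_lt hu)

lemma tau_lt_tauLeft (hr : ∀ k, 0 < r k) (hs : Summable fun s : jumps x => r (jumpRank x s))
    {s t : Icc (0 : ℝ) T} (hst : s < t) : tau r x s < tauLeft r x t := by
  have h1 := tau_add_le hr hs hst
  have h2 : (s : ℝ) < t := hst
  linarith

lemma tau_strictMono (hr : ∀ k, 0 < r k) (hs : Summable fun s : jumps x => r (jumpRank x s)) :
    StrictMono (tau r x) := fun _ _ hst =>
  (tau_lt_tauLeft hr hs hst).trans_le (tauLeft_le_tau hr hs _)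

lemma tau_of_mem (hr : ∀ k, 0 < r k) (hs : Summable fun s : jumps x => r (jumpRank x s))
    {t : Icc (0 : ℝ) T} (ht : t ∈ jumps x) :
    tau r x t = tauLeft r x t + r (jumpRank x t) := by
  classical
  have h1 : ∀ s : jumps x, (if (s : Icc (0 : ℝ) T) ≤ t then r (jumpRank x s) else 0) =
      (if (s : Icc (0 : ℝ) T) < t then r (jumpRank x s) else 0) +
        (if s = ⟨t, ht⟩ then r (jumpRank x t) else 0) := by
    intro s
    rcases lt_trichotomy (s : Icc (0 : ℝ) T) t with h | h | h
    · rw [if_pos h.le, if_pos h, if_neg (fun e => h.ne (congrArg Subtype.val e)), add_zero]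
    · rw [if_pos h.le, if_neg h.not_lt, if_pos (Subtype.ext h), h, zero_add]
    · rw [if_neg h.not_ge, if_neg h.not_gt, if_neg (fun e => h.ne' (congrArg Subtype.val e)), add_zero]
  have h2 : Summable fun s : jumps x => if s = ⟨t, ht⟩ then r (jumpRank x t) else 0 :=
    (hasSum_ite_eq _ _).summable
  have h3 := (summable_ite hr hs fun s => (s : Icc (0 : ℝ) T) < t).tsum_add h2
  rw [tsum_ite_eq] at h3
  simp only [tau, tauLeft]
  rw [add_assoc]
  congr 1
  refine Eq.trans ?_ h3
  exact tsum_congr fun s => h1 s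

lemma tau_of_notMem {t : Icc (0 : ℝ) T} (ht : t ∉ jumps x) : tau r x t = tauLeft r x t := by
  simp only [tau, tauLeft]
  congr 1
  refine tsum_congr fun s => ?_
  have : (s : Icc (0 : ℝ) T) ≤ t ↔ (s : Icc (0 : ℝ) T) < t :=
    ⟨fun h => h.lt_of_ne fun e => ht (e ▸ s.2), fun h => h.le⟩
  simp only [this]

lemma zero_notMem_jumps (hT : 0 ≤ T) : (⟨0, le_rfl, hT⟩ : Icc (0 : ℝ) T) ∉ jumps x := fun h =>
  h (leftLim_eq_of_isBot fun t => t.2.1)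

lemma tauLeft_zero (hT : 0 ≤ T) : tauLeft r x ⟨0, le_rfl, hT⟩ = 0 := by
  have : ∀ s : Icc (0 : ℝ) T, ¬ s < ⟨0, le_rfl, hT⟩ := fun s => not_lt.2 s.2.1
  simp only [tauLeft, this, if_false, tsum_zero, add_zero]

lemma tau_zero (hT : 0 ≤ T) : tau r x ⟨0, le_rfl, hT⟩ = 0 := by
  rw [tau_of_notMem (zero_notMem_jumps hT), tauLeft_zero hT]

lemma tau_last (hT : 0 ≤ T) : tau r x ⟨T, hT, le_rfl⟩ = T + extra r x := by
  have : ∀ s : Icc (0 : ℝ) T, s ≤ ⟨T, hT, le_rfl⟩ := fun s => s.2.2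
  simp only [tau, this, if_true, extra]

lemma tau_smul (δ : ℝ) (t : Icc (0 : ℝ) T) :
    tau (fun k => δ * r k) x t = (1 - δ) * t + δ * tau r x t := by
  simp only [tau, ← mul_ite_zero, tsum_mul_left]
  ring

lemma tauLeft_smul (δ : ℝ) (t : Icc (0 : ℝ) T) :
    tauLeft (fun k => δ * r k) x t = (1 - δ) * t + δ * tauLeft r x t := by
  simp only [tauLeft, ← mul_ite_zero, tsum_mul_left]
  ring

lemma extra_smul (δ : ℝ) : extra (fun k => δ * r k) x = δ * extra r x := by
  simp only [extra, tsum_mul_left]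

lemma tau_sub_le (hr : ∀ k, 0 < r k) (hs : Summable fun s : jumps x => r (jumpRank x s))
    (t : Icc (0 : ℝ) T) : tau r x t ≤ t + extra r x := by
  classical
  have := tsum_ite_mono hr hs (P := fun u => (u : Icc (0 : ℝ) T) ≤ t) (Q := fun _ => True)
    fun _ _ => trivial
  simp only [if_true] at this
  simp only [tau, extra]
  gcongr

lemma le_tauLeft (hr : ∀ k, 0 < r k) (t : Icc (0 : ℝ) T) : (t : ℝ) ≤ tauLeft r x t := by
  simp only [tauLeft]
  refine le_add_of_nonneg_right (tsum_nonneg fun s => ?_)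
  split_ifs
  exacts [(hr _).le, le_rfl]

/-- Dominated convergence, each indicator being constant just to the right of t. From the left the
summand at t itself is absent, whence the limit `tauLeft`. -/
lemma tendsto_tau_right (hr : ∀ k, 0 < r k) (hs : Summable fun s : jumps x => r (jumpRank x s))
    (t : Icc (0 : ℝ) T) : Tendsto (tau r x) (𝓝[>] t) (𝓝 (tau r x t)) := by
  refine Tendsto.add ((continuous_subtype_val.tendsto t).mono_left nhdsWithin_le_nhds) ?_
  refine tendsto_tsum_of_dominated_convergence hs (fun s => ?_) (Eventually.of_forall fun u s => ?_)
  · refine tendsto_const_nhds.congr' ?_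
    rcases le_or_gt (s : Icc (0 : ℝ) T) t with h | h
    · filter_upwards [self_mem_nhdsWithin] with u hu
      rw [if_pos h, if_pos (h.trans (le_of_lt hu))]
    · filter_upwards [nhdsWithin_le_nhds (Iio_mem_nhds h)] with u hu
      rw [if_neg (not_le.2 h), if_neg (not_le.2 hu)]
  · split_ifs
    · rw [Real.norm_of_nonneg (hr _).le]
    · rw [norm_zero]
      exact (hr _).le

lemma tendsto_tau_left (hr : ∀ k, 0 < r k) (hs : Summable fun s : jumps x => r (jumpRank x s))
    (t : Icc (0 : ℝ) T) : Tendsto (tau r x) (𝓝[<] t) (𝓝 (tauLeft r x t)) := by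
  refine Tendsto.add ((continuous_subtype_val.tendsto t).mono_left nhdsWithin_le_nhds) ?_
  refine tendsto_tsum_of_dominated_convergence hs (fun s => ?_) (Eventually.of_forall fun u s => ?_)
  · refine tendsto_const_nhds.congr' ?_
    rcases lt_or_ge (s : Icc (0 : ℝ) T) t with h | h
    · filter_upwards [nhdsWithin_le_nhds (Ioi_mem_nhds h)] with u hu
      rw [if_pos h, if_pos (le_of_lt hu)]
    · filter_upwards [self_mem_nhdsWithin] with u hu
      rw [if_neg (not_lt.2 h), if_neg (not_le.2 (lt_of_lt_of_le hu h))]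
  · split_ifs
    · rw [Real.norm_of_nonneg (hr _).le]
    · rw [norm_zero]
      exact (hr _).le

/-- The stretched time `u` belongs to the interval over `t`. -/
def Slot (r : ℕ → ℝ) (x : Icc (0 : ℝ) T → G N d) (u : ℝ) (t : Icc (0 : ℝ) T) : Prop :=
  u ∈ Icc (tauLeft r x t) (tau r x t)

lemma slot_tau (hr : ∀ k, 0 < r k) (hs : Summable fun s : jumps x => r (jumpRank x s))
    (t : Icc (0 : ℝ) T) : Slot r x (tau r x t) t := ⟨tauLeft_le_tau hr hs t, le_rfl⟩

lemma Slot.le (hr : ∀ k, 0 < r k) (hs : Summable fun s : jumps x => r (jumpRank x s)) {u u' : ℝ}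
    {t t' : Icc (0 : ℝ) T} (h : Slot r x u t) (h' : Slot r x u' t') (huu : u ≤ u') : t ≤ t' := by
  by_contra! hlt
  exact absurd (huu.trans h'.2) (not_le.2 ((tau_lt_tauLeft hr hs hlt).trans_le h.1))

lemma Slot.unique (hr : ∀ k, 0 < r k) (hs : Summable fun s : jumps x => r (jumpRank x s)) {u : ℝ}
    {t t' : Icc (0 : ℝ) T} (h : Slot r x u t) (h' : Slot r x u t') : t = t' :=
  le_antisymm (h.le hr hs h' le_rfl) (h'.le hr hs h le_rfl)

lemma Slot.sub_le (hr : ∀ k, 0 < r k) (hs : Summable fun s : jumps x => r (jumpRank x s)) {u u' : ℝ}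
    {t t' : Icc (0 : ℝ) T} (h : Slot r x u t) (h' : Slot r x u' t') (huu : u ≤ u') :
    (t' : ℝ) - t ≤ u' - u := by
  rcases (h.le hr hs h' huu).eq_or_lt with rfl | hlt
  · simpa using huu
  · have := tau_add_le hr hs hlt
    have := h.2
    have := h'.1
    linarith

lemma Slot.smul {δ u : ℝ} (hδ : 0 ≤ δ) {t : Icc (0 : ℝ) T} (h : Slot r x u t) :
    Slot (fun k => δ * r k) x ((1 - δ) * t + δ * u) t := by
  rw [Slot, tau_smul, tauLeft_smul]
  have h1 := mul_le_mul_of_nonneg_left h.1 hδ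
  have h2 := mul_le_mul_of_nonneg_left h.2 hδ
  exact ⟨by linarith, by linarith⟩

/-- Take the infimum t of the times at which τ has reached u. Before t the values of τ stay below u,
which bounds the left limit; after t they are at least u, and τ is right-continuous. -/
lemma exists_slot (hT : 0 ≤ T) (hr : ∀ k, 0 < r k)
    (hs : Summable fun s : jumps x => r (jumpRank x s)) {u : ℝ} (hu : u ∈ Icc 0 (T + extra r x)) :
    ∃ t, Slot r x u t := by
  set A : Set ℝ := {s | ∃ h : s ∈ Icc 0 T, u ≤ tau r x ⟨s, h⟩} with hA
  have hTA : T ∈ A := ⟨⟨hT, le_rfl⟩, by rw [tau_last hT]; exact hu.2⟩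
  have hb : BddBelow A := ⟨0, fun s hs => hs.1.1⟩
  have hmem : sInf A ∈ Icc 0 T := ⟨le_csInf ⟨T, hTA⟩ fun s hs => hs.1.1, csInf_le hb hTA⟩
  set t : Icc (0 : ℝ) T := ⟨sInf A, hmem⟩ with ht
  refine ⟨t, ?_, ?_⟩
  · rcases hmem.1.eq_or_lt with h0 | h0
    · have : t = ⟨0, le_rfl, hT⟩ := Subtype.ext h0.symm
      rw [this, tauLeft_zero hT]
      exact hu.1
    · have : (𝓝[<] t).NeBot := nhdsLT_neBot_of_exists_lt ⟨⟨0, le_rfl, hT⟩, h0⟩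
      refine le_of_tendsto (tendsto_tau_left hr hs t) ?_
      filter_upwards [self_mem_nhdsWithin] with s hs'
      by_contra! hlt
      exact absurd (csInf_le hb (show (s : ℝ) ∈ A from ⟨s.2, hlt.le⟩)) (not_le.2 hs')
  · rcases hmem.2.eq_or_lt with h0 | h0
    · have : t = ⟨T, hT, le_rfl⟩ := Subtype.ext h0
      rw [this, tau_last hT]
      exact hu.2
    · have : (𝓝[>] t).NeBot := nhdsGT_neBot_of_exists_gt ⟨⟨T, hT, le_rfl⟩, h0⟩
      refine ge_of_tendsto (tendsto_tau_right hr hs t) ?_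
      filter_upwards [self_mem_nhdsWithin] with s hs'
      obtain ⟨a, ⟨ha, hua⟩, has⟩ := exists_lt_of_csInf_lt ⟨T, hTA⟩ (show sInf A < s from hs')
      exact hua.trans ((tau_strictMono hr hs).monotone (show (⟨a, ha⟩ : Icc (0 : ℝ) T) ≤ s from has.le))

/-- The map θ sends a point of the normalised interval to the original time it comes from; it is the
generalised inverse of the time change. It is Lipschitz because τ increases at least at unit speed.
-/
lemma exists_theta (hT : 0 < T) (hr : ∀ k, 0 < r k)
    (hs : Summable fun s : jumps x => r (jumpRank x s)) : ∃ θ : Icc (0 : ℝ) T → Icc (0 : ℝ) T,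
      (∀ v : Icc (0 : ℝ) T, Slot r x (v * (T + extra r x) / T) (θ v)) ∧ Monotone θ ∧ Continuous θ := by
  have hR := extra_nonneg (x := x) hr
  have h1 : ∀ v : Icc (0 : ℝ) T, v * (T + extra r x) / T ∈ Icc 0 (T + extra r x) := fun v =>
    ⟨div_nonneg (mul_nonneg v.2.1 (by positivity)) hT.le, by
      rw [div_le_iff₀ hT, mul_comm]
      exact mul_le_mul_of_nonneg_left v.2.2 (by positivity)⟩
  choose θ hθ using fun v => exists_slot hT.le hr hs (h1 v)
  have hmono : ∀ {v w : Icc (0 : ℝ) T}, v ≤ w →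
      v * (T + extra r x) / T ≤ w * (T + extra r x) / T := fun {v w} hvw =>
    div_le_div_of_nonneg_right (mul_le_mul_of_nonneg_right hvw (by positivity)) hT.le
  have hm : Monotone θ := fun v w hvw => (hθ v).le hr hs (hθ w) (hmono hvw)
  refine ⟨θ, hθ, hm, ?_⟩
  have hlip : ∀ v w : Icc (0 : ℝ) T, v ≤ w →
      dist (θ v) (θ w) ≤ (T + extra r x) / T * dist v w := by
    intro v w hvw
    rw [Subtype.dist_eq, Subtype.dist_eq, dist_comm, dist_comm (v : ℝ), Real.dist_eq, Real.dist_eq,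
      abs_of_nonneg (sub_nonneg.2 (show (θ v : ℝ) ≤ θ w from hm hvw)),
      abs_of_nonneg (sub_nonneg.2 (show (v : ℝ) ≤ w from hvw))]
    refine ((hθ v).sub_le hr hs (hθ w) (hmono hvw)).trans (le_of_eq ?_)
    ring
  refine (LipschitzWith.of_dist_le_mul (K := ((T + extra r x) / T).toNNReal) fun v w => ?_).continuous
  rw [Real.coe_toNNReal _ (by positivity)]
  rcases le_total v w with h | h
  · exact hlip v w h
  · rw [dist_comm, dist_comm v]
    exact hlip w v h

/-! ### The stretched path -/

variable {φ : PathFunction N d}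

lemma stretched_tau (hr : ∀ k, 0 < r k) (hs : Summable fun s : jumps x => r (jumpRank x s))
    (t : Icc (0 : ℝ) T) : stretched φ r x (tau r x t) = x t := by
  have h : ∃ t', tau r x t = tau r x t' := ⟨t, rfl⟩
  rw [stretched, dif_pos h]
  congr 1
  exact (tau_strictMono hr hs).injective h.choose_spec.symm

/-- The definition assigns the right end of the slot to its first branch; there the formula still
holds, since the connecting path ends at `x t`. -/
lemma stretched_of_mem (hr : ∀ k, 0 < r k) (hs : Summable fun s : jumps x => r (jumpRank x s))
    {t : Icc (0 : ℝ) T} (ht : t ∈ jumps x) (hJ : (Function.leftLim x t, x t) ∈ φ.J) {u : ℝ}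
    (hu : Slot r x u t) : stretched φ r x u = φ.toFun (Function.leftLim x t) (x t)
      (projIcc 0 1 zero_le_one ((u - tauLeft r x t) / r (jumpRank x t))) := by
  rcases hu.2.eq_or_lt with rfl | hlt
  · rw [stretched_tau hr hs, tau_of_mem hr hs ht, add_sub_cancel_left, div_self (hr _).ne',
      projIcc_right]
    exact (φ.target _ _ hJ).symm
  · have h1 : ¬ ∃ t', u = tau r x t' := by
      rintro ⟨t', rfl⟩
      have := hu.unique hr hs (slot_tau hr hs t')
      rw [this] at hlt
      exact lt_irrefl _ hlt
    have h2 : ∃ t ∈ jumps x, u ∈ Ico (tauLeft r x t) (tau r x t) := ⟨t, ht, hu.1, hlt⟩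
    have h3 : h2.choose = t :=
      Slot.unique hr hs ⟨h2.choose_spec.2.1, h2.choose_spec.2.2.le⟩ hu
    rw [stretched, dif_neg h1, dif_pos h2, h3]

lemma stretched_of_notMem (hr : ∀ k, 0 < r k) (hs : Summable fun s : jumps x => r (jumpRank x s))
    {t : Icc (0 : ℝ) T} (ht : t ∉ jumps x) {u : ℝ} (hu : Slot r x u t) :
    stretched φ r x u = x t := by
  have : u = tau r x t := le_antisymm hu.2 ((tau_of_notMem ht).le.trans hu.1)
  rw [this, stretched_tau hr hs]

/-- The affine map from u to (1 - δ) t + δ u carries the slot over t for the series r onto the one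
for δ r, and preserves the relative position on the connecting path. -/
lemma stretched_smul (hr : ∀ k, 0 < r k) (hs : Summable fun s : jumps x => r (jumpRank x s))
    (hJ : ∀ t ∈ jumps x, (Function.leftLim x t, x t) ∈ φ.J) {δ : ℝ} (hδ : 0 < δ)
    {t : Icc (0 : ℝ) T} {u : ℝ} (hu : Slot r x u t) :
    stretched φ (fun k => δ * r k) x ((1 - δ) * t + δ * u) = stretched φ r x u := by
  have hr' : ∀ k, 0 < δ * r k := fun k => mul_pos hδ (hr k)
  have hs' : Summable fun s : jumps x => δ * r (jumpRank x s) := hs.mul_left δ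
  have hu' := hu.smul hδ.le
  by_cases ht : t ∈ jumps x
  · rw [stretched_of_mem hr hs ht (hJ t ht) hu, stretched_of_mem hr' hs' ht (hJ t ht) hu',
      tauLeft_smul]
    congr 2
    have := hr (jumpRank x t)
    field_simp
    ring
  · rw [stretched_of_notMem hr hs ht hu, stretched_of_notMem hr' hs' ht hu']

lemma interp_apply (v : Icc (0 : ℝ) T) :
    interp φ r x v = stretched φ r x (v * (T + extra r x) / T) := rfl

/-- The paths built with different series are reparametrisations of each other. -/
lemma exists_rescale (hT : 0 < T) (hr : ∀ k, 0 < r k)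
    (hs : Summable fun s : jumps x => r (jumpRank x s))
    (hJ : ∀ t ∈ jumps x, (Function.leftLim x t, x t) ∈ φ.J) {δ : ℝ} (hδ : 0 < δ) (hδ1 : δ ≤ 1) :
    ∃ a : Icc (0 : ℝ) T ≃o Icc (0 : ℝ) T,
      (∀ v, interp φ (fun k => δ * r k) x (a v) = interp φ r x v) ∧
      ∀ v t : Icc (0 : ℝ) T, Slot r x (v * (T + extra r x) / T) t →
        |(a v : ℝ) - t| ≤ δ * extra r x := by
  obtain ⟨θ, hθ, hθm, hθc⟩ := exists_theta hT hr hs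
  have hR := extra_nonneg (x := x) hr
  set R := extra r x with hRdef
  have hTR : 0 < T + δ * R := by positivity
  -- Over each original time θ(v), f is the affine map between the two slots, followed by the
  -- normalisation from [0, T + δ R] to [0, T].
  set f : ℝ → ℝ := fun v => ((1 - δ) * θ (projIcc 0 T hT.le v) + δ * (v * (T + R) / T)) *
    (T / (T + δ * R)) with hf
  have hfm : StrictMono f := by
    intro v w hvw
    refine mul_lt_mul_of_pos_right ?_ (by positivity)
    have h1 : (θ (projIcc 0 T hT.le v) : ℝ) ≤ θ (projIcc 0 T hT.le w) :=
      hθm (monotone_projIcc hT.le hvw.le)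
    have h2 : v * (T + R) / T < w * (T + R) / T := by gcongr
    have h3 : (1 - δ) * (θ (projIcc 0 T hT.le v) : ℝ) ≤ (1 - δ) * θ (projIcc 0 T hT.le w) :=
      mul_le_mul_of_nonneg_left h1 (by linarith)
    have h4 := mul_lt_mul_of_pos_left h2 hδ
    linarith
  have hfc : Continuous f := by
    have : Continuous fun v => (θ (projIcc 0 T hT.le v) : ℝ) :=
      continuous_subtype_val.comp (hθc.comp continuous_projIcc)
    fun_prop
  have hθ0 : θ ⟨0, le_rfl, hT.le⟩ = ⟨0, le_rfl, hT.le⟩ := by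
    refine (hθ _).unique hr hs ?_
    rw [Slot, tau_zero hT.le, tauLeft_zero hT.le]
    simp
  have hθT : θ ⟨T, hT.le, le_rfl⟩ = ⟨T, hT.le, le_rfl⟩ := by
    refine (hθ _).unique hr hs ?_
    have h1 := slot_tau hr hs (⟨T, hT.le, le_rfl⟩ : Icc (0 : ℝ) T)
    rw [tau_last hT.le] at h1
    rwa [mul_div_cancel_left₀ _ hT.ne']
  have hT1 : (1 - δ) * T + δ * (T + R) = T + δ * R := by ring
  obtain ⟨a, ha⟩ := exists_orderIso_of_strictMonoOn hT.le hfc.continuousOn (hfm.strictMonoOn _)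
    (by simp only [hf]; rw [projIcc_left, hθ0]; simp)
    (by
      simp only [hf]
      rw [projIcc_right, hθT, mul_div_cancel_left₀ _ hT.ne', hT1, mul_div_cancel₀ _ hTR.ne'])
  have ha' : ∀ v, (a v : ℝ) = ((1 - δ) * θ v + δ * (v * (T + R) / T)) * (T / (T + δ * R)) :=
    fun v => by
      rw [ha]
      simp only [hf, projIcc_val]
  refine ⟨a, fun v => ?_, fun v t ht => ?_⟩
  · rw [interp_apply, interp_apply, extra_smul, ← hRdef, ← stretched_smul hr hs hJ hδ (hθ v), ha']
    congr 1
    field_simp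
  · rw [ha', (hθ v).unique hr hs ht]
    have hb1 := (le_tauLeft (x := x) hr t).trans ht.1
    have hb2 := ht.2.trans (tau_sub_le hr hs t)
    rw [← hRdef] at hb2
    set u := (v : ℝ) * (T + R) / T
    -- Here u - t lies in [0, R] and t in [0, T], so (u - t) T and t R both lie in [0, T R] and
    -- their difference is at most T R in absolute value.
    have e : ((1 - δ) * (t : ℝ) + δ * u) * (T / (T + δ * R)) - t =
        δ * ((u - t) * T - t * R) / (T + δ * R) := by
      field_simp
      ring
    rw [e, abs_div, abs_of_pos hTR, abs_mul, abs_of_pos hδ, div_le_iff₀ hTR]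
    have h1 : |(u - t) * T - t * R| ≤ T * R := by
      have h2 : 0 ≤ (u - t) * T := mul_nonneg (by linarith) hT.le
      have h3 : (u - t) * T ≤ R * T := mul_le_mul_of_nonneg_right (by linarith) hT.le
      have h4 : 0 ≤ (t : ℝ) * R := mul_nonneg t.2.1 hR
      have h5 : (t : ℝ) * R ≤ T * R := mul_le_mul_of_nonneg_right t.2.2 hR
      rw [abs_le]
      constructor <;> linarith
    have h6 : 0 ≤ δ * R := by positivity
    calc δ * |(u - t) * T - t * R| ≤ δ * (T * R) := by gcongr
      _ ≤ δ * R * (T + δ * R) := by nlinarith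

lemma interp_of_continuous (hT : 0 < T) (hr : ∀ k, 0 < r k) (hx : Continuous x) :
    interp φ r x = x := by
  have hj : jumps x = ∅ := by
    refine eq_empty_of_forall_notMem fun t ht => ht ?_
    exact hx.continuousWithinAt.leftLim_eq
  have : IsEmpty (jumps x) := isEmpty_coe_sort.2 hj
  have hs : Summable fun s : jumps x => r (jumpRank x s) := summable_empty
  funext v
  have h1 : v * (T + extra r x) / T = tau r x v := by
    simp only [extra, tau, tsum_empty, add_zero]
    field_simp
  rw [interp_apply, h1, stretched_tau hr hs]

end

/-! ### Continuity of the interpolated paths -/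

/-- If the control V converges along l, then z is Cauchy along l; its limit may therefore be
computed along any g tending to l. This is needed where infinitely many inserted intervals
accumulate. -/
lemma tendsto_of_control {V : Icc (0 : ℝ) T → ℝ} {q : ℝ} (hq : 0 < q) {z : Icc (0 : ℝ) T → G N d}
    (hV : ∀ s t, s ≤ t → ccDist (z s) (z t) ≤ ENNReal.ofReal ((V t - V s) ^ q))
    (hVm : Monotone V) {l : Filter (Icc (0 : ℝ) T)} {c : ℝ} (hc : Tendsto V l (𝓝 c))
    {β : Type*} {m : Filter β} [m.NeBot] {g : β → Icc (0 : ℝ) T} (hg : Tendsto g m l) {a : G N d}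
    (ha : Tendsto (z ∘ g) m (𝓝 a)) : Tendsto z l (𝓝 a) := by
  have hV' : ∀ s t, ccDist (z s) (z t) ≤ ENNReal.ofReal (|V t - V s| ^ q) := by
    intro s t
    rcases le_total s t with h | h
    · rw [abs_of_nonneg (sub_nonneg.2 (hVm h))]
      exact hV s t h
    · rw [ccDist_comm, abs_sub_comm, abs_of_nonneg (sub_nonneg.2 (hVm h))]
      exact hV t s h
  have h1 : Tendsto (fun b : Icc (0 : ℝ) T × β => ENNReal.ofReal (|V (g b.2) - V b.1| ^ q)) (l ×ˢ m)
      (𝓝 0) := by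
    have h2 : Tendsto (fun b : Icc (0 : ℝ) T × β => V (g b.2) - V b.1) (l ×ˢ m) (𝓝 (c - c)) :=
      ((hc.comp hg).comp tendsto_snd).sub (hc.comp tendsto_fst)
    rw [sub_self] at h2
    have h3 : Continuous fun y : ℝ => ENNReal.ofReal (|y| ^ q) :=
      ENNReal.continuous_ofReal.comp (continuous_abs.rpow_const fun _ => Or.inr hq.le)
    have h4 := (h3.tendsto 0).comp h2
    simp only [abs_zero, Real.zero_rpow hq.ne', ENNReal.ofReal_zero] at h4
    exact h4
  have h2 : Tendsto (fun b : Icc (0 : ℝ) T × β => ccDist (z (g b.2)) a) (l ×ˢ m) (𝓝 0) :=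
    (tendsto_ccDist ha tendsto_const_nhds).comp tendsto_snd
  have h3 : Tendsto (fun b : Icc (0 : ℝ) T × β => ccDist a (z b.1)) (l ×ˢ m) (𝓝 0) := by
    have h4 := h1.add h2
    rw [add_zero] at h4
    refine tendsto_of_tendsto_of_tendsto_of_le_of_le tendsto_const_nhds h4 (fun _ => zero_le)
      fun b => ?_
    change ccDist a (z b.1) ≤ _
    rw [ccDist_comm]
    exact (ccDist_triangle _ (z (g b.2)) _).trans (add_le_add (hV' _ _) le_rfl)
  have h4 : Tendsto (fun b : Icc (0 : ℝ) T × β => z b.1) (l ×ˢ m) (𝓝 a) :=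
    tendsto_of_ccDist tendsto_const_nhds h3
  rw [← map_fst_prod l m]
  exact tendsto_map'_iff.2 h4

/-- Inside a slot this is the continuity of the connecting path. At an end of a slot the càdlàg
property gives a limit only along the normalised times of the original path. Connecting paths over
small jumps could a priori be large; finite p-variation excludes this through the control. -/
lemma continuous_interp (hT : 0 < T) {p : ℝ} (hp : 0 < p) {φ : PathFunction N d} {r : ℕ → ℝ}
    {x : Icc (0 : ℝ) T → G N d} (hr : ∀ k, 0 < r k) (hrs : Summable r) (hx : IsCadlag x)
    (hJ : ∀ t ∈ jumps x, (Function.leftLim x t, x t) ∈ φ.J) (hv : pVar p (interp φ r x) < ∞) :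
    Continuous (interp φ r x) := by
  have hs := summable_jumps hx hrs
  obtain ⟨θ, hθ, hθm, hθc⟩ := exists_theta hT hr hs
  obtain ⟨V, hVm, hV0, hVle, hV⟩ := exists_control hT.le hp hv
  have hR := extra_nonneg (x := x) hr
  set R := extra r x with hRdef
  have hTR : 0 < T + R := by positivity
  set z := interp φ r x with hz
  -- the normalised time change
  have hbd : ∀ t : Icc (0 : ℝ) T, tau r x t * (T / (T + R)) ∈ Icc 0 T := fun t => by
    have h1 := (le_tauLeft (x := x) hr t).trans (tauLeft_le_tau hr hs t)
    have h2 := tau_sub_le hr hs t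
    refine ⟨mul_nonneg (t.2.1.trans h1) (by positivity), ?_⟩
    rw [← mul_div_assoc, div_le_iff₀ hTR, mul_comm]
    have := t.2.2
    exact mul_le_mul_of_nonneg_left (by linarith) hT.le
  set g : Icc (0 : ℝ) T → Icc (0 : ℝ) T := fun t => ⟨tau r x t * (T / (T + R)), hbd t⟩ with hg
  have hscale : ∀ y : ℝ, y * (T / (T + R)) * (T + R) / T = y := fun y => by field_simp
  have hzg : ∀ t, z (g t) = x t := fun t => by
    rw [hz, interp_apply, ← hRdef]
    simp only [hg]
    rw [hscale, stretched_tau hr hs]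
  have hlt : ∀ {v w : Icc (0 : ℝ) T}, v < w ↔ v * (T + R) / T < w * (T + R) / T := by
    intro v w
    rw [div_lt_div_iff_of_pos_right hT, mul_lt_mul_iff_left₀ hTR]
    rfl
  have hgT : ∀ t, (g t : ℝ) * (T + R) / T = tau r x t := fun t => hscale _
  have hlim : ∀ (v : Icc (0 : ℝ) T) (y : ℝ) (l : Filter (Icc (0 : ℝ) T)), Tendsto (tau r x) l (𝓝 y) →
      y = v * (T + R) / T → Tendsto g l (𝓝 v) := by
    intro v y l h hy
    rw [tendsto_subtype_rng]
    have := h.mul_const (T / (T + R))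
    rw [hy] at this
    convert this using 2
    field_simp
  refine continuous_iff_continuousAt.2 fun v => ?_
  set t := θ v with ht
  have hsv := hθ v
  rw [← ht] at hsv
  have hright : Tendsto z (𝓝[>] v) (𝓝 (z v)) := by
    rcases hsv.2.lt_or_eq with h | h
    · -- inside a connecting path
      have htj : t ∈ jumps x := by
        by_contra hn
        rw [tau_of_notMem hn] at h
        exact absurd hsv.1 (not_le.2 h)
      have hc : Continuous fun w : Icc (0 : ℝ) T => φ.toFun (Function.leftLim x t) (x t)
          (projIcc 0 1 zero_le_one (((w : ℝ) * (T + R) / T - tauLeft r x t) / r (jumpRank x t))) := by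
        refine (φ.toFun _ _).continuous.comp (continuous_projIcc.comp ?_)
        fun_prop
      have h1 : ∀ᶠ w in 𝓝[>] v, z w = φ.toFun (Function.leftLim x t) (x t)
          (projIcc 0 1 zero_le_one (((w : ℝ) * (T + R) / T - tauLeft r x t) / r (jumpRank x t))) := by
        have hcw : Continuous fun w : Icc (0 : ℝ) T => (w : ℝ) * (T + R) / T := by fun_prop
        filter_upwards [self_mem_nhdsWithin,
          nhdsWithin_le_nhds (hcw.continuousAt.eventually_lt_const h)] with w hw1 hw2
        exact stretched_of_mem hr hs htj (hJ t htj) ⟨hsv.1.trans (hlt.1 hw1).le, hw2.le⟩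
      have h2 : z v = _ := stretched_of_mem hr hs htj (hJ t htj) hsv
      rw [h2]
      exact ((hc.tendsto v).mono_left nhdsWithin_le_nhds).congr' (h1.mono fun _ h => h.symm)
    · have hvg : v = g t := by
        refine Subtype.ext ?_
        simp only [hg]
        rw [← h]
        field_simp
      have hzv : z v = x t := by rw [hvg, hzg]
      rcases eq_or_neBot (𝓝[>] v) with hb | hb
      · rw [hb]
        exact tendsto_bot
      have htT : (t : ℝ) < T := by
        refine lt_of_le_of_ne t.2.2 fun e => ?_
        have e1 : t = ⟨T, hT.le, le_rfl⟩ := Subtype.ext e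
        have e2 : (v : ℝ) = T := by
          rw [hvg]
          simp only [hg, e1]
          rw [tau_last hT.le, ← hRdef]
          field_simp
        have e3 : Ioi v = ∅ := by
          refine eq_empty_of_forall_notMem fun w hw => ?_
          have : (v : ℝ) < w := hw
          rw [e2] at this
          exact absurd w.2.2 (not_le.2 this)
        rw [e3, nhdsWithin_empty] at hb
        exact hb.ne rfl
      have : (𝓝[>] t).NeBot := nhdsGT_neBot_of_exists_gt ⟨⟨T, hT.le, le_rfl⟩, htT⟩
      -- The points g(s) with s decreasing to t approach v from the right, and there z equals x(s),
      -- which tends to x(t).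
      have hg1 : Tendsto g (𝓝[>] t) (𝓝[>] v) := by
        refine tendsto_nhdsWithin_iff.2 ⟨hlim v _ _ (tendsto_tau_right hr hs t) h.symm, ?_⟩
        filter_upwards [self_mem_nhdsWithin] with s hst
        refine hlt.2 ?_
        rw [hgT, h]
        exact tau_strictMono hr hs hst
      have hV1 : ∃ c, Tendsto V (𝓝[>] v) (𝓝 c) :=
        ⟨_, hVm.tendsto_nhdsGT v⟩
      obtain ⟨c, hc⟩ := hV1
      refine tendsto_of_control (one_div_pos.2 hp) hV hVm hc hg1 ?_
      rw [hzv]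
      refine (hx.tendsto_right t).congr fun s => (hzg s).symm
  have hleft : Tendsto z (𝓝[<] v) (𝓝 (z v)) := by
    rcases hsv.1.lt_or_eq with h | h
    · have htj : t ∈ jumps x := by
        by_contra hn
        rw [← tau_of_notMem hn] at h
        exact absurd hsv.2 (not_le.2 h)
      have hc : Continuous fun w : Icc (0 : ℝ) T => φ.toFun (Function.leftLim x t) (x t)
          (projIcc 0 1 zero_le_one (((w : ℝ) * (T + R) / T - tauLeft r x t) / r (jumpRank x t))) := by
        refine (φ.toFun _ _).continuous.comp (continuous_projIcc.comp ?_)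
        fun_prop
      have h1 : ∀ᶠ w in 𝓝[<] v, z w = φ.toFun (Function.leftLim x t) (x t)
          (projIcc 0 1 zero_le_one (((w : ℝ) * (T + R) / T - tauLeft r x t) / r (jumpRank x t))) := by
        have hcw : Continuous fun w : Icc (0 : ℝ) T => (w : ℝ) * (T + R) / T := by fun_prop
        filter_upwards [self_mem_nhdsWithin,
          nhdsWithin_le_nhds (hcw.continuousAt.eventually_const_lt h)] with w hw1 hw2
        exact stretched_of_mem hr hs htj (hJ t htj) ⟨hw2.le, (hlt.1 hw1).le.trans hsv.2⟩
      have h2 : z v = _ := stretched_of_mem hr hs htj (hJ t htj) hsv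
      rw [h2]
      exact ((hc.tendsto v).mono_left nhdsWithin_le_nhds).congr' (h1.mono fun _ h => h.symm)
    · have hzv : z v = Function.leftLim x t := by
        by_cases htj : t ∈ jumps x
        · have h2 : z v = _ := stretched_of_mem hr hs htj (hJ t htj) hsv
          change z v = φ.toFun (Function.leftLim x t) (x t) (projIcc 0 1 zero_le_one
            (((v : ℝ) * (T + R) / T - tauLeft r x t) / r (jumpRank x t))) at h2
          rw [h2, ← h, sub_self, zero_div, projIcc_left]
          exact φ.source _ _ (hJ t htj)
        · have h2 : z v = _ := stretched_of_notMem hr hs htj hsv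
          rw [h2]
          exact (not_not.1 htj).symm
      rcases eq_or_neBot (𝓝[<] v) with hb | hb
      · rw [hb]
        exact tendsto_bot
      have htT : (0 : ℝ) < t := by
        refine lt_of_le_of_ne t.2.1 fun e => ?_
        have e1 : t = ⟨0, le_rfl, hT.le⟩ := Subtype.ext e.symm
        rw [e1, tauLeft_zero hT.le] at h
        have e2 : (v : ℝ) = 0 := by
          rcases div_eq_zero_iff.1 h.symm with h' | h'
          · exact (mul_eq_zero.1 h').resolve_right hTR.ne'
          · exact absurd h' hT.ne'
        have e3 : Iio v = ∅ := by
          refine eq_empty_of_forall_notMem fun w hw => ?_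
          have : (w : ℝ) < v := hw
          rw [e2] at this
          exact absurd w.2.1 (not_le.2 this)
        rw [e3, nhdsWithin_empty] at hb
        exact hb.ne rfl
      have : (𝓝[<] t).NeBot := nhdsLT_neBot_of_exists_lt ⟨⟨0, le_rfl, hT.le⟩, htT⟩
      -- From the left the approach is along s increasing to t, and the limit is the left limit of
      -- x, where the connecting path begins.
      have hg1 : Tendsto g (𝓝[<] t) (𝓝[<] v) := by
        refine tendsto_nhdsWithin_iff.2 ⟨hlim v _ _ (tendsto_tau_left hr hs t) h, ?_⟩
        filter_upwards [self_mem_nhdsWithin] with s hst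
        refine hlt.2 ?_
        rw [hgT, ← h]
        exact tau_lt_tauLeft hr hs hst
      have hV1 : ∃ c, Tendsto V (𝓝[<] v) (𝓝 c) :=
        ⟨_, hVm.tendsto_nhdsLT v⟩
      obtain ⟨c, hc⟩ := hV1
      refine tendsto_of_control (one_div_pos.2 hp) hV hVm hc hg1 ?_
      rw [hzv]
      refine (hx.tendsto_leftLim t).congr fun s => (hzg s).symm
  exact continuousAt_iff_continuous_left'_right'.2 ⟨hleft, hright⟩

/-! ### The limiting distance -/

section Alpha

variable {φ : PathFunction N d} {r : ℕ → ℝ} {p : ℝ} {x y z : Icc (0 : ℝ) T → G N d}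

lemma exists_reparam (hT : 0 < T) (hr : ∀ k, 0 < r k) (hrs : Summable r) (hx : x ∈ Dp T φ r p)
    {δ δ' : ℝ} (hδ : δ ∈ Ioc (0 : ℝ) 1) (hδ' : δ' ∈ Ioc (0 : ℝ) 1) :
    ∃ b : Icc (0 : ℝ) T ≃o Icc (0 : ℝ) T,
      interp φ (fun k => δ * r k) x = interp φ (fun k => δ' * r k) x ∘ b ∧
      ∀ u, edist (b u) u ≤ ENNReal.ofReal ((δ + δ') * extra r x) := by
  have hs := summable_jumps hx.2.1 hrs
  obtain ⟨a, ha, ha'⟩ := exists_rescale (φ := φ) hT hr hs hx.2.2.1 hδ.1 hδ.2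
  obtain ⟨c, hc, hc'⟩ := exists_rescale (φ := φ) hT hr hs hx.2.2.1 hδ'.1 hδ'.2
  obtain ⟨θ, hθ, -⟩ := exists_theta hT hr hs
  refine ⟨a.symm.trans c, ?_, fun u => ?_⟩
  · funext u
    change _ = interp φ (fun k => δ' * r k) x (c (a.symm u))
    rw [hc, ← ha, OrderIso.apply_symm_apply]
  · rw [edist_Icc]
    refine ENNReal.ofReal_le_ofReal ?_
    change |(c (a.symm u) : ℝ) - u| ≤ _
    have h1 := ha' (a.symm u) _ (hθ _)
    have h2 := hc' (a.symm u) _ (hθ _)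
    rw [OrderIso.apply_symm_apply] at h1
    rw [abs_le] at h1 h2 ⊢
    constructor <;> linarith

/-- Changing δ only reparametrises both paths, so the ρ-term is untouched and the cost is the
displacement of times, which is linear in δ + δ'. -/
lemma sigmaInterp_le (hT : 0 < T) (hp : 0 < p) (hr : ∀ k, 0 < r k) (hrs : Summable r)
    (hx : x ∈ Dp T φ r p) (hy : y ∈ Dp T φ r p) {δ δ' : ℝ} (hδ : δ ∈ Ioc (0 : ℝ) 1)
    (hδ' : δ' ∈ Ioc (0 : ℝ) 1) : sigmaInterp φ r p δ x y ≤
      sigmaInterp φ r p δ' x y + ENNReal.ofReal ((extra r x + extra r y) * (δ + δ')) := by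
  obtain ⟨a, ha, ha'⟩ := exists_reparam hT hr hrs hx hδ hδ'
  obtain ⟨b, hb, hb'⟩ := exists_reparam hT hr hrs hy hδ hδ'
  have h1 := extra_nonneg (x := x) hr
  have h2 := extra_nonneg (x := y) hr
  unfold sigmaInterp
  rw [ha, hb]
  refine (sigma_comp_le hT.le hp _ _ a b ha' hb').trans (le_of_eq ?_)
  have h3 : 0 ≤ δ + δ' := by linarith [hδ.1, hδ'.1]
  rw [← ENNReal.ofReal_add (by positivity) (by positivity)]
  congr 2
  ring

/-- The limit is the infimum of g(δ) + C δ; the hypothesis places g(δ) within C δ of it. This gives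
a rate of convergence together with the existence of the limit. -/
lemma exists_tendsto_of_le_add {g : ℝ → ℝ≥0∞} {C : ℝ} (hC : 0 ≤ C)
    (h : ∀ δ ∈ Ioc (0 : ℝ) 1, ∀ δ' ∈ Ioc (0 : ℝ) 1, g δ ≤ g δ' + ENNReal.ofReal (C * (δ + δ'))) :
    ∃ L, Tendsto g (𝓝[>] 0) (𝓝 L) ∧ ∀ δ ∈ Ioc (0 : ℝ) 1,
      g δ ≤ L + ENNReal.ofReal (C * δ) ∧ L ≤ g δ + ENNReal.ofReal (C * δ) := by
  set L : ℝ≥0∞ := ⨅ δ : Ioc (0 : ℝ) 1, g δ + ENNReal.ofReal (C * δ) with hL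
  have key : ∀ δ ∈ Ioc (0 : ℝ) 1,
      g δ ≤ L + ENNReal.ofReal (C * δ) ∧ L ≤ g δ + ENNReal.ofReal (C * δ) := by
    refine fun δ hδ => ⟨?_, iInf_le (fun δ : Ioc (0 : ℝ) 1 => g δ + ENNReal.ofReal (C * δ)) ⟨δ, hδ⟩⟩
    rw [hL, ENNReal.iInf_add]
    refine le_iInf fun δ' => (h δ hδ δ' δ'.2).trans (le_of_eq ?_)
    have h1 := mul_nonneg hC hδ.1.le
    have h2 := mul_nonneg hC δ'.2.1.le
    rw [add_assoc, ← ENNReal.ofReal_add h2 h1]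
    congr 2
    ring
  refine ⟨L, ?_, key⟩
  have h0 : Tendsto (fun δ : ℝ => ENNReal.ofReal (C * δ)) (𝓝[>] 0) (𝓝 0) := by
    have : Continuous fun δ : ℝ => ENNReal.ofReal (C * δ) :=
      ENNReal.continuous_ofReal.comp (by fun_prop)
    simpa using (this.tendsto 0).mono_left nhdsWithin_le_nhds
  have hmem : ∀ᶠ δ : ℝ in 𝓝[>] 0, δ ∈ Ioc (0 : ℝ) 1 := Ioc_mem_nhdsGT one_pos
  have h1 : Tendsto (fun δ : ℝ => L - ENNReal.ofReal (C * δ)) (𝓝[>] 0) (𝓝 L) := by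
    simpa using ENNReal.Tendsto.sub tendsto_const_nhds h0 (Or.inr ENNReal.zero_ne_top)
  have h2 : Tendsto (fun δ : ℝ => L + ENNReal.ofReal (C * δ)) (𝓝[>] 0) (𝓝 L) := by
    simpa using (tendsto_const_nhds (x := L)).add h0
  refine tendsto_of_tendsto_of_tendsto_of_le_of_le' h1 h2 ?_ ?_
  · filter_upwards [hmem] with δ hδ
    exact tsub_le_iff_right.2 (key δ hδ).2
  · filter_upwards [hmem] with δ hδ
    exact (key δ hδ).1

lemma alpha_spec (hT : 0 < T) (hp : 0 < p) (hr : ∀ k, 0 < r k) (hrs : Summable r)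
    (hx : x ∈ Dp T φ r p) (hy : y ∈ Dp T φ r p) :
    Tendsto (fun δ => sigmaInterp φ r p δ x y) (𝓝[>] 0) (𝓝 (alpha φ r p x y)) ∧
      ∀ δ ∈ Ioc (0 : ℝ) 1,
        sigmaInterp φ r p δ x y ≤
          alpha φ r p x y + ENNReal.ofReal ((extra r x + extra r y) * δ) ∧
        alpha φ r p x y ≤
          sigmaInterp φ r p δ x y + ENNReal.ofReal ((extra r x + extra r y) * δ) := by
  obtain ⟨L, hL, h⟩ := exists_tendsto_of_le_add (g := fun δ => sigmaInterp φ r p δ x y)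
    (add_nonneg (extra_nonneg (x := x) hr) (extra_nonneg (x := y) hr))
    fun δ hδ δ' hδ' => sigmaInterp_le hT hp hr hrs hx hy hδ hδ'
  have : alpha φ r p x y = L := hL.limUnder_eq
  rw [this]
  exact ⟨hL, h⟩

lemma alpha_lt_top (hT : 0 < T) (hp : 0 < p) (hr : ∀ k, 0 < r k) (hrs : Summable r)
    (hx : x ∈ Dp T φ r p) (hy : y ∈ Dp T φ r p) : alpha φ r p x y < ∞ := by
  refine (((alpha_spec hT hp hr hrs hx hy).2 1 ⟨one_pos, le_rfl⟩).2).trans_lt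
    (ENNReal.add_lt_top.2 ⟨?_, ENNReal.ofReal_lt_top⟩)
  unfold sigmaInterp
  simp only [one_mul]
  exact (sigma_le_rho _ _ _).trans_lt (rho_lt_top hp hx.2.2.2 hy.2.2.2)

lemma alpha_comm (hT : 0 < T) (hp : 0 < p) (x y : Icc (0 : ℝ) T → G N d) :
    alpha φ r p x y = alpha φ r p y x := by
  have h : (fun δ => sigmaInterp φ r p δ x y) = fun δ => sigmaInterp φ r p δ y x := by
    funext δ
    exact sigma_comm hT.le hp _ _
  unfold alpha
  rw [h]

lemma alpha_triangle (hT : 0 < T) (hp : 0 < p) (hr : ∀ k, 0 < r k) (hrs : Summable r)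
    (hx : x ∈ Dp T φ r p) (hy : y ∈ Dp T φ r p) (hz : z ∈ Dp T φ r p) :
    alpha φ r p x z ≤ quasiC N p * (alpha φ r p x y + alpha φ r p y z) := by
  have h1 := ENNReal.Tendsto.const_mul ((alpha_spec hT hp hr hrs hx hy).1.add
    (alpha_spec hT hp hr hrs hy hz).1) (Or.inr (quasiC_ne_top N p))
  have h2 : ∀ δ, sigmaInterp φ r p δ x z ≤
      quasiC N p * (sigmaInterp φ r p δ x y + sigmaInterp φ r p δ y z) := fun δ => by
    unfold sigmaInterp
    exact sigma_triangle hT.le hp _ _ _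
  exact le_of_tendsto_of_tendsto' (alpha_spec hT hp hr hrs hx hz).1 h1 h2

lemma alpha_self (hp : 0 < p) (x : Icc (0 : ℝ) T → G N d) :
    alpha φ r p x x = 0 := by
  have : Tendsto (fun δ => sigmaInterp φ r p δ x x) (𝓝[>] (0 : ℝ)) (𝓝 0) := by
    refine tendsto_const_nhds.congr fun δ => ?_
    refine (nonpos_iff_eq_zero.1 ((sigma_le_rho _ _ _).trans (rho_self hp _).le)).symm
  exact this.limUnder_eq

/-! ### Continuous paths and their density -/

lemma alpha_of_continuous (hT : 0 < T) (hr : ∀ k, 0 < r k) (hx : Continuous x)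
    (hy : Continuous y) : alpha φ r p x y = sigma p x y := by
  have : Tendsto (fun δ => sigmaInterp φ r p δ x y) (𝓝[>] (0 : ℝ)) (𝓝 (sigma p x y)) := by
    refine tendsto_const_nhds.congr' ?_
    filter_upwards [self_mem_nhdsWithin] with δ hδ
    unfold sigmaInterp
    rw [interp_of_continuous hT (fun k => mul_pos hδ (hr k)) hx,
      interp_of_continuous hT (fun k => mul_pos hδ (hr k)) hy]
  exact this.limUnder_eq

lemma _root_.Continuous.jumps_eq_empty (hx : Continuous x) : jumps x = ∅ := by
  refine eq_empty_of_forall_notMem fun t ht => ht hx.continuousWithinAt.leftLim_eq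

lemma _root_.Continuous.isCadlag (hx : Continuous x) : IsCadlag x :=
  fun t => ⟨hx.continuousWithinAt, x t, (hx.tendsto t).mono_left nhdsWithin_le_nhds⟩

lemma Cp_subset_Dp (hT : 0 < T) (hr : ∀ k, 0 < r k) : Cp N d T p ⊆ Dp T φ r p := by
  intro x hx
  refine ⟨hx.1, hx.2.1.isCadlag, ?_, ?_⟩
  · rw [hx.2.1.jumps_eq_empty]
    simp
  · rw [interp_of_continuous hT hr hx.2.1]
    exact hx.2.2

lemma interp_zero (hT : 0 < T) (hr : ∀ k, 0 < r k) (hs : Summable fun s : jumps x => r (jumpRank x s)) :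
    interp φ r x ⟨0, le_rfl, hT.le⟩ = x ⟨0, le_rfl, hT.le⟩ := by
  have h := stretched_tau (φ := φ) hr hs ⟨0, le_rfl, hT.le⟩
  rw [tau_zero hT.le] at h
  rw [interp_apply, zero_mul, zero_div, h]

lemma interp_last (hT : 0 < T) (hr : ∀ k, 0 < r k) (hs : Summable fun s : jumps x => r (jumpRank x s)) :
    interp φ r x ⟨T, hT.le, le_rfl⟩ = x ⟨T, hT.le, le_rfl⟩ := by
  have h := stretched_tau (φ := φ) hr hs ⟨T, hT.le, le_rfl⟩
  rw [tau_last hT.le] at h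
  rw [interp_apply, mul_div_assoc, mul_div_cancel₀ _ hT.ne', h]

lemma startsAtOne_interp (hT : 0 < T) (hr : ∀ k, 0 < r k)
    (hs : Summable fun s : jumps x => r (jumpRank x s)) (hx : StartsAtOne x) :
    StartsAtOne (interp φ r x) := by
  intro t ht
  have : t = ⟨0, le_rfl, hT.le⟩ := Subtype.ext ht
  rw [this, interp_zero hT hr hs]
  exact hx _ rfl

lemma interp_mem_Cp (hT : 0 < T) (hp : 0 < p) (hr : ∀ k, 0 < r k) (hrs : Summable r)
    (hx : x ∈ Dp T φ r p) {δ : ℝ} (hδ : δ ∈ Ioc (0 : ℝ) 1) :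
    interp φ (fun k => δ * r k) x ∈ Cp N d T p := by
  have hs := summable_jumps hx.2.1 hrs
  obtain ⟨b, hb, -⟩ := exists_reparam hT hr hrs hx hδ (δ' := 1) ⟨one_pos, le_rfl⟩
  simp only [one_mul] at hb
  refine ⟨startsAtOne_interp hT (fun k => mul_pos hδ.1 (hr k)) (hs.mul_left δ) hx.1, ?_, ?_⟩
  · rw [hb]
    exact (continuous_interp hT hp hr hrs hx.2.1 hx.2.2.1 hx.2.2.2).comp b.continuous
  · rw [hb]
    exact (pVar_comp_le hT.le hp _ b.monotone).trans_lt hx.2.2.2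

/-- The approximation is x^{φ,δ} itself. The exponent p' is separate from p so that the same
approximation serves both (ii) and (v). -/
lemma exists_Cp_alpha_lt (hT : 0 < T) (hp : 0 < p) (hr : ∀ k, 0 < r k) (hrs : Summable r)
    (hx : x ∈ Dp T φ r p) {p' : ℝ} (hpp : p ≤ p') {ε : ℝ≥0∞} (hε : 0 < ε) :
    ∃ y ∈ Cp N d T p, alpha φ r p' x y < ε := by
  have hx' : x ∈ Dp T φ r p' :=
    ⟨hx.1, hx.2.1, hx.2.2.1, (pVar_anti hp hpp _).trans_lt hx.2.2.2⟩
  have h0 : Tendsto (fun δ : ℝ => ENNReal.ofReal (extra r x * δ)) (𝓝[>] 0) (𝓝 0) := by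
    have : Continuous fun δ : ℝ => ENNReal.ofReal (extra r x * δ) :=
      ENNReal.continuous_ofReal.comp (by fun_prop)
    simpa using (this.tendsto 0).mono_left nhdsWithin_le_nhds
  have hmem : ∀ᶠ δ : ℝ in 𝓝[>] 0, δ ∈ Ioc (0 : ℝ) 1 := Ioc_mem_nhdsGT one_pos
  obtain ⟨δ, hδ, hδε⟩ := (hmem.and (h0.eventually_lt_const hε)).exists
  have hy := interp_mem_Cp hT hp hr hrs hx hδ
  have hp' := hp.trans_le hpp
  refine ⟨_, hy, (((alpha_spec hT hp' hr hrs hx'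
    (Cp_subset_Dp hT hr (Cp_anti hp hpp hy))).2 δ hδ).2).trans_lt ?_⟩
  -- A continuous path has no jumps: it is its own interpolation and contributes no inserted time,
  -- so at parameter δ the distance σ is zero and only the error term of x remains.
  have he : extra r (interp φ (fun k => δ * r k) x) = 0 := by
    unfold extra
    have := hy.2.1.jumps_eq_empty
    have hE : IsEmpty (jumps (interp φ (fun k => δ * r k) x)) := isEmpty_coe_sort.2 this
    exact tsum_empty
  have h1 : sigmaInterp φ r p' δ x (interp φ (fun k => δ * r k) x) = 0 := by
    unfold sigmaInterp
    rw [interp_of_continuous hT (fun k => mul_pos hδ.1 (hr k)) hy.2.1]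
    exact nonpos_iff_eq_zero.1 ((sigma_le_rho _ _ _).trans (rho_self hp' _).le)
  rw [h1, he, zero_add, add_zero]
  exact hδε

lemma Dp_anti (hp : 0 < p) {p' : ℝ} (hpp : p ≤ p') : Dp T φ r p ⊆ Dp T φ r p' :=
  fun _ hx => ⟨hx.1, hx.2.1, hx.2.2.1, (pVar_anti hp hpp _).trans_lt hx.2.2.2⟩

/-! ### Vanishing of the limiting distance -/

/-- As both paths start at the identity, their values are their increments from time 0. The
components of order zero, which ρ ignores, are both 1. -/
lemma norm_sub_le_of_rho (hT : 0 ≤ T) (hp : 0 < p) (hx : StartsAtOne x) (hy : StartsAtOne y)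
    {η : ℝ} (hη : 0 ≤ η) (h : rho p x y ≤ ENNReal.ofReal η) (t : Icc (0 : ℝ) T) :
    ‖(x t : TruncTensor N d) - y t‖ ≤ η := by
  have hi : ∀ {w : Icc (0 : ℝ) T → G N d}, StartsAtOne w →
      incr (w ⟨0, le_rfl, hT⟩) (w t) = w t := by
    intro w hw
    rw [incr, hw _ rfl, Ring.inverse_one, one_mul]
  rw [norm_le_iff_level hη]
  intro k
  rw [level_sub]
  by_cases hk : 1 ≤ (k : ℕ)
  · have := (levelDist_le_rho hT hp x y k hk (show (⟨0, le_rfl, hT⟩ : Icc (0 : ℝ) T) ≤ t from t.2.1)).trans h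
    unfold levelDist at this
    rw [hi hx, hi hy] at this
    rwa [← ofReal_norm, ENNReal.ofReal_le_ofReal_iff hη] at this
  · have hk0 : k = 0 := Fin.ext (by simpa using hk)
    have h0 : ∀ (g : G N d) (v : Fin (0 : Fin (N + 1)) → Fin d),
        level 0 (g : TruncTensor N d) v = 1 := fun g v => by
      have e : List.ofFn v = [] := List.eq_nil_of_length_eq_zero List.length_ofFn
      rw [← coeff_ofFn, e, g.coeff_nil]
    have h1 : level 0 (x t : TruncTensor N d) = level 0 (y t : TruncTensor N d) := by
      ext v
      rw [h0, h0]
    rw [hk0, h1, sub_self, norm_zero]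
    exact hη

lemma exists_close (hT : 0 < T) (hp : 0 < p) (hr : ∀ k, 0 < r k) (hrs : Summable r)
    (hx : x ∈ Dp T φ r p) (hy : y ∈ Dp T φ r p) (h : alpha φ r p x y = 0) {ε : ℝ} (hε : 0 < ε) :
    ∃ δ ∈ Ioc (0 : ℝ) 1, δ * extra r x ≤ ε ∧ δ * extra r y ≤ ε ∧
      ∃ l : Icc (0 : ℝ) T ≃o Icc (0 : ℝ) T, ∀ u, |(l u : ℝ) - u| ≤ ε ∧
        ‖(interp φ (fun k => δ * r k) x (l u) : TruncTensor N d) -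
          interp φ (fun k => δ * r k) y u‖ ≤ ε := by
  have hEx := extra_nonneg (x := x) hr
  have hEy := extra_nonneg (x := y) hr
  set C := extra r x + extra r y with hC
  set δ := min 1 (ε / (C + 1)) with hδ
  have hδ0 : 0 < δ := lt_min one_pos (by positivity)
  have hδε : δ * (C + 1) ≤ ε := by
    rw [← le_div_iff₀ (by positivity)]
    exact min_le_right _ _
  have hδI : δ ∈ Ioc (0 : ℝ) 1 := ⟨hδ0, min_le_left _ _⟩
  have h1 := ((alpha_spec hT hp hr hrs hx hy).2 δ hδI).1
  rw [h, zero_add] at h1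
  have h2 : sigmaInterp φ r p δ x y < ENNReal.ofReal ε := by
    refine h1.trans_lt ((ENNReal.ofReal_lt_ofReal_iff hε).2 ?_)
    rw [← hC]
    nlinarith
  obtain ⟨l, hl1, hl2⟩ := exists_of_sigma_lt h2
  refine ⟨δ, hδI, by nlinarith, by nlinarith, l, fun u => ⟨?_, ?_⟩⟩
  · have := (hl1 u).le
    rwa [edist_Icc, ENNReal.ofReal_le_ofReal_iff hε.le] at this
  · have hr' : ∀ k, 0 < δ * r k := fun k => mul_pos hδ0 (hr k)
    have hX := startsAtOne_interp (φ := φ) hT hr' ((summable_jumps hx.2.1 hrs).mul_left δ) hx.1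
    have hY := startsAtOne_interp (φ := φ) hT hr' ((summable_jumps hy.2.1 hrs).mul_left δ) hy.1
    exact norm_sub_le_of_rho hT.le hp (hX.comp_orderIso hT.le l) hY hε.le hl2.le u

/-- For small δ a time change matches x^{φ,δ} with y^{φ,δ}. Transporting back to δ = 1, where the
path of x no longer depends on δ, gives points v with θ(v) near t and x^φ(v) near y(t); compactness
produces an exact one. -/
lemma exists_theta_eq (hT : 0 < T) (hp : 0 < p) (hr : ∀ k, 0 < r k) (hrs : Summable r)
    (hx : x ∈ Dp T φ r p) (hy : y ∈ Dp T φ r p) (h : alpha φ r p x y = 0) (t : Icc (0 : ℝ) T) :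
    ∃ v : Icc (0 : ℝ) T, Slot r x (v * (T + extra r x) / T) t ∧ interp φ r x v = y t := by
  have hsx := summable_jumps hx.2.1 hrs
  have hsy := summable_jumps hy.2.1 hrs
  obtain ⟨θ, hθ, hθm, hθc⟩ := exists_theta hT hr hsx
  obtain ⟨θ', hθ', -⟩ := exists_theta hT hr hsy
  have hEx := extra_nonneg (x := x) hr
  have hEy := extra_nonneg (x := y) hr
  have hTE : 0 < T + extra r y := by linarith
  have key : ∀ ε > 0, ∃ v : Icc (0 : ℝ) T,
      max |(θ v : ℝ) - t| ‖(interp φ r x v : TruncTensor N d) - y t‖ ≤ ε := by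
    intro ε hε
    obtain ⟨δ, hδ, h1, h2, l, hl⟩ := exists_close hT hp hr hrs hx hy h (ε := ε / 3) (by positivity)
    obtain ⟨a, ha, ha'⟩ := exists_rescale (φ := φ) hT hr hsx hx.2.2.1 hδ.1 hδ.2
    obtain ⟨b, hb, hb'⟩ := exists_rescale (φ := φ) hT hr hsy hy.2.2.1 hδ.1 hδ.2
    -- This is the normalised time at which the interpolation of y takes the value `y t`.
    have hw : tau r y t * (T / (T + extra r y)) ∈ Icc 0 T := by
      have h3 := (le_tauLeft (x := y) hr t).trans (tauLeft_le_tau hr hsy t)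
      have h4 := tau_sub_le hr hsy t
      refine ⟨mul_nonneg (t.2.1.trans h3) (by positivity), ?_⟩
      rw [← mul_div_assoc, div_le_iff₀ hTE, mul_comm]
      exact mul_le_mul_of_nonneg_left (by linarith [t.2.2]) hT.le
    set w : Icc (0 : ℝ) T := ⟨_, hw⟩ with hwdef
    have hwe : (w : ℝ) * (T + extra r y) / T = tau r y t := by
      rw [hwdef]
      field_simp
    have hwt : interp φ r y w = y t := by rw [interp_apply, hwe, stretched_tau hr hsy]
    have hb1 := hb' w t (by rw [hwe]; exact slot_tau hr hsy t)
    have ha1 := ha' (a.symm (l (b w))) _ (hθ _)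
    rw [a.apply_symm_apply] at ha1
    obtain ⟨hl1, hl2⟩ := hl (b w)
    refine ⟨a.symm (l (b w)), max_le ?_ ?_⟩
    · rw [abs_le] at ha1 hb1 hl1 ⊢
      constructor <;> linarith
    · rw [hb, hwt] at hl2
      rw [← ha, a.apply_symm_apply]
      linarith
  have hc : Continuous fun v : Icc (0 : ℝ) T =>
      max |(θ v : ℝ) - t| ‖(interp φ r x v : TruncTensor N d) - y t‖ := by
    have := continuous_interp hT hp hr hrs hx.2.1 hx.2.2.1 hx.2.2.2
    fun_prop
  -- The continuous function measuring both discrepancies attains its minimum, and the minimum is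
  -- below every ε.
  obtain ⟨v, -, hv⟩ := isCompact_univ.exists_isMinOn ⟨t, mem_univ t⟩ hc.continuousOn
  have h0 : max |(θ v : ℝ) - t| ‖(interp φ r x v : TruncTensor N d) - y t‖ ≤ 0 := by
    refine le_of_forall_pos_le_add fun ε hε => ?_
    obtain ⟨v', hv'⟩ := key ε hε
    rw [zero_add]
    exact (hv (mem_univ v')).trans hv'
  have h1 := abs_nonpos_iff.1 ((le_max_left _ _).trans h0)
  have h2 := norm_le_zero_iff.1 ((le_max_right _ _).trans h0)
  have h3 : θ v = t := Subtype.ext (sub_eq_zero.1 h1)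
  refine ⟨v, ?_, Subtype.ext (sub_eq_zero.1 h2)⟩
  rw [← h3]
  exact hθ v

lemma countable_jumps (hx : IsCadlag x) : (jumps x).Countable :=
  countable_coe_iff.1 (jumpRank_injective hx).countable

/-- The jumps are countable, whereas every interval to the right of t is not. -/
lemma frequently_notMem_jumps (hx : IsCadlag x) {t : Icc (0 : ℝ) T} (ht : (t : ℝ) < T) :
    ∃ᶠ s in 𝓝[>] t, s ∉ jumps x := by
  intro h
  have hT : 0 ≤ T := t.2.1.trans ht.le
  simp only [not_not] at h
  obtain ⟨u, hu, hu'⟩ := (mem_nhdsGT_iff_exists_Ioo_subset'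
    (show t < (⟨T, hT, le_rfl⟩ : Icc (0 : ℝ) T) from ht)).1 h
  have h1 := ((countable_jumps hx).mono hu').image Subtype.val
  have h2 : Ioo (t : ℝ) u ⊆ Subtype.val '' Ioo t u := fun s hs =>
    ⟨⟨s, t.2.1.trans hs.1.le, hs.2.le.trans u.2.2⟩, ⟨hs.1, hs.2⟩, rfl⟩
  exact absurd (Cardinal.Real.Ioo_countable_iff.1 (h1.mono h2)) (not_le.2 hu)

/-- Off the jumps of x the slot is a single point, so x and y agree there. Such times occur
arbitrarily close to the right of each t < T, and both paths are right-continuous. -/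
lemma eq_of_alpha_eq_zero (hT : 0 < T) (hp : 0 < p) (hr : ∀ k, 0 < r k) (hrs : Summable r)
    (hx : x ∈ Dp T φ r p) (hy : y ∈ Dp T φ r p) (h : alpha φ r p x y = 0) : x = y := by
  have hsx := summable_jumps hx.2.1 hrs
  have hsy := summable_jumps hy.2.1 hrs
  have hnj : ∀ t ∉ jumps x, x t = y t := by
    intro t ht
    obtain ⟨v, hv, hv'⟩ := exists_theta_eq hT hp hr hrs hx hy h t
    rw [← hv', interp_apply, stretched_of_notMem hr hsx ht hv]
  funext t
  rcases t.2.2.lt_or_eq with ht | ht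
  · have : (𝓝[>] t).NeBot := nhdsGT_neBot_of_exists_gt ⟨⟨T, hT.le, le_rfl⟩, ht⟩
    exact tendsto_nhds_unique_of_frequently_eq (hx.2.1.tendsto_right t) (hy.2.1.tendsto_right t)
      ((frequently_notMem_jumps hx.2.1 ht).mono hnj)
  -- The end point T has no times to its right, but every increasing bijection fixes it and the
  -- interpolations take the values of x and y there.
  · have h3 : t = ⟨T, hT.le, le_rfl⟩ := Subtype.ext ht
    refine Subtype.ext (sub_eq_zero.1 (norm_le_zero_iff.1 ?_))
    refine le_of_forall_pos_le_add fun ε hε => ?_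
    obtain ⟨δ, hδ, -, -, l, hl⟩ := exists_close hT hp hr hrs hx hy h hε
    have hr' : ∀ k, 0 < δ * r k := fun k => mul_pos hδ.1 (hr k)
    have h4 := (hl t).2
    have h5 : l t = t := by
      refine le_antisymm ?_ ?_
      · exact ((l t).2.2.trans ht.ge : (l t : ℝ) ≤ t)
      · rw [← l.apply_symm_apply t]
        refine l.monotone ?_
        rw [l.apply_symm_apply]
        exact ((l.symm t).2.2.trans ht.ge : (l.symm t : ℝ) ≤ t)
    rw [h5, h3, interp_last hT hr' (hsx.mul_left δ), interp_last hT hr' (hsy.mul_left δ), ← h3] at h4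
    rwa [zero_add]

/-! ### Separability -/

lemma exists_mul_add_lt {K ε : ℝ≥0∞} (hK : K ≠ ∞) (hε : 0 < ε) :
    ∃ η : ℝ≥0∞, 0 < η ∧ ∀ a b, a < η → b < η → K * (a + b) < ε := by
  have h : Tendsto (fun η : ℝ≥0∞ => K * (η + η)) (𝓝[>] 0) (𝓝 0) := by
    have h1 : Tendsto (fun η : ℝ≥0∞ => η + η) (𝓝 0) (𝓝 (0 + 0)) := tendsto_id.add tendsto_id
    have h2 := ENNReal.Tendsto.const_mul h1 (Or.inr hK)
    rw [add_zero, mul_zero] at h2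
    exact h2.mono_left nhdsWithin_le_nhds
  obtain ⟨η, hη, hη'⟩ := ((h.eventually_lt_const hε).and self_mem_nhdsWithin).exists
  exact ⟨η, hη', fun a b ha hb => (by gcongr : K * (a + b) ≤ K * (η + η)).trans_lt hη⟩

/-- The derivatives of the smooth lifts form a subset of a separable space. A dense sequence is
taken inside that subset, so that its members are derivatives of smooth lifts; uniform closeness of
derivatives implies ρ-closeness of lifts. -/
lemma exists_countable_dense_smoothLifts (N d : ℕ) (hT : 0 < T) : ∃ S ⊆ smoothLifts N d T,
    S.Countable ∧ ∀ x ∈ smoothLifts N d T, ∀ ε > 0, ∃ y ∈ S, rho 1 x y < ε := by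
  choose w R h h0 hw using fun x : smoothLifts N d T => exists_path_of_mem_smoothLifts hT x.2
  obtain ⟨D, hD, hDc, hDd⟩ :=
    (TopologicalSpace.IsSeparable.of_separableSpace (range w)).exists_countable_dense_subset
  choose g hg using fun f (hf : f ∈ D) => hD hf
  have := hDc.to_subtype
  refine ⟨range fun f : D => (g f f.2 : Icc (0 : ℝ) T → G N d), ?_, countable_range _, fun x hx ε hε => ?_⟩
  · rintro _ ⟨f, rfl⟩
    exact (g f f.2).2
  · obtain ⟨ε', hε', hεε⟩ := exists_between hε
    obtain ⟨δ, hδ, hδ'⟩ := exists_rho_path_le N d hT.le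
      (∫ t in (0 : ℝ)..T, ‖w ⟨x, hx⟩ (projIcc 0 T hT.le t)‖) hε'
    obtain ⟨f, hf, hwf⟩ := Metric.mem_closure_iff.1 (hDd (mem_range_self ⟨x, hx⟩)) (δ / T)
      (by positivity)
    refine ⟨_, ⟨⟨f, hf⟩, rfl⟩, lt_of_le_of_lt ?_ hεε⟩
    have := hδ' _ _ _ _ (h ⟨x, hx⟩) (h (g f hf)) (h0 _) (h0 _) le_rfl ?_
    · rwa [← hw, ← hw] at this
    · simp only [hg f hf]
      have h1 := intervalIntegral.norm_integral_le_of_norm_le_const (a := 0) (b := T) (C := δ / T)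
        (f := fun t => ‖w ⟨x, hx⟩ (projIcc 0 T hT.le t) - f (projIcc 0 T hT.le t)‖) fun t _ => by
          rw [norm_norm, ← dist_eq_norm]
          exact (ContinuousMap.dist_apply_le_dist _).trans hwf.le
      rw [sub_zero, abs_of_pos hT, div_mul_cancel₀ _ hT.ne'] at h1
      exact (le_abs_self _).trans h1

lemma alpha_le_rho (hT : 0 < T) (hr : ∀ k, 0 < r k) (hx : Continuous x) (hy : Continuous y) :
    alpha φ r p x y ≤ rho p x y := by
  rw [alpha_of_continuous hT hr hx hy]
  exact sigma_le_rho p x y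

/-- The chain runs from x to a path of C^{0,1-var}, then to a smooth lift, then to the countable
set; each link is small and the quasi-triangle inequality is used twice. -/
lemma exists_countable_dense_D0p (hT : 0 < T) (hp : 1 ≤ p) (hr : ∀ k, 0 < r k) (hrs : Summable r) :
    ∃ S ⊆ D0p T φ r p, S.Countable ∧ ∀ x ∈ D0p T φ r p, ∀ ε > 0, ∃ y ∈ S, alpha φ r p x y < ε := by
  have hp0 := one_pos.trans_le hp
  obtain ⟨S, hS, hSc, hSd⟩ := exists_countable_dense_smoothLifts N d hT
  have hC1 : ∀ {y}, y ∈ Cp N d T 1 → y ∈ Dp T φ r p := fun hy =>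
    Cp_subset_Dp hT hr (Cp_anti one_pos hp hy)
  have hSm : ∀ {y}, y ∈ S → y ∈ Cp N d T 1 := fun hy => smoothLifts_subset hT (hS hy)
  refine ⟨S, fun y hy => ⟨hC1 (hSm hy), fun ε hε =>
    ⟨y, smoothLifts_subset_C0p hT le_rfl (hS hy), ?_⟩⟩, hSc, fun x hx ε hε => ?_⟩
  · rwa [alpha_self hp0]
  · obtain ⟨η, hη, hη'⟩ := exists_mul_add_lt (quasiC_ne_top N p) hε
    obtain ⟨ξ, hξ, hξ'⟩ := exists_mul_add_lt (quasiC_ne_top N p) hη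
    obtain ⟨y, hy, hxy⟩ := hx.2 η hη
    obtain ⟨z, hz, hyz⟩ := hy.2 ξ hξ
    obtain ⟨s, hs, hzs⟩ := hSd z hz ξ hξ
    have hzC := smoothLifts_subset hT hz
    refine ⟨s, hs, (alpha_triangle hT hp0 hr hrs hx.1 (hC1 hy.1) (hC1 (hSm hs))).trans_lt
      (hη' _ _ hxy ?_)⟩
    refine (alpha_triangle hT hp0 hr hrs (hC1 hy.1) (hC1 hzC) (hC1 (hSm hs))).trans_lt
      (hξ' _ _ ?_ ?_)
    · exact ((alpha_le_rho hT hr hy.1.2.1 hzC.2.1).trans (rho_anti one_pos hp _ _)).trans_lt hyz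
    · exact ((alpha_le_rho hT hr hzC.2.1 (hSm hs).2.1).trans (rho_anti one_pos hp _ _)).trans_lt hzs

end Alpha

/-! ### A Hölder function which is rough at every scale -/

/-- The distance to the nearest integer. -/
def tri (t : ℝ) : ℝ := |t - round t|

lemma tri_nonneg (t : ℝ) : 0 ≤ tri t := abs_nonneg _

lemma tri_le (t : ℝ) : tri t ≤ 1 / 2 := abs_sub_round t

lemma tri_sub_le (s t : ℝ) : |tri s - tri t| ≤ |s - t| := by
  have h : ∀ s t : ℝ, tri s - tri t ≤ |s - t| := fun s t => by
    have h1 : tri s ≤ |s - round t| := round_le s (round t)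
    have h2 : |s - round t| ≤ |s - t| + |t - round t| := abs_sub_le _ _ _
    unfold tri at *
    linarith
  rw [abs_le]
  constructor
  · have := h t s
    rw [abs_sub_comm] at this
    linarith
  · exact h s t

lemma tri_natCast (n : ℕ) : tri n = 0 := by simp [tri]

lemma tri_natCast_add_half (n : ℕ) : tri (n + 1 / 2) = 1 / 2 := by
  have h : round ((n : ℝ) + 1 / 2) = n + 1 := by
    rw [round_eq, show (n : ℝ) + 1 / 2 + 1 / 2 = ((n + 1 : ℤ) : ℝ) by push_cast; ring,
      Int.floor_intCast]
  rw [tri, h]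
  push_cast
  rw [show (n : ℝ) + 1 / 2 - (n + 1) = -(1 / 2) by ring, abs_neg, abs_of_pos (by norm_num)]

/-- A lacunary series of triangle functions. -/
def triSeries (b : ℕ) (β : ℝ) (t : ℝ) : ℝ := ∑' k : ℕ, β ^ k * tri (b ^ k * t)

section TriSeries

variable {b : ℕ} {β : ℝ}

lemma triSeries_summable (hβ : 0 ≤ β) (hβ1 : β < 1) (t : ℝ) :
    Summable fun k : ℕ => β ^ k * tri (b ^ k * t) :=
  Summable.of_nonneg_of_le (fun k => mul_nonneg (pow_nonneg hβ k) (tri_nonneg _))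
    (fun k => mul_le_mul_of_nonneg_left (tri_le _) (pow_nonneg hβ k))
    ((summable_geometric_of_lt_one hβ hβ1).mul_right _)

lemma triSeries_eq (hβ : 0 ≤ β) (hβ1 : β < 1) (t : ℝ) :
    triSeries b β t = tri t + β * triSeries b β (b * t) := by
  unfold triSeries
  rw [(triSeries_summable hβ hβ1 t).tsum_eq_zero_add, ← tsum_mul_left]
  congr 1
  · simp
  · refine tsum_congr fun k => ?_
    rw [pow_succ', pow_succ, mul_assoc, mul_assoc]

lemma triSeries_natCast (n : ℕ) : triSeries b β n = 0 := by
  unfold triSeries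
  rw [← tsum_zero (β := ℕ)]
  refine tsum_congr fun k => ?_
  rw [show (b : ℝ) ^ k * n = ((b ^ k * n : ℕ) : ℝ) by push_cast; ring, tri_natCast, mul_zero]

/-- For even b, multiplication by b sends half-integers to integers, so only the first term of the
series contributes. -/
lemma triSeries_natCast_add_half (hβ : 0 ≤ β) (hβ1 : β < 1) (hb : Even b) (n : ℕ) :
    triSeries b β (n + 1 / 2) = 1 / 2 := by
  obtain ⟨c, rfl⟩ := hb
  rw [triSeries_eq hβ hβ1, tri_natCast_add_half,
    show ((c + c : ℕ) : ℝ) * (n + 1 / 2) = (((c + c) * n + c : ℕ) : ℝ) by push_cast; ring,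
    triSeries_natCast, mul_zero, add_zero]

/-- Induct on the scale through the self-similarity f(t) = tri t + β f(bt). The extra term b^(-m)/4
closes the induction: scaling turns it into at least (3/4) b^(-(m+1)), the added triangle function
costs at most (1/2) b^(-(m+1)), and a quarter is left. -/
lemma triSeries_sub_ge (hβ : 0 ≤ β) (hβ1 : β < 1) (hb : Even b) (hb0 : 0 < b) (hβb : 3 ≤ b * β)
    (m i : ℕ) : β ^ m / 4 + ((b : ℝ) ^ m)⁻¹ / 4 ≤
      |triSeries b β ((i + 1 / 2) / b ^ m) - triSeries b β (i / b ^ m)| := by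
  have hb' : (0 : ℝ) < b := Nat.cast_pos.2 hb0
  induction m with
  | zero =>
    rw [pow_zero, pow_zero, div_one, div_one, triSeries_natCast, triSeries_natCast_add_half hβ hβ1 hb]
    norm_num
  | succ m ih =>
    have e : ∀ c : ℝ, (b : ℝ) * (c / b ^ (m + 1)) = c / b ^ m := fun c => by
      rw [pow_succ]
      field_simp
    rw [triSeries_eq hβ hβ1, triSeries_eq hβ hβ1 (i / b ^ (m + 1)), e, e]
    have h1 := tri_sub_le (((i : ℝ) + 1 / 2) / b ^ (m + 1)) (i / b ^ (m + 1))
    have h2 : |((i : ℝ) + 1 / 2) / b ^ (m + 1) - i / b ^ (m + 1)| = ((b : ℝ) ^ (m + 1))⁻¹ / 2 := by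
      rw [← sub_div, add_sub_cancel_left, abs_of_pos (by positivity)]
      field_simp
    rw [h2] at h1
    set A := triSeries b β (((i : ℝ) + 1 / 2) / b ^ m)
    set B := triSeries b β ((i : ℝ) / b ^ m)
    set P := tri (((i : ℝ) + 1 / 2) / b ^ (m + 1))
    set Q := tri ((i : ℝ) / b ^ (m + 1))
    have h3 : β * |A - B| ≤ |P + β * A - (Q + β * B)| + |P - Q| := by
      rw [← abs_of_nonneg hβ, ← abs_mul, abs_of_nonneg hβ]
      have : β * (A - B) = (P + β * A - (Q + β * B)) - (P - Q) := by ring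
      rw [this]
      exact abs_sub _ _
    have h4 : β * (β ^ m / 4 + ((b : ℝ) ^ m)⁻¹ / 4) ≤ β * |A - B| :=
      mul_le_mul_of_nonneg_left ih hβ
    have h5 : 3 * ((b : ℝ) ^ (m + 1))⁻¹ ≤ β * ((b : ℝ) ^ m)⁻¹ := by
      rw [show β * ((b : ℝ) ^ m)⁻¹ = (b * β) * ((b : ℝ) ^ (m + 1))⁻¹ by rw [pow_succ]; field_simp]
      exact mul_le_mul_of_nonneg_right hβb (by positivity)
    have h6 : β ^ (m + 1) = β * β ^ m := pow_succ' _ _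
    linarith

/-- The same induction for the upper bound. The subtracted b^(-m)/2 becomes at least (3/2)
b^(-(m+1)), which pays for the Lipschitz triangle function and leaves one half. -/
lemma exists_triSeries_sub_le (hβ : 0 ≤ β) (hβ1 : β < 1) (hb0 : 0 < b) (hβb : 3 ≤ b * β) :
    ∃ B : ℝ, 0 ≤ B ∧ ∀ (m : ℕ) (s t : ℝ), |s - t| ≤ ((b : ℝ) ^ m)⁻¹ →
      |triSeries b β s - triSeries b β t| ≤ B * β ^ m - ((b : ℝ) ^ m)⁻¹ / 2 := by
  have hb' : (0 : ℝ) < b := Nat.cast_pos.2 hb0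
  set M : ℝ := ∑' k : ℕ, β ^ k * (1 / 2)
  have hM0 : 0 ≤ M := tsum_nonneg fun k => by positivity
  have hM : ∀ t, triSeries b β t ≤ M := fun t =>
    (triSeries_summable hβ hβ1 t).tsum_le_tsum
      (fun k => mul_le_mul_of_nonneg_left (tri_le _) (pow_nonneg hβ k))
      ((summable_geometric_of_lt_one hβ hβ1).mul_right _)
  have h0 : ∀ t, 0 ≤ triSeries b β t := fun t =>
    tsum_nonneg fun k => mul_nonneg (pow_nonneg hβ k) (tri_nonneg _)
  refine ⟨M + 1 / 2, by positivity, fun m => ?_⟩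
  induction m with
  | zero =>
    intro s t _
    rw [pow_zero, pow_zero, abs_le]
    constructor <;> linarith [hM s, hM t, h0 s, h0 t]
  | succ m ih =>
    intro s t hst
    rw [triSeries_eq hβ hβ1, triSeries_eq hβ hβ1 t]
    have h1 := tri_sub_le s t
    have h2 := ih (b * s) (b * t) (by
      rw [← mul_sub, abs_mul, abs_of_pos hb']
      refine (mul_le_mul_of_nonneg_left hst hb'.le).trans (le_of_eq ?_)
      rw [pow_succ]
      field_simp)
    set A := triSeries b β (b * s)
    set B := triSeries b β (b * t)
    have h3 : |tri s + β * A - (tri t + β * B)| ≤ |tri s - tri t| + β * |A - B| := by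
      rw [← abs_of_nonneg hβ, ← abs_mul, abs_of_nonneg hβ]
      have : tri s + β * A - (tri t + β * B) = (tri s - tri t) + β * (A - B) := by ring
      rw [this]
      exact abs_add_le _ _
    have h4 := mul_le_mul_of_nonneg_left h2 hβ
    have h5 : 3 * ((b : ℝ) ^ (m + 1))⁻¹ ≤ β * ((b : ℝ) ^ m)⁻¹ := by
      rw [show β * ((b : ℝ) ^ m)⁻¹ = (b * β) * ((b : ℝ) ^ (m + 1))⁻¹ by rw [pow_succ]; field_simp]
      exact mul_le_mul_of_nonneg_right hβb (by positivity)
    have h6 : β ^ (m + 1) = β * β ^ m := pow_succ' _ _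
    rw [h6]
    nlinarith

end TriSeries

lemma exists_rough_function {q : ℝ} (hq : 1 < q) : ∃ (f : ℝ → ℝ) (b : ℕ) (K : ℝ), 2 ≤ b ∧
    3 ≤ b * (b : ℝ) ^ (-(1 / q)) ∧ f 0 = 0 ∧ 0 ≤ K ∧
    (∀ s ∈ Icc (0 : ℝ) 1, ∀ t ∈ Icc (0 : ℝ) 1, |f s - f t| ≤ K * |s - t| ^ (1 / q)) ∧
    ∀ m i : ℕ, ((b : ℝ) ^ (-(1 / q))) ^ m / 4 ≤ |f ((i + 1 / 2) / b ^ m) - f (i / b ^ m)| := by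
  have hq0 : 0 < q := by linarith
  have hq1 : 1 / q < 1 := by rwa [div_lt_one hq0]
  obtain ⟨c, hc⟩ := exists_nat_ge ((3 : ℝ) ^ (1 / (1 - 1 / q)))
  -- b is even and so large that b β = b^(1 - 1/q) is at least 3.
  set b : ℕ := 2 * (c + 1) with hb
  have hb2 : 2 ≤ b := by omega
  have hb1 : (1 : ℝ) < b := by exact_mod_cast hb2
  have hb0 : (0 : ℝ) < b := by linarith
  set β : ℝ := (b : ℝ) ^ (-(1 / q)) with hβdef
  have hβ : 0 < β := Real.rpow_pos_of_pos hb0 _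
  have hβ1 : β < 1 := Real.rpow_lt_one_of_one_lt_of_neg hb1 (by linarith [one_div_pos.2 hq0])
  have hβb : 3 ≤ b * β := by
    have h1 : (b : ℝ) * β = (b : ℝ) ^ (1 - 1 / q) := by
      rw [hβdef, sub_eq_add_neg, Real.rpow_add hb0, Real.rpow_one]
    have h2 : (3 : ℝ) ^ (1 / (1 - 1 / q)) ≤ b := by
      refine hc.trans ?_
      rw [hb]
      push_cast
      linarith [Nat.cast_nonneg (α := ℝ) c]
    rw [h1]
    calc (3 : ℝ) = ((3 : ℝ) ^ (1 / (1 - 1 / q))) ^ (1 - 1 / q) := by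
          rw [← Real.rpow_mul (by norm_num), one_div_mul_cancel (by linarith), Real.rpow_one]
      _ ≤ _ := Real.rpow_le_rpow (by positivity) h2 (by linarith)
  obtain ⟨B, hB, hBh⟩ := exists_triSeries_sub_le hβ.le hβ1 (by omega) hβb
  refine ⟨triSeries b β, b, B * β⁻¹, hb2, hβb, ?_, by positivity, ?_, ?_⟩
  · exact_mod_cast triSeries_natCast (b := b) (β := β) 0
  · intro s hs t ht
    rcases eq_or_ne s t with rfl | hst
    · rw [sub_self, sub_self, abs_zero]
      positivity
    · have h1 : 0 < |s - t| := abs_pos.2 (sub_ne_zero.2 hst)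
      have h2 : |s - t| ≤ 1 := by
        rw [abs_le]
        constructor <;> linarith [hs.1, hs.2, ht.1, ht.2]
      -- Here b^(-(m+1)) < |s - t| ≤ b^(-m). The estimate at scale m gives β^m, which equals β⁻¹
      -- β^(m+1) and is thus at most β⁻¹ |s - t|^(1/q).
      obtain ⟨m, hm1, hm2⟩ := exists_nat_pow_near_of_lt_one h1 h2 (inv_pos.2 hb0)
        (inv_lt_one_of_one_lt₀ hb1)
      refine (hBh m s t (by rwa [← inv_pow])).trans ?_
      have h3 : β ^ (m + 1) ≤ |s - t| ^ (1 / q) := by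
        have : β ^ (m + 1) = (((b : ℝ)⁻¹) ^ (m + 1)) ^ (1 / q) := by
          rw [hβdef, ← Real.rpow_natCast, ← Real.rpow_natCast, ← Real.rpow_mul hb0.le,
            ← Real.rpow_neg_one, ← Real.rpow_mul hb0.le, ← Real.rpow_mul hb0.le]
          congr 1
          ring
        rw [this]
        exact Real.rpow_le_rpow (by positivity) hm1.le (by positivity)
      have h4 : β ^ m = β⁻¹ * β ^ (m + 1) := by
        rw [pow_succ]
        field_simp
      have h5 : B * β ^ m ≤ B * (β⁻¹ * |s - t| ^ (1 / q)) := by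
        rw [h4]
        gcongr
      have h6 : (0 : ℝ) ≤ ((b : ℝ) ^ m)⁻¹ / 2 := by positivity
      linarith
  · intro m i
    have h1 := triSeries_sub_ge hβ.le hβ1 (b := b) ⟨c + 1, by omega⟩ (by omega) hβb m i
    have h2 : (0 : ℝ) ≤ ((b : ℝ) ^ m)⁻¹ / 4 := by positivity
    linarith

/-- Use the partition into 2n equal intervals and keep only the first half of each of the n cells.
-/
lemma mul_le_varSup (hT : 0 ≤ T) (c : Icc (0 : ℝ) T → Icc (0 : ℝ) T → ℝ≥0∞)
    (hc : ∀ t, c t t = 0) {n : ℕ} {a : ℝ≥0∞} (h : ∀ s t : Icc (0 : ℝ) T, ∀ i < n,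
      (s : ℝ) = i / n * T → (t : ℝ) = (i + 1 / 2) / n * T → a ≤ c s t) : n * a ≤ varSup c := by
  set u : ℕ → Icc (0 : ℝ) T := fun j => projIcc 0 T hT (j / (2 * n) * T) with hu
  have hum : Monotone u := fun i j hij => by
    refine monotone_projIcc hT ?_
    gcongr
  have hval : ∀ j ≤ 2 * n, (u j : ℝ) = j / (2 * n) * T := fun j hj => by
    have h1 : (j : ℝ) / (2 * n) ≤ 1 := div_le_one_of_le₀ (by exact_mod_cast hj) (by positivity)
    simp only [hu]
    rw [projIcc_of_mem hT ⟨by positivity, mul_le_of_le_one_left hT h1⟩]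
  have key : ∀ k ≤ n, k * a ≤ ∑ j ∈ Finset.range (2 * k), c (u j) (u (j + 1)) := by
    intro k
    induction k with
    | zero => simp
    | succ k ih =>
      intro hk
      have hn : (n : ℝ) ≠ 0 := by
        have : n ≠ 0 := by omega
        exact_mod_cast this
      rw [show 2 * (k + 1) = 2 * k + 1 + 1 by ring, Finset.sum_range_succ, Finset.sum_range_succ]
      have h1 := ih (by omega)
      have h2 : a ≤ c (u (2 * k)) (u (2 * k + 1)) := by
        refine h _ _ k (by omega) ?_ ?_
        · rw [hval _ (by omega)]
          push_cast
          field_simp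
        · rw [hval _ (by omega)]
          push_cast
          field_simp
      calc ((k + 1 : ℕ) : ℝ≥0∞) * a = k * a + a := by push_cast; ring
        _ ≤ _ := le_add_right (add_le_add h1 h2)
  exact (key n le_rfl).trans (sum_range_le_varSup hT c hc hum _)

/-! ### Rough paths in one direction -/

lemma norm_level_one_gexp (hN : 1 ≤ N) (v : EuclideanSpace ℝ (Fin d)) :
    ‖level ⟨1, by omega⟩ (TruncTensor.exp (vec v) : TruncTensor N d)‖ = ‖v‖ := by
  rw [← norm_homog, ← norm_vec (N := N) v hN]
  congr 1
  rw [TruncTensor.exp, map_sum, Finset.sum_eq_single 1]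
  · simp [homog_vec]
  · intro k _ hk
    rw [map_smul]
    rcases Nat.lt_or_ge 1 k with h | h
    · rw [homog_eq_zero_of_mem (pow_mem_ordGE (vec_mem_ordGE v) k) h, smul_zero]
    · have : k = 0 := by omega
      rw [this, pow_zero, homog_one, if_neg one_ne_zero, smul_zero]
  · intro h
    exact absurd (Finset.mem_range.2 (by omega)) h

lemma incr_gexp_smul (v : EuclideanSpace ℝ (Fin d)) (s t : ℝ) :
    incr (gexp (s • v) : G N d) (gexp (t • v)) = TruncTensor.exp (vec ((t - s) • v)) := by
  rw [incr_eq, inv_gexp, ← neg_smul, gexp_mul_gexp, neg_add_eq_sub, coe_gexp]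

lemma ccDist_gexp_smul_le {v : EuclideanSpace ℝ (Fin d)} (hv : ‖v‖ = 1) (s t : ℝ) :
    ccDist (gexp (s • v) : G N d) (gexp (t • v)) ≤ ENNReal.ofReal |s - t| := by
  rw [ccDist, incr_gexp_smul]
  refine (ccNorm_gexp_le _).trans (le_of_eq ?_)
  rw [← ofReal_norm, norm_smul, hv, mul_one, Real.norm_eq_abs, abs_sub_comm]

lemma norm_level_one_incr_gexp (hN : 1 ≤ N) {v : EuclideanSpace ℝ (Fin d)} (hv : ‖v‖ = 1)
    (s t : ℝ) : ‖level ⟨1, by omega⟩ (incr (gexp (s • v) : G N d) (gexp (t • v)))‖ = |t - s| := by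
  rw [incr_gexp_smul, norm_level_one_gexp hN, norm_smul, hv, mul_one, Real.norm_eq_abs]

/-- For a (1/q)-Hölder function the q-th power of the distance is bounded by a multiple of t - s,
which is additive. -/
lemma gexp_mem_Cp (hT : 0 < T) {q : ℝ} (hq : 0 < q) {v : EuclideanSpace ℝ (Fin d)} (hv : ‖v‖ = 1)
    {f : ℝ → ℝ} (hf0 : f 0 = 0) {K : ℝ} (hK : 0 ≤ K)
    (hf : ∀ s ∈ Icc (0 : ℝ) T, ∀ t ∈ Icc (0 : ℝ) T, |f s - f t| ≤ K * |s - t| ^ (1 / q)) :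
    (fun t : Icc (0 : ℝ) T => gexp (f t • v)) ∈ Cp N d T q := by
  have hcc : ∀ s t : Icc (0 : ℝ) T, ccDist (gexp (f s • v) : G N d) (gexp (f t • v)) ≤
      ENNReal.ofReal (K * |(s : ℝ) - t| ^ (1 / q)) := fun s t =>
    (ccDist_gexp_smul_le hv _ _).trans (ENNReal.ofReal_le_ofReal (hf s s.2 t t.2))
  refine ⟨fun t ht => ?_, continuous_iff_continuousAt.2 fun t => ?_, ?_⟩
  · change ((gexp (f t • v) : G N d) : TruncTensor N d) = 1
    rw [ht, hf0, zero_smul, gexp_zero, G.coe_one]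
  · refine tendsto_of_ccDist tendsto_const_nhds ?_
    have h1 : Continuous fun s : Icc (0 : ℝ) T =>
        ENNReal.ofReal (K * |(t : ℝ) - s| ^ (1 / q)) := by
      refine ENNReal.continuous_ofReal.comp (continuous_const.mul ?_)
      refine Continuous.rpow_const (by fun_prop) fun s => Or.inr (by positivity)
    have h2 := h1.tendsto t
    rw [sub_self, abs_zero, Real.zero_rpow (one_div_pos.2 hq).ne', mul_zero, ENNReal.ofReal_zero] at h2
    exact tendsto_of_tendsto_of_tendsto_of_le_of_le tendsto_const_nhds h2 (fun _ => zero_le)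
      fun s => hcc t s
  · refine lt_of_le_of_lt (b := (ENNReal.ofReal (K ^ q * T - K ^ q * 0)) ^ (1 / q)) ?_
      (ENNReal.rpow_lt_top_of_nonneg (by positivity) ENNReal.ofReal_ne_top)
    rw [pVar_le_iff hq, ← ENNReal.rpow_mul, one_div_mul_cancel hq.ne', ENNReal.rpow_one]
    refine varSup_le_of_additive hT.le (A := fun t => K ^ q * t)
      (fun s t hst => mul_le_mul_of_nonneg_left hst (by positivity)) fun s t hst => ?_
    refine (ENNReal.rpow_le_rpow (hcc s t) hq.le).trans ?_
    have h0 : 0 ≤ (t : ℝ) - s := sub_nonneg.2 (show (s : ℝ) ≤ t from hst)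
    rw [ENNReal.ofReal_rpow_of_nonneg (by positivity) hq.le, abs_sub_comm, abs_of_nonneg h0,
      Real.mul_rpow hK (by positivity), ← Real.rpow_mul h0, one_div_mul_cancel hq.ne', Real.rpow_one]
    exact ENNReal.ofReal_le_ofReal (by rw [mul_sub])

/-- A path in one direction which oscillates like `h ^ (1 / q)` at every scale `h`. -/
lemma exists_rough_path (hd : 1 ≤ d) (hN : 1 ≤ N) (hT : 0 < T) {q : ℝ} (hq : 1 < q) :
    ∃ x ∈ Cp N d T q, ∃ b : ℕ, 2 ≤ b ∧ 3 ≤ b * (b : ℝ) ^ (-(1 / q)) ∧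
      ∀ (m i : ℕ) (s t : Icc (0 : ℝ) T), (s : ℝ) = i / (b ^ m : ℕ) * T →
        (t : ℝ) = (i + 1 / 2) / (b ^ m : ℕ) * T →
        ((b : ℝ) ^ (-(1 / q))) ^ m / 4 ≤ ‖level ⟨1, by omega⟩ (incr (x s) (x t))‖ := by
  obtain ⟨f, b, K, hb, hb3, hf0, hK, hfK, hfb⟩ := exists_rough_function hq
  have hq0 : 0 < q := by linarith
  set v : EuclideanSpace ℝ (Fin d) := EuclideanSpace.single ⟨0, hd⟩ 1
  have hv : ‖v‖ = 1 := by simp [v]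
  refine ⟨fun t => gexp (f (t / T) • v), gexp_mem_Cp hT hq0 hv (f := fun t => f (t / T)) (by simpa)
    (K := K * ((1 / T) ^ (1 / q))) (by positivity) ?_, b, hb, hb3, ?_⟩
  · intro s hs t ht
    have hI : ∀ u ∈ Icc (0 : ℝ) T, u / T ∈ Icc (0 : ℝ) 1 := fun u hu =>
      ⟨div_nonneg hu.1 hT.le, div_le_one_of_le₀ hu.2 hT.le⟩
    refine (hfK _ (hI s hs) _ (hI t ht)).trans (le_of_eq ?_)
    rw [← sub_div, abs_div, abs_of_pos hT, mul_assoc, ← Real.mul_rpow (by positivity) (by positivity)]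
    congr 2
    ring
  · intro m i s t hs ht
    rw [norm_level_one_incr_gexp hN hv, hs, ht, mul_div_cancel_right₀ _ hT.ne',
      mul_div_cancel_right₀ _ hT.ne']
    push_cast
    exact hfb m i

lemma exists_lipschitz_of_mem_smoothLifts (hT : 0 < T) {y : Icc (0 : ℝ) T → G N d}
    (hy : y ∈ smoothLifts N d T) : ∃ L : ℝ, 0 ≤ L ∧ ∀ s t : Icc (0 : ℝ) T, s ≤ t →
      ccDist (y s) (y t) ≤ ENNReal.ofReal (L * (t - s)) := by
  obtain ⟨w, R, h, h0, rfl⟩ := exists_path_of_mem_smoothLifts hT hy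
  refine ⟨‖w‖, norm_nonneg _, fun s t hst => (h.ccDist_path_le h0 hst).trans
    (ENNReal.ofReal_le_ofReal ?_)⟩
  have h1 := intervalIntegral.norm_integral_le_of_norm_le_const (a := (s : ℝ)) (b := t) (C := ‖w‖)
    (f := fun r => ‖w (projIcc 0 T hT.le r)‖) fun r _ => by
      rw [norm_norm]
      exact w.norm_coe_le_norm _
  rw [abs_of_nonneg (sub_nonneg.2 (show (s : ℝ) ≤ t from hst))] at h1
  exact (le_abs_self _).trans h1

lemma mul_rpow_le_rho (hT : 0 ≤ T) {p : ℝ} (hp : 0 < p) (x y : Icc (0 : ℝ) T → G N d)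
    (k : Fin (N + 1)) (hk : (k : ℕ) = 1) {n : ℕ} {a : ℝ≥0∞} (h : ∀ s t : Icc (0 : ℝ) T, ∀ i < n,
      (s : ℝ) = i / n * T → (t : ℝ) = (i + 1 / 2) / n * T → a ≤ levelDist k x y s t) :
    n * a ^ p ≤ rho p x y ^ p := by
  have h1 := varSup_levelDist_le hp x y k hk.ge
  simp only [hk, Nat.cast_one, div_one] at h1
  exact le_trans (mul_le_varSup hT (fun s t => levelDist k x y s t ^ p)
    (fun t => levelDist_rpow_self hp k x y t) fun s t i hi hs ht =>
      ENNReal.rpow_le_rpow (h s t i hi hs ht) hp.le) h1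

/-- At scale b^(-m) the rough path has b^m increments of size β^m/4 or more, and b^m β^(mp) = 1, so
their p-th powers sum to a fixed positive amount. A smooth lift has increments O(b^(-m)), negligible
against β^m because bβ > 1, so it cannot cancel them. -/
lemma exists_mem_Cp_notMem_C0p (hd : 1 ≤ d) (hN : 1 ≤ N) (hT : 0 < T) {p : ℝ} (hp : 1 < p) :
    ∃ x ∈ Cp N d T p, x ∉ C0p N d T p := by
  obtain ⟨x, hx, b, hb, hb3, hxb⟩ := exists_rough_path hd hN hT hp
  have hp0 : 0 < p := by linarith
  refine ⟨x, hx, fun hx0 => ?_⟩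
  have hb0 : (0 : ℝ) < b := by positivity
  set β : ℝ := (b : ℝ) ^ (-(1 / p)) with hβ
  have hβ0 : 0 < β := Real.rpow_pos_of_pos hb0 _
  -- The estimates below bound the distance to every smooth lift from below by 1/8; any radius under
  -- that would do.
  obtain ⟨y, hy, hxy⟩ := hx0.2 (ENNReal.ofReal (1 / 16)) (by simp)
  obtain ⟨L, hL, hyL⟩ := exists_lipschitz_of_mem_smoothLifts hT hy
  set B := ballC N d
  have hB : 0 ≤ B := ballC_nonneg
  -- At this scale the increments of y over half a cell are at most β^m/8, leaving at least β^m/8 of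
  -- those of x.
  obtain ⟨m, hm⟩ := pow_unbounded_of_one_lt (4 * (B * (L * T))) (show 1 < b * β by linarith)
  have hbm : (0 : ℝ) < (b : ℝ) ^ m := by positivity
  have hm' : B * (L * (1 / 2 / b ^ m * T)) ≤ β ^ m / 8 := by
    rw [mul_pow] at hm
    have : B * (L * (1 / 2 / b ^ m * T)) = (4 * (B * (L * T))) / b ^ m / 8 := by
      field_simp
      ring
    rw [this]
    gcongr
    rw [div_le_iff₀ hbm]
    linarith
  have key : ((b ^ m : ℕ) : ℝ≥0∞) * ENNReal.ofReal (β ^ m / 8) ^ p ≤ rho p x y ^ p := by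
    refine mul_rpow_le_rho hT.le hp0 x y ⟨1, by omega⟩ rfl fun s t i _ hs ht => ?_
    have hd' : (t : ℝ) - s = 1 / 2 / b ^ m * T := by
      rw [hs, ht]
      push_cast
      ring
    have hst : s ≤ t := by
      have : (0 : ℝ) ≤ t - s := by
        rw [hd']
        positivity
      exact (sub_nonneg.1 this : (s : ℝ) ≤ t)
    have h2 := hxb m i s t hs ht
    have h3 := (enorm_level_le_ccDist ⟨1, by omega⟩ (y s) (y t)).trans
      (mul_le_mul_right (pow_le_pow_left' (hyL s t hst) _) _)
    rw [pow_one, ← ENNReal.ofReal_mul hB, ← ofReal_norm, hd',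
      ENNReal.ofReal_le_ofReal_iff (by positivity)] at h3
    unfold levelDist
    rw [← ofReal_norm]
    refine ENNReal.ofReal_le_ofReal ?_
    have h4 := norm_sub_norm_le (level ⟨1, by omega⟩ (incr (x s) (x t)))
      (level ⟨1, by omega⟩ (incr (y s) (y t)))
    linarith
  -- The scale cancels, as β^p = 1/b.
  have h5 : ((b ^ m : ℕ) : ℝ≥0∞) * ENNReal.ofReal (β ^ m / 8) ^ p = ENNReal.ofReal (1 / 8) ^ p := by
    rw [ENNReal.ofReal_rpow_of_nonneg (by positivity) hp0.le,
      ENNReal.ofReal_rpow_of_nonneg (by positivity) hp0.le, ← ENNReal.ofReal_natCast,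
      ← ENNReal.ofReal_mul (by positivity)]
    congr 1
    rw [div_eq_mul_one_div, Real.mul_rpow (by positivity) (by positivity), ← mul_assoc]
    convert one_mul _ using 2
    push_cast
    rw [hβ, ← Real.rpow_natCast, ← Real.rpow_natCast, ← Real.rpow_mul hb0.le, ← Real.rpow_mul hb0.le,
      ← Real.rpow_add hb0]
    convert Real.rpow_zero _ using 2
    field_simp
    ring
  rw [h5] at key
  have h6 := (ENNReal.rpow_le_rpow_iff hp0).1 key
  have h7 := h6.trans_lt hxy
  rw [ENNReal.ofReal_lt_ofReal_iff (by norm_num)] at h7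
  norm_num at h7

/-- The path is rough of exponent q. Its b^m increments at scale b^(-m) have p-th powers adding up
to a multiple of (b β^p)^m, and b β^p = b^(1 - p/q) > 1 for p < q. -/
lemma exists_mem_Cp_pVar_eq_top (hd : 1 ≤ d) (hN : 1 ≤ N) (hT : 0 < T) {p q : ℝ} (hp : 1 ≤ p)
    (hpq : p < q) : ∃ x ∈ Cp N d T q, pVar p x = ∞ := by
  obtain ⟨x, hx, b, hb, hb3, hxb⟩ := exists_rough_path hd hN hT (hp.trans_lt hpq)
  have hp0 : 0 < p := by linarith
  have hq0 : 0 < q := by linarith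
  refine ⟨x, hx, by_contra fun hxp => ?_⟩
  have hb0 : (0 : ℝ) < b := by positivity
  have hb1 : (1 : ℝ) < b := by exact_mod_cast hb
  set β : ℝ := (b : ℝ) ^ (-(1 / q)) with hβ
  have hβ0 : 0 < β := Real.rpow_pos_of_pos hb0 _
  set R := ENNReal.ofReal (ballC N d) ^ p * pVar p x ^ p
  have hR : R ≠ ∞ := ENNReal.mul_ne_top
    (ENNReal.rpow_ne_top_of_nonneg hp0.le ENNReal.ofReal_ne_top)
    (ENNReal.rpow_ne_top_of_nonneg hp0.le hxp)
  have key : ∀ m : ℕ, ((b ^ m : ℕ) : ℝ≥0∞) * ENNReal.ofReal (β ^ m / 4) ^ p ≤ R := by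
    intro m
    have h1 := varSup_const_mul_le (ENNReal.ofReal (ballC N d) ^ p)
      (fun s t => ccDist (x s) (x t) ^ p)
    rw [varSup_eq_pVar_rpow hp0] at h1
    refine le_trans (mul_le_varSup hT.le (fun s t => ENNReal.ofReal (ballC N d) ^ p *
      ccDist (x s) (x t) ^ p) (fun t => ?_) fun s t i hi hs ht => ?_) h1
    · rw [ccDist_rpow_self hp0, mul_zero]
    · have h3 := enorm_level_le_ccDist ⟨1, by omega⟩ (x s) (x t)
      rw [pow_one] at h3
      rw [← ENNReal.mul_rpow_of_nonneg _ _ hp0.le]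
      refine ENNReal.rpow_le_rpow (le_trans ?_ h3) hp0.le
      rw [← ofReal_norm]
      exact ENNReal.ofReal_le_ofReal (hxb m i s t hs ht)
  have h5 : ∀ m : ℕ, ((b ^ m : ℕ) : ℝ≥0∞) * ENNReal.ofReal (β ^ m / 4) ^ p =
      ENNReal.ofReal ((b * β ^ p) ^ m * (1 / 4) ^ p) := by
    intro m
    rw [ENNReal.ofReal_rpow_of_nonneg (by positivity) hp0.le, ← ENNReal.ofReal_natCast,
      ← ENNReal.ofReal_mul (by positivity)]
    congr 1
    rw [div_eq_mul_one_div, Real.mul_rpow (by positivity) (by positivity), ← mul_assoc, mul_pow,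
      ← Real.rpow_natCast (β ^ p), ← Real.rpow_mul hβ0.le, mul_comm p, Real.rpow_mul hβ0.le,
      Real.rpow_natCast]
    push_cast
    ring
  have h6 : 1 < b * β ^ p := by
    have : (b : ℝ) * β ^ p = (b : ℝ) ^ (1 - p / q) := by
      rw [hβ, ← Real.rpow_mul hb0.le, sub_eq_add_neg, Real.rpow_add hb0, Real.rpow_one]
      congr 2
      ring
    rw [this]
    exact Real.one_lt_rpow hb1 (sub_pos.2 ((div_lt_one hq0).2 hpq))
  obtain ⟨m, hm⟩ := pow_unbounded_of_one_lt (R.toReal / (1 / 4) ^ p) h6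
  rw [div_lt_iff₀ (by positivity)] at hm
  have h7 := key m
  rw [h5] at h7
  exact absurd (ENNReal.ofReal_le_iff_le_toReal hR |>.1 h7) (not_le.2 hm)

/-! ### Closures -/

variable {φ : PathFunction N d} {r : ℕ → ℝ} {p p' : ℝ}

/-- Pass from x to its continuous interpolation, then to a lift. For p = 1 there is no larger
exponent to give room; the second step relies on the time change permitted by σ instead. -/
lemma D0p_one_eq (hT : 0 < T) (hr : ∀ k, 0 < r k) (hrs : Summable r) :
    D0p T φ r 1 = Dp T φ r 1 := by
  refine Subset.antisymm (fun x hx => hx.1) fun x hx => ⟨hx, fun ε hε => ?_⟩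
  obtain ⟨η, hη, hη'⟩ := exists_mul_add_lt (quasiC_ne_top N 1) hε
  obtain ⟨y, hy, hxy⟩ := exists_Cp_alpha_lt hT one_pos hr hrs hx le_rfl hη
  obtain ⟨z, hz, hyz⟩ := exists_C0p_sigma_lt hT hy hη
  refine ⟨z, hz, (alpha_triangle hT one_pos hr hrs hx (Cp_subset_Dp hT hr hy)
    (Cp_subset_Dp hT hr hz.1)).trans_lt (hη' _ _ hxy ?_)⟩
  rwa [alpha_of_continuous hT hr hy.2.1 hz.1.2.1]

/-- A time change l with x ∘ l close to y makes x close to y composed with the inverse of l, with no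
time change left. That path may fail to be a limit of smooth lifts in 1-variation, but it is
continuous of bounded variation, which suffices in p-variation for p > 1. -/
lemma sigma_closure_eq (hT : 0 < T) (hp : 1 < p) :
    {x | x ∈ Cp N d T p ∧ ∀ ε > 0, ∃ y ∈ C0p N d T 1, sigma p x y < ε} = C0p N d T p := by
  have hp0 : 0 < p := by linarith
  refine Subset.antisymm (fun x hx => ⟨hx.1, fun ε hε => ?_⟩) fun x hx => ⟨hx.1, fun ε hε => ?_⟩
  · obtain ⟨η, hη, hη'⟩ := exists_mul_add_lt (quasiC_ne_top N p) hε
    obtain ⟨ξ, hξ, hξ'⟩ := exists_mul_add_lt (quasiC_ne_top N p) hη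
    obtain ⟨y, hy, hxy⟩ := hx.2 η hη
    obtain ⟨l, -, hl⟩ := exists_of_sigma_lt hxy
    set w : Icc (0 : ℝ) T → G N d := y ∘ l.symm with hw
    have hxw : rho p x w < η := by
      rw [← rho_comp hT.le hp0 x w l]
      have : w ∘ l = y := by
        funext t
        simp [hw]
      rwa [this]
    have hwC : w ∈ Cp N d T 1 := ⟨hy.1.1.comp_orderIso hT.le l.symm,
      hy.1.2.1.comp l.symm.continuous,
      (pVar_comp_le hT.le one_pos y l.symm.monotone).trans_lt hy.1.2.2⟩
    obtain ⟨z, hz, hwz⟩ := exists_C0p_rho_lt hT le_rfl hp hwC hξ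
    obtain ⟨s, hs, hzs⟩ := hz.2 ξ hξ
    exact ⟨s, hs, (rho_triangle hp0 x w s).trans_lt (hη' _ _ hxw
      ((rho_triangle hp0 w z s).trans_lt (hξ' _ _ hwz ((rho_anti one_pos hp.le _ _).trans_lt hzs))))⟩
  · obtain ⟨y, hy, hxy⟩ := hx.2 ε hε
    exact ⟨y, smoothLifts_subset_C0p hT le_rfl hy, (sigma_le_rho _ _ _).trans_lt hxy⟩

/-- On continuous paths α is σ, so a continuous path in the closure would belong to C^{0,p-var}; the
rough path of exponent p does not. -/
lemma D0p_ssubset (hd : 1 ≤ d) (hN : 1 ≤ N) (hT : 0 < T) (hp : 1 < p) (hr : ∀ k, 0 < r k) :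
    D0p T φ r p ⊂ Dp T φ r p := by
  obtain ⟨x, hx, hx'⟩ := exists_mem_Cp_notMem_C0p hd hN hT hp
  refine (ssubset_iff_of_subset fun x hx => hx.1).2 ⟨x, Cp_subset_Dp hT hr hx, fun h => hx' ?_⟩
  rw [← sigma_closure_eq hT hp]
  refine ⟨hx, fun ε hε => ?_⟩
  obtain ⟨y, hy, hxy⟩ := h.2 ε hε
  rw [alpha_of_continuous hT hr hx.2.1 hy.1.2.1] at hxy
  exact ⟨y, hy, hxy⟩

lemma Dp_subset_D0p (hT : 0 < T) (hp : 1 ≤ p) (hpp : p < p') (hr : ∀ k, 0 < r k)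
    (hrs : Summable r) : Dp T φ r p ⊆ D0p T φ r p' := by
  have hp0 : 0 < p := by linarith
  intro x hx
  refine ⟨Dp_anti hp0 hpp.le hx, fun ε hε => ?_⟩
  obtain ⟨η, hη, hη'⟩ := exists_mul_add_lt (quasiC_ne_top N p') hε
  obtain ⟨y, hy, hxy⟩ := exists_Cp_alpha_lt hT hp0 hr hrs hx hpp.le hη
  obtain ⟨z, hz, hyz⟩ := exists_C0p_rho_lt hT hp hpp hy hη
  exact ⟨z, hz, (alpha_triangle hT (hp0.trans hpp) hr hrs (Dp_anti hp0 hpp.le hx)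
    (Cp_subset_Dp hT hr (Cp_anti hp0 hpp.le hy))
    (Cp_subset_Dp hT hr (Cp_anti one_pos (hp.trans hpp.le) hz.1))).trans_lt
      (hη' _ _ hxy ((alpha_le_rho hT hr hy.2.1 hz.1.2.1).trans_lt hyz))⟩

/-- Choose q strictly between p and p'. A continuous path of finite q-variation and infinite
p-variation lies in the closure for p', by the inclusion with q in place of p, but not in the space
for p. -/
lemma Dp_ssubset_D0p (hd : 1 ≤ d) (hN : 1 ≤ N) (hT : 0 < T) (hp : 1 ≤ p) (hpp : p < p')
    (hr : ∀ k, 0 < r k) (hrs : Summable r) : Dp T φ r p ⊂ D0p T φ r p' := by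
  obtain ⟨q, hpq, hqp⟩ := exists_between hpp
  obtain ⟨x, hx, hx'⟩ := exists_mem_Cp_pVar_eq_top hd hN hT hp hpq
  refine (ssubset_iff_of_subset (Dp_subset_D0p hT hp hpp hr hrs)).2
    ⟨x, Dp_subset_D0p hT (hp.trans hpq.le) hqp hr hrs (Cp_subset_Dp hT hr hx), fun h => ?_⟩
  have := h.2.2.2
  rw [interp_of_continuous hT hr hx.2.1, hx'] at this
  exact lt_irrefl _ this

end CadlagRough

end

theorem mainTheorem12 (N d : ℕ) (hd : 1 ≤ d) (T : ℝ) (hT : 0 < T) (p : ℝ) (hp : 1 ≤ p)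
    (hpN : ⌊p⌋₊ ≤ N) (φ : PathFunction N d)
    (r : ℕ → ℝ) (hr : ∀ k, 0 < r k) (hrs : Summable r) :
    -- the limit defining the distance exists and is finite
    (∀ x ∈ Dp T φ r p, ∀ y ∈ Dp T φ r p,
      Tendsto (fun δ => sigmaInterp φ r p δ x y) (𝓝[>] 0) (𝓝 (alpha φ r p x y)) ∧
        alpha φ r p x y < ∞) ∧
    -- (i) it is a metric if `N ≤ p`, and a quasi-metric in general
    (∀ x ∈ Dp T φ r p, ∀ y ∈ Dp T φ r p, alpha φ r p x y = 0 ↔ x = y) ∧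
    (∀ x ∈ Dp T φ r p, ∀ y ∈ Dp T φ r p, alpha φ r p x y = alpha φ r p y x) ∧
    (∀ x ∈ Dp T φ r p, ∀ y ∈ Dp T φ r p, ∀ z ∈ Dp T φ r p,
      alpha φ r p x z ≤
        ENNReal.ofReal (max 1 (2 ^ ((N : ℝ) / p - 1))) * (alpha φ r p x y + alpha φ r p y z)) ∧
    -- (i) separability
    (∃ S ⊆ D0p T φ r p, S.Countable ∧
      ∀ x ∈ D0p T φ r p, ∀ ε > 0, ∃ y ∈ S, alpha φ r p x y < ε) ∧
    -- (ii) density of the continuous rough paths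
    (Cp N d T p ⊆ Dp T φ r p ∧
      ∀ x ∈ Dp T φ r p, ∀ ε > 0, ∃ y ∈ Cp N d T p, alpha φ r p x y < ε) ∧
    -- (iii)
    D0p T φ r 1 = Dp T φ r 1 ∧
    -- (iv)
    (1 < p →
      {x | x ∈ Cp N d T p ∧ ∀ ε > 0, ∃ y ∈ C0p N d T 1, sigma p x y < ε} = C0p N d T p ∧
      D0p T φ r p ⊂ Dp T φ r p) ∧
    -- (v)
    (∀ p' : ℝ, p < p' → Dp T φ r p ⊂ D0p T φ r p') := by
  have hp0 : 0 < p := one_pos.trans_le hp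
  -- The rough paths need the order one, and p ≥ 1 together with ⌊p⌋ ≤ N provides it.
  have hN : 1 ≤ N := (Nat.le_floor (by exact_mod_cast hp)).trans hpN
  refine ⟨fun x hx y hy => ⟨(alpha_spec hT hp0 hr hrs hx hy).1, alpha_lt_top hT hp0 hr hrs hx hy⟩,
    fun x hx y hy => ⟨eq_of_alpha_eq_zero hT hp0 hr hrs hx hy, ?_⟩,
    fun x _ y _ => alpha_comm hT hp0 x y,
    fun x hx y hy z hz => alpha_triangle hT hp0 hr hrs hx hy hz,
    exists_countable_dense_D0p hT hp hr hrs,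
    ⟨Cp_subset_Dp hT hr, fun x hx ε hε => exists_Cp_alpha_lt hT hp0 hr hrs hx le_rfl hε⟩,
    D0p_one_eq hT hr hrs,
    fun hp1 => ⟨sigma_closure_eq hT hp1, D0p_ssubset hd hN hT hp1 hr⟩,
    fun p' hpp => Dp_ssubset_D0p hd hN hT hp hpp hr hrs⟩
  rintro rfl
  exact alpha_self hp0 x
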